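/- **Theorem (seven-dimensional nonsolvable symmetry algebras).** *Setting.* Let $\Gamma(n,m)$ consist of $(n,m)$ and its six neighbours, in the order $(n,m),(n+1,m),(n,m+1),(n-1,m+1),(n-1,m),(n,m-1),(n+1,m-1)$. Consider $$\ddot u_{nm}=F_{nm}\big(t,\{u_{pq}\}_{(p,q)\in\Gamma(n,m)}\big),\qquad (n,m)\in\mathbb Z^2, \tag{1}$$ for $t$ in an open interval $I$ and $u_{nm}$ in open intervals $J_{nm}$ whose union is an interval; $F_{nm}$ is a smooth function on an open set $\Omega_{nm}\subseteq I\times\prod_{\Gamma(n,m)}J_{pq}$ in which all $(t,u_{nm})\in I\times J_{nm}$ occur. It is nonlinear (for all $(n,m)$ some $\partial^2F_{nm}/\partial u_{pq}\partial u_{p'q'}$ is not identically zero) and coupled (no $\partial F_{nm}/\partial u_{pq}$, $(p,q)\in\Gamma(n,m)$, vanishes identically on a nonempty open set). A symmetry is a smooth field $\hat X=\tau(t,u_{nm})\partial_t+\phi_{nm}(t,u_{nm})\partial_{u_{nm}}$ on the sets $I\times J_{nm}$, with the same function $\tau$ for all sites, such that $$\phi^{tt}_{nm}-\tau\,\partial_tF_{nm}-\sum_{(p,q)\in\Gamma(n,m)}\phi_{pq}(t,u_{pq})\,\partial_{u_{pq}}F_{nm}=0\quad\text{whenever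 }\ddot u_{nm}=F_{nm},$$ where $\phi^{tt}_{nm}=D_t^2\phi_{nm}-(D_t^2\tau)\dot u_{nm}-2(D_t\tau)\ddot u_{nm}$. Allowed transformations are $u_{nm}(t)=\dot{\tilde t}^{\,-1/2}P_{nm}\,\tilde u_{nm}(\tilde t)+Q_{nm}(t)$ with $\tilde t,Q_{nm}$ smooth, $\dot{\tilde t}>0$, and constants $P_{nm}\neq0$. They turn (1) into an equation of the same form with $$\tilde F_{nm}=\dot{\tilde t}^{\,-3/2}P_{nm}^{-1}(F_{nm}-\ddot Q_{nm})+\tfrac12\dot{\tilde t}^{\,-3}\big(\dddot{\tilde t}-\tfrac32\dot{\tilde t}^{\,-1}\ddot{\tilde t}^{\,2}\big)\tilde u_{nm}.$$ For functions $f^{(i)}$ on $\mathbb Z^2$ let $\mathcal D[f^{(1)}_{p_1q_1},\dots,f^{(N)}_{p_Nq_N}]=\det\big(f^{(j)}_{p_kq_k}\big)_{j,k}$; $1_{pq}$ is the constant function. A real power of a nonzero number means that of its absolute value. *The algebras considered.* Let $L$ be a real Lie algebra of symmetries of (1), $\dim L=7$, not solvable, such that no nonzero element of $L$ vanishes during a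 whole open interval of times. Let $L$ be in general position: a space $V$ of functions on $\mathbb Z^2$ of dimension $N$ is called nondegenerate if for all $(n,m)$ a function in $V$ that vanishes at the first $N$ points of $\Gamma(n,m)$ is zero (that is, $\mathcal D[f^{(1)}_{nm},f^{(2)}_{n+1\,m},\dots]\ne0$ for a basis); it is required that * the span of $1$ and of all $a_{nm}$ with $(a_{nm}u_{nm}+\lambda_{nm}(t))\partial_{u_{nm}}\in L$ is nondegenerate; * for each $t\in I$ the space $T_t$ of the functions $(n,m)\mapsto\lambda_{nm}(t)$ with $\lambda_{nm}\partial_{u_{nm}}\in L$ is nondegenerate, and if $\dim T_t=2$, then a function in $T_t$ that vanishes at $(n,m)$ and $(n,m+1)$, for some $(n,m)$, is zero. *Two classes.* In both classes $L$ is, up to an allowed transformation, spanned by $\partial_t,\ t\partial_t+\tfrac12u_{nm}\partial_{u_{nm}},\ t^2\partial_t+tu_{nm}\partial_{u_{nm}}$ (a copy of $\mathrm{sl}(2,\mathbb R)$) and the radical $\langle\hat Y_1,\dots,\hat Y_4\rangle$, and the transformed interaction is locally of the form shown (near each point of the domain where, in the new variables, all $u_{pq}\ne0$, respectively $\mathcal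 D[u_{nm},\kappa_{n+1\,m},1_{n\,m+1}]\neq0$; $f_{nm}$ is a smooth function, which may depend on that point). $NS_{7,1}$: $\hat Y_i=a^{(i)}_{nm}u_{nm}\partial_{u_{nm}}$, $i=1,\dots,4$, where for all $(n,m)$ $\Delta_{nm}:=\mathcal D[a^{(1)}_{nm},a^{(2)}_{n+1\,m},a^{(3)}_{n\,m+1},a^{(4)}_{n-1\,m+1},1_{n-1\,m}]\ne0$, and with $s_0,\dots,s_4$ the first five points of $\Gamma(n,m)$, $$F_{nm}=u_{nm}\Big[\prod_{j=0}^4u_{s_j}^{(-1)^{j+1}M_j}\Big]^{4/\Delta_{nm}}f_{nm}(\xi_{n\,m-1},\xi_{n+1\,m-1}),\qquad \xi_{pq}=\Big(\prod_{j=0}^{4}u_{s_j}^{(-1)^jM_j^{pq}}\Big)\,u_{pq}^{-\Delta_{nm}},$$ where $M_j$ is the determinant $\mathcal D[a^{(1)},a^{(2)},a^{(3)},a^{(4)}]$ at the four points $s_0,\dots,s_4$ other than $s_j$, in this order, and $M_j^{pq}$ is the determinant $\mathcal D[a^{(1)},a^{(2)},a^{(3)},a^{(4)},1_{pq}]$ at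 the same four points followed by $(p,q)$. $NS_{7,2}$: $\hat Y_1=\partial_{u_{nm}}$, $\hat Y_2=t\partial_{u_{nm}}$, $\hat Y_3=\kappa_{nm}\partial_{u_{nm}}$, $\hat Y_4=\kappa_{nm}t\partial_{u_{nm}}$, where $\kappa_{nm}$ does not depend on $t$ and $\kappa_{nm}\ne\kappa_{n+1\,m}$, $\kappa_{nm}\neq\kappa_{n\,m+1}$ for all $(n,m)$, and $$F_{nm}=\big(\mathcal D[u_{nm},\kappa_{n+1\,m},1_{n\,m+1}]\big)^{-3}f_{nm}(\xi_{pq}),\quad \xi_{pq}=\frac{\mathcal D[u_{nm},\kappa_{n+1\,m},1_{pq}]}{\mathcal D[u_{nm},\kappa_{n+1\,m},1_{n\,m+1}]},$$ with $(p,q)\in\Gamma(n,m)\setminus\{(n,m),(n+1,m),(n,m+1)\}$. *Claim.* (a) If a nonlinear coupled equation (1) has an algebra $L$ as above, then every nonempty open interval of times in $I$ contains a nonempty open interval over which $(F,L)$ belongs to $NS_{7,1}$ or to $NS_{7,2}$. (b) Conversely, if $F$ is smooth and $(F,L)$ belongs to one of the two classes, then $L$ is an algebra as above, with radical $\langle\hat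 Y_1,\dots,\hat Y_4\rangle$ in the new variables. (c) Each class contains a pair $(F,L)$, with $F$ nonlinear and coupled, for which $L$ is the algebra of all symmetries of (1). (d) No pair $(F,L)$ belongs to both classes. -/

import Mathlib

open Set Filter Topology
open scoped ContDiff

namespace TriLattice

/-! ### The triangular lattice and the equation -/

abbrev Site := ℤ × ℤ

/-- The offsets of the seven points of `Γ`: the centre, then the six nearest neighbours in the order
`(n+1,m), (n,m+1), (n-1,m+1), (n-1,m), (n,m-1), (n+1,m-1)`. -/
def nbr : Fin 7 → Site :=
  ![(0, 0), (1, 0), (0, 1), (-1, 1), (-1, 0), (0, -1), (1, -1)]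

/-- Where the equation lives: times `t ∈ I`, values `u s ∈ J s` at the site `s`, and, for the
interaction at `s`, the set `Ω s` of points `(t, v)` with `v i = u (s + nbr i)`. -/
structure LatticeDomain where
  I : Set ℝ
  J : Site → Set ℝ
  Ω : Site → Set (ℝ × (Fin 7 → ℝ))

/-- `I` and all `J s` are nonempty open intervals, the values that occur at all sites together form
an interval, and `Ω s` is an open set of points with the right coordinates, above all of `I × J s`. -/
structure LatticeDomain.Regular (D : LatticeDomain) : Prop where
  isOpen_I : IsOpen D.I
  ordConnected_I : D.I.OrdConnected
  nonempty_I : D.I.Nonempty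
  isOpen_J : ∀ s, IsOpen (D.J s)
  ordConnected_J : ∀ s, (D.J s).OrdConnected
  nonempty_J : ∀ s, (D.J s).Nonempty
  union_J : (⋃ s, D.J s).OrdConnected
  isOpen_Ω : ∀ s, IsOpen (D.Ω s)
  Ω_subset : ∀ s, ∀ x ∈ D.Ω s, x.1 ∈ D.I ∧ ∀ i, x.2 i ∈ D.J (s + nbr i)
  Ω_onto : ∀ s, ∀ t ∈ D.I, ∀ u ∈ D.J s, ∃ v, (t, v) ∈ D.Ω s ∧ v 0 = u

/-- The same domain over a smaller set of times. -/
def LatticeDomain.restrict (D : LatticeDomain) (I' : Set ℝ) : LatticeDomain where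
  I := I'
  J := D.J
  Ω := fun s => {x ∈ D.Ω s | x.1 ∈ I'}

/-- The region of the `(t, u s)`-plane at the site `s`. -/
def LatticeDomain.plane (D : LatticeDomain) (s : Site) : Set (ℝ × ℝ) := D.I ×ˢ D.J s

/-- The partial derivative of a function of `(t, v)` in the variable `v i`. -/
noncomputable def partialU (g : ℝ × (Fin 7 → ℝ) → ℝ) (i : Fin 7) (x : ℝ × (Fin 7 → ℝ)) : ℝ :=
  fderiv ℝ g x (0, Pi.single i 1)

/-- `F s (t, v)` is the right-hand side of `ü s = F s (t, v)`: smooth, nonlinear in the `u`'s at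
every site, and coupled to all seven points of `Γ` (no `∂F/∂u` vanishes on a nonempty open set). -/
structure IsInteraction (D : LatticeDomain) (F : Site → ℝ × (Fin 7 → ℝ) → ℝ) : Prop where
  smooth : ∀ s, ContDiffOn ℝ ∞ (F s) (D.Ω s)
  nonlinear : ∀ s, ∃ i j, ∃ x ∈ D.Ω s, partialU (partialU (F s) i) j x ≠ 0
  coupled : ∀ s i, ∀ O ⊆ D.Ω s, IsOpen O → O.Nonempty → ∃ x ∈ O, partialU (F s) i x ≠ 0

/-! ### Vector fields and symmetries -/

/-- At each site `s` a vector field on the `(t, u s)`-plane, with components `(τ, φ s)`. -/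
abbrev LatticeField := Site → ℝ × ℝ → ℝ × ℝ

/-- The total time derivative of `g (t, u)`; `w` stands for `u̇`. -/
noncomputable def totalD (g : ℝ × ℝ → ℝ) (p : ℝ × ℝ) (w : ℝ) : ℝ := fderiv ℝ g p (1, w)

/-- The second total time derivative of `g (t, u)`; `w` stands for `u̇` and `z` for `ü`. -/
noncomputable def totalD2 (g : ℝ × ℝ → ℝ) (p : ℝ × ℝ) (w z : ℝ) : ℝ :=
  fderiv ℝ (fun q => totalD g q w) p (1, w) + fderiv ℝ g p (0, z)

/-- The coefficient of `∂/∂ü` in the second prolongation of `τ ∂_t + φ ∂_u`: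
`D_t² φ - (D_t² τ) u̇ - 2 (D_t τ) ü`. -/
noncomputable def phiTT (V : ℝ × ℝ → ℝ × ℝ) (p : ℝ × ℝ) (w z : ℝ) : ℝ :=
  totalD2 (fun q => (V q).2) p w z - totalD2 (fun q => (V q).1) p w z * w
    - 2 * totalD (fun q => (V q).1) p w * z

/-- `τ(t,u s) ∂_t + φ s (t,u s) ∂_{u s}` is a Lie point symmetry: its second prolongation annihilates
`ü s - F s` on the solution set, for every velocity `w = u̇ s`. The field is a smooth one on the planes
`I × J s`, with one function `τ` for all sites, and is extended by zero outside. -/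
structure IsSymmetry (D : LatticeDomain) (F : Site → ℝ × (Fin 7 → ℝ) → ℝ)
    (X : LatticeField) : Prop where
  zero_outside : ∀ s, ∀ p, p ∉ D.plane s → X s p = 0
  smooth : ∀ s, ContDiffOn ℝ ∞ (X s) (D.plane s)
  common_tau : ∃ τ : ℝ × ℝ → ℝ, ∀ s, ∀ p ∈ D.plane s, (X s p).1 = τ p
  invariance : ∀ s, ∀ x ∈ D.Ω s, ∀ w : ℝ,
    phiTT (X s) (x.1, x.2 0) w (F s x)
      - fderiv ℝ (F s) x ((X s (x.1, x.2 0)).1,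
          fun i => (X (s + nbr i) (x.1, x.2 i)).2) = 0

/-! ### Lie algebras of fields -/

noncomputable def bracket (X Y : LatticeField) : LatticeField :=
  fun s => VectorField.lieBracket ℝ (X s) (Y s)

/-- The space spanned by all brackets of elements of `L`. -/
noncomputable def derivedSpan (L : Submodule ℝ LatticeField) : Submodule ℝ LatticeField :=
  Submodule.span ℝ {Z | ∃ X ∈ L, ∃ Y ∈ L, Z = bracket X Y}

/-- The derived series of `L` reaches zero. -/
def IsSolvableSpace (L : Submodule ℝ LatticeField) : Prop := ∃ k : ℕ, derivedSpan^[k] L = ⊥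

def IsIdealOf (S L : Submodule ℝ LatticeField) : Prop :=
  S ≤ L ∧ ∀ X ∈ L, ∀ Y ∈ S, bracket X Y ∈ S

/-- `R` is the largest solvable ideal of `L`. -/
def IsRadicalOf (R L : Submodule ℝ LatticeField) : Prop :=
  IsIdealOf R L ∧ IsSolvableSpace R ∧ ∀ S, IsIdealOf S L → IsSolvableSpace S → S ≤ R

/-- `L` is a Lie algebra of symmetries, and no nonzero element of it vanishes during a whole
interval of time. -/
structure IsSymmetryAlgebra (D : LatticeDomain) (F : Site → ℝ × (Fin 7 → ℝ) → ℝ)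
    (L : Submodule ℝ LatticeField) : Prop where
  symm : ∀ X ∈ L, IsSymmetry D F X
  closed : ∀ X ∈ L, ∀ Y ∈ L, bracket X Y ∈ L
  effective : ∀ X ∈ L, ∀ b c : ℝ, b < c → Ioo b c ⊆ D.I →
    (∀ s, ∀ p ∈ D.plane s, p.1 ∈ Ioo b c → X s p = 0) → X = 0

/-! ### General position with respect to the lattice -/

/-- The span of the constant function and of the functions `a` on the lattice such that `L` contains
a field `(a_s u + λ_s(t)) ∂_u`. -/
noncomputable def scalingSpace (D : LatticeDomain) (L : Submodule ℝ LatticeField) :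
    Submodule ℝ (Site → ℝ) :=
  Submodule.span ℝ ({f | ∃ X ∈ L, ∀ s, ∀ p ∈ D.plane s,
    (X s p).1 = 0 ∧ fderiv ℝ (X s) p (0, 1) = (0, f s)} ∪ {fun _ => 1})

/-- The functions `s ↦ λ_s(t)`, for the fields `λ_s(t) ∂_u` in `L`, at the time `t`. -/
noncomputable def translationSpace (D : LatticeDomain) (L : Submodule ℝ LatticeField) (t : ℝ) :
    Submodule ℝ (Site → ℝ) :=
  Submodule.span ℝ {f | ∃ X ∈ L, (∀ s, ∀ p ∈ D.plane s,
    (X s p).1 = 0 ∧ fderiv ℝ (X s) p (0, 1) = 0) ∧ ∀ s, ∀ u ∈ D.J s, (X s (t, u)).2 = f s}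

/-- An `N`-dimensional space of functions on the lattice is determined by the values at the first `N`
points of `Γ`, around every site: for a basis `f⁽¹⁾, …, f⁽ᴺ⁾`, the determinant of the values of
`f⁽¹⁾, …, f⁽ᴺ⁾` at these points is nonzero. -/
def NonvanishingDet (V : Submodule ℝ (Site → ℝ)) : Prop :=
  ∀ s, ∀ f ∈ V, (∀ i : Fin 7, (i : ℕ) < Module.finrank ℝ V → f (s + nbr i) = 0) → f = 0

/-- The determinants formed with the coefficients of `L` do not vanish; two-dimensional translation
spaces are nondegenerate along both `n` and `m`. -/
structure GeneralPosition (D : LatticeDomain) (L : Submodule ℝ LatticeField) : Prop where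
  scaling : NonvanishingDet (scalingSpace D L)
  translation : ∀ t ∈ D.I, NonvanishingDet (translationSpace D L t)
  translation_two : ∀ t ∈ D.I, Module.finrank ℝ (translationSpace D L t) = 2 →
    ∀ s, ∀ f ∈ translationSpace D L t, f s = 0 → f (s + (0, 1)) = 0 → f = 0

/-- The restriction of fields to the times in `I'` (zero at other times). -/
noncomputable def cutoff (I' : Set ℝ) : LatticeField →ₗ[ℝ] LatticeField where
  toFun X := fun s => (Prod.fst ⁻¹' I').indicator (X s)
  map_add' X Y := by
    funext s
    exact Set.indicator_add _ (X s) (Y s)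
  map_smul' c X := by
    funext s
    exact Set.indicator_const_smul _ c (X s)

/-! ### Allowed transformations -/

/-- The transformation `t̃ = θ(t)`, `u_s(t) = θ'(t)^(-1/2) P_s ũ_s(t̃) + Q_s(t)`. -/
structure AllowedMap where
  θ : ℝ → ℝ
  P : Site → ℝ
  Q : Site → ℝ → ℝ

def AllowedMap.Admissible (Φ : AllowedMap) (I : Set ℝ) : Prop :=
  ContDiffOn ℝ ∞ Φ.θ I ∧ (∀ t ∈ I, 0 < deriv Φ.θ t) ∧ (∀ s, Φ.P s ≠ 0) ∧
    ∀ s, ContDiffOn ℝ ∞ (Φ.Q s) I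

/-- `ũ_s` as a function of `(t, u_s)`. -/
noncomputable def AllowedMap.newU (Φ : AllowedMap) (s : Site) (p : ℝ × ℝ) : ℝ :=
  √(deriv Φ.θ p.1) * (p.2 - Φ.Q s p.1) / Φ.P s

/-- `(t, u_s) ↦ (t̃, ũ_s)`. -/
noncomputable def AllowedMap.pointMap (Φ : AllowedMap) (s : Site) (p : ℝ × ℝ) : ℝ × ℝ :=
  (Φ.θ p.1, Φ.newU s p)

/-- The seven values `ũ` at the points of `Γ` around `s`. -/
noncomputable def AllowedMap.newV (Φ : AllowedMap) (s : Site) (x : ℝ × (Fin 7 → ℝ)) : Fin 7 → ℝ :=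
  fun i => Φ.newU (s + nbr i) (x.1, x.2 i)

/-- The transformed interaction, `ũ_s'' = F̃_s`, as a function of the old variables. -/
noncomputable def AllowedMap.newF (Φ : AllowedMap) (F : Site → ℝ × (Fin 7 → ℝ) → ℝ) (s : Site)
    (x : ℝ × (Fin 7 → ℝ)) : ℝ :=
  (deriv Φ.θ x.1) ^ (-(3 / 2) : ℝ) * (Φ.P s)⁻¹ * (F s x - iteratedDeriv 2 (Φ.Q s) x.1)
    + 1 / 2 * ((deriv Φ.θ x.1) ^ 3)⁻¹
      * (iteratedDeriv 3 Φ.θ x.1 - 3 / 2 * (deriv Φ.θ x.1)⁻¹ * (iteratedDeriv 2 Φ.θ x.1) ^ 2)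
      * Φ.newU s (x.1, x.2 0)

/-- `L` consists of the fields on the domain that the transformation `Φ` carries to the fields in
`V`. -/
def Corresponds (D : LatticeDomain) (Φ : AllowedMap) (L V : Submodule ℝ LatticeField) : Prop :=
  ∀ X, X ∈ L ↔ (∀ s, ∀ p, p ∉ D.plane s → X s p = 0) ∧
    ∃ Y ∈ V, ∀ s, ∀ p ∈ D.plane s,
      fderiv ℝ (Φ.pointMap s) p (X s p) = Y s (Φ.pointMap s p)

/-! ### The canonical fields -/

/-- `∂_t`, `t ∂_t + (1/2) u ∂_u`, `t² ∂_t + t u ∂_u`. -/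
noncomputable def slField : Fin 3 → LatticeField :=
  ![fun _ _ => (1, 0), fun _ p => (p.1, p.2 / 2), fun _ p => (p.1 ^ 2, p.1 * p.2)]

/-- `a_s u ∂_u`. -/
def scalingField (a : Site → ℝ) : LatticeField := fun s p => (0, a s * p.2)

/-- `∂_u`, `t ∂_u`, `κ_s ∂_u`, `κ_s t ∂_u`. -/
def translationField (κ : Site → ℝ) : Fin 4 → LatticeField :=
  ![fun _ _ => (0, 1), fun _ p => (0, p.1), fun s _ => (0, κ s), fun s p => (0, κ s * p.1)]

/-- `span (a⁽¹⁾ u ∂_u, …, a⁽⁴⁾ u ∂_u)`. -/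
def radical1 (a : Fin 4 → Site → ℝ) : Submodule ℝ LatticeField :=
  Submodule.span ℝ (Set.range fun i => scalingField (a i))

/-- `span (∂_u, t ∂_u, κ ∂_u, κ t ∂_u)`. -/
def radical2 (κ : Site → ℝ) : Submodule ℝ LatticeField :=
  Submodule.span ℝ (Set.range (translationField κ))

def slSpan : Submodule ℝ LatticeField := Submodule.span ℝ (Set.range slField)

/-! ### The two classes -/

/-- `𝒟[f⁽¹⁾_{p₁}, …, f⁽ᴺ⁾_{p_N}]`, the determinant with entry `f⁽ʲ⁾_{p_k}` in row `j`, column `k`. -/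
def latDet {N : ℕ} (f : Fin N → Site → ℝ) (p : Fin N → Site) : ℝ :=
  Matrix.det (Matrix.of fun j k => f j (p k))

/-- `a⁽¹⁾, …, a⁽⁴⁾, 1`. -/
def withOne (a : Fin 4 → Site → ℝ) : Fin 5 → Site → ℝ :=
  Fin.snoc (α := fun _ => Site → ℝ) a (fun _ => 1)

/-- The index of the `k`-th of the first five points of `Γ`. -/
def five (k : Fin 5) : Fin 7 := Fin.castLE (by norm_num) k

/-- The indices of the first five points of `Γ`, followed by that of the point
`(n,m-1)` (`i = 0`) or `(n+1,m-1)` (`i = 1`). -/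
def six (i : Fin 2) : Fin 6 → Fin 7 :=
  Fin.snoc (α := fun _ => Fin 7) five (Fin.natAdd 5 i)

/-- `𝒟[a⁽¹⁾_{nm}, a⁽²⁾_{n+1,m}, a⁽³⁾_{n,m+1}, a⁽⁴⁾_{n-1,m+1}, 1_{n-1,m}]`. -/
def mainDet (a : Fin 4 → Site → ℝ) (s : Site) : ℝ :=
  latDet (withOne a) (fun k => s + nbr (five k))

/-- The invariants `ξ_{n,m-1}` and `ξ_{n+1,m-1}` of the first class; a real power of a nonzero number
is that of its absolute value. -/
noncomputable def xi1 (a : Fin 4 → Site → ℝ) (s : Site) (v : Fin 7 → ℝ) : Fin 2 → ℝ :=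
  fun i => ∏ j : Fin 6,
    |v (six i j)| ^ ((-1) ^ (j : ℕ) * latDet (withOne a) (fun k => s + nbr (six i (j.succAbove k))))

/-- The factor of `f(ξ)` in the interactions of the first class. -/
noncomputable def factor1 (a : Fin 4 → Site → ℝ) (s : Site) (v : Fin 7 → ℝ) : ℝ :=
  v 0 * (∏ j : Fin 5,
    |v (five j)| ^ ((-1) ^ ((j : ℕ) + 1) * latDet a (fun k => s + nbr (five (j.succAbove k)))))
      ^ (4 / mainDet a s)

/-- `𝒟[u_{nm}, κ_{n+1,m}, 1_{pq}]`, where `(p,q)` is the `i`-th point of `Γ`. -/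
noncomputable def det2 (κ : Site → ℝ) (s : Site) (v : Fin 7 → ℝ) (i : Fin 7) : ℝ :=
  Matrix.det !![v 0, v 1, v i;
    κ (s + nbr 0), κ (s + nbr 1), κ (s + nbr i);
    1, 1, 1]

/-- The invariants `ξ_{pq}` of the second class, at the last four points of `Γ`. -/
noncomputable def xi2 (κ : Site → ℝ) (s : Site) (v : Fin 7 → ℝ) : Fin 4 → ℝ :=
  fun i => det2 κ s v (Fin.natAdd 3 i) / det2 κ s v 2

/-- The class `NS_{7,1}`: in the new variables the algebra is `sl(2,ℝ)` together with the fields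
`a⁽ⁱ⁾ u ∂_u`, and, near every point where it makes sense, the interaction is
`u [∏ …]^α f(ξ)` with a smooth `f`. -/
structure ClassOne (D : LatticeDomain) (F : Site → ℝ × (Fin 7 → ℝ) → ℝ)
    (L : Submodule ℝ LatticeField) (Φ : AllowedMap) (a : Fin 4 → Site → ℝ) : Prop where
  admissible : Φ.Admissible D.I
  det_ne : ∀ s, mainDet a s ≠ 0
  algebra : Corresponds D Φ L (slSpan ⊔ radical1 a)
  form : ∀ s, ∀ x ∈ D.Ω s, (∀ i, Φ.newV s x i ≠ 0) →
    ∃ (f : (Fin 2 → ℝ) → ℝ) (O : Set (Fin 2 → ℝ)), IsOpen O ∧ xi1 a s (Φ.newV s x) ∈ O ∧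
      ContDiffOn ℝ ∞ f O ∧
      ∀ᶠ y in 𝓝 x, Φ.newF F s y = factor1 a s (Φ.newV s y) * f (xi1 a s (Φ.newV s y))

/-- The class `NS_{7,2}`: in the new variables the algebra is `sl(2,ℝ)` together with the fields
`∂_u, t ∂_u, κ ∂_u, κ t ∂_u`, and, near every point where it makes sense, the interaction is
`𝒟[u_{nm}, κ_{n+1,m}, 1_{n,m+1}]⁻³ f(ξ)` with a smooth `f`. -/
structure ClassTwo (D : LatticeDomain) (F : Site → ℝ × (Fin 7 → ℝ) → ℝ)
    (L : Submodule ℝ LatticeField) (Φ : AllowedMap) (κ : Site → ℝ) : Prop where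
  admissible : Φ.Admissible D.I
  ne_n : ∀ s, κ s ≠ κ (s + (1, 0))
  ne_m : ∀ s, κ s ≠ κ (s + (0, 1))
  algebra : Corresponds D Φ L (slSpan ⊔ radical2 κ)
  form : ∀ s, ∀ x ∈ D.Ω s, det2 κ s (Φ.newV s x) 2 ≠ 0 →
    ∃ (f : (Fin 4 → ℝ) → ℝ) (O : Set (Fin 4 → ℝ)), IsOpen O ∧ xi2 κ s (Φ.newV s x) ∈ O ∧
      ContDiffOn ℝ ∞ f O ∧
      ∀ᶠ y in 𝓝 x, Φ.newF F s y =
        (det2 κ s (Φ.newV s y) 2 ^ 3)⁻¹ * f (xi2 κ s (Φ.newV s y))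

/-- A seven-dimensional nonsolvable Lie algebra of symmetries, in general position. -/
structure IsNonsolvableSeven (D : LatticeDomain) (F : Site → ℝ × (Fin 7 → ℝ) → ℝ)
    (L : Submodule ℝ LatticeField) : Prop where
  algebra : IsSymmetryAlgebra D F L
  dim : Module.finrank ℝ L = 7
  nonsolvable : ¬ IsSolvableSpace L
  position : GeneralPosition D L

end TriLattice

open TriLattice

namespace TriLattice

/-! ### Smooth functions of one and two variables on open sets -/

/-! The invariance condition is polynomial in the velocity. Its coefficients, together with
coupling, force every symmetry into the form `τ(t) ∂_t + ((τ'/2 + a_s) u + l_s(t)) ∂_u` with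
constants `a_s` (`IsSymmetry.exists_isAff`). The fields without time component form a solvable
ideal: their brackets are pure translations, and translations commute. A nonsolvable `L` therefore
owes its nonsolvability to the algebra of its time components, a finite-dimensional algebra of
vector fields on a line.

Lie's classification on the line (`LineAlgebra.classification`) applies once no nonzero element
vanishes on an interval: either all brackets are multiples of one field, or the algebra is a copy of
`sl(2,ℝ)`. It comes from the orders of vanishing at a point where some `e` is nonzero. No nonzero
element vanishes to all orders, by uniqueness for a linear differential equation, and the largest
order is at most two. Smooth fields are not determined by their germs, so one first passes to an
interval of times on which the ideal of fields without time component cannot grow any more. This,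
and the need for `e > 0`, is why the result is local in time.

Let `e, h, f` be the standard basis of the algebra of time components. In the time `θ = h / e` they
become `1, θ, θ²`. On translations, `e` acts by `l ↦ e l' - e' l / 2`, whose kernel is spanned by
`√e`, and every kernel vector has the weight `-1/2` under `h`. Finite-dimensional representation
theory then leaves only copies of the two-dimensional representation (`sq_eq_zero_of_sl_two`), so
translations are `(c + d θ) √e`. A suitable shift `Q` removes the inhomogeneous parts of the
generators (`SlData.exists_standard`), and `L` becomes `ParSub A C`: `sl(2,ℝ)`, scalings `a ∈ A`,
translations `c + d t` with `c, d ∈ C`, and `A C ⊆ C`.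

Dimension seven means `dim A + 2 dim C = 4`. The case `(2, 1)` is impossible: `C` is spanned by a
function without zeros, so `A` consists of constants. In the case `(4, 0)`, coupling excludes `1 ∈
A` and general position gives `Δ ≠ 0`. In the case `(0, 2)`, general position gives `C = P · {1,
κ}`, and `P` is absorbed into the transformation.

In the new variables the determining equations say that the interaction does not depend on time, is
homogeneous of degree `-3`, is equivariant under `A` and invariant under `C` (`detEq_iff_red`).
Moving a point along the orbits to a slice on which only the invariants vary gives the two normal
forms (`local_form1`, `local_form2`). Conversely, these forms satisfy the equations off a set
without interior, hence everywhere by continuity. The algebra is then explicit, and simplicity of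
`sl(2,ℝ)` identifies the radical (`isRadicalOf`). The classes differ because only the second
contains translations. For the full symmetry algebras, two rational interactions are given whose
determining equations can be solved completely. -/

theorem smooth_hasDerivAt {f : ℝ → ℝ} {I : Set ℝ} (hI : IsOpen I) (hf : ContDiffOn ℝ ∞ f I)
    {t : ℝ} (ht : t ∈ I) : HasDerivAt f (deriv f t) t :=
  ((hf.contDiffAt (hI.mem_nhds ht)).differentiableAt (by simp)).hasDerivAt

theorem smooth_deriv {f : ℝ → ℝ} {I : Set ℝ} (hI : IsOpen I) (hf : ContDiffOn ℝ ∞ f I) :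
    ContDiffOn ℝ ∞ (deriv f) I :=
  hf.deriv_of_isOpen hI (by simp)

theorem const_of_hasDerivAt_zero {f : ℝ → ℝ} {I : Set ℝ} (hI : IsOpen I) (hc : I.OrdConnected)
    (hf : ∀ t ∈ I, HasDerivAt f 0 t) {x y : ℝ} (hx : x ∈ I) (hy : y ∈ I) : f x = f y :=
  hI.is_const_of_deriv_eq_zero hc.isPreconnected
    (fun t ht => (hf t ht).differentiableAt.differentiableWithinAt) (fun t ht => (hf t ht).deriv) hx hy

theorem deriv_congr_on {f g : ℝ → ℝ} {I : Set ℝ} (hI : IsOpen I) (h : EqOn f g I) :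
    EqOn (deriv f) (deriv g) I := fun _ ht =>
  (Filter.eventuallyEq_of_mem (hI.mem_nhds ht) h).deriv_eq

/-- The partial derivatives of a function of two variables. -/
noncomputable def pt (g : ℝ × ℝ → ℝ) (q : ℝ × ℝ) : ℝ := fderiv ℝ g q (1, 0)
noncomputable def pu (g : ℝ × ℝ → ℝ) (q : ℝ × ℝ) : ℝ := fderiv ℝ g q (0, 1)

theorem fderiv_two (g : ℝ × ℝ → ℝ) (q : ℝ × ℝ) (a b : ℝ) :
    fderiv ℝ g q (a, b) = a * pt g q + b * pu g q := by
  have : ((a, b) : ℝ × ℝ) = a • (1, 0) + b • (0, 1) := by simp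
  rw [this, map_add, map_smul, map_smul]; rfl

section
variable {g : ℝ × ℝ → ℝ} {U : Set (ℝ × ℝ)}

theorem smooth_fderiv_apply (hU : IsOpen U) (hg : ContDiffOn ℝ ∞ g U) (v : ℝ × ℝ) :
    ContDiffOn ℝ ∞ (fun q => fderiv ℝ g q v) U :=
  (hg.fderiv_of_isOpen hU (m := ∞) (by simp)).clm_apply contDiffOn_const

theorem smooth_pt (hU : IsOpen U) (hg : ContDiffOn ℝ ∞ g U) : ContDiffOn ℝ ∞ (pt g) U :=
  smooth_fderiv_apply hU hg _

theorem smooth_pu (hU : IsOpen U) (hg : ContDiffOn ℝ ∞ g U) : ContDiffOn ℝ ∞ (pu g) U :=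
  smooth_fderiv_apply hU hg _

theorem smooth_hasFDerivAt (hU : IsOpen U) (hg : ContDiffOn ℝ ∞ g U) {p} (hp : p ∈ U) :
    HasFDerivAt g (fderiv ℝ g p) p :=
  ((hg.contDiffAt (hU.mem_nhds hp)).differentiableAt (by simp)).hasFDerivAt

theorem hasDerivAt_fst (hU : IsOpen U) (hg : ContDiffOn ℝ ∞ g U) {t u : ℝ} (hp : (t, u) ∈ U) :
    HasDerivAt (fun t => g (t, u)) (pt g (t, u)) t :=
  (smooth_hasFDerivAt hU hg hp).comp_hasDerivAt t
    ((hasDerivAt_id t).prodMk (hasDerivAt_const t u))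

theorem hasDerivAt_snd (hU : IsOpen U) (hg : ContDiffOn ℝ ∞ g U) {t u : ℝ} (hp : (t, u) ∈ U) :
    HasDerivAt (fun u => g (t, u)) (pu g (t, u)) u :=
  (smooth_hasFDerivAt hU hg hp).comp_hasDerivAt u
    ((hasDerivAt_const u t).prodMk (hasDerivAt_id u))

theorem pt_pu_comm (hU : IsOpen U) (hg : ContDiffOn ℝ ∞ g U) {p} (hp : p ∈ U) :
    pt (pu g) p = pu (pt g) p := by
  have hc : ContDiffAt ℝ ∞ g p := hg.contDiffAt (hU.mem_nhds hp)
  have hs := (contDiffAt_infty.1 hc 2).isSymmSndFDerivAt (by simp)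
  have hd : DifferentiableAt ℝ (fderiv ℝ g) p :=
    (hc.fderiv_right (m := ∞) (by simp)).differentiableAt (by simp)
  have key : ∀ v w : ℝ × ℝ, fderiv ℝ (fun q => fderiv ℝ g q v) p w = fderiv ℝ (fderiv ℝ g) p w v := by
    intro v w
    have := (hd.hasFDerivAt.clm_apply (hasFDerivAt_const v p)).fderiv
    rw [this]; simp
  unfold pt pu
  rw [key, key]
  exact hs.eq _ _

theorem totalD_eq (g : ℝ × ℝ → ℝ) (q : ℝ × ℝ) (w : ℝ) : totalD g q w = pt g q + w * pu g q := by
  rw [totalD, fderiv_two]; ring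

theorem totalD2_eq (hU : IsOpen U) (hg : ContDiffOn ℝ ∞ g U) {p} (hp : p ∈ U) (w z : ℝ) :
    totalD2 g p w z = pt (pt g) p + 2 * w * pu (pt g) p + w ^ 2 * pu (pu g) p + z * pu g p := by
  have h1 := smooth_hasFDerivAt hU (smooth_pt hU hg) hp
  have h2 := smooth_hasFDerivAt hU (smooth_pu hU hg) hp
  have : HasFDerivAt (fun q => totalD g q w) (fderiv ℝ (pt g) p + w • fderiv ℝ (pu g) p) p := by
    simp only [totalD_eq]
    exact h1.add (h2.const_mul w)
  rw [totalD2, this.fderiv, _root_.add_apply, _root_.smul_apply,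
    fderiv_two, fderiv_two, fderiv_two, ← pt_pu_comm hU hg hp]
  simp only [smul_eq_mul]; ring

end

theorem phiTT_eq {V : ℝ × ℝ → ℝ × ℝ} {U : Set (ℝ × ℝ)} (hU : IsOpen U) (hV : ContDiffOn ℝ ∞ V U) {p}
    (hp : p ∈ U) (w z : ℝ) :
    phiTT V p w z =
      (pt (pt fun q => (V q).2) p + z * pu (fun q => (V q).2) p - 2 * z * pt (fun q => (V q).1) p)
      + (2 * pu (pt fun q => (V q).2) p - pt (pt fun q => (V q).1) p
        - 3 * z * pu (fun q => (V q).1) p) * w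
      + (pu (pu fun q => (V q).2) p - 2 * pu (pt fun q => (V q).1) p) * w ^ 2
      - pu (pu fun q => (V q).1) p * w ^ 3 := by
  have h1 : ContDiffOn ℝ ∞ (fun q => (V q).1) U := hV.fst
  have h2 : ContDiffOn ℝ ∞ (fun q => (V q).2) U := hV.snd
  rw [phiTT, totalD2_eq hU h1 hp, totalD2_eq hU h2 hp, totalD_eq]
  ring

/-- Four sample values determine a cubic. This splits the invariance condition by powers of the
velocity. -/
theorem cubic_zero {a b c d r : ℝ} (h : ∀ w : ℝ, a + b * w + c * w ^ 2 - d * w ^ 3 - r = 0) :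
    a = r ∧ b = 0 ∧ c = 0 ∧ d = 0 := by
  have h0 := h 0; have h1 := h 1; have h2 := h (-1); have h3 := h 2
  norm_num at h0 h1 h2 h3
  refine ⟨?_, ?_, ?_, ?_⟩ <;> linarith

/-! ### Domains -/

section
variable {D : LatticeDomain}

theorem LatticeDomain.Regular.isOpen_plane (hD : D.Regular) (s : Site) : IsOpen (D.plane s) :=
  hD.isOpen_I.prod (hD.isOpen_J s)

theorem LatticeDomain.Regular.mem_plane (hD : D.Regular) {s : Site} {x} (hx : x ∈ D.Ω s) (i : Fin 7) :
    (x.1, x.2 i) ∈ D.plane (s + nbr i) :=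
  ⟨(hD.Ω_subset s x hx).1, (hD.Ω_subset s x hx).2 i⟩

theorem nbr_zero : nbr 0 = 0 := rfl

theorem LatticeDomain.Regular.mem_plane_zero (hD : D.Regular) {s : Site} {x} (hx : x ∈ D.Ω s) :
    (x.1, x.2 0) ∈ D.plane s := by
  simpa [nbr_zero] using hD.mem_plane hx 0

theorem LatticeDomain.Regular.restrict (hD : D.Regular) {I' : Set ℝ} (ho : IsOpen I')
    (hc : I'.OrdConnected) (hn : I'.Nonempty) (hs : I' ⊆ D.I) : (D.restrict I').Regular where
  isOpen_I := ho
  ordConnected_I := hc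
  nonempty_I := hn
  isOpen_J := hD.isOpen_J
  ordConnected_J := hD.ordConnected_J
  nonempty_J := hD.nonempty_J
  union_J := hD.union_J
  isOpen_Ω s := (hD.isOpen_Ω s).inter (ho.preimage continuous_fst)
  Ω_subset s x hx := ⟨hx.2, (hD.Ω_subset s x hx.1).2⟩
  Ω_onto s t ht u hu := by
    obtain ⟨v, h, h0⟩ := hD.Ω_onto s t (hs ht) u hu
    exact ⟨v, ⟨h, ht⟩, h0⟩

end

/-! ### The form of the symmetries -/

/-- The field `τ(t) ∂_t + ((τ'(t)/2 + a_s) u + l_s(t)) ∂_u` on the planes of `D`, zero elsewhere. -/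
structure IsAff (D : LatticeDomain) (X : LatticeField) (τ : ℝ → ℝ) (a : Site → ℝ)
    (l : Site → ℝ → ℝ) : Prop where
  zero_out : ∀ s, ∀ p, p ∉ D.plane s → X s p = 0
  eq : ∀ s t u, (t, u) ∈ D.plane s → X s (t, u) = (τ t, (deriv τ t / 2 + a s) * u + l s t)
  smooth_tau : ContDiffOn ℝ ∞ τ D.I
  smooth_l : ∀ s, ContDiffOn ℝ ∞ (l s) D.I

/-- The form in which coupling gets contradicted: `h` is an expression for the interaction that does
not contain the `i`-th value. -/
theorem partialU_eq_zero_of_const {F : ℝ × (Fin 7 → ℝ) → ℝ} {O : Set (ℝ × (Fin 7 → ℝ))} (hO : IsOpen O)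
    (hF : DifferentiableOn ℝ F O) {i : Fin 7} {h : ℝ × (Fin 7 → ℝ) → ℝ}
    (heq : ∀ x ∈ O, F x = h x) (hc : ∀ (x : ℝ × (Fin 7 → ℝ)) (r : ℝ), h (x.1, x.2 + r • Pi.single i 1) = h x) {x} (hx : x ∈ O) :
    partialU F i x = 0 := by
  have hline : HasDerivAt (fun r : ℝ => (x.1, x.2 + r • (Pi.single i 1 : Fin 7 → ℝ)))
      (0, Pi.single i 1) 0 := by
    have := ((hasDerivAt_id (0:ℝ)).smul_const (Pi.single i 1 : Fin 7 → ℝ)).const_add x.2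
    simpa using (hasDerivAt_const (0:ℝ) x.1).prodMk this
  have h0 : (x.1, x.2 + (0:ℝ) • (Pi.single i 1 : Fin 7 → ℝ)) = x := by simp
  have hFx : HasFDerivAt F (fderiv ℝ F x) ((x.1, x.2 + (0:ℝ) • (Pi.single i 1 : Fin 7 → ℝ))) := by
    rw [h0]; exact ((hF x hx).differentiableAt (hO.mem_nhds hx)).hasFDerivAt
  have hcomp := hFx.comp_hasDerivAt (0:ℝ) hline
  have hev : (fun r : ℝ => h x) =ᶠ[𝓝 0] (F ∘ fun r : ℝ => (x.1, x.2 + r • (Pi.single i 1 : Fin 7 → ℝ))) := by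
    have : ∀ᶠ r in 𝓝 (0:ℝ), (x.1, x.2 + r • (Pi.single i 1 : Fin 7 → ℝ)) ∈ O :=
      hline.continuousAt (by rw [h0]; exact hO.mem_nhds hx)
    filter_upwards [this] with r hr
    simp only [Function.comp]
    rw [heq _ hr, hc]
  exact (hcomp.congr_of_eventuallyEq hev).unique (hasDerivAt_const _ _)

/-- These are the coefficients of `w` and `w²` in the invariance condition, which holds for every
velocity `w`. -/
theorem IsSymmetry.coeffs {D : LatticeDomain} (hD : D.Regular) {F : Site → ℝ × (Fin 7 → ℝ) → ℝ}
    {X : LatticeField} (hX : IsSymmetry D F X) {s : Site} {x} (hx : x ∈ D.Ω s) :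
    2 * pu (pt fun q => (X s q).2) (x.1, x.2 0) - pt (pt fun q => (X s q).1) (x.1, x.2 0)
        - 3 * F s x * pu (fun q => (X s q).1) (x.1, x.2 0) = 0 ∧
      pu (pu fun q => (X s q).2) (x.1, x.2 0) - 2 * pu (pt fun q => (X s q).1) (x.1, x.2 0) = 0 := by
  have h := cubic_zero fun w => by
    have := hX.invariance s x hx w
    rw [phiTT_eq (hD.isOpen_plane s) (hX.smooth s) (hD.mem_plane_zero hx)] at this
    exact this
  exact ⟨h.2.1, h.2.2.1⟩

/-- The time component of a symmetry does not depend on `u`. -/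
theorem IsSymmetry.pu_tau {D : LatticeDomain} (hD : D.Regular) {F : Site → ℝ × (Fin 7 → ℝ) → ℝ}
    (hF : IsInteraction D F) {X : LatticeField} (hX : IsSymmetry D F X) {s : Site} {p}
    (hp : p ∈ D.plane s) : pu (fun q => (X s q).1) p = 0 := by
  by_contra hne
  have ho := hD.isOpen_plane s
  have h1 : ContDiffOn ℝ ∞ (fun q => (X s q).1) (D.plane s) := (hX.smooth s).fst
  have hcont : ContinuousAt (pu fun q => (X s q).1) p :=
    ((smooth_pu ho h1).contDiffAt (ho.mem_nhds hp)).continuousAt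
  obtain ⟨N, hN, hNo, hpN⟩ := mem_nhds_iff.1 (hcont.eventually_ne hne)
  obtain ⟨v, hv, hv0⟩ := hD.Ω_onto s p.1 hp.1 p.2 hp.2
  set O := {x ∈ D.Ω s | (x.1, x.2 0) ∈ N} with hOdef
  have hO : IsOpen O := (hD.isOpen_Ω s).inter (hNo.preimage (by fun_prop))
  -- Where `τ_u ≠ 0`, the coefficient of `w` can be solved for `F`, which then depends on `t` and
  -- the value at the centre only. This contradicts coupling to the neighbour with index `1`.
  obtain ⟨x, hx, hne'⟩ := hF.coupled s 1 O (fun x hx => hx.1) hO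
    ⟨(p.1, v), hv, by simpa [hv0] using hpN⟩
  apply hne'
  refine partialU_eq_zero_of_const hO (((hF.smooth s).differentiableOn (by simp)).mono fun x hx => hx.1)
    (h := fun x => (2 * pu (pt fun q => (X s q).2) (x.1, x.2 0)
      - pt (pt fun q => (X s q).1) (x.1, x.2 0)) / (3 * pu (fun q => (X s q).1) (x.1, x.2 0))) ?_ ?_ hx
  · intro y hy
    have := (hX.coeffs hD hy.1).1
    have hny : pu (fun q => (X s q).1) (y.1, y.2 0) ≠ 0 := hN hy.2
    rw [eq_div_iff (by positivity)]; linarith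
  · intro y r; simp

/-- The common function `τ(t, u)` is locally constant in `u` on every `J s`. As the union of all `J
s` is an interval, constancy carries over between sites whose own intervals are disjoint. -/
theorem IsSymmetry.tau_const {D : LatticeDomain} (hD : D.Regular) {F : Site → ℝ × (Fin 7 → ℝ) → ℝ}
    (hF : IsInteraction D F) {X : LatticeField} (hX : IsSymmetry D F X) {s s' : Site} {t u u' : ℝ}
    (hp : (t, u) ∈ D.plane s) (hp' : (t, u') ∈ D.plane s') : (X s (t, u)).1 = (X s' (t, u')).1 := by
  obtain ⟨τ, hτ⟩ := hX.common_tau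
  rw [hτ s _ hp, hτ s' _ hp']
  refine const_of_hasDerivAt_zero (f := fun u => τ (t, u)) (isOpen_iUnion hD.isOpen_J) hD.union_J ?_
    (mem_iUnion_of_mem s hp.2) (mem_iUnion_of_mem s' hp'.2)
  intro v hv
  obtain ⟨r, hr⟩ := mem_iUnion.1 hv
  have hpr : (t, v) ∈ D.plane r := ⟨hp.1, hr⟩
  have := hasDerivAt_snd (hD.isOpen_plane r) (g := fun q => (X r q).1) (hX.smooth r).fst hpr
  rw [hX.pu_tau hD hF hpr] at this
  refine this.congr_of_eventuallyEq ?_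
  filter_upwards [(hD.isOpen_J r).mem_nhds hr] with y hy
  exact (hτ r (t, y) ⟨hp.1, hy⟩).symm

/-- Once `τ_u = 0`, the coefficients of `w²` and `w` say `φ_uu = 0` and `2 φ_tu = τ''`. So `φ` is
affine in `u`, and its slope differs from `τ'/2` by a constant at each site. -/
theorem IsSymmetry.exists_isAff {D : LatticeDomain} (hD : D.Regular)
    {F : Site → ℝ × (Fin 7 → ℝ) → ℝ} (hF : IsInteraction D F) {X : LatticeField}
    (hX : IsSymmetry D F X) : ∃ τ a l, IsAff D X τ a l := by
  choose u hu using hD.nonempty_J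
  have hslice : ∀ s, MapsTo (fun t : ℝ => (t, u s)) D.I (D.plane s) := fun s t ht => ⟨ht, hu s⟩
  have hsm : ∀ (g : ℝ × ℝ → ℝ) s, ContDiffOn ℝ ∞ g (D.plane s) →
      ContDiffOn ℝ ∞ (fun t => g (t, u s)) D.I := fun g s hg =>
    hg.comp (contDiff_id.prodMk contDiff_const).contDiffOn (hslice s)
  have h1 : ∀ s, ContDiffOn ℝ ∞ (fun q => (X s q).1) (D.plane s) := fun s => (hX.smooth s).fst
  have h2 : ∀ s, ContDiffOn ℝ ∞ (fun q => (X s q).2) (D.plane s) := fun s => (hX.smooth s).snd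
  have ho := hD.isOpen_plane
  have hput : ∀ s, ∀ p ∈ D.plane s, pu (pt fun q => (X s q).1) p = 0 := by
    intro s p hp
    rw [← pt_pu_comm (ho s) (h1 s) hp, pt]
    have : (pu fun q => (X s q).1) =ᶠ[𝓝 p] fun _ => 0 := by
      filter_upwards [(ho s).mem_nhds hp] with q hq using hX.pu_tau hD hF hq
    rw [this.fderiv_eq]; simp
  have hcoef : ∀ s, ∀ p ∈ D.plane s, pu (pu fun q => (X s q).2) p = 0 ∧
      2 * pt (pu fun q => (X s q).2) p = pt (pt fun q => (X s q).1) p := by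
    intro s p hp
    obtain ⟨v, hv, hv0⟩ := hD.Ω_onto s p.1 hp.1 p.2 hp.2
    have := hX.coeffs hD hv
    simp only [hv0, Prod.mk.eta] at this
    rw [hX.pu_tau hD hF hp, hput s p hp] at this
    rw [pt_pu_comm (ho s) (h2 s) hp]
    constructor <;> linarith
  obtain ⟨t₀, ht₀⟩ := hD.nonempty_I
  set τ : ℝ → ℝ := fun t => (X 0 (t, u 0)).1 with hτ
  set α : Site → ℝ → ℝ := fun s t => pu (fun q => (X s q).2) (t, u s) with hα
  have hτs : ContDiffOn ℝ ∞ τ D.I := hsm (fun q => (X 0 q).1) 0 (h1 0)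
  have hτeq : ∀ s t v, (t, v) ∈ D.plane s → (X s (t, v)).1 = τ t := fun s t v h =>
    hX.tau_const hD hF h (hslice 0 h.1)
  have hτ1 : ∀ s t, t ∈ D.I → HasDerivAt τ (pt (fun q => (X s q).1) (t, u s)) t := by
    intro s t ht
    refine (hasDerivAt_fst (ho s) (h1 s) (hslice s ht)).congr_of_eventuallyEq ?_
    filter_upwards [hD.isOpen_I.mem_nhds ht] with r hr using (hτeq s r _ (hslice s hr)).symm
  have hτ2 : ∀ s t, t ∈ D.I → HasDerivAt (deriv τ) (pt (pt fun q => (X s q).1) (t, u s)) t := by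
    intro s t ht
    refine (hasDerivAt_fst (ho s) (smooth_pt (ho s) (h1 s)) (hslice s ht)).congr_of_eventuallyEq ?_
    filter_upwards [hD.isOpen_I.mem_nhds ht] with r hr using (hτ1 s r hr).deriv
  have hα1 : ∀ s t, t ∈ D.I → α s t = deriv τ t / 2 + (α s t₀ - deriv τ t₀ / 2) := by
    intro s t ht
    have := const_of_hasDerivAt_zero (f := fun t => α s t - deriv τ t / 2) hD.isOpen_I
      hD.ordConnected_I ?_ ht ht₀
    · beta_reduce at this; linarith
    · intro r hr
      have := (hasDerivAt_fst (ho s) (smooth_pu (ho s) (h2 s)) (hslice s hr)).sub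
        ((hτ2 s r hr).div_const 2)
      rwa [← (hcoef s _ (hslice s hr)).2, mul_div_cancel_left₀ _ (two_ne_zero), sub_self] at this
  have hpu : ∀ s t v, (t, v) ∈ D.plane s → pu (fun q => (X s q).2) (t, v) = α s t := by
    intro s t v h
    refine const_of_hasDerivAt_zero (f := fun v => pu (fun q => (X s q).2) (t, v)) (hD.isOpen_J s)
      (hD.ordConnected_J s) ?_ h.2 (hu s)
    intro y hy
    have hp : (t, y) ∈ D.plane s := ⟨h.1, hy⟩
    have := hasDerivAt_snd (ho s) (smooth_pu (ho s) (h2 s)) hp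
    rwa [(hcoef s _ hp).1] at this
  refine ⟨τ, fun s => α s t₀ - deriv τ t₀ / 2, fun s t => (X s (t, u s)).2 - α s t * u s,
    hX.zero_outside, ?_, hτs, ?_⟩
  · intro s t v h
    refine Prod.ext (hτeq s t v h) ?_
    rw [← hα1 s t h.1]
    have := const_of_hasDerivAt_zero (f := fun v => (X s (t, v)).2 - α s t * v) (hD.isOpen_J s)
      (hD.ordConnected_J s) ?_ h.2 (hu s)
    · beta_reduce at this; linarith
    · intro y hy
      have hp : (t, y) ∈ D.plane s := ⟨h.1, hy⟩
      have := (hasDerivAt_snd (ho s) (h2 s) hp).sub ((hasDerivAt_id y).const_mul (α s t))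
      rwa [hpu s t y hp, mul_one, sub_self] at this
  · intro s
    exact (hsm _ s (h2 s)).sub ((hsm _ s (smooth_pu (ho s) (h2 s))).mul contDiffOn_const)


/-! ### Affine fields: prolongation and brackets -/

section
variable {D : LatticeDomain} {X Y : LatticeField} {τ τ₁ τ₂ : ℝ → ℝ} {a a₁ a₂ : Site → ℝ}
  {l l₁ l₂ : Site → ℝ → ℝ}

theorem affine_hasFDerivAt {g : ℝ × ℝ → ℝ} {U : Set (ℝ × ℝ)} (hU : IsOpen U) {α β : ℝ → ℝ}
    (hg : ∀ t u, (t, u) ∈ U → g (t, u) = α t * u + β t) {t u α' β' : ℝ} (hp : (t, u) ∈ U)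
    (hα : HasDerivAt α α' t) (hβ : HasDerivAt β β' t) :
    HasFDerivAt g ((α' * u + β') • ContinuousLinearMap.fst ℝ ℝ ℝ +
      α t • ContinuousLinearMap.snd ℝ ℝ ℝ) (t, u) := by
  have hα2 : HasFDerivAt (fun q : ℝ × ℝ => α q.1) (α' • ContinuousLinearMap.fst ℝ ℝ ℝ) (t, u) :=
    HasDerivAt.comp_hasFDerivAt (t, u) (f := fun q : ℝ × ℝ => q.1) hα hasFDerivAt_fst
  have hβ2 : HasFDerivAt (fun q : ℝ × ℝ => β q.1) (β' • ContinuousLinearMap.fst ℝ ℝ ℝ) (t, u) :=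
    HasDerivAt.comp_hasFDerivAt (t, u) (f := fun q : ℝ × ℝ => q.1) hβ hasFDerivAt_fst
  have h := (hα2.mul (hasFDerivAt_snd (p := (t, u)))).add hβ2
  refine (h.congr_of_eventuallyEq ?_).congr_fderiv ?_
  · filter_upwards [hU.mem_nhds hp] with q hq using hg q.1 q.2 hq
  · ext <;> simp; ring

theorem affine_pt_pu {g : ℝ × ℝ → ℝ} {U : Set (ℝ × ℝ)} (hU : IsOpen U) {α β : ℝ → ℝ}
    (hg : ∀ t u, (t, u) ∈ U → g (t, u) = α t * u + β t) {t u α' β' : ℝ} (hp : (t, u) ∈ U)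
    (hα : HasDerivAt α α' t) (hβ : HasDerivAt β β' t) :
    pt g (t, u) = α' * u + β' ∧ pu g (t, u) = α t := by
  have := (affine_hasFDerivAt hU hg hp hα hβ).fderiv
  simp [pt, pu, this]

theorem IsAff.smooth_coef (h : IsAff D X τ a l) (hI : IsOpen D.I) (s : Site) :
    ContDiffOn ℝ ∞ (fun t => deriv τ t / 2 + a s) D.I :=
  ((smooth_deriv hI h.smooth_tau).div_const 2).add contDiffOn_const

theorem IsAff.smooth (h : IsAff D X τ a l) (hD : D.Regular) (s : Site) :
    ContDiffOn ℝ ∞ (X s) (D.plane s) := by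
  have hm : MapsTo (Prod.fst : ℝ × ℝ → ℝ) (D.plane s) D.I := fun p hp => hp.1
  have h1 := h.smooth_tau.comp contDiff_fst.contDiffOn hm
  have h2 := ((h.smooth_coef hD.isOpen_I s).comp contDiff_fst.contDiffOn hm).mul
    (contDiff_snd (𝕜 := ℝ) (E := ℝ) (F := ℝ) (n := ∞)).contDiffOn
  have h3 := (h.smooth_l s).comp contDiff_fst.contDiffOn hm
  exact (h1.prodMk (h2.add h3)).congr fun p hp => h.eq s p.1 p.2 hp

theorem IsAff.hasDerivAt_coef (h : IsAff D X τ a l) (hD : D.Regular) (s : Site) {t : ℝ}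
    (ht : t ∈ D.I) : HasDerivAt (fun t => deriv τ t / 2 + a s) (deriv (deriv τ) t / 2) t := by
  simpa using ((smooth_hasDerivAt hD.isOpen_I (smooth_deriv hD.isOpen_I h.smooth_tau) ht).div_const
    2).add_const (a s)

theorem IsAff.fderiv_apply (h : IsAff D X τ a l) (hD : D.Regular) {s : Site} {t u : ℝ}
    (hp : (t, u) ∈ D.plane s) (v : ℝ × ℝ) :
    fderiv ℝ (X s) (t, u) v = (deriv τ t * v.1,
      (deriv (deriv τ) t / 2 * u + deriv (l s) t) * v.1 + (deriv τ t / 2 + a s) * v.2) := by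
  have ho := hD.isOpen_plane s
  have h1 := affine_hasFDerivAt ho (g := fun q => (X s q).1) (α := fun _ => 0) (β := τ)
    (fun t u hq => by simp [h.eq s t u hq]) hp (hasDerivAt_const _ _)
    (smooth_hasDerivAt hD.isOpen_I h.smooth_tau hp.1)
  have h2 := affine_hasFDerivAt ho (g := fun q => (X s q).2)
    (fun t u hq => by simp [h.eq s t u hq]) hp (h.hasDerivAt_coef hD s hp.1)
    (smooth_hasDerivAt hD.isOpen_I (h.smooth_l s) hp.1)
  have := (h1.prodMk h2).fderiv
  simp only [Prod.mk.eta] at this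
  rw [show X s = fun q => X s q from rfl, this]
  simp

/-- The slope `τ'/2` is exactly what makes all powers of the velocity cancel, so the symmetry
condition for an affine field is one equation without `w`. -/
theorem IsAff.phiTT_eq (h : IsAff D X τ a l) (hD : D.Regular) {s : Site} {t u : ℝ}
    (hp : (t, u) ∈ D.plane s) (w z : ℝ) :
    phiTT (X s) (t, u) w z = deriv (deriv (deriv τ)) t / 2 * u + deriv (deriv (l s)) t
      + (a s - 3 / 2 * deriv τ t) * z := by
  have ho := hD.isOpen_plane s
  have hI := hD.isOpen_I
  have dτ := fun {t} (ht : t ∈ D.I) => smooth_hasDerivAt hI h.smooth_tau ht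
  have dτ2 := fun {t} (ht : t ∈ D.I) => smooth_hasDerivAt hI (smooth_deriv hI h.smooth_tau) ht
  have dτ3 := fun {t} (ht : t ∈ D.I) =>
    smooth_hasDerivAt hI (smooth_deriv hI (smooth_deriv hI h.smooth_tau)) ht
  have dl := fun {t} (ht : t ∈ D.I) => smooth_hasDerivAt hI (h.smooth_l s) ht
  have dl2 := fun {t} (ht : t ∈ D.I) => smooth_hasDerivAt hI (smooth_deriv hI (h.smooth_l s)) ht
  have h1 := fun t u (hq : (t, u) ∈ D.plane s) =>
    affine_pt_pu ho (g := fun q => (X s q).1) (α := fun _ => 0) (β := τ)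
      (fun t u hq => by simp [h.eq s t u hq]) hq (hasDerivAt_const _ _) (dτ hq.1)
  have h2 := fun t u (hq : (t, u) ∈ D.plane s) => affine_pt_pu ho (g := fun q => (X s q).2)
    (fun t u hq => by simp [h.eq s t u hq]) hq (h.hasDerivAt_coef hD s hq.1) (dl hq.1)
  have h11 := affine_pt_pu ho (g := pt fun q => (X s q).1) (α := fun _ => 0) (β := deriv τ)
    (fun t u hq => by simpa using (h1 t u hq).1) hp (hasDerivAt_const _ _) (dτ2 hp.1)
  have h10 := affine_pt_pu ho (g := pu fun q => (X s q).1) (α := fun _ => 0) (β := fun _ => 0)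
    (fun t u hq => by simpa using (h1 t u hq).2) hp (hasDerivAt_const _ _) (hasDerivAt_const _ _)
  have h21 := affine_pt_pu ho (g := pt fun q => (X s q).2) (fun t u hq => (h2 t u hq).1) hp
    ((dτ3 hp.1).div_const 2) (dl2 hp.1)
  have h20 := affine_pt_pu ho (g := pu fun q => (X s q).2) (α := fun _ => 0)
    (β := fun t => deriv τ t / 2 + a s)
    (fun t u hq => by simpa using (h2 t u hq).2) hp (hasDerivAt_const _ _)
    (h.hasDerivAt_coef hD s hp.1)
  rw [TriLattice.phiTT_eq ho (h.smooth hD s) hp, h11.1, h11.2, h10.2, h21.1, h21.2, h20.2,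
    (h1 t u hp).1, (h1 t u hp).2, (h2 t u hp).2]
  ring

/-- The determining equation for an affine field, at a point of the domain. -/
def DetEq (F : Site → ℝ × (Fin 7 → ℝ) → ℝ) (τ : ℝ → ℝ) (a : Site → ℝ) (l : Site → ℝ → ℝ)
    (s : Site) (x : ℝ × (Fin 7 → ℝ)) : Prop :=
  fderiv ℝ (F s) x (τ x.1,
      fun i => (deriv τ x.1 / 2 + a (s + nbr i)) * x.2 i + l (s + nbr i) x.1) =
    deriv (deriv (deriv τ)) x.1 / 2 * x.2 0 + deriv (deriv (l s)) x.1
      + (a s - 3 / 2 * deriv τ x.1) * F s x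

theorem IsAff.isSymmetry_iff (h : IsAff D X τ a l) (hD : D.Regular)
    {F : Site → ℝ × (Fin 7 → ℝ) → ℝ} :
    IsSymmetry D F X ↔ ∀ s, ∀ x ∈ D.Ω s, DetEq F τ a l s x := by
  have key : ∀ s, ∀ x ∈ D.Ω s, ∀ w, (phiTT (X s) (x.1, x.2 0) w (F s x)
      - fderiv ℝ (F s) x ((X s (x.1, x.2 0)).1, fun i => (X (s + nbr i) (x.1, x.2 i)).2) = 0 ↔
      DetEq F τ a l s x) := by
    intro s x hx w
    rw [h.phiTT_eq hD (hD.mem_plane_zero hx), sub_eq_zero, DetEq, eq_comm,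
      h.eq s _ _ (hD.mem_plane_zero hx)]
    simp only [fun i => h.eq (s + nbr i) _ _ (hD.mem_plane hx i)]
  constructor
  · intro hX s x hx
    exact (key s x hx 0).1 (hX.invariance s x hx 0)
  · intro H
    exact ⟨h.zero_out, h.smooth hD, ⟨fun p => τ p.1, fun s p hp => by rw [h.eq s p.1 p.2 hp]⟩,
      fun s x hx w => (key s x hx w).2 (H s x hx)⟩

theorem bracket_apply (X Y : LatticeField) (s : Site) (p : ℝ × ℝ) :
    bracket X Y s p = fderiv ℝ (Y s) p (X s p) - fderiv ℝ (X s) p (Y s p) := rfl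

theorem bracket_zero_out {s : Site} {p : ℝ × ℝ} (hX : X s p = 0) (hY : Y s p = 0) :
    bracket X Y s p = 0 := by
  rw [bracket_apply, hX, hY]; simp

/-- The coefficients of `u` are scalars and commute, so only their time derivatives contribute.
These add up to half the derivative of the new time component and leave no scaling constant. -/
theorem IsAff.bracket (hD : D.Regular) (h₁ : IsAff D X τ₁ a₁ l₁) (h₂ : IsAff D Y τ₂ a₂ l₂) :
    IsAff D (bracket X Y) (fun t => τ₁ t * deriv τ₂ t - τ₂ t * deriv τ₁ t) 0
      (fun s t => τ₁ t * deriv (l₂ s) t - τ₂ t * deriv (l₁ s) t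
        + l₁ s t * (deriv τ₂ t / 2 + a₂ s) - l₂ s t * (deriv τ₁ t / 2 + a₁ s)) := by
  have hI := hD.isOpen_I
  refine ⟨fun s p hp => bracket_zero_out (h₁.zero_out s p hp) (h₂.zero_out s p hp), ?_, ?_, ?_⟩
  · intro s t u hp
    have hd : deriv (fun t => τ₁ t * deriv τ₂ t - τ₂ t * deriv τ₁ t) t
        = τ₁ t * deriv (deriv τ₂) t - τ₂ t * deriv (deriv τ₁) t := by
      have := ((smooth_hasDerivAt hI h₁.smooth_tau hp.1).mul
        (smooth_hasDerivAt hI (smooth_deriv hI h₂.smooth_tau) hp.1)).sub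
        ((smooth_hasDerivAt hI h₂.smooth_tau hp.1).mul
        (smooth_hasDerivAt hI (smooth_deriv hI h₁.smooth_tau) hp.1))
      refine this.deriv.trans ?_
      ring
    rw [bracket_apply, h₁.fderiv_apply hD hp, h₂.fderiv_apply hD hp, h₁.eq s t u hp,
      h₂.eq s t u hp, hd]
    refine Prod.ext ?_ ?_
    · simp only [Prod.fst_sub]; ring
    · simp only [Prod.snd_sub, Pi.zero_apply]; ring
  · exact (h₁.smooth_tau.mul (smooth_deriv hI h₂.smooth_tau)).sub
      (h₂.smooth_tau.mul (smooth_deriv hI h₁.smooth_tau))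
  · intro s
    exact (((h₁.smooth_tau.mul (smooth_deriv hI (h₂.smooth_l s))).sub
      (h₂.smooth_tau.mul (smooth_deriv hI (h₁.smooth_l s)))).add
      ((h₁.smooth_l s).mul (h₂.smooth_coef hI s))).sub ((h₂.smooth_l s).mul (h₁.smooth_coef hI s))

end

/-! ### Algebra of fields that are smooth on the planes and vanish elsewhere -/

section
variable {D : LatticeDomain} {X Y Z : LatticeField}

/-- Smooth on the planes, zero elsewhere. -/
structure IsSmoothField (D : LatticeDomain) (X : LatticeField) : Prop where
  zero_out : ∀ s, ∀ p, p ∉ D.plane s → X s p = 0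
  smooth : ∀ s, ContDiffOn ℝ ∞ (X s) (D.plane s)

theorem IsSmoothField.contDiffAt (h : IsSmoothField D X) (hD : D.Regular) {s p}
    (hp : p ∈ D.plane s) : ContDiffAt ℝ ∞ (X s) p :=
  (h.smooth s).contDiffAt ((hD.isOpen_plane s).mem_nhds hp)

theorem IsSmoothField.differentiableAt (h : IsSmoothField D X) (hD : D.Regular) {s p}
    (hp : p ∈ D.plane s) : DifferentiableAt ℝ (X s) p :=
  (h.contDiffAt hD hp).differentiableAt (by simp)

theorem bracket_add_right (hD : D.Regular) (hX : IsSmoothField D X) (hY : IsSmoothField D Y)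
    (hZ : IsSmoothField D Z) : bracket X (Y + Z) = bracket X Y + bracket X Z := by
  funext s p
  by_cases hp : p ∈ D.plane s
  · simp only [bracket_apply, Pi.add_apply,
      fderiv_add (hY.differentiableAt hD hp) (hZ.differentiableAt hD hp), map_add,
      _root_.add_apply]
    abel
  · rw [Pi.add_apply, Pi.add_apply, bracket_zero_out (hX.zero_out s p hp) (hY.zero_out s p hp),
      bracket_zero_out (hX.zero_out s p hp) (hZ.zero_out s p hp),
      bracket_zero_out (hX.zero_out s p hp) (by
        rw [Pi.add_apply, Pi.add_apply, hY.zero_out s p hp, hZ.zero_out s p hp, add_zero]), add_zero]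

theorem bracket_smul_right (hD : D.Regular) (hX : IsSmoothField D X) (hY : IsSmoothField D Y)
    (c : ℝ) : bracket X (c • Y) = c • bracket X Y := by
  funext s p
  by_cases hp : p ∈ D.plane s
  · simp only [bracket_apply, Pi.smul_apply,
      fderiv_const_smul (hY.differentiableAt hD hp) c, map_smul, _root_.smul_apply, smul_sub]
  · rw [Pi.smul_apply, Pi.smul_apply, bracket_zero_out (hX.zero_out s p hp) (hY.zero_out s p hp),
      bracket_zero_out (hX.zero_out s p hp) (by
        rw [Pi.smul_apply, Pi.smul_apply, hY.zero_out s p hp, smul_zero]), smul_zero]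

end


/-! ### The standard fields and their pull-backs -/

/-- `q₀ + q₁ x + q₂ x²` and its derivative. -/
noncomputable def quad (q : Fin 3 → ℝ) (x : ℝ) : ℝ := q 0 + q 1 * x + q 2 * x ^ 2
noncomputable def quadD (q : Fin 3 → ℝ) (x : ℝ) : ℝ := q 1 + 2 * q 2 * x

theorem quad_hasDerivAt (q : Fin 3 → ℝ) (x : ℝ) : HasDerivAt (quad q) (quadD q x) x := by
  have h1 : HasDerivAt (fun x : ℝ => q 1 * x) (q 1) x := by
    simpa using (hasDerivAt_id x).const_mul (q 1)
  have := (h1.const_add (q 0)).add ((hasDerivAt_pow 2 x).const_mul (q 2))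
  refine this.congr_deriv ?_
  simp [quadD]; ring

theorem quad_contDiff (q : Fin 3 → ℝ) : ContDiff ℝ ∞ (quad q) := by
  unfold quad; fun_prop

/-- The coefficients `(q, a, c, d)` of a field `q ∂_t + ((q'/2 + a_s) u + c_s + d_s t) ∂_u`. -/
abbrev Par := (Fin 3 → ℝ) × (Site → ℝ) × (Site → ℝ) × (Site → ℝ)

noncomputable def stdF : Par →ₗ[ℝ] LatticeField where
  toFun m := fun s p => (quad m.1 p.1, (quadD m.1 p.1 / 2 + m.2.1 s) * p.2
    + (m.2.2.1 s + m.2.2.2 s * p.1))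
  map_add' m m' := by
    funext s p; ext <;> simp [quad, quadD] <;> ring
  map_smul' r m := by
    funext s p; ext <;> simp [quad, quadD] <;> ring

/-- The first slot is the Wronskian of the two quadratics; the scaling slot of a bracket is zero. -/
noncomputable def parBr (m m' : Par) : Par :=
  (![m.1 0 * m'.1 1 - m'.1 0 * m.1 1, 2 * (m.1 0 * m'.1 2 - m'.1 0 * m.1 2),
      m.1 1 * m'.1 2 - m'.1 1 * m.1 2], 0,
    fun s => m.1 0 * m'.2.2.2 s - m'.1 0 * m.2.2.2 s + m.2.2.1 s * (m'.1 1 / 2 + m'.2.1 s)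
      - m'.2.2.1 s * (m.1 1 / 2 + m.2.1 s),
    fun s => m.1 1 * m'.2.2.2 s - m'.1 1 * m.2.2.2 s + m.2.2.2 s * (m'.1 1 / 2 + m'.2.1 s)
      - m'.2.2.2 s * (m.1 1 / 2 + m.2.1 s) + m.2.2.1 s * m'.1 2 - m'.2.2.1 s * m.1 2)

/-- The domain without any restriction on the values. -/
def fullDomain (Ω : Set (ℝ × (Fin 7 → ℝ))) : LatticeDomain where
  I := univ
  J := fun _ => univ
  Ω := fun _ => Ω

theorem fullDomain_regular {Ω : Set (ℝ × (Fin 7 → ℝ))} (ho : IsOpen Ω)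
    (hΩ : ∀ t u : ℝ, ∃ v, (t, v) ∈ Ω ∧ v 0 = u) : (fullDomain Ω).Regular where
  isOpen_I := isOpen_univ
  ordConnected_I := ordConnected_univ
  nonempty_I := univ_nonempty
  isOpen_J _ := isOpen_univ
  ordConnected_J _ := ordConnected_univ
  nonempty_J _ := univ_nonempty
  union_J := by simpa [fullDomain, iUnion_const] using ordConnected_univ
  isOpen_Ω _ := ho
  Ω_subset _ _ _ := ⟨mem_univ _, fun _ => mem_univ _⟩
  Ω_onto _ t _ u _ := hΩ t u

theorem mem_plane_fullDomain {Ω : Set (ℝ × (Fin 7 → ℝ))} (s : Site) (p : ℝ × ℝ) :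
    p ∈ (fullDomain Ω).plane s := ⟨mem_univ _, mem_univ _⟩

theorem stdF_isAff (Ω : Set (ℝ × (Fin 7 → ℝ))) (m : Par) :
    IsAff (fullDomain Ω) (stdF m) (quad m.1) m.2.1 (fun s t => m.2.2.1 s + m.2.2.2 s * t) where
  zero_out s p hp := absurd (mem_plane_fullDomain s p) hp
  eq s t u _ := by rw [(quad_hasDerivAt _ _).deriv]; rfl
  smooth_tau := (quad_contDiff _).contDiffOn
  smooth_l s := by fun_prop

theorem bracket_stdF (m m' : Par) : bracket (stdF m) (stdF m') = stdF (parBr m m') := by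
  have hD : (fullDomain univ).Regular :=
    fullDomain_regular isOpen_univ fun t u => ⟨fun _ => u, mem_univ _, rfl⟩
  have h := (stdF_isAff univ m).bracket hD (stdF_isAff univ m')
  have hd : ∀ (m : Par) s t, deriv (fun t => m.2.2.1 s + m.2.2.2 s * t) t = m.2.2.2 s := by
    intro m s t
    simp
  have hq : ∀ t, deriv (fun t => quad m.1 t * deriv (quad m'.1) t - quad m'.1 t * deriv (quad m.1) t) t
      = quadD (parBr m m').1 t := by
    intro t
    rw [← (quad_hasDerivAt _ t).deriv]
    congr 1
    funext t
    rw [(quad_hasDerivAt _ _).deriv, (quad_hasDerivAt _ _).deriv]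
    simp [quad, quadD, parBr]; ring
  funext s p
  rw [← Prod.mk.eta (p := p), h.eq s p.1 p.2 (mem_plane_fullDomain s _), hd, hd, (quad_hasDerivAt _ _).deriv,
    (quad_hasDerivAt _ _).deriv, hq]
  refine Prod.ext ?_ ?_
  · simp [stdF, parBr, quad, quadD]; ring
  · simp [stdF, parBr, quad, quadD]; ring

/-- Differentiate `Df · X = V ∘ f` along `Y` and antisymmetrise: the second derivative of `f` drops
out by symmetry. No inverse of `f` is needed. -/
theorem related_lieBracket {E : Type*} [NormedAddCommGroup E] [NormedSpace ℝ E] {f : E → E}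
    {X Y V W : E → E} {x : E} (hf : ContDiffAt ℝ 2 f x) (hX : DifferentiableAt ℝ X x)
    (hY : DifferentiableAt ℝ Y x) (hV : DifferentiableAt ℝ V (f x)) (hW : DifferentiableAt ℝ W (f x))
    (h₁ : ∀ᶠ y in 𝓝 x, fderiv ℝ f y (X y) = V (f y)) (h₂ : ∀ᶠ y in 𝓝 x, fderiv ℝ f y (Y y) = W (f y)) :
    fderiv ℝ f x (VectorField.lieBracket ℝ X Y x) = VectorField.lieBracket ℝ V W (f x) := by
  have hfd : HasFDerivAt f (fderiv ℝ f x) x := (hf.differentiableAt (by simp)).hasFDerivAt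
  have hf2 : HasFDerivAt (fderiv ℝ f) (fderiv ℝ (fderiv ℝ f) x) x :=
    ((hf.fderiv_right (m := 1) (by norm_num)).differentiableAt (by simp)).hasFDerivAt
  have key : ∀ {X V : E → E}, DifferentiableAt ℝ X x → DifferentiableAt ℝ V (f x) →
      (∀ᶠ y in 𝓝 x, fderiv ℝ f y (X y) = V (f y)) → ∀ v : E,
      fderiv ℝ f x (fderiv ℝ X x v) + fderiv ℝ (fderiv ℝ f) x v (X x) =
        fderiv ℝ V (f x) (fderiv ℝ f x v) := by
    intro X V hX hV h v
    have h1 := hf2.clm_apply hX.hasFDerivAt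
    have h2 := (hV.hasFDerivAt.comp x hfd).congr_of_eventuallyEq
      (f₁ := fun y => fderiv ℝ f y (X y)) h
    have := congrArg (fun T : E →L[ℝ] E => T v) (h1.unique h2)
    simpa using this
  have e1 := key hX hV h₁ (Y x)
  have e2 := key hY hW h₂ (X x)
  have hs := (hf.isSymmSndFDerivAt (by simp)).eq (X x) (Y x)
  rw [h₂.self_of_nhds] at e1
  rw [h₁.self_of_nhds] at e2
  rw [VectorField.lieBracket_eq, VectorField.lieBracket_eq]
  beta_reduce
  rw [map_sub, ← e1, ← e2, hs]
  abel

/-! ### Pull-back of fields along an allowed transformation -/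

section
variable {Φ : AllowedMap} {I : Set ℝ}

theorem AllowedMap.Admissible.hasDerivAt_sqrt (h : Φ.Admissible I) (hI : IsOpen I) {t : ℝ}
    (ht : t ∈ I) : HasDerivAt (fun t => √(deriv Φ.θ t))
      (deriv (deriv Φ.θ) t / (2 * √(deriv Φ.θ t))) t :=
  (smooth_hasDerivAt hI (smooth_deriv hI h.1) ht).sqrt (h.2.1 t ht).ne'

theorem AllowedMap.Admissible.smooth_sqrt (h : Φ.Admissible I) (hI : IsOpen I) :
    ContDiffOn ℝ ∞ (fun t => √(deriv Φ.θ t)) I :=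
  (smooth_deriv hI h.1).sqrt fun t ht => (h.2.1 t ht).ne'

theorem AllowedMap.Admissible.sqrt_pos (h : Φ.Admissible I) {t : ℝ} (ht : t ∈ I) :
    0 < √(deriv Φ.θ t) := Real.sqrt_pos.2 (h.2.1 t ht)

theorem AllowedMap.Admissible.contDiffAt_pointMap (h : Φ.Admissible I) (hI : IsOpen I) (s : Site)
    {p : ℝ × ℝ} (hp : p.1 ∈ I) : ContDiffAt ℝ ∞ (Φ.pointMap s) p := by
  have hc := fun {f : ℝ → ℝ} (hf : ContDiffOn ℝ ∞ f I) =>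
    (hf.contDiffAt (hI.mem_nhds hp)).comp p contDiffAt_fst
  exact (hc h.1).prodMk
    (((hc (h.smooth_sqrt hI)).mul (contDiffAt_snd.sub (hc (h.2.2.2 s)))).div_const _)

theorem AllowedMap.Admissible.fderiv_pointMap (h : Φ.Admissible I) (hI : IsOpen I) (s : Site)
    {t : ℝ} (ht : t ∈ I) (u : ℝ) (v : ℝ × ℝ) :
    fderiv ℝ (Φ.pointMap s) (t, u) v = (deriv Φ.θ t * v.1,
      (deriv (deriv Φ.θ) t / (2 * √(deriv Φ.θ t)) * (u - Φ.Q s t)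
        - √(deriv Φ.θ t) * deriv (Φ.Q s) t) / Φ.P s * v.1 + √(deriv Φ.θ t) / Φ.P s * v.2) := by
  have hr := h.hasDerivAt_sqrt hI ht
  have hQ := smooth_hasDerivAt hI (h.2.2.2 s) ht
  have h1 := affine_hasFDerivAt isOpen_univ (g := fun q : ℝ × ℝ => Φ.θ q.1) (α := fun _ => 0)
    (β := Φ.θ) (fun t u _ => by simp) (mem_univ (t, u)) (hasDerivAt_const _ _)
    (smooth_hasDerivAt hI h.1 ht)
  have h2 := affine_hasFDerivAt isOpen_univ (g := Φ.newU s)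
    (α := fun t => √(deriv Φ.θ t) / Φ.P s) (β := fun t => -(√(deriv Φ.θ t) * Φ.Q s t) / Φ.P s)
    (fun t u _ => by simp only [AllowedMap.newU]; ring) (mem_univ (t, u)) (hr.div_const _)
    (((hr.mul hQ).neg).div_const _)
  have := (h1.prodMk h2).fderiv
  rw [show Φ.pointMap s = fun q : ℝ × ℝ => (Φ.θ q.1, Φ.newU s q) from rfl, this]
  refine Prod.ext (by simp) ?_
  simp only [ContinuousLinearMap.prod_apply, _root_.add_apply, _root_.smul_apply,
    ContinuousLinearMap.coe_fst', ContinuousLinearMap.coe_snd', smul_eq_mul]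
  ring

/-- The value at `p` of the field that the transformation carries to `stdF m`. -/
noncomputable def pbv (Φ : AllowedMap) (m : Par) (s : Site) (p : ℝ × ℝ) : ℝ × ℝ :=
  (quad m.1 (Φ.θ p.1) / deriv Φ.θ p.1,
    (quadD m.1 (Φ.θ p.1) / 2 - quad m.1 (Φ.θ p.1) * deriv (deriv Φ.θ) p.1 / (2 * deriv Φ.θ p.1 ^ 2)
        + m.2.1 s) * (p.2 - Φ.Q s p.1)
      + quad m.1 (Φ.θ p.1) / deriv Φ.θ p.1 * deriv (Φ.Q s) p.1
      + Φ.P s * (m.2.2.1 s + m.2.2.2 s * Φ.θ p.1) / √(deriv Φ.θ p.1))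

theorem fderiv_pointMap_eq_iff (h : Φ.Admissible I) (hI : IsOpen I) (m : Par) (s : Site)
    {p : ℝ × ℝ} (hp : p.1 ∈ I) (v : ℝ × ℝ) :
    fderiv ℝ (Φ.pointMap s) p v = stdF m s (Φ.pointMap s p) ↔ v = pbv Φ m s p := by
  obtain ⟨t, u⟩ := p
  have ht : t ∈ I := hp
  rw [h.fderiv_pointMap hI s ht]
  have hk := h.2.1 t ht
  have hP := h.2.2.1 s
  simp only [stdF, LinearMap.coe_mk, AddHom.coe_mk, AllowedMap.pointMap, AllowedMap.newU, pbv]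
  -- Writing `θ' = r²` with `r > 0` turns the claim into an identity of rational functions.
  obtain ⟨r, hr, hkr⟩ : ∃ r : ℝ, 0 < r ∧ deriv Φ.θ t = r ^ 2 :=
    ⟨_, h.sqrt_pos ht, (Real.sq_sqrt hk.le).symm⟩
  have hsr : √(r ^ 2) = r := Real.sqrt_sq hr.le
  simp only [hkr, hsr]
  generalize quadD m.1 (Φ.θ t) = qd
  generalize quad m.1 (Φ.θ t) = q
  generalize deriv (deriv Φ.θ) t = k1
  generalize deriv (Φ.Q s) t = Q1
  generalize Φ.Q s t = Q
  generalize m.2.2.1 s + m.2.2.2 s * Φ.θ t = c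
  generalize m.2.1 s = a
  generalize Φ.P s = P at hP
  obtain ⟨v1, v2⟩ := v
  simp only [Prod.mk.injEq]
  constructor
  · rintro ⟨h1, h2⟩
    have h1' : v1 = q / r ^ 2 := by field_simp; linarith
    refine ⟨h1', ?_⟩
    subst h1'
    field_simp at h2 ⊢
    linear_combination h2
  · rintro ⟨rfl, rfl⟩
    constructor
    · field_simp
    · field_simp; ring

/-- The field on the domain that the transformation carries to `stdF m`. -/
noncomputable def pbF (D : LatticeDomain) (Φ : AllowedMap) : Par →ₗ[ℝ] LatticeField where
  toFun m := fun s => (D.plane s).indicator (pbv Φ m s)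
  map_add' m m' := by
    funext s
    have : pbv Φ (m + m') s = pbv Φ m s + pbv Φ m' s := by
      funext p; ext <;> simp [pbv, quad, quadD] <;> ring
    rw [this]
    exact Set.indicator_add _ _ _
  map_smul' r m := by
    funext s
    have : pbv Φ (r • m) s = r • pbv Φ m s := by
      funext p; ext <;> simp [pbv, quad, quadD] <;> ring
    rw [this]
    exact Set.indicator_const_smul (D.plane s) r (pbv Φ m s)

theorem pbF_of_mem {D : LatticeDomain} (m : Par) {s : Site} {p : ℝ × ℝ} (hp : p ∈ D.plane s) :
    pbF D Φ m s p = pbv Φ m s p := Set.indicator_of_mem hp _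

theorem pbF_of_notMem {D : LatticeDomain} (m : Par) {s : Site} {p : ℝ × ℝ} (hp : p ∉ D.plane s) :
    pbF D Φ m s p = 0 := Set.indicator_of_notMem hp _

end

section
variable {D : LatticeDomain} {Φ : AllowedMap}

/-- The derivative of the point map is invertible, so each standard field has exactly one pull-back.
From here on algebras are images of spaces of coefficients. -/
theorem corresponds_iff (hD : D.Regular) (h : Φ.Admissible D.I) (M : Submodule ℝ Par)
    (L : Submodule ℝ LatticeField) : Corresponds D Φ L (M.map stdF) ↔ L = M.map (pbF D Φ) := by
  have key : ∀ X : LatticeField, ((∀ s, ∀ p, p ∉ D.plane s → X s p = 0) ∧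
      ∃ Y ∈ M.map stdF, ∀ s, ∀ p ∈ D.plane s,
        fderiv ℝ (Φ.pointMap s) p (X s p) = Y s (Φ.pointMap s p)) ↔ X ∈ M.map (pbF D Φ) := by
    intro X
    constructor
    · rintro ⟨h0, Y, ⟨m, hm, rfl⟩, hY⟩
      refine ⟨m, hm, ?_⟩
      funext s p
      by_cases hp : p ∈ D.plane s
      · rw [pbF_of_mem m hp]
        exact ((fderiv_pointMap_eq_iff h hD.isOpen_I m s hp.1 _).1 (hY s p hp)).symm
      · rw [pbF_of_notMem m hp, h0 s p hp]
    · rintro ⟨m, hm, rfl⟩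
      refine ⟨fun s p hp => pbF_of_notMem m hp, stdF m, ⟨m, hm, rfl⟩, fun s p hp => ?_⟩
      rw [fderiv_pointMap_eq_iff h hD.isOpen_I m s hp.1, pbF_of_mem m hp]
  constructor
  · intro hc
    ext X
    exact (hc X).trans (key X)
  · rintro rfl X
    exact (key X).symm

/-- The coefficients of the pulled-back field. -/
noncomputable def pbTau (Φ : AllowedMap) (m : Par) (t : ℝ) : ℝ := quad m.1 (Φ.θ t) / deriv Φ.θ t
noncomputable def pbL (Φ : AllowedMap) (m : Par) (s : Site) (t : ℝ) : ℝ :=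
  pbTau Φ m t * deriv (Φ.Q s) t - (deriv (pbTau Φ m) t / 2 + m.2.1 s) * Φ.Q s t
    + Φ.P s * (m.2.2.1 s + m.2.2.2 s * Φ.θ t) / √(deriv Φ.θ t)

theorem pbTau_hasDerivAt (hI : IsOpen D.I) (h : Φ.Admissible D.I) (m : Par) {t : ℝ} (ht : t ∈ D.I) :
    HasDerivAt (pbTau Φ m)
      (quadD m.1 (Φ.θ t) - quad m.1 (Φ.θ t) * deriv (deriv Φ.θ) t / deriv Φ.θ t ^ 2) t := by
  have hk := (h.2.1 t ht).ne'
  have h1 := (quad_hasDerivAt m.1 (Φ.θ t)).comp t (smooth_hasDerivAt hI h.1 ht)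
  refine (h1.div (smooth_hasDerivAt hI (smooth_deriv hI h.1) ht) hk).congr_deriv ?_
  simp only [Function.comp]
  field_simp

theorem pbF_isAff (hD : D.Regular) (h : Φ.Admissible D.I) (m : Par) :
    IsAff D (pbF D Φ m) (pbTau Φ m) m.2.1 (pbL Φ m) := by
  have hI := hD.isOpen_I
  have hq : ContDiffOn ℝ ∞ (pbTau Φ m) D.I :=
    ((quad_contDiff m.1).comp_contDiffOn h.1).div (smooth_deriv hI h.1) fun t ht => (h.2.1 t ht).ne'
  refine ⟨fun s p hp => pbF_of_notMem m hp, ?_, hq, ?_⟩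
  · intro s t u hp
    rw [pbF_of_mem m hp, pbL, (pbTau_hasDerivAt hI h m hp.1).deriv, pbv, pbTau]
    refine Prod.ext rfl ?_
    have hk := (h.2.1 t hp.1).ne'
    simp only
    generalize √(deriv Φ.θ t) = r
    field_simp
    ring
  · intro s
    refine ((hq.mul (smooth_deriv hI (h.2.2.2 s))).sub ((((smooth_deriv hI hq).div_const 2).add
      contDiffOn_const).mul (h.2.2.2 s))).add ((contDiffOn_const.mul (contDiffOn_const.add
      (contDiffOn_const.mul h.1))).div (h.smooth_sqrt hI) fun t ht => (h.sqrt_pos ht).ne')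

/-- Pull-backs are related to the standard fields by the point map, so every Lie algebra question
about them becomes one about `parBr`. -/
theorem bracket_pbF (hD : D.Regular) (h : Φ.Admissible D.I) (m m' : Par) :
    bracket (pbF D Φ m) (pbF D Φ m') = pbF D Φ (parBr m m') := by
  funext s p
  by_cases hp : p ∈ D.plane s
  · rw [pbF_of_mem _ hp, ← fderiv_pointMap_eq_iff h hD.isOpen_I _ s hp.1, ← bracket_stdF]
    have hd : ∀ m, DifferentiableAt ℝ (pbF D Φ m s) p := fun m =>
      (((pbF_isAff hD h m).smooth hD s).contDiffAt ((hD.isOpen_plane s).mem_nhds hp)).differentiableAt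
        (by simp)
    have hs : ∀ m, DifferentiableAt ℝ (stdF m s) (Φ.pointMap s p) := fun m =>
      (((stdF_isAff univ m).smooth (fullDomain_regular isOpen_univ
        fun t u => ⟨fun _ => u, mem_univ _, rfl⟩) s).contDiffAt
        (((isOpen_univ.prod isOpen_univ).mem_nhds (mem_plane_fullDomain (Ω := univ) s _)))
        ).differentiableAt (by simp)
    have hr : ∀ m, ∀ᶠ y in 𝓝 p, fderiv ℝ (Φ.pointMap s) y (pbF D Φ m s y)
        = stdF m s (Φ.pointMap s y) := by
      intro m
      filter_upwards [(hD.isOpen_plane s).mem_nhds hp] with y hy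
      rw [fderiv_pointMap_eq_iff h hD.isOpen_I m s hy.1, pbF_of_mem m hy]
    exact related_lieBracket (contDiffAt_infty.1 (h.contDiffAt_pointMap hD.isOpen_I s hp.1) 2)
      (hd m) (hd m') (hs m) (hs m') (hr m) (hr m')
  · rw [pbF_of_notMem _ hp, bracket_zero_out (pbF_of_notMem _ hp) (pbF_of_notMem _ hp)]

end

/-! ### The spaces of coefficients -/

/-- Coefficients with `a ∈ A` and `c, d ∈ C`. -/
def ParSub (A C : Submodule ℝ (Site → ℝ)) : Submodule ℝ Par :=
  (⊤ : Submodule ℝ (Fin 3 → ℝ)).prod (A.prod (C.prod C))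

/-- Coefficients with `q = 0`, `a ∈ A` and `c, d ∈ C`. -/
def RadSub (A C : Submodule ℝ (Site → ℝ)) : Submodule ℝ Par :=
  (⊥ : Submodule ℝ (Fin 3 → ℝ)).prod (A.prod (C.prod C))

theorem mem_ParSub {A C : Submodule ℝ (Site → ℝ)} {m : Par} :
    m ∈ ParSub A C ↔ m.2.1 ∈ A ∧ m.2.2.1 ∈ C ∧ m.2.2.2 ∈ C := by
  simp [ParSub, Submodule.mem_prod]

theorem mem_RadSub {A C : Submodule ℝ (Site → ℝ)} {m : Par} :
    m ∈ RadSub A C ↔ m.1 = 0 ∧ m.2.1 ∈ A ∧ m.2.2.1 ∈ C ∧ m.2.2.2 ∈ C := by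
  simp [RadSub, Submodule.mem_prod]

theorem slSpan_eq : slSpan = (ParSub ⊥ ⊥).map stdF := by
  apply le_antisymm
  · rw [slSpan, Submodule.span_le]
    rintro _ ⟨i, rfl⟩
    fin_cases i
    · exact ⟨(![1, 0, 0], 0), mem_ParSub.2 (by simp), by
        funext s p; simp [stdF, slField, quad, quadD]⟩
    · exact ⟨(![0, 1, 0], 0), mem_ParSub.2 (by simp), by
        funext s p; simp [stdF, slField, quad, quadD]; ring⟩
    · exact ⟨(![0, 0, 1], 0), mem_ParSub.2 (by simp), by
        funext s p; simp [stdF, slField, quad, quadD]⟩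
  · rintro _ ⟨⟨q, a, c, d⟩, hm, rfl⟩
    obtain ⟨rfl, rfl, rfl⟩ : a = 0 ∧ c = 0 ∧ d = 0 := by simpa using mem_ParSub.1 hm
    have : stdF (q, 0, 0, 0) = q 0 • slField 0 + q 1 • slField 1 + q 2 • slField 2 := by
      funext s p
      ext
      · simp [stdF, slField, quad]
      · simp [stdF, slField, quadD]; ring
    rw [this]
    have h : ∀ i, slField i ∈ slSpan := fun i => Submodule.subset_span ⟨i, rfl⟩
    exact add_mem (add_mem (Submodule.smul_mem _ _ (h 0)) (Submodule.smul_mem _ _ (h 1)))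
      (Submodule.smul_mem _ _ (h 2))

/-- The coefficients of `a u ∂_u`. -/
def parA : (Site → ℝ) →ₗ[ℝ] Par := LinearMap.inr ℝ _ _ ∘ₗ LinearMap.inl ℝ _ _
/-- The coefficients of `c ∂_u`. -/
def parC : (Site → ℝ) →ₗ[ℝ] Par :=
  LinearMap.inr ℝ _ _ ∘ₗ LinearMap.inr ℝ _ _ ∘ₗ LinearMap.inl ℝ _ _
/-- The coefficients of `d t ∂_u`. -/
def parD : (Site → ℝ) →ₗ[ℝ] Par :=
  LinearMap.inr ℝ _ _ ∘ₗ LinearMap.inr ℝ _ _ ∘ₗ LinearMap.inr ℝ _ _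

theorem RadSub_eq (A C : Submodule ℝ (Site → ℝ)) :
    RadSub A C = A.map parA ⊔ (C.map parC ⊔ C.map parD) := by
  apply le_antisymm
  · rintro ⟨q, a, c, d⟩ hm
    obtain ⟨rfl, ha, hc, hd⟩ := mem_RadSub.1 hm
    have : ((0, a, c, d) : Par) = parA a + (parC c + parD d) := by simp [parA, parC, parD]
    simp only at ha hc hd ⊢
    rw [this]
    exact Submodule.add_mem_sup ⟨a, ha, rfl⟩ (Submodule.add_mem_sup ⟨c, hc, rfl⟩ ⟨d, hd, rfl⟩)
  · refine sup_le ?_ (sup_le ?_ ?_)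
    · rintro _ ⟨a, ha, rfl⟩
      exact mem_RadSub.2 ⟨rfl, ha, C.zero_mem, C.zero_mem⟩
    · rintro _ ⟨a, ha, rfl⟩
      exact mem_RadSub.2 ⟨rfl, A.zero_mem, ha, C.zero_mem⟩
    · rintro _ ⟨a, ha, rfl⟩
      exact mem_RadSub.2 ⟨rfl, A.zero_mem, C.zero_mem, ha⟩

theorem ParSub_eq (A C : Submodule ℝ (Site → ℝ)) : ParSub A C = ParSub ⊥ ⊥ ⊔ RadSub A C := by
  apply le_antisymm
  · rintro ⟨q, m⟩ hm
    have : ((q, m) : Par) = (q, 0) + (0, m) := by simp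
    rw [this]
    exact Submodule.add_mem_sup (mem_ParSub.2 (by simp)) (mem_RadSub.2 ⟨rfl, mem_ParSub.1 hm⟩)
  · refine sup_le (fun m hm => ?_) fun m hm => mem_ParSub.2 (mem_RadSub.1 hm).2
    obtain ⟨h1, h2, h3⟩ := mem_ParSub.1 hm
    rw [Submodule.mem_bot] at h1 h2 h3
    exact mem_ParSub.2 (by simp [h1, h2, h3])

theorem radical1_eq (a : Fin 4 → Site → ℝ) :
    radical1 a = (RadSub (Submodule.span ℝ (range a)) ⊥).map stdF := by
  rw [RadSub_eq, Submodule.map_bot, Submodule.map_bot, sup_bot_eq, sup_bot_eq,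
    Submodule.map_span, Submodule.map_span, radical1, ← range_comp, ← range_comp]
  congr 2
  funext i s p
  simp [parA, stdF, scalingField, quad, quadD]

theorem radical2_eq (κ : Site → ℝ) :
    radical2 κ = (RadSub ⊥ (Submodule.span ℝ {1, κ})).map stdF := by
  rw [RadSub_eq, Submodule.map_bot, bot_sup_eq, Submodule.map_sup]
  simp only [Submodule.map_span, ← Submodule.span_union]
  rw [radical2]
  congr 1
  ext X
  have h0 : stdF (parC 1) = translationField κ 0 := by
    funext s p; simp [parC, stdF, translationField, quad, quadD]
  have h1 : stdF (parD 1) = translationField κ 1 := by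
    funext s p; simp [parD, stdF, translationField, quad, quadD]
  have h2 : stdF (parC κ) = translationField κ 2 := by
    funext s p; simp [parC, stdF, translationField, quad, quadD]
  have h3 : stdF (parD κ) = translationField κ 3 := by
    funext s p; simp [parD, stdF, translationField, quad, quadD]
  simp only [image_insert_eq, image_singleton, h0, h1, h2, h3, mem_range, Fin.exists_fin_succ,
    mem_union, mem_insert_iff, mem_singleton_iff]
  simp only [eq_comm (a := X)]
  simp
  tauto

theorem stdSpan1_eq (a : Fin 4 → Site → ℝ) :
    slSpan ⊔ radical1 a = (ParSub (Submodule.span ℝ (range a)) ⊥).map stdF := by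
  rw [slSpan_eq, radical1_eq, ← Submodule.map_sup, ← ParSub_eq]

theorem stdSpan2_eq (κ : Site → ℝ) :
    slSpan ⊔ radical2 κ = (ParSub ⊥ (Submodule.span ℝ {1, κ})).map stdF := by
  rw [slSpan_eq, radical2_eq, ← Submodule.map_sup, ← ParSub_eq]

/-- The product of two subspaces, as a subspace and as a space. -/
def prodSubmoduleEquiv {V W : Type*} [AddCommGroup V] [Module ℝ V] [AddCommGroup W]
    [Module ℝ W] (A : Submodule ℝ V) (B : Submodule ℝ W) : (A.prod B) ≃ₗ[ℝ] A × B where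
  toFun x := (⟨x.1.1, x.2.1⟩, ⟨x.1.2, x.2.2⟩)
  invFun x := ⟨(x.1.1, x.2.1), ⟨x.1.2, x.2.2⟩⟩
  map_add' _ _ := rfl
  map_smul' _ _ := rfl
  left_inv _ := rfl
  right_inv _ := rfl

instance {V W : Type*} [AddCommGroup V] [Module ℝ V] [AddCommGroup W] [Module ℝ W]
    (A : Submodule ℝ V) (B : Submodule ℝ W) [FiniteDimensional ℝ A] [FiniteDimensional ℝ B] :
    FiniteDimensional ℝ (A.prod B) := Module.Finite.equiv (prodSubmoduleEquiv A B).symm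

theorem finrank_prod_submodule {V W : Type*} [AddCommGroup V] [Module ℝ V] [AddCommGroup W]
    [Module ℝ W] (A : Submodule ℝ V) (B : Submodule ℝ W) [FiniteDimensional ℝ A]
    [FiniteDimensional ℝ B] :
    Module.finrank ℝ (A.prod B) = Module.finrank ℝ A + Module.finrank ℝ B := by
  rw [(prodSubmoduleEquiv A B).finrank_eq, Module.finrank_prod]

theorem finrank_ParSub (A C : Submodule ℝ (Site → ℝ)) [FiniteDimensional ℝ A]
    [FiniteDimensional ℝ C] :
    Module.finrank ℝ (ParSub A C) = 3 + (Module.finrank ℝ A + 2 * Module.finrank ℝ C) := by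
  rw [ParSub, finrank_prod_submodule, finrank_prod_submodule, finrank_prod_submodule, finrank_top]
  simp
  ring

/-- The products `a * c` are the only terms of the bracket that are not linear combinations of
elements of `C`. -/
theorem parBr_mem {A C : Submodule ℝ (Site → ℝ)} (hAC : ∀ a ∈ A, ∀ c ∈ C, a * c ∈ C) {m m' : Par}
    (hm : m ∈ ParSub A C) (hm' : m' ∈ ParSub A C) : parBr m m' ∈ ParSub ⊥ C := by
  obtain ⟨ha, hc, hd⟩ := mem_ParSub.1 hm
  obtain ⟨ha', hc', hd'⟩ := mem_ParSub.1 hm'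
  refine mem_ParSub.2 ⟨by simp [parBr], ?_, ?_⟩
  · have : (parBr m m').2.2.1 = m.1 0 • m'.2.2.2 - m'.1 0 • m.2.2.2
        + ((m'.1 1 / 2) • m.2.2.1 + m'.2.1 * m.2.2.1)
        - ((m.1 1 / 2) • m'.2.2.1 + m.2.1 * m'.2.2.1) := by
      funext s; simp [parBr]; ring
    rw [this]
    exact sub_mem (add_mem (sub_mem (C.smul_mem _ hd') (C.smul_mem _ hd))
      (add_mem (C.smul_mem _ hc) (hAC _ ha' _ hc))) (add_mem (C.smul_mem _ hc') (hAC _ ha _ hc'))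
  · have : (parBr m m').2.2.2 = m.1 1 • m'.2.2.2 - m'.1 1 • m.2.2.2
        + ((m'.1 1 / 2) • m.2.2.2 + m'.2.1 * m.2.2.2)
        - ((m.1 1 / 2) • m'.2.2.2 + m.2.1 * m'.2.2.2) + m'.1 2 • m.2.2.1 - m.1 2 • m'.2.2.1 := by
      funext s; simp [parBr]; ring
    rw [this]
    exact sub_mem (add_mem (sub_mem (add_mem (sub_mem (C.smul_mem _ hd') (C.smul_mem _ hd))
      (add_mem (C.smul_mem _ hd) (hAC _ ha' _ hd))) (add_mem (C.smul_mem _ hd') (hAC _ ha _ hd')))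
      (C.smul_mem _ hc)) (C.smul_mem _ hc')

/-! ### Faithfulness of the pull-back -/

section
variable {D : LatticeDomain} {Φ : AllowedMap}

theorem quad_eq_zero {q : Fin 3 → ℝ} {x y z : ℝ} (hxy : x < y) (hyz : y < z) (hx : quad q x = 0)
    (hy : quad q y = 0) (hz : quad q z = 0) : q = 0 := by
  simp only [quad] at hx hy hz
  have e1 : q 1 + q 2 * (x + y) = 0 := by
    apply mul_left_cancel₀ (sub_ne_zero.2 hxy.ne'); linear_combination hy - hx
  have e2 : q 1 + q 2 * (y + z) = 0 := by
    apply mul_left_cancel₀ (sub_ne_zero.2 hyz.ne'); linear_combination hz - hy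
  have h2 : q 2 = 0 := by
    apply mul_left_cancel₀ (sub_ne_zero.2 (hxy.trans hyz).ne'); linear_combination e2 - e1
  have h1 : q 1 = 0 := by rw [h2] at e1; linarith
  have h0 : q 0 = 0 := by rw [h1, h2] at hx; linarith
  funext i; fin_cases i <;> assumption

theorem AllowedMap.Admissible.theta_lt {I : Set ℝ} (h : Φ.Admissible I)
    (hc : I.OrdConnected) {x y : ℝ} (hx : x ∈ I) (hy : y ∈ I) (hxy : x < y) : Φ.θ x < Φ.θ y :=
  strictMonoOn_of_deriv_pos hc.convex h.1.continuousOn (fun t ht => h.2.1 t (interior_subset ht))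
    hx hy hxy

theorem quad_eq_zero_of_theta (hD : D.Regular) (h : Φ.Admissible D.I) {q : Fin 3 → ℝ} {b c : ℝ}
    (hbc : b < c) (hI : Ioo b c ⊆ D.I) (hz : ∀ t ∈ Ioo b c, quad q (Φ.θ t) = 0) : q = 0 := by
  have hm : ∀ r ∈ Ioo (0:ℝ) 1, b + r * (c - b) ∈ Ioo b c := fun r hr => by
    constructor <;> nlinarith [hr.1, hr.2]
  have h1 := hm (1/4) (by norm_num)
  have h2 := hm (1/2) (by norm_num)
  have h3 := hm (3/4) (by norm_num)
  exact quad_eq_zero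
    (h.theta_lt hD.ordConnected_I (hI h1) (hI h2) (by linarith))
    (h.theta_lt hD.ordConnected_I (hI h2) (hI h3) (by linarith))
    (hz _ h1) (hz _ h2) (hz _ h3)

theorem exists_ne_of_isOpen {J : Set ℝ} (hJ : IsOpen J) (hn : J.Nonempty) :
    ∃ u ∈ J, ∃ v ∈ J, u ≠ v := by
  obtain ⟨u, hu⟩ := hn
  obtain ⟨ε, hε, hb⟩ := Metric.isOpen_iff.1 hJ u hu
  exact ⟨u, hu, u + ε / 2, hb (by simp [abs_of_pos hε, hε]), by linarith⟩

/-- A pulled-back field determines its coefficients, even over a small interval of times. -/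
theorem par_eq_zero (hD : D.Regular) (h : Φ.Admissible D.I) {m : Par} {b c : ℝ}
    (hbc : b < c) (hI : Ioo b c ⊆ D.I)
    (hz : ∀ s, ∀ p ∈ D.plane s, p.1 ∈ Ioo b c → pbF D Φ m s p = 0) : m = 0 := by
  have hq : m.1 = 0 := by
    obtain ⟨u, hu⟩ := hD.nonempty_J 0
    refine quad_eq_zero_of_theta hD h hbc hI fun t ht => ?_
    have := congrArg Prod.fst (hz 0 (t, u) ⟨hI ht, hu⟩ ht)
    rw [pbF_of_mem m ⟨hI ht, hu⟩] at this
    simpa [pbv, (h.2.1 t (hI ht)).ne'] using this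
  have hv : ∀ s, ∀ t ∈ Ioo b c, ∀ u ∈ D.J s, m.2.1 s * (u - Φ.Q s t)
      + Φ.P s * (m.2.2.1 s + m.2.2.2 s * Φ.θ t) / √(deriv Φ.θ t) = 0 := by
    intro s t ht u hu
    have := congrArg Prod.snd (hz s (t, u) ⟨hI ht, hu⟩ ht)
    rw [pbF_of_mem m ⟨hI ht, hu⟩] at this
    simpa [pbv, hq, quad, quadD] using this
  -- Two values of `u` isolate `a_s`; two times, at which the increasing function `θ` differs,
  -- separate `c_s` from `d_s`.
  obtain ⟨t₁, h1⟩ := nonempty_Ioo.2 hbc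
  obtain ⟨t₂, h2⟩ := nonempty_Ioo.2 h1.1
  have h2' : t₂ ∈ Ioo b c := ⟨h2.1, h2.2.trans h1.2⟩
  have ha : ∀ s, m.2.1 s = 0 := by
    intro s
    obtain ⟨u, hu, v, hv', huv⟩ := exists_ne_of_isOpen (hD.isOpen_J s) (hD.nonempty_J s)
    apply mul_right_cancel₀ (sub_ne_zero.2 huv)
    linear_combination hv s t₁ h1 u hu - hv s t₁ h1 v hv'
  have hl : ∀ s, ∀ t ∈ Ioo b c, m.2.2.1 s + m.2.2.2 s * Φ.θ t = 0 := by
    intro s t ht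
    obtain ⟨u, hu⟩ := hD.nonempty_J s
    have := hv s t ht u hu
    rw [ha s, zero_mul, zero_add, div_eq_zero_iff] at this
    simpa [h.2.2.1 s, (h.sqrt_pos (hI ht)).ne'] using this
  have hlt := h.theta_lt hD.ordConnected_I (hI h2') (hI h1) h2.2
  have hd : ∀ s, m.2.2.2 s = 0 := fun s => by
    apply mul_right_cancel₀ (sub_ne_zero.2 hlt.ne')
    linear_combination hl s _ h1 - hl s _ h2'
  have hcc : ∀ s, m.2.2.1 s = 0 := fun s => by
    have := hl s _ h1
    rwa [hd s, zero_mul, add_zero] at this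
  exact Prod.ext hq (Prod.ext (funext ha) (Prod.ext (funext hcc) (funext hd)))

theorem exists_Ioo_subset {I : Set ℝ} (hI : IsOpen I) {t : ℝ} (ht : t ∈ I) :
    ∃ b c, b < c ∧ t ∈ Ioo b c ∧ Ioo b c ⊆ I := by
  obtain ⟨ε, hε, hb⟩ := Metric.isOpen_iff.1 hI t ht
  rw [Real.ball_eq_Ioo] at hb
  exact ⟨t - ε, t + ε, by linarith, ⟨by linarith, by linarith⟩, hb⟩

theorem pbF_injective (hD : D.Regular) (h : Φ.Admissible D.I) :
    Function.Injective (pbF D Φ) := by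
  rw [← LinearMap.ker_eq_bot, LinearMap.ker_eq_bot']
  intro m hm
  obtain ⟨t, ht⟩ := hD.nonempty_I
  obtain ⟨b, c, hbc, -, hs⟩ := exists_Ioo_subset hD.isOpen_I ht
  exact par_eq_zero hD h hbc hs fun s p _ _ => by rw [hm]; rfl

theorem finrank_map_pbF (hD : D.Regular) (h : Φ.Admissible D.I) (M : Submodule ℝ Par) :
    Module.finrank ℝ (M.map (pbF D Φ)) = Module.finrank ℝ M :=
  (Submodule.equivMapOfInjective _ (pbF_injective hD h) M).finrank_eq.symm

/-! ### Solvability and the radical -/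

/-- The `sl(2,ℝ)` components of the fields in `T`. -/
noncomputable def slPart (D : LatticeDomain) (Φ : AllowedMap) (T : Submodule ℝ LatticeField) :
    Submodule ℝ (Fin 3 → ℝ) := (T.comap (pbF D Φ)).map (LinearMap.fst ℝ _ _)

theorem mem_slPart {T : Submodule ℝ LatticeField} {q : Fin 3 → ℝ} :
    q ∈ slPart D Φ T ↔ ∃ m, pbF D Φ m ∈ T ∧ m.1 = q := by
  simp [slPart, Submodule.mem_map]

theorem slPart_eq_top {V : Submodule ℝ (Fin 3 → ℝ)} (h0 : ![1, 0, 0] ∈ V) (h1 : ![0, 1, 0] ∈ V)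
    (h2 : ![0, 0, 1] ∈ V) : V = ⊤ := by
  rw [eq_top_iff]
  intro q _
  have : q = q 0 • ![1, 0, 0] + q 1 • ![0, 1, 0] + q 2 • ![0, 0, 1] := by
    funext i; fin_cases i <;> simp
  rw [this]
  exact add_mem (add_mem (V.smul_mem _ h0) (V.smul_mem _ h1)) (V.smul_mem _ h2)

/-- The algebra `sl(2,ℝ)` is perfect: the brackets of its standard basis return each basis element
up to a factor. -/
theorem slPart_derivedSpan (hD : D.Regular) (h : Φ.Admissible D.I) {T : Submodule ℝ LatticeField}
    (hT : slPart D Φ T = ⊤) : slPart D Φ (derivedSpan T) = ⊤ := by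
  have key : ∀ q r : Fin 3 → ℝ, (parBr (q, 0) (r, 0)).1 ∈ slPart D Φ (derivedSpan T) := by
    intro q r
    obtain ⟨m, hm, rfl⟩ := mem_slPart.1 (hT ▸ Submodule.mem_top : q ∈ slPart D Φ T)
    obtain ⟨m', hm', rfl⟩ := mem_slPart.1 (hT ▸ Submodule.mem_top : r ∈ slPart D Φ T)
    refine mem_slPart.2 ⟨parBr m m', ?_, rfl⟩
    rw [← bracket_pbF hD h]
    exact Submodule.subset_span ⟨_, hm, _, hm', rfl⟩
  refine slPart_eq_top ?_ ?_ ?_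
  · simpa [parBr] using key ![1, 0, 0] ![0, 1, 0]
  · have := Submodule.smul_mem _ (1 / 2 : ℝ) (key ![1, 0, 0] ![0, 0, 1])
    simpa [parBr] using this
  · simpa [parBr] using key ![0, 1, 0] ![0, 0, 1]

theorem not_isSolvableSpace (hD : D.Regular) (h : Φ.Admissible D.I) {T : Submodule ℝ LatticeField}
    (hT : slPart D Φ T = ⊤) : ¬ IsSolvableSpace T := by
  rintro ⟨k, hk⟩
  have : slPart D Φ (derivedSpan^[k] T) = ⊤ := by
    clear hk
    induction k with
    | zero => exact hT
    | succ k ih => rw [Function.iterate_succ_apply']; exact slPart_derivedSpan hD h ih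
  have h1 : (![1, 0, 0] : Fin 3 → ℝ) ∈ slPart D Φ (derivedSpan^[k] T) := this ▸ Submodule.mem_top
  rw [hk] at h1
  obtain ⟨m, hm, hm1⟩ := mem_slPart.1 h1
  have : m = 0 := pbF_injective hD h (by rw [map_zero]; simpa using hm)
  rw [this] at hm1
  simpa using congrFun hm1 0

/-- The algebra `sl(2,ℝ)` is simple: bracketing a nonzero quadratic with `∂_t` lowers its degree
until a constant remains, and bracketing with `t² ∂_t` then produces the other basis elements. -/
theorem slPart_ideal (hD : D.Regular) (h : Φ.Admissible D.I) {L S : Submodule ℝ LatticeField}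
    (hL : slPart D Φ L = ⊤) (hS : IsIdealOf S L) {q : Fin 3 → ℝ} (hq : q ∈ slPart D Φ S)
    (hq0 : q ≠ 0) : slPart D Φ S = ⊤ := by
  have key : ∀ q r : Fin 3 → ℝ, r ∈ slPart D Φ S → (parBr (q, 0) (r, 0)).1 ∈ slPart D Φ S := by
    intro q r hr
    obtain ⟨m, hm, rfl⟩ := mem_slPart.1 (hL ▸ Submodule.mem_top : q ∈ slPart D Φ L)
    obtain ⟨m', hm', rfl⟩ := mem_slPart.1 hr
    refine mem_slPart.2 ⟨parBr m m', ?_, rfl⟩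
    rw [← bracket_pbF hD h]
    exact hS.2 _ hm _ hm'
  have h0 : ![1, 0, 0] ∈ slPart D Φ S := by
    by_cases h2 : q 2 = 0
    · by_cases h1 : q 1 = 0
      · have h0 : q 0 ≠ 0 := fun h0 => hq0 (by funext i; fin_cases i <;> assumption)
        have := Submodule.smul_mem _ (q 0)⁻¹ hq
        convert this using 1
        funext i; fin_cases i <;> simp [h0, h1, h2]
      · have := Submodule.smul_mem _ (q 1)⁻¹ (key ![1, 0, 0] q hq)
        convert this using 1
        funext i; fin_cases i <;> simp [parBr, h1, h2]
    · have := Submodule.smul_mem _ (2 * q 2)⁻¹ (key ![1, 0, 0] _ (key ![1, 0, 0] q hq))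
      convert this using 1
      funext i; fin_cases i <;> simp [parBr]
      field_simp
  have h1 : ![0, 1, 0] ∈ slPart D Φ S := by
    have := Submodule.smul_mem _ (-1 / 2 : ℝ) (key ![0, 0, 1] _ h0)
    convert this using 1
    funext i; fin_cases i <;> simp [parBr]
  refine slPart_eq_top h0 h1 ?_
  have := Submodule.smul_mem _ (-1 : ℝ) (key ![0, 0, 1] _ h1)
  convert this using 1
  funext i; fin_cases i <;> simp [parBr]

theorem derivedSpan_le {T U : Submodule ℝ LatticeField}
    (h : ∀ X ∈ T, ∀ Y ∈ T, bracket X Y ∈ U) : derivedSpan T ≤ U := by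
  rw [derivedSpan, Submodule.span_le]
  rintro _ ⟨X, hX, Y, hY, rfl⟩
  exact h X hX Y hY

theorem slPart_map_ParSub (A C : Submodule ℝ (Site → ℝ)) :
    slPart D Φ ((ParSub A C).map (pbF D Φ)) = ⊤ := by
  rw [eq_top_iff]
  intro q _
  exact mem_slPart.2 ⟨(q, 0), ⟨_, mem_ParSub.2 ⟨A.zero_mem, C.zero_mem, C.zero_mem⟩, rfl⟩, rfl⟩

/-- Brackets lose the scaling part and translations commute, so `RadSub` is solvable of length two.
An ideal that contains an element with nonzero `q` projects onto all of `sl(2,ℝ)` and is not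
solvable. -/
theorem isRadicalOf (hD : D.Regular) (h : Φ.Admissible D.I) {A C : Submodule ℝ (Site → ℝ)}
    (hAC : ∀ a ∈ A, ∀ c ∈ C, a * c ∈ C) :
    IsRadicalOf ((RadSub A C).map (pbF D Φ)) ((ParSub A C).map (pbF D Φ)) := by
  have hle : RadSub A C ≤ ParSub A C := fun m hm => mem_ParSub.2 (mem_RadSub.1 hm).2
  refine ⟨⟨Submodule.map_mono hle, ?_⟩, ⟨2, ?_⟩, ?_⟩
  · rintro _ ⟨m, hm, rfl⟩ _ ⟨m', hm', rfl⟩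
    rw [bracket_pbF hD h]
    refine ⟨_, mem_RadSub.2 ⟨?_, ?_⟩, rfl⟩
    · have := (mem_RadSub.1 hm').1
      funext i; fin_cases i <;> simp [parBr, this]
    · have := mem_ParSub.1 (parBr_mem hAC hm (hle hm'))
      exact ⟨A.zero_mem, this.2⟩
  · have h1 : derivedSpan ((RadSub A C).map (pbF D Φ)) ≤ (RadSub ⊥ C).map (pbF D Φ) := by
      refine derivedSpan_le ?_
      rintro _ ⟨m, hm, rfl⟩ _ ⟨m', hm', rfl⟩
      rw [bracket_pbF hD h]
      have e := (mem_RadSub.1 hm).1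
      have e' := (mem_RadSub.1 hm').1
      refine ⟨_, mem_RadSub.2 ⟨?_, mem_ParSub.1 (parBr_mem hAC (hle hm) (hle hm'))⟩, rfl⟩
      funext i; fin_cases i <;> simp [parBr, e, e']
    rw [Function.iterate_succ_apply', Function.iterate_one, eq_bot_iff]
    refine derivedSpan_le ?_
    intro X hX Y hY
    obtain ⟨m, hm, rfl⟩ := h1 hX
    obtain ⟨m', hm', rfl⟩ := h1 hY
    obtain ⟨e, f, -⟩ := mem_RadSub.1 hm
    obtain ⟨e', f', -⟩ := mem_RadSub.1 hm'
    rw [Submodule.mem_bot] at f f' ⊢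
    rw [bracket_pbF hD h]
    have : parBr m m' = 0 := by
      refine Prod.ext ?_ (Prod.ext rfl (Prod.ext ?_ ?_))
      · funext i; fin_cases i <;> simp [parBr, e, e']
      · funext s; simp [parBr, e, e', f, f']
      · funext s; simp [parBr, e, e', f, f']
    rw [this, map_zero]
  · intro S hS hsol X hX
    obtain ⟨m, hm, rfl⟩ := hS.1 hX
    refine ⟨m, mem_RadSub.2 ⟨?_, mem_ParSub.1 hm⟩, rfl⟩
    by_contra hq
    exact not_isSolvableSpace hD h (slPart_ideal hD h (slPart_map_ParSub A C) hS
      (mem_slPart.2 ⟨m, hX, rfl⟩) hq) hsol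

/-! ### The scaling and translation spaces -/

theorem pbTau_of_zero {m : Par} (hm : m.1 = 0) (t : ℝ) : pbTau Φ m t = 0 := by
  simp [pbTau, hm, quad]

theorem pbF_tau_zero (hD : D.Regular) (h : Φ.Admissible D.I) {m : Par}
    (hz : ∀ s, ∀ p ∈ D.plane s, (pbF D Φ m s p).1 = 0) : m.1 = 0 := by
  obtain ⟨t, ht⟩ := hD.nonempty_I
  obtain ⟨b, c, hbc, -, hs⟩ := exists_Ioo_subset hD.isOpen_I ht
  obtain ⟨u, hu⟩ := hD.nonempty_J 0
  refine quad_eq_zero_of_theta hD h hbc hs fun t ht => ?_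
  have := hz 0 (t, u) ⟨hs ht, hu⟩
  rw [pbF_of_mem m ⟨hs ht, hu⟩] at this
  simpa [pbv, (h.2.1 t (hs ht)).ne'] using this

theorem fderiv_pbF_snd (hD : D.Regular) (h : Φ.Admissible D.I) {m : Par} (hm : m.1 = 0) {s : Site}
    {p : ℝ × ℝ} (hp : p ∈ D.plane s) : fderiv ℝ (pbF D Φ m s) p (0, 1) = (0, m.2.1 s) := by
  rw [← Prod.mk.eta (p := p), (pbF_isAff hD h m).fderiv_apply hD hp]
  have : pbTau Φ m = fun _ => 0 := funext (pbTau_of_zero hm)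
  simp [this]

theorem exists_mem_plane (hD : D.Regular) (s : Site) : ∃ p, p ∈ D.plane s := by
  obtain ⟨t, ht⟩ := hD.nonempty_I
  obtain ⟨u, hu⟩ := hD.nonempty_J s
  exact ⟨(t, u), ht, hu⟩

theorem scalingSpace_eq (hD : D.Regular) (h : Φ.Admissible D.I) (A C : Submodule ℝ (Site → ℝ)) :
    scalingSpace D ((ParSub A C).map (pbF D Φ)) = A ⊔ Submodule.span ℝ {1} := by
  rw [scalingSpace, Submodule.span_union]
  congr 1
  have : {f : Site → ℝ | ∃ X ∈ (ParSub A C).map (pbF D Φ), ∀ s, ∀ p ∈ D.plane s,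
      (X s p).1 = 0 ∧ fderiv ℝ (X s) p (0, 1) = (0, f s)} = (A : Set (Site → ℝ)) := by
    ext f
    constructor
    · rintro ⟨_, ⟨m, hm, rfl⟩, hf⟩
      have hq := pbF_tau_zero hD h fun s p hp => (hf s p hp).1
      have : m.2.1 = f := by
        funext s
        obtain ⟨p, hp⟩ := exists_mem_plane hD s
        have := (hf s p hp).2
        rw [fderiv_pbF_snd hD h hq hp] at this
        exact congrArg Prod.snd this
      rw [← this]
      exact (mem_ParSub.1 hm).1
    · intro hf
      refine ⟨_, ⟨(0, f, 0, 0), mem_ParSub.2 ⟨hf, C.zero_mem, C.zero_mem⟩, rfl⟩, fun s p hp => ⟨?_, ?_⟩⟩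
      · rw [pbF_of_mem _ hp]; simp [pbv, quad]
      · rw [fderiv_pbF_snd hD h rfl hp]
  rw [this, Submodule.span_eq]

/-- At a fixed time `c + d θ(t)` runs through `C`, and the scalar `√θ'` does not matter; only the
site factors `P` remain. -/
theorem translationSpace_eq (hD : D.Regular) (h : Φ.Admissible D.I) (A C : Submodule ℝ (Site → ℝ))
    {t : ℝ} (ht : t ∈ D.I) : translationSpace D ((ParSub A C).map (pbF D Φ)) t =
      C.map (LinearMap.mulLeft ℝ Φ.P) := by
  have hr := (h.sqrt_pos ht).ne'
  have : {f : Site → ℝ | ∃ X ∈ (ParSub A C).map (pbF D Φ), (∀ s, ∀ p ∈ D.plane s,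
      (X s p).1 = 0 ∧ fderiv ℝ (X s) p (0, 1) = 0) ∧ ∀ s, ∀ u ∈ D.J s, (X s (t, u)).2 = f s}
      = (C.map (LinearMap.mulLeft ℝ Φ.P) : Submodule ℝ (Site → ℝ)) := by
    ext f
    constructor
    · rintro ⟨_, ⟨m, hm, rfl⟩, hf, hft⟩
      have hq := pbF_tau_zero hD h fun s p hp => (hf s p hp).1
      have ha : ∀ s, m.2.1 s = 0 := by
        intro s
        obtain ⟨p, hp⟩ := exists_mem_plane hD s
        have := (hf s p hp).2
        rw [fderiv_pbF_snd hD h hq hp] at this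
        exact congrArg Prod.snd this
      refine ⟨(√(deriv Φ.θ t))⁻¹ • (m.2.2.1 + Φ.θ t • m.2.2.2), C.smul_mem _
        (add_mem (mem_ParSub.1 hm).2.1 (C.smul_mem _ (mem_ParSub.1 hm).2.2)), ?_⟩
      funext s
      obtain ⟨u, hu⟩ := hD.nonempty_J s
      rw [← hft s u hu, pbF_of_mem _ ⟨ht, hu⟩]
      simp [pbv, hq, quad, quadD, ha s]
      field_simp
    · rintro ⟨c, hc, rfl⟩
      refine ⟨_, ⟨(0, 0, √(deriv Φ.θ t) • c, 0), mem_ParSub.2 ⟨A.zero_mem, C.smul_mem _ hc, C.zero_mem⟩,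
        rfl⟩, fun s p hp => ⟨?_, ?_⟩, fun s u hu => ?_⟩
      · rw [pbF_of_mem _ hp]; simp [pbv, quad]
      · rw [fderiv_pbF_snd hD h rfl hp]; rfl
      · rw [pbF_of_mem _ ⟨ht, hu⟩]
        simp [pbv, quad, quadD]
        field_simp
  rw [translationSpace, this, Submodule.span_eq]

end

/-! ### The interaction as a function of the old time and the new values -/

/-- `(t, v) ↦ (t, ũ)` and its inverse. -/
noncomputable def newZ (Φ : AllowedMap) (s : Site) (x : ℝ × (Fin 7 → ℝ)) : ℝ × (Fin 7 → ℝ) :=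
  (x.1, Φ.newV s x)
noncomputable def oldV (Φ : AllowedMap) (s : Site) (z : ℝ × (Fin 7 → ℝ)) : ℝ × (Fin 7 → ℝ) :=
  (z.1, fun i => Φ.P (s + nbr i) * z.2 i / √(deriv Φ.θ z.1) + Φ.Q (s + nbr i) z.1)

/-- The transformed interaction at `(t, ũ)`. -/
noncomputable def mixF (Φ : AllowedMap) (F : Site → ℝ × (Fin 7 → ℝ) → ℝ) (s : Site)
    (z : ℝ × (Fin 7 → ℝ)) : ℝ := Φ.newF F s (oldV Φ s z)

section
variable {D : LatticeDomain} {Φ : AllowedMap} {F : Site → ℝ × (Fin 7 → ℝ) → ℝ} {s : Site}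

theorem oldV_newZ (h : Φ.Admissible D.I) {x : ℝ × (Fin 7 → ℝ)} (hx : x.1 ∈ D.I) :
    oldV Φ s (newZ Φ s x) = x := by
  have hr := (h.sqrt_pos hx).ne'
  refine Prod.ext rfl (funext fun i => ?_)
  have hP := h.2.2.1 (s + nbr i)
  simp only [oldV, newZ, AllowedMap.newV, AllowedMap.newU]
  field_simp
  ring

theorem newZ_oldV (h : Φ.Admissible D.I) {z : ℝ × (Fin 7 → ℝ)} (hz : z.1 ∈ D.I) :
    newZ Φ s (oldV Φ s z) = z := by
  have hr := (h.sqrt_pos hz).ne'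
  refine Prod.ext rfl (funext fun i => ?_)
  have hP := h.2.2.1 (s + nbr i)
  simp only [oldV, newZ, AllowedMap.newV, AllowedMap.newU]
  field_simp
  ring

theorem mixF_newZ (h : Φ.Admissible D.I) {x : ℝ × (Fin 7 → ℝ)} (hx : x.1 ∈ D.I) :
    mixF Φ F s (newZ Φ s x) = Φ.newF F s x := by
  rw [mixF, oldV_newZ h hx]

theorem contDiffAt_oldV (hI : IsOpen D.I) (h : Φ.Admissible D.I) {z : ℝ × (Fin 7 → ℝ)}
    (hz : z.1 ∈ D.I) : ContDiffAt ℝ ∞ (oldV Φ s) z := by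
  have hc := fun {f : ℝ → ℝ} (hf : ContDiffOn ℝ ∞ f D.I) =>
    (hf.contDiffAt (hI.mem_nhds hz)).comp z contDiffAt_fst
  refine contDiffAt_fst.prodMk (contDiffAt_pi.2 fun i => ?_)
  refine ContDiffAt.add (ContDiffAt.div ?_ (hc (h.smooth_sqrt hI)) (h.sqrt_pos hz).ne')
    (hc (h.2.2.2 (s + nbr i)))
  exact contDiffAt_const.mul (by fun_prop)

theorem contDiffAt_newZ (hI : IsOpen D.I) (h : Φ.Admissible D.I) {x : ℝ × (Fin 7 → ℝ)}
    (hx : x.1 ∈ D.I) : ContDiffAt ℝ ∞ (newZ Φ s) x := by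
  have hc := fun {f : ℝ → ℝ} (hf : ContDiffOn ℝ ∞ f D.I) =>
    (hf.contDiffAt (hI.mem_nhds hx)).comp x contDiffAt_fst
  refine contDiffAt_fst.prodMk (contDiffAt_pi.2 fun i => ?_)
  refine ContDiffAt.div_const (ContDiffAt.mul (hc (h.smooth_sqrt hI))
    (ContDiffAt.sub (by fun_prop) (hc (h.2.2.2 (s + nbr i))))) _

/-- The coefficients in `newF`. -/
noncomputable def coefA (Φ : AllowedMap) (s : Site) (t : ℝ) : ℝ :=
  deriv Φ.θ t ^ (-(3 / 2) : ℝ) * (Φ.P s)⁻¹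
noncomputable def coefS (Φ : AllowedMap) (t : ℝ) : ℝ :=
  1 / 2 * ((deriv Φ.θ t) ^ 3)⁻¹ * (deriv (deriv (deriv Φ.θ)) t
    - 3 / 2 * (deriv Φ.θ t)⁻¹ * (deriv (deriv Φ.θ) t) ^ 2)

theorem newF_eq (x : ℝ × (Fin 7 → ℝ)) : Φ.newF F s x =
    coefA Φ s x.1 * (F s x - deriv (deriv (Φ.Q s)) x.1) + coefS Φ x.1 * Φ.newU s (x.1, x.2 0) := by
  simp only [AllowedMap.newF, coefA, coefS, iteratedDeriv_succ, iteratedDeriv_zero]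

theorem mixF_eq (h : Φ.Admissible D.I) {z : ℝ × (Fin 7 → ℝ)} (hz : z.1 ∈ D.I) :
    mixF Φ F s z = coefA Φ s z.1 * (F s (oldV Φ s z) - deriv (deriv (Φ.Q s)) z.1)
      + coefS Φ z.1 * z.2 0 := by
  rw [mixF, newF_eq]
  have := congrFun (congrArg Prod.snd (newZ_oldV (s := s) h hz)) 0
  simp only [newZ, AllowedMap.newV, nbr_zero, add_zero] at this
  rw [this]; rfl

theorem smooth_coefA (hI : IsOpen D.I) (h : Φ.Admissible D.I) (s : Site) :
    ContDiffOn ℝ ∞ (coefA Φ s) D.I :=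
  ((smooth_deriv hI h.1).rpow_const_of_ne fun t ht => (h.2.1 t ht).ne').mul contDiffOn_const

theorem smooth_coefS (hI : IsOpen D.I) (h : Φ.Admissible D.I) :
    ContDiffOn ℝ ∞ (coefS Φ) D.I := by
  have h1 := smooth_deriv hI h.1
  have h2 := smooth_deriv hI h1
  have h3 := smooth_deriv hI h2
  have hne : ∀ t ∈ D.I, deriv Φ.θ t ≠ 0 := fun t ht => (h.2.1 t ht).ne'
  exact (contDiffOn_const.mul ((h1.pow 3).inv fun t ht => pow_ne_zero 3 (hne t ht))).mul
    (h3.sub ((contDiffOn_const.mul (h1.inv hne)).mul (h2.pow 2)))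

theorem contDiffAt_mixF (hD : D.Regular) (h : Φ.Admissible D.I)
    (hF : ContDiffOn ℝ ∞ (F s) (D.Ω s)) {z : ℝ × (Fin 7 → ℝ)} (hz : oldV Φ s z ∈ D.Ω s) :
    ContDiffAt ℝ ∞ (mixF Φ F s) z := by
  have hI := hD.isOpen_I
  have hzI : z.1 ∈ D.I := (hD.Ω_subset s _ hz).1
  have hc := fun {f : ℝ → ℝ} (hf : ContDiffOn ℝ ∞ f D.I) =>
    (hf.contDiffAt (hI.mem_nhds hzI)).comp z contDiffAt_fst
  have h1 := (hF.contDiffAt ((hD.isOpen_Ω s).mem_nhds hz)).comp z (contDiffAt_oldV hI h hzI)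
  have : ContDiffAt ℝ ∞ (fun z : ℝ × (Fin 7 → ℝ) => coefA Φ s z.1 *
      (F s (oldV Φ s z) - deriv (deriv (Φ.Q s)) z.1) + coefS Φ z.1 * z.2 0) z :=
    ((hc (smooth_coefA hI h s)).mul (h1.sub (hc (smooth_deriv hI (smooth_deriv hI (h.2.2.2 s)))))).add
      ((hc (smooth_coefS hI h)).mul (by fun_prop))
  refine this.congr_of_eventuallyEq ?_
  filter_upwards [(hI.preimage continuous_fst).mem_nhds hzI] with y hy using mixF_eq h hy

theorem coefA_hasDerivAt (hI : IsOpen D.I) (h : Φ.Admissible D.I) (s : Site) {t : ℝ} (ht : t ∈ D.I) :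
    HasDerivAt (coefA Φ s)
      (-(3 / 2) * deriv (deriv Φ.θ) t / deriv Φ.θ t * coefA Φ s t) t := by
  have hk := h.2.1 t ht
  have := ((smooth_hasDerivAt hI (smooth_deriv hI h.1) ht).rpow_const (p := -(3 / 2))
    (Or.inl hk.ne')).mul_const (Φ.P s)⁻¹
  refine this.congr_deriv ?_
  rw [coefA, Real.rpow_sub_one hk.ne']
  ring

theorem coefA_eq (h : Φ.Admissible D.I) (s : Site) {t : ℝ} (ht : t ∈ D.I) :
    coefA Φ s t = (√(deriv Φ.θ t) ^ 3)⁻¹ * (Φ.P s)⁻¹ := by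
  have hk := h.2.1 t ht
  rw [coefA, Real.sqrt_eq_rpow, ← Real.rpow_natCast, ← Real.rpow_mul hk.le, ← Real.rpow_neg hk.le]
  norm_num

/-- Computed along the line through the point in the direction `(τ, W)`, so that rules for one
variable suffice. -/
theorem fderiv_mixF (hD : D.Regular) (h : Φ.Admissible D.I)
    (hF : ContDiffOn ℝ ∞ (F s) (D.Ω s)) {x : ℝ × (Fin 7 → ℝ)} (hx : x ∈ D.Ω s) (τ : ℝ)
    (W : Fin 7 → ℝ) :
    fderiv ℝ (mixF Φ F s) (newZ Φ s x) (τ, W) =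
      -(3 / 2) * deriv (deriv Φ.θ) x.1 / deriv Φ.θ x.1 * coefA Φ s x.1 * τ *
        (F s x - deriv (deriv (Φ.Q s)) x.1)
      + coefA Φ s x.1 * (fderiv ℝ (F s) x (τ, fun i => Φ.P (s + nbr i) * W i / √(deriv Φ.θ x.1)
          - Φ.P (s + nbr i) * Φ.newV s x i * (deriv (deriv Φ.θ) x.1 / (2 * √(deriv Φ.θ x.1)))
            / deriv Φ.θ x.1 * τ + deriv (Φ.Q (s + nbr i)) x.1 * τ)
          - deriv (deriv (deriv (Φ.Q s))) x.1 * τ)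
      + (deriv (coefS Φ) x.1 * τ * Φ.newV s x 0 + coefS Φ x.1 * W 0) := by
  have hI := hD.isOpen_I
  have hxI : x.1 ∈ D.I := (hD.Ω_subset s _ hx).1
  set z := newZ Φ s x with hz
  have hzx : oldV Φ s z = x := oldV_newZ h hxI
  have hline : HasDerivAt (fun ρ : ℝ => z + ρ • ((τ, W) : ℝ × (Fin 7 → ℝ))) (τ, W) 0 := by
    simpa using ((hasDerivAt_id (0:ℝ)).smul_const ((τ, W) : ℝ × (Fin 7 → ℝ))).const_add z
  have hG : HasFDerivAt (mixF Φ F s) (fderiv ℝ (mixF Φ F s) z)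
      (z + (0:ℝ) • ((τ, W) : ℝ × (Fin 7 → ℝ))) := by
    rw [zero_smul, add_zero]
    exact ((contDiffAt_mixF hD h hF (by rw [hzx]; exact hx)).differentiableAt (by simp)).hasFDerivAt
  have e1 := hG.comp_hasDerivAt (0:ℝ) hline
  have ht : HasDerivAt (fun ρ : ℝ => x.1 + ρ * τ) τ 0 := by
    simpa using ((hasDerivAt_id (0:ℝ)).mul_const τ).const_add x.1
  have hw : ∀ i, HasDerivAt (fun ρ : ℝ => Φ.newV s x i + ρ * W i) (W i) 0 := fun i => by
    simpa using ((hasDerivAt_id (0:ℝ)).mul_const (W i)).const_add (Φ.newV s x i)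
  have hcomp : ∀ {f : ℝ → ℝ} {f' : ℝ}, HasDerivAt f f' x.1 →
      HasDerivAt (fun ρ : ℝ => f (x.1 + ρ * τ)) (f' * τ) 0 := fun {f f'} hf =>
    HasDerivAt.comp (0:ℝ) (h₂ := f) (by simpa using hf) ht
  have hsm : ∀ {f : ℝ → ℝ}, ContDiffOn ℝ ∞ f D.I →
      HasDerivAt (fun ρ : ℝ => f (x.1 + ρ * τ)) (deriv f x.1 * τ) 0 := fun hf =>
    hcomp (smooth_hasDerivAt hI hf hxI)
  have hr := hcomp (h.hasDerivAt_sqrt hI hxI)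
  have hrpos := h.sqrt_pos hxI
  have hV : HasDerivAt (fun ρ : ℝ => oldV Φ s (z + ρ • ((τ, W) : ℝ × (Fin 7 → ℝ))))
      (τ, fun i => Φ.P (s + nbr i) * W i / √(deriv Φ.θ x.1)
          - Φ.P (s + nbr i) * Φ.newV s x i * (deriv (deriv Φ.θ) x.1 / (2 * √(deriv Φ.θ x.1)))
            / deriv Φ.θ x.1 * τ + deriv (Φ.Q (s + nbr i)) x.1 * τ) 0 := by
    refine ht.prodMk (hasDerivAt_pi.2 fun i => ?_)
    have := (((hw i).const_mul (Φ.P (s + nbr i))).div hr (by simpa using hrpos.ne')).add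
      (hsm (h.2.2.2 (s + nbr i)))
    refine this.congr_deriv ?_
    simp only [zero_mul, add_zero]
    rw [Real.sq_sqrt (h.2.1 _ hxI).le]
    have hk : deriv Φ.θ x.1 = √(deriv Φ.θ x.1) ^ 2 := (Real.sq_sqrt (h.2.1 _ hxI).le).symm
    generalize √(deriv Φ.θ x.1) = r at hk hrpos ⊢
    rw [hk]
    field_simp
  have hFx : HasFDerivAt (F s) (fderiv ℝ (F s) x) (oldV Φ s (z + (0:ℝ) • ((τ, W) : ℝ × (Fin 7 → ℝ)))) := by
    rw [zero_smul, add_zero, hzx]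
    exact ((hF.contDiffAt ((hD.isOpen_Ω s).mem_nhds hx)).differentiableAt (by simp)).hasFDerivAt
  have e2 := ((hcomp (coefA_hasDerivAt hI h s hxI)).mul ((hFx.comp_hasDerivAt (0:ℝ) hV).sub
    (hsm (smooth_deriv hI (smooth_deriv hI (h.2.2.2 s)))))).add
    ((hsm (smooth_coefS hI h)).mul (hw 0))
  have hev : (mixF Φ F s ∘ fun ρ : ℝ => z + ρ • ((τ, W) : ℝ × (Fin 7 → ℝ))) =ᶠ[𝓝 0] fun ρ : ℝ =>
      coefA Φ s (x.1 + ρ * τ) * (F s (oldV Φ s (z + ρ • ((τ, W) : ℝ × (Fin 7 → ℝ))))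
        - deriv (deriv (Φ.Q s)) (x.1 + ρ * τ)) + coefS Φ (x.1 + ρ * τ) * (Φ.newV s x 0 + ρ * W 0) := by
    have : ∀ᶠ ρ in 𝓝 (0:ℝ), x.1 + ρ * τ ∈ D.I :=
      ht.continuousAt (by simpa using hI.mem_nhds hxI)
    filter_upwards [this] with ρ hρ
    exact mixF_eq (F := F) (s := s) h (z := z + ρ • ((τ, W) : ℝ × (Fin 7 → ℝ))) hρ
  refine (e1.unique (e2.congr_of_eventuallyEq hev)).trans ?_
  simp only [zero_mul, add_zero, Function.comp, zero_smul, hzx, Pi.sub_apply]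

theorem deriv_coefS (hI : IsOpen D.I) (h : Φ.Admissible D.I) {t : ℝ} (ht : t ∈ D.I) :
    deriv (coefS Φ) t = 1 / 2 * (deriv (deriv (deriv (deriv Φ.θ))) t / deriv Φ.θ t ^ 3
      - 6 * deriv (deriv Φ.θ) t * deriv (deriv (deriv Φ.θ)) t / deriv Φ.θ t ^ 4
      + 6 * deriv (deriv Φ.θ) t ^ 3 / deriv Φ.θ t ^ 5) := by
  have hk := (h.2.1 t ht).ne'
  have s1 := smooth_deriv hI h.1
  have s2 := smooth_deriv hI s1
  have s3 := smooth_deriv hI s2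
  have h1 := smooth_hasDerivAt hI s1 ht
  have h2 := smooth_hasDerivAt hI s2 ht
  have h3 := smooth_hasDerivAt hI s3 ht
  have := (((h1.pow 3).inv (pow_ne_zero 3 hk)).const_mul (1 / 2)).mul
    (h3.sub (((h1.inv hk).const_mul (3 / 2)).mul (h2.pow 2)))
  refine this.deriv.trans ?_
  simp only [Pi.pow_apply, Pi.inv_apply, Pi.sub_apply, Pi.mul_apply]
  field_simp
  ring

theorem deriv2_pbTau (hI : IsOpen D.I) (h : Φ.Admissible D.I) (m : Par) {t : ℝ} (ht : t ∈ D.I) :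
    deriv (deriv (pbTau Φ m)) t = 2 * m.1 2 * deriv Φ.θ t
      - quadD m.1 (Φ.θ t) * deriv (deriv Φ.θ) t / deriv Φ.θ t
      - quad m.1 (Φ.θ t) * deriv (deriv (deriv Φ.θ)) t / deriv Φ.θ t ^ 2
      + 2 * quad m.1 (Φ.θ t) * deriv (deriv Φ.θ) t ^ 2 / deriv Φ.θ t ^ 3 := by
  have hk := (h.2.1 t ht).ne'
  have s1 := smooth_deriv hI h.1
  have h0 := smooth_hasDerivAt hI h.1 ht
  have h1 := smooth_hasDerivAt hI s1 ht
  have h2 := smooth_hasDerivAt hI (smooth_deriv hI s1) ht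
  have hq := (quad_hasDerivAt m.1 (Φ.θ t)).comp t h0
  have hqd : HasDerivAt (fun t => quadD m.1 (Φ.θ t)) (2 * m.1 2 * deriv Φ.θ t) t := by
    simpa [quadD] using (h0.const_mul (2 * m.1 2)).const_add (m.1 1)
  rw [deriv_congr_on hI (fun r hr => (pbTau_hasDerivAt hI h m hr).deriv) ht]
  refine (hqd.sub ((hq.mul h2).div (h1.pow 2) (pow_ne_zero 2 hk))).deriv.trans ?_
  simp only [Pi.pow_apply, Function.comp, Pi.mul_apply]
  field_simp
  ring

theorem deriv3_pbTau (hI : IsOpen D.I) (h : Φ.Admissible D.I) (m : Par) {t : ℝ} (ht : t ∈ D.I) :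
    deriv (deriv (deriv (pbTau Φ m))) t =
      -2 * quadD m.1 (Φ.θ t) * deriv (deriv (deriv Φ.θ)) t / deriv Φ.θ t
      + 3 * quadD m.1 (Φ.θ t) * deriv (deriv Φ.θ) t ^ 2 / deriv Φ.θ t ^ 2
      - quad m.1 (Φ.θ t) * deriv (deriv (deriv (deriv Φ.θ))) t / deriv Φ.θ t ^ 2
      + 6 * quad m.1 (Φ.θ t) * deriv (deriv Φ.θ) t * deriv (deriv (deriv Φ.θ)) t / deriv Φ.θ t ^ 3
      - 6 * quad m.1 (Φ.θ t) * deriv (deriv Φ.θ) t ^ 3 / deriv Φ.θ t ^ 4 := by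
  have hk := (h.2.1 t ht).ne'
  have s1 := smooth_deriv hI h.1
  have s2 := smooth_deriv hI s1
  have h0 := smooth_hasDerivAt hI h.1 ht
  have h1 := smooth_hasDerivAt hI s1 ht
  have h2 := smooth_hasDerivAt hI s2 ht
  have h3 := smooth_hasDerivAt hI (smooth_deriv hI s2) ht
  have hq := (quad_hasDerivAt m.1 (Φ.θ t)).comp t h0
  have hqd : HasDerivAt (fun t => quadD m.1 (Φ.θ t)) (2 * m.1 2 * deriv Φ.θ t) t := by
    simpa [quadD] using (h0.const_mul (2 * m.1 2)).const_add (m.1 1)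
  rw [deriv_congr_on hI (fun r hr => deriv2_pbTau hI h m hr) ht]
  refine ((((h1.const_mul (2 * m.1 2)).sub ((hqd.mul h2).div h1 hk)).sub
    ((hq.mul h3).div (h1.pow 2) (pow_ne_zero 2 hk))).add
    (((hq.const_mul 2).mul (h2.pow 2)).div (h1.pow 3) (pow_ne_zero 3 hk))).deriv.trans ?_
  simp only [Pi.pow_apply, Function.comp, Pi.mul_apply]
  field_simp
  ring

theorem deriv_pbL (hI : IsOpen D.I) (h : Φ.Admissible D.I) (m : Par) (s : Site) {t : ℝ}
    (ht : t ∈ D.I) : deriv (pbL Φ m s) t =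
      deriv (pbTau Φ m) t * deriv (Φ.Q s) t + pbTau Φ m t * deriv (deriv (Φ.Q s)) t
      - (deriv (deriv (pbTau Φ m)) t / 2 * Φ.Q s t
        + (deriv (pbTau Φ m) t / 2 + m.2.1 s) * deriv (Φ.Q s) t)
      + Φ.P s * (m.2.2.2 s * √(deriv Φ.θ t) - (m.2.2.1 s + m.2.2.2 s * Φ.θ t) *
        deriv (deriv Φ.θ) t / (2 * √(deriv Φ.θ t) ^ 3)) := by
  have hk := h.2.1 t ht
  have hrpos := h.sqrt_pos ht
  have s1 := smooth_deriv hI h.1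
  have sτ := (quad_contDiff m.1).comp_contDiffOn h.1 |>.div s1 fun t ht => (h.2.1 t ht).ne'
  have dτ := smooth_hasDerivAt hI (f := pbTau Φ m) sτ ht
  have dτ1 := smooth_hasDerivAt hI (smooth_deriv hI (f := pbTau Φ m) sτ) ht
  have dQ := smooth_hasDerivAt hI (h.2.2.2 s) ht
  have dQ1 := smooth_hasDerivAt hI (smooth_deriv hI (h.2.2.2 s)) ht
  have dr := h.hasDerivAt_sqrt hI ht
  have dℓ := ((smooth_hasDerivAt hI h.1 ht).const_mul (m.2.2.2 s)).const_add (m.2.2.1 s)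
  refine (((dτ.mul dQ1).sub (((dτ1.div_const 2).add_const (m.2.1 s)).mul dQ)).add
    ((dℓ.const_mul (Φ.P s)).div dr hrpos.ne')).deriv.trans ?_
  congr 1
  have hkr : deriv Φ.θ t = √(deriv Φ.θ t) ^ 2 := (Real.sq_sqrt hk.le).symm
  generalize √(deriv Φ.θ t) = r at hkr hrpos ⊢
  rw [hkr]
  field_simp

theorem deriv2_pbL (hI : IsOpen D.I) (h : Φ.Admissible D.I) (m : Par) (s : Site) {t : ℝ}
    (ht : t ∈ D.I) : deriv (deriv (pbL Φ m s)) t =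
      deriv (pbTau Φ m) t * deriv (deriv (Φ.Q s)) t + pbTau Φ m t * deriv (deriv (deriv (Φ.Q s))) t
      + (deriv (deriv (pbTau Φ m)) t / 2 * deriv (Φ.Q s) t + deriv (pbTau Φ m) t / 2 * deriv (deriv (Φ.Q s)) t)
      - (deriv (deriv (deriv (pbTau Φ m))) t / 2 * Φ.Q s t
        + deriv (deriv (pbTau Φ m)) t / 2 * deriv (Φ.Q s) t
        + m.2.1 s * deriv (deriv (Φ.Q s)) t)
      + Φ.P s * (m.2.2.1 s + m.2.2.2 s * Φ.θ t) *
        (3 / 4 * deriv (deriv Φ.θ) t ^ 2 / √(deriv Φ.θ t) ^ 5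
        - deriv (deriv (deriv Φ.θ)) t / (2 * √(deriv Φ.θ t) ^ 3)) := by
  have hk := h.2.1 t ht
  have hrpos := h.sqrt_pos ht
  have s1 := smooth_deriv hI h.1
  have sτ := (quad_contDiff m.1).comp_contDiffOn h.1 |>.div s1 fun t ht => (h.2.1 t ht).ne'
  have dτ := smooth_hasDerivAt hI (f := pbTau Φ m) sτ ht
  have dτ1 := smooth_hasDerivAt hI (smooth_deriv hI (f := pbTau Φ m) sτ) ht
  have dQ := smooth_hasDerivAt hI (h.2.2.2 s) ht
  have dQ1 := smooth_hasDerivAt hI (smooth_deriv hI (h.2.2.2 s)) ht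
  have dr := h.hasDerivAt_sqrt hI ht
  have dℓ := ((smooth_hasDerivAt hI h.1 ht).const_mul (m.2.2.2 s)).const_add (m.2.2.1 s)
  have dk1 := smooth_hasDerivAt hI (smooth_deriv hI s1) ht
  have dτ2 := smooth_hasDerivAt hI (smooth_deriv hI (smooth_deriv hI (f := pbTau Φ m) sτ)) ht
  have dQ2 := smooth_hasDerivAt hI (smooth_deriv hI (smooth_deriv hI (h.2.2.2 s))) ht
  rw [deriv_congr_on hI (fun r hr => deriv_pbL hI h m s hr) ht]
  refine (((((dτ1.mul dQ1).add (dτ.mul dQ2)).sub (((dτ2.div_const 2).mul dQ).add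
    (((dτ1.div_const 2).add_const (m.2.1 s)).mul dQ1)))).add
    (((dr.const_mul (m.2.2.2 s)).sub ((dℓ.mul dk1).div ((dr.pow 3).const_mul 2)
      (by simp [hrpos.ne']))).const_mul (Φ.P s))).deriv.trans ?_
  have hkr : deriv Φ.θ t = √(deriv Φ.θ t) ^ 2 := (Real.sq_sqrt hk.le).symm
  simp only [Pi.pow_apply, Pi.mul_apply]
  generalize √(deriv Φ.θ t) = r at hkr hrpos ⊢
  rw [hkr]
  field_simp
  ring

/-- The determining equation, for the interaction as a function of `(t, ũ)`. -/
theorem detEq_iff (hD : D.Regular) (h : Φ.Admissible D.I)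
    (hF : ContDiffOn ℝ ∞ (F s) (D.Ω s)) (m : Par) {x : ℝ × (Fin 7 → ℝ)} (hx : x ∈ D.Ω s) :
    DetEq F (pbTau Φ m) m.2.1 (pbL Φ m) s x ↔
      fderiv ℝ (mixF Φ F s) (newZ Φ s x) (quad m.1 (Φ.θ x.1) / deriv Φ.θ x.1,
        fun i => (quadD m.1 (Φ.θ x.1) / 2 + m.2.1 (s + nbr i)) * Φ.newV s x i
          + (m.2.2.1 (s + nbr i) + m.2.2.2 (s + nbr i) * Φ.θ x.1)) =
      (m.2.1 s - 3 / 2 * quadD m.1 (Φ.θ x.1)) * mixF Φ F s (newZ Φ s x) := by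
  have hI := hD.isOpen_I
  have hxI : x.1 ∈ D.I := (hD.Ω_subset s _ hx).1
  have hk := h.2.1 _ hxI
  have hs0 : s + nbr 0 = s := by simp [nbr_zero]
  have hrpos := h.sqrt_pos hxI
  have hkr : deriv Φ.θ x.1 = √(deriv Φ.θ x.1) ^ 2 := (Real.sq_sqrt hk.le).symm
  have hP : ∀ s, Φ.P s ≠ 0 := h.2.2.1
  have hx2 : ∀ i, x.2 i = Φ.P (s + nbr i) * Φ.newV s x i / √(deriv Φ.θ x.1) + Φ.Q (s + nbr i) x.1 :=
    fun i => (congrFun (congrArg Prod.snd (oldV_newZ (s := s) h hxI)) i).symm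
  have hτ1 := (pbTau_hasDerivAt hI h m hxI).deriv
  rw [fderiv_mixF hD h hF hx, mixF_eq h (z := newZ Φ s x) hxI, oldV_newZ h hxI, DetEq]
  have hvec : (fun i => (deriv (pbTau Φ m) x.1 / 2 + m.2.1 (s + nbr i)) * x.2 i
      + pbL Φ m (s + nbr i) x.1) = fun i => Φ.P (s + nbr i) *
        ((quadD m.1 (Φ.θ x.1) / 2 + m.2.1 (s + nbr i)) * Φ.newV s x i
          + (m.2.2.1 (s + nbr i) + m.2.2.2 (s + nbr i) * Φ.θ x.1)) / √(deriv Φ.θ x.1)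
          - Φ.P (s + nbr i) * Φ.newV s x i * (deriv (deriv Φ.θ) x.1 / (2 * √(deriv Φ.θ x.1)))
            / deriv Φ.θ x.1 * (quad m.1 (Φ.θ x.1) / deriv Φ.θ x.1)
          + deriv (Φ.Q (s + nbr i)) x.1 * (quad m.1 (Φ.θ x.1) / deriv Φ.θ x.1) := by
    funext i
    rw [hx2 i, pbL, hτ1, pbTau]
    generalize √(deriv Φ.θ x.1) = r at hkr hrpos ⊢
    rw [hkr]
    field_simp
    ring
  rw [hvec]
  have h0 := hx2 0
  rw [hs0] at h0
  simp only [newZ]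
  rw [deriv3_pbTau hI h m hxI, deriv2_pbL hI h m s hxI, deriv3_pbTau hI h m hxI,
    deriv2_pbTau hI h m hxI, hτ1, h0, deriv_coefS hI h hxI, coefA_eq h s hxI, hs0]
  simp only [coefS, pbTau]
  generalize fderiv ℝ (F s) x _ = XF
  have hP0 := hP s
  generalize √(deriv Φ.θ x.1) = r at hkr hrpos ⊢
  rw [hkr]
  generalize deriv (deriv (deriv (deriv Φ.θ))) x.1 = k3
  generalize deriv (deriv (deriv Φ.θ)) x.1 = k2
  generalize deriv (deriv Φ.θ) x.1 = k1
  generalize deriv (deriv (deriv (Φ.Q s))) x.1 = Q3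
  generalize deriv (deriv (Φ.Q s)) x.1 = Q2
  generalize deriv (Φ.Q s) x.1 = Q1
  generalize Φ.Q s x.1 = Q0
  generalize Φ.P s = P at hP0 ⊢
  generalize quad m.1 (Φ.θ x.1) = q
  generalize quadD m.1 (Φ.θ x.1) = qd
  generalize m.2.2.1 s + m.2.2.2 s * Φ.θ x.1 = c
  generalize m.2.1 s = a
  generalize Φ.newV s x 0 = z
  generalize F s x = f
  -- After multiplication by this factor, by which accelerations transform, the old equation becomes
  -- the new one. The terms of the transformed interaction with `Q''` and with the Schwarzian
  -- derivative of `θ` absorb all inhomogeneous terms.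
  have hA : (r ^ 3)⁻¹ * P⁻¹ ≠ 0 := by positivity
  rw [← sub_eq_zero, ← sub_eq_zero (a := _ + _ + _)]
  rw [← mul_right_inj' hA, mul_zero]
  rw [← eq_iff_iff]
  congr 1
  field_simp
  ring

end

/-! ### The reduced system for the interaction -/

/-- The determining equations for `sl(2,ℝ)`, the scalings in `A` and the translations in `C`. -/
structure Red (A C : Submodule ℝ (Site → ℝ)) (s : Site) (G : ℝ × (Fin 7 → ℝ) → ℝ)
    (z : ℝ × (Fin 7 → ℝ)) : Prop where
  time : fderiv ℝ G z (1, 0) = 0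
  euler : fderiv ℝ G z (0, z.2) = -3 * G z
  scal : ∀ a ∈ A, fderiv ℝ G z (0, fun i => a (s + nbr i) * z.2 i) = a s * G z
  trans : ∀ c ∈ C, fderiv ℝ G z (0, fun i => c (s + nbr i)) = 0

section
variable {D : LatticeDomain} {Φ : AllowedMap} {F : Site → ℝ × (Fin 7 → ℝ) → ℝ} {s : Site}
  {A C : Submodule ℝ (Site → ℝ)}

/-- At a given point a quadratic `q` enters only through `q(θ)` and `q'(θ)`, so the three generators
of `sl(2,ℝ)` impose just two conditions: independence of time and homogeneity of degree `-3`. In the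
same way a translation `d t ∂_u` imposes nothing beyond the condition for `d ∂_u`. -/
theorem detEq_iff_red (hD : D.Regular) (h : Φ.Admissible D.I)
    (hF : ContDiffOn ℝ ∞ (F s) (D.Ω s)) {x : ℝ × (Fin 7 → ℝ)} (hx : x ∈ D.Ω s) :
    (∀ m ∈ ParSub A C, DetEq F (pbTau Φ m) m.2.1 (pbL Φ m) s x) ↔
      Red A C s (mixF Φ F s) (newZ Φ s x) := by
  have hxI : x.1 ∈ D.I := (hD.Ω_subset s _ hx).1
  have hk := (h.2.1 _ hxI).ne'
  set G := mixF Φ F s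
  set z := newZ Φ s x
  have hz2 : Φ.newV s x = z.2 := rfl
  set T := fderiv ℝ G z
  constructor
  · intro H
    replace H := fun m hm => (detEq_iff hD h hF m hx).1 (H m hm)
    rw [hz2] at H
    have ht : T (1, 0) = 0 := by
      have := H (![1, 0, 0], 0) (mem_ParSub.2 ⟨A.zero_mem, C.zero_mem, C.zero_mem⟩)
      simp only [quad, quadD] at this
      have e : T ((deriv Φ.θ x.1)⁻¹ • ((1, 0) : ℝ × (Fin 7 → ℝ))) = 0 := by
        rw [← show T _ = 0 by simpa using this]
        congr 1
        refine Prod.ext (by simp) (funext fun i => by simp)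
      rw [map_smul, smul_eq_zero] at e
      exact e.resolve_left (inv_ne_zero hk)
    have hpair : ∀ (r : ℝ) (W : Fin 7 → ℝ), T (r, W) = T (0, W) := by
      intro r W
      have : ((r, W) : ℝ × (Fin 7 → ℝ)) = r • (1, 0) + (0, W) := by simp
      rw [this, map_add, map_smul, ht, smul_zero, zero_add]
    refine ⟨ht, ?_, ?_, ?_⟩
    · have := H (![0, 1, 0], 0) (mem_ParSub.2 ⟨A.zero_mem, C.zero_mem, C.zero_mem⟩)
      rw [hpair] at this
      simp [quadD] at this
      have e : T ((2:ℝ)⁻¹ • ((0, z.2) : ℝ × (Fin 7 → ℝ))) = -(3 / 2 * G z) := by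
        rw [← this]
        congr 1
        refine Prod.ext (by simp) (funext fun i => by simp)
      rw [map_smul, smul_eq_mul] at e
      linarith
    · intro a ha
      have := H (0, a, 0, 0) (mem_ParSub.2 ⟨ha, C.zero_mem, C.zero_mem⟩)
      rw [hpair] at this
      simpa [quadD] using this
    · intro c hc
      have := H (0, 0, c, 0) (mem_ParSub.2 ⟨A.zero_mem, hc, C.zero_mem⟩)
      rw [hpair] at this
      simpa [quadD] using this
  · intro H m hm
    obtain ⟨ha, hc, hd⟩ := mem_ParSub.1 hm
    rw [detEq_iff hD h hF m hx, hz2]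
    have : ((quad m.1 (Φ.θ x.1) / deriv Φ.θ x.1,
        fun i => (quadD m.1 (Φ.θ x.1) / 2 + m.2.1 (s + nbr i)) * z.2 i
          + (m.2.2.1 (s + nbr i) + m.2.2.2 (s + nbr i) * Φ.θ x.1)) : ℝ × (Fin 7 → ℝ)) =
        (quad m.1 (Φ.θ x.1) / deriv Φ.θ x.1) • (1, 0) + (quadD m.1 (Φ.θ x.1) / 2) • (0, z.2)
        + (0, fun i => m.2.1 (s + nbr i) * z.2 i) + (0, fun i => m.2.2.1 (s + nbr i))
        + Φ.θ x.1 • (0, fun i => m.2.2.2 (s + nbr i)) := by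
      refine Prod.ext (by simp) (funext fun i => ?_)
      simp; ring
    rw [this, map_add, map_add, map_add, map_add, map_smul, map_smul, map_smul, H.time, H.euler,
      H.scal _ ha, H.trans _ hc, H.trans _ hd]
    simp only [smul_eq_mul]
    ring

theorem isSymmetry_iff_red (hD : D.Regular) (h : Φ.Admissible D.I)
    (hF : ∀ s, ContDiffOn ℝ ∞ (F s) (D.Ω s)) :
    (∀ X ∈ (ParSub A C).map (pbF D Φ), IsSymmetry D F X) ↔
      ∀ s, ∀ x ∈ D.Ω s, Red A C s (mixF Φ F s) (newZ Φ s x) := by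
  constructor
  · intro H s x hx
    rw [← detEq_iff_red hD h (hF s) hx]
    intro m hm
    exact ((pbF_isAff hD h m).isSymmetry_iff hD).1 (H _ ⟨m, hm, rfl⟩) s x hx
  · rintro H _ ⟨m, hm, rfl⟩
    rw [(pbF_isAff hD h m).isSymmetry_iff hD]
    intro s x hx
    exact (detEq_iff_red hD h (hF s) hx).2 (H s x hx) m hm

theorem eventually_oldV_mem (hD : D.Regular) (h : Φ.Admissible D.I) {x : ℝ × (Fin 7 → ℝ)}
    (hx : x ∈ D.Ω s) : ∀ᶠ z in 𝓝 (newZ Φ s x), oldV Φ s z ∈ D.Ω s := by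
  have hxI : x.1 ∈ D.I := (hD.Ω_subset s _ hx).1
  refine (contDiffAt_oldV hD.isOpen_I h (z := newZ Φ s x) hxI).continuousAt ?_
  rw [oldV_newZ h hxI]
  exact (hD.isOpen_Ω s).mem_nhds hx

theorem eventually_red (hD : D.Regular) (h : Φ.Admissible D.I)
    (hF : ∀ s, ContDiffOn ℝ ∞ (F s) (D.Ω s))
    (H : ∀ s, ∀ x ∈ D.Ω s, Red A C s (mixF Φ F s) (newZ Φ s x)) {x : ℝ × (Fin 7 → ℝ)}
    (hx : x ∈ D.Ω s) : ∀ᶠ z in 𝓝 (newZ Φ s x),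
      ContDiffAt ℝ ∞ (mixF Φ F s) z ∧ Red A C s (mixF Φ F s) z := by
  filter_upwards [eventually_oldV_mem hD h hx] with z hz
  refine ⟨contDiffAt_mixF hD h (hF s) hz, ?_⟩
  have := H s _ hz
  rwa [newZ_oldV (z := z) h (hD.Ω_subset s _ hz).1] at this

theorem eventually_newF (hD : D.Regular) (h : Φ.Admissible D.I) {x : ℝ × (Fin 7 → ℝ)}
    (hx : x ∈ D.Ω s) {g : (Fin 7 → ℝ) → ℝ} (hg : ∀ᶠ z in 𝓝 (newZ Φ s x), mixF Φ F s z = g z.2) :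
    ∀ᶠ y in 𝓝 x, Φ.newF F s y = g (Φ.newV s y) := by
  have hxI : x.1 ∈ D.I := (hD.Ω_subset s _ hx).1
  filter_upwards [(contDiffAt_newZ hD.isOpen_I h hxI).continuousAt.eventually hg,
    (hD.isOpen_I.preimage continuous_fst).mem_nhds hxI] with y hy hyI
  rw [← mixF_newZ h hyI, hy]; rfl

theorem eventually_mixF (hD : D.Regular) (h : Φ.Admissible D.I) {x : ℝ × (Fin 7 → ℝ)}
    (hx : x ∈ D.Ω s) {g : (Fin 7 → ℝ) → ℝ} (hg : ∀ᶠ y in 𝓝 x, Φ.newF F s y = g (Φ.newV s y)) :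
    ∀ᶠ z in 𝓝 (newZ Φ s x), mixF Φ F s z = g z.2 := by
  have hxI : x.1 ∈ D.I := (hD.Ω_subset s _ hx).1
  have hc := (contDiffAt_oldV (s := s) hD.isOpen_I h (z := newZ Φ s x) hxI).continuousAt
  rw [ContinuousAt, oldV_newZ h hxI] at hc
  filter_upwards [hc.eventually hg, (hD.isOpen_I.preimage continuous_fst).mem_nhds hxI] with z hz hzI
  rw [mixF, hz]
  exact congrArg (fun w => g w.2) (newZ_oldV (s := s) h hzI)

end

/-! ### Integration along orbits -/

section
variable {G : ℝ × (Fin 7 → ℝ) → ℝ} {z₀ : ℝ × (Fin 7 → ℝ)} {ε : ℝ}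

theorem eq_exp_of_path {p v : ℝ → ℝ × (Fin 7 → ℝ)} {κ : ℝ}
    (hp : ∀ ρ ∈ Icc (0:ℝ) 1, HasDerivAt p (v ρ) ρ)
    (hG : ∀ ρ ∈ Icc (0:ℝ) 1, DifferentiableAt ℝ G (p ρ))
    (hd : ∀ ρ ∈ Icc (0:ℝ) 1, fderiv ℝ G (p ρ) (v ρ) = κ * G (p ρ)) :
    G (p 1) = Real.exp κ * G (p 0) := by
  have hder : ∀ ρ ∈ Icc (0:ℝ) 1, HasDerivAt (fun ρ => Real.exp (-κ * ρ) * G (p ρ)) 0 ρ := by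
    intro ρ hρ
    have h1 : HasDerivAt (fun ρ : ℝ => Real.exp (-κ * ρ)) (Real.exp (-κ * ρ) * -κ) ρ := by
      simpa using ((hasDerivAt_id ρ).const_mul (-κ)).exp
    refine (h1.mul ((hG ρ hρ).hasFDerivAt.comp_hasDerivAt ρ (hp ρ hρ))).congr_deriv ?_
    rw [hd ρ hρ]
    simp only [Function.comp]
    ring
  have := constant_of_has_deriv_right_zero (f := fun ρ => Real.exp (-κ * ρ) * G (p ρ)) (a := 0) (b := 1)
    (fun ρ hρ => (hder ρ hρ).continuousAt.continuousWithinAt)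
    (fun ρ hρ => (hder ρ ⟨hρ.1, hρ.2.le⟩).hasDerivWithinAt) 1 ⟨zero_le_one, le_rfl⟩
  simp only [mul_one, mul_zero, Real.exp_zero, one_mul] at this
  rw [← this, ← mul_assoc, ← Real.exp_add]
  simp

theorem mem_ball_iff {z : ℝ × (Fin 7 → ℝ)} (hε : 0 < ε) :
    z ∈ Metric.ball z₀ ε ↔ z.1 ∈ Metric.ball z₀.1 ε ∧ ∀ i, z.2 i ∈ Metric.ball (z₀.2 i) ε := by
  rw [← Prod.mk.eta (p := z₀), ← ball_prod_same, mem_prod, ball_pi _ hε]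
  simp [Set.mem_pi]

theorem time_invariant (hG : ∀ z ∈ Metric.ball z₀ ε, DifferentiableAt ℝ G z ∧ fderiv ℝ G z (1, 0) = 0)
    {t t' : ℝ} {w : Fin 7 → ℝ} (h1 : (t, w) ∈ Metric.ball z₀ ε) (h2 : (t', w) ∈ Metric.ball z₀ ε) :
    G (t', w) = G (t, w) := by
  have hmem : ∀ ρ ∈ Icc (0:ℝ) 1, (t + ρ * (t' - t), w) ∈ Metric.ball z₀ ε := by
    intro ρ hρ
    convert (convex_ball z₀ ε).add_smul_sub_mem h1 h2 hρ using 1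
    simp
  have := eq_exp_of_path (G := G) (p := fun ρ => (t + ρ * (t' - t), w)) (v := fun ρ => (t' - t, 0))
    (κ := 0) (fun ρ _ => ?_) (fun ρ hρ => (hG _ (hmem ρ hρ)).1) (fun ρ hρ => ?_)
  · simpa using this
  · refine HasDerivAt.prodMk ?_ (hasDerivAt_const _ _)
    simpa using ((hasDerivAt_id ρ).mul_const (t' - t)).const_add t
  · have : ((t' - t, 0) : ℝ × (Fin 7 → ℝ)) = (t' - t) • (1, 0) := by simp
    rw [this, map_smul, (hG _ (hmem ρ hρ)).2]
    simp

theorem trans_invariant {c : Fin 7 → ℝ}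
    (hG : ∀ z ∈ Metric.ball z₀ ε, DifferentiableAt ℝ G z ∧ fderiv ℝ G z (0, c) = 0)
    {t : ℝ} {w : Fin 7 → ℝ} (h1 : (t, w) ∈ Metric.ball z₀ ε) (h2 : (t, w + c) ∈ Metric.ball z₀ ε) :
    G (t, w + c) = G (t, w) := by
  have hmem : ∀ ρ ∈ Icc (0:ℝ) 1, (t, w + ρ • c) ∈ Metric.ball z₀ ε := by
    intro ρ hρ
    convert (convex_ball z₀ ε).add_smul_sub_mem h1 h2 hρ using 1
    simp
  have := eq_exp_of_path (G := G) (p := fun ρ => (t, w + ρ • c)) (v := fun ρ => (0, c))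
    (κ := 0) (fun ρ _ => ?_) (fun ρ hρ => (hG _ (hmem ρ hρ)).1) (fun ρ hρ => ?_)
  · simpa using this
  · refine HasDerivAt.prodMk (hasDerivAt_const _ _) ?_
    simpa using ((hasDerivAt_id ρ).smul_const c).const_add w
  · rw [(hG _ (hmem ρ hρ)).2]; simp

theorem mul_exp_mem_uIcc (x c ρ : ℝ) (hρ : ρ ∈ Icc (0:ℝ) 1) :
    x * Real.exp (ρ * c) ∈ uIcc x (x * Real.exp c) := by
  have key : Real.exp (ρ * c) ∈ uIcc 1 (Real.exp c) := by
    rw [mem_uIcc]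
    rcases le_total 0 c with hc | hc
    · left
      exact ⟨Real.one_le_exp (mul_nonneg hρ.1 hc), Real.exp_le_exp.2 (by nlinarith [hρ.2])⟩
    · right
      exact ⟨Real.exp_le_exp.2 (by nlinarith [hρ.2]), Real.exp_le_one_iff.2 (by nlinarith [hρ.1])⟩
  have := mem_image_of_mem (fun y => x * y) key
  rwa [image_const_mul_uIcc, mul_one] at this

/-- The orbit of a scaling is not a segment, but each coordinate stays between its two end values,
and a ball of the sup norm is a product of intervals. Hence the orbit stays in the ball. -/
theorem scale_equivariant {c : Fin 7 → ℝ} {κ : ℝ} (hε : 0 < ε)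
    (hG : ∀ z ∈ Metric.ball z₀ ε, DifferentiableAt ℝ G z ∧
      fderiv ℝ G z (0, fun i => c i * z.2 i) = κ * G z)
    {t : ℝ} {w : Fin 7 → ℝ} (h1 : (t, w) ∈ Metric.ball z₀ ε)
    (h2 : (t, fun i => w i * Real.exp (c i)) ∈ Metric.ball z₀ ε) :
    G (t, fun i => w i * Real.exp (c i)) = Real.exp κ * G (t, w) := by
  have hmem : ∀ ρ ∈ Icc (0:ℝ) 1, (t, fun i => w i * Real.exp (ρ * c i)) ∈ Metric.ball z₀ ε := by
    intro ρ hρ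
    rw [mem_ball_iff hε] at h1 h2 ⊢
    refine ⟨h1.1, fun i => ?_⟩
    have ho : (Metric.ball (z₀.2 i) ε).OrdConnected := by
      rw [Real.ball_eq_Ioo]; exact ordConnected_Ioo
    exact ho.uIcc_subset (h1.2 i) (h2.2 i) (mul_exp_mem_uIcc _ _ _ hρ)
  have := eq_exp_of_path (G := G) (p := fun ρ => (t, fun i => w i * Real.exp (ρ * c i)))
    (v := fun ρ => (0, fun i => c i * (w i * Real.exp (ρ * c i))))
    (κ := κ) (fun ρ _ => ?_) (fun ρ hρ => (hG _ (hmem ρ hρ)).1) (fun ρ hρ => (hG _ (hmem ρ hρ)).2)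
  · simpa using this
  · refine HasDerivAt.prodMk (hasDerivAt_const _ _) (hasDerivAt_pi.2 fun i => ?_)
    refine (((hasDerivAt_id ρ).mul_const (c i)).exp.const_mul (w i)).congr_deriv ?_
    simp; ring

/-- The infinitesimal form of equivariance, for the passage from the normal forms back to the
determining equations. -/
theorem scale_derivative {c : Fin 7 → ℝ} {κ : ℝ} (hG : DifferentiableAt ℝ G z₀)
    (h : ∀ᶠ ρ in 𝓝 (0:ℝ), G (z₀.1, fun i => z₀.2 i * Real.exp (ρ * c i)) = Real.exp (ρ * κ) * G z₀) :
    fderiv ℝ G z₀ (0, fun i => c i * z₀.2 i) = κ * G z₀ := by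
  have hp : HasDerivAt (fun ρ : ℝ => (z₀.1, fun i => z₀.2 i * Real.exp (ρ * c i)))
      (0, fun i => c i * z₀.2 i) 0 := by
    refine HasDerivAt.prodMk (hasDerivAt_const _ _) (hasDerivAt_pi.2 fun i => ?_)
    refine (((hasDerivAt_id (0:ℝ)).mul_const (c i)).exp.const_mul (z₀.2 i)).congr_deriv ?_
    simp; ring
  have hG' : HasFDerivAt G (fderiv ℝ G z₀) ((fun ρ : ℝ => (z₀.1, fun i => z₀.2 i * Real.exp (ρ * c i))) 0) := by
    simpa using hG.hasFDerivAt
  have h1 := hG'.comp_hasDerivAt (0:ℝ) hp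
  have h2 : HasDerivAt (fun ρ : ℝ => Real.exp (ρ * κ) * G z₀) (κ * G z₀) 0 := by
    simpa using (((hasDerivAt_id (0:ℝ)).mul_const κ).exp).mul_const (G z₀)
  exact h1.unique (h2.congr_of_eventuallyEq h)

theorem line_derivative {v : ℝ × (Fin 7 → ℝ)} (hG : DifferentiableAt ℝ G z₀)
    (h : ∀ᶠ ρ in 𝓝 (0:ℝ), G (z₀ + ρ • v) = G z₀) : fderiv ℝ G z₀ v = 0 := by
  have hp : HasDerivAt (fun ρ : ℝ => z₀ + ρ • v) v 0 := by
    simpa using ((hasDerivAt_id (0:ℝ)).smul_const v).const_add z₀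
  have hG' : HasFDerivAt G (fderiv ℝ G z₀) ((fun ρ : ℝ => z₀ + ρ • v) 0) := by
    simpa using hG.hasFDerivAt
  exact (hG'.comp_hasDerivAt (0:ℝ) hp).unique ((hasDerivAt_const _ _).congr_of_eventuallyEq h)

end

/-! ### The second class: invariants -/

section
variable {κ : Site → ℝ} {s : Site} {G : ℝ × (Fin 7 → ℝ) → ℝ} {z₀ : ℝ × (Fin 7 → ℝ)}

theorem det2_eq (κ : Site → ℝ) (s : Site) (v : Fin 7 → ℝ) (i : Fin 7) : det2 κ s v i =
    v 0 * (κ (s + nbr 1) - κ (s + nbr i)) - v 1 * (κ (s + nbr 0) - κ (s + nbr i))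
      + v i * (κ (s + nbr 0) - κ (s + nbr 1)) := by
  rw [det2, Matrix.det_fin_three]
  simp
  ring

theorem det2_smul (r : ℝ) (v : Fin 7 → ℝ) (i : Fin 7) : det2 κ s (r • v) i = r * det2 κ s v i := by
  simp only [det2_eq, Pi.smul_apply, smul_eq_mul]; ring

/-- A translation from the span of `1` and `κ` adds a combination of the other two rows to the first
row of the determinant. -/
theorem det2_add {c : Site → ℝ} (hc : c ∈ Submodule.span ℝ {1, κ}) (v : Fin 7 → ℝ) (i : Fin 7) :
    det2 κ s (v + fun i => c (s + nbr i)) i = det2 κ s v i := by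
  obtain ⟨α, β, rfl⟩ := Submodule.mem_span_pair.1 hc
  simp only [det2_eq, Pi.add_apply, Pi.smul_apply, Pi.one_apply, smul_eq_mul]; ring

theorem exists_ball {P : ℝ × (Fin 7 → ℝ) → Prop} (h : ∀ᶠ z in 𝓝 z₀, P z) :
    ∃ ε > 0, ∀ z ∈ Metric.ball z₀ ε, P z := Metric.eventually_nhds_iff_ball.1 h

theorem eventually_ball_fst {ε : ℝ} (hε : 0 < ε) :
    ∀ᶠ z : ℝ × (Fin 7 → ℝ) in 𝓝 z₀, (z₀.1, z.2) ∈ Metric.ball z₀ ε := by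
  have : ContinuousAt (fun z : ℝ × (Fin 7 → ℝ) => (z₀.1, z.2)) z₀ := by fun_prop
  exact this (Metric.ball_mem_nhds _ hε)

/-- The point on the slice through `v₀` with given invariants. -/
noncomputable def slice2 (κ : Site → ℝ) (s : Site) (v₀ : Fin 7 → ℝ) (ξ : Fin 4 → ℝ) : Fin 7 → ℝ :=
  fun i => (det2 κ s v₀ 2 * (Fin.append (m := 3) (n := 4) ![0, 0, 1] ξ) i
    - v₀ 0 * (κ (s + nbr 1) - κ (s + nbr i)) + v₀ 1 * (κ (s + nbr 0) - κ (s + nbr i)))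
      / (κ (s + nbr 0) - κ (s + nbr 1))

theorem contDiff_slice2 (κ : Site → ℝ) (s : Site) (v₀ : Fin 7 → ℝ) :
    ContDiff ℝ ∞ (slice2 κ s v₀) := by
  refine contDiff_pi.2 fun i => ?_
  unfold slice2
  refine ContDiff.div_const (ContDiff.add (ContDiff.sub (contDiff_const.mul ?_) contDiff_const)
    contDiff_const) _
  refine Fin.addCases (m := 3) (n := 4) (fun j => ?_) (fun j => ?_) i
  · simp only [Fin.append_left]; exact contDiff_const
  · simp only [Fin.append_right]; fun_prop

/-- The determinant with index `i` is linear in `v i` with the coefficient `κ_{nm} - κ_{n+1,m} ≠ 0`,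
so a point is determined by its first two values and its determinants. The ratios of the
determinants to the one with index `2` are `0, 0, 1` at the first three points and `ξ` at the
others. -/
theorem slice2_eq (hκ : κ (s + nbr 0) ≠ κ (s + nbr 1)) {v₀ v w : Fin 7 → ℝ}
    (hd : det2 κ s v 2 ≠ 0) (h0 : w 0 = v₀ 0) (h1 : w 1 = v₀ 1)
    (hw : ∀ i, det2 κ s w i = det2 κ s v₀ 2 / det2 κ s v 2 * det2 κ s v i) :
    slice2 κ s v₀ (xi2 κ s v) = w := by
  have hk := sub_ne_zero.2 hκ
  have hξ : ∀ i, det2 κ s v₀ 2 * (Fin.append (m := 3) (n := 4) ![0, 0, 1] (xi2 κ s v)) i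
      = det2 κ s w i := by
    intro i
    refine Fin.addCases (m := 3) (n := 4) (fun j => ?_) (fun j => ?_) i
    · rw [Fin.append_left]
      fin_cases j
      · simp [det2_eq]; ring
      · simp [det2_eq]
      · have := hw 2
        rw [div_mul_cancel₀ _ hd] at this
        simpa using this.symm
    · rw [Fin.append_right, hw, xi2]
      ring
  funext i
  rw [slice2, hξ i, div_eq_iff hk, det2_eq, h0, h1]
  ring

/-- The local form of the interaction in the second class. -/
theorem local_form2 (hκ : κ (s + nbr 0) ≠ κ (s + nbr 1)) {A : Submodule ℝ (Site → ℝ)}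
    (hG : ∀ᶠ z in 𝓝 z₀, ContDiffAt ℝ ∞ G z ∧ Red A (Submodule.span ℝ {1, κ}) s G z)
    (hd₀ : det2 κ s z₀.2 2 ≠ 0) :
    ∃ (f : (Fin 4 → ℝ) → ℝ) (O : Set (Fin 4 → ℝ)), IsOpen O ∧ xi2 κ s z₀.2 ∈ O ∧
      ContDiffOn ℝ ∞ f O ∧
      ∀ᶠ z in 𝓝 z₀, G z = (det2 κ s z.2 2 ^ 3)⁻¹ * f (xi2 κ s z.2) := by
  obtain ⟨ε, hε, hB⟩ := exists_ball hG
  have hdiff : ∀ z ∈ Metric.ball z₀ ε, DifferentiableAt ℝ G z := fun z hz =>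
    (hB z hz).1.differentiableAt (by simp)
  have hk := sub_ne_zero.2 hκ
  set σ : (Fin 4 → ℝ) → ℝ × (Fin 7 → ℝ) := fun ξ => (z₀.1, slice2 κ s z₀.2 ξ) with hσ
  have hσc : ContDiff ℝ ∞ σ := contDiff_const.prodMk (contDiff_slice2 κ s z₀.2)
  have hσ0 : σ (xi2 κ s z₀.2) = z₀ := by
    refine Prod.ext rfl (slice2_eq hκ hd₀ rfl rfl fun i => ?_)
    rw [div_self hd₀, one_mul]
  have hcd : ∀ i, Continuous fun z : ℝ × (Fin 7 → ℝ) => det2 κ s z.2 i := fun i => by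
    simp only [det2_eq]; fun_prop
  -- The determinant with index `2` is constant on the slice, so the claimed formula, read on the
  -- slice, leaves this choice of `f`.
  refine ⟨fun ξ => det2 κ s z₀.2 2 ^ 3 * G (σ ξ), σ ⁻¹' Metric.ball z₀ ε,
    Metric.isOpen_ball.preimage hσc.continuous, ?_, ?_, ?_⟩
  · rw [mem_preimage, hσ0]; exact Metric.mem_ball_self hε
  · intro ξ hξ
    exact (contDiffAt_const.mul ((hB _ hξ).1.comp ξ hσc.contDiffAt)).contDiffWithinAt
  -- the three moves: time, scaling, translation
  set k : ℝ × (Fin 7 → ℝ) → ℝ := fun z => det2 κ s z₀.2 2 / det2 κ s z.2 2 with hkdef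
  have hkc : ContinuousAt k z₀ := continuousAt_const.div (hcd 2).continuousAt hd₀
  have hk0 : k z₀ = 1 := div_self hd₀
  have hscale : ContinuousAt (fun z : ℝ × (Fin 7 → ℝ) => (z₀.1, k z • z.2)) z₀ :=
    continuousAt_const.prodMk (hkc.smul continuousAt_snd)
  have hslice : ContinuousAt (fun z : ℝ × (Fin 7 → ℝ) => σ (xi2 κ s z.2)) z₀ := by
    refine hσc.continuous.continuousAt.comp (continuousAt_pi.2 fun i => ?_)
    exact (hcd _).continuousAt.div (hcd 2).continuousAt hd₀
  have hs2 : ∀ᶠ z : ℝ × (Fin 7 → ℝ) in 𝓝 z₀, (z₀.1, k z • z.2) ∈ Metric.ball z₀ ε :=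
    hscale (by simp only [hk0, one_smul]; exact Metric.ball_mem_nhds _ hε)
  have hs3 : ∀ᶠ z : ℝ × (Fin 7 → ℝ) in 𝓝 z₀, σ (xi2 κ s z.2) ∈ Metric.ball z₀ ε :=
    hslice (by show Metric.ball z₀ ε ∈ 𝓝 (σ (xi2 κ s z₀.2)); rw [hσ0]; exact Metric.ball_mem_nhds _ hε)
  filter_upwards [Metric.ball_mem_nhds z₀ hε, eventually_ball_fst hε, (hcd 2).continuousAt.eventually_ne hd₀,
    hkc.eventually (lt_mem_nhds (hk0 ▸ one_pos)), hs2, hs3]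
    with z hz hz1 hd hkpos hz2 hz3
  have e1 : G (z₀.1, z.2) = G z := time_invariant (fun y hy => ⟨hdiff y hy, (hB y hy).2.time⟩) hz hz1
  -- The factor `k z` brings the determinant with index `2` to its value at `z₀`. It is close to
  -- `1`, hence positive and reached by the flow of the uniform scaling.
  have hexp : Real.exp (Real.log (k z)) = k z := Real.exp_log hkpos
  have hsm : (fun i => z.2 i * Real.exp (Real.log (k z))) = k z • z.2 := by
    funext i; rw [hexp, Pi.smul_apply, smul_eq_mul, mul_comm]
  have e2 := scale_equivariant (c := fun _ => Real.log (k z)) (κ := -3 * Real.log (k z)) hε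
    (fun y hy => ⟨hdiff y hy, by
      have : ((0, fun i => Real.log (k z) * y.2 i) : ℝ × (Fin 7 → ℝ)) = Real.log (k z) • (0, y.2) := by
        refine Prod.ext (by simp) (funext fun i => by simp)
      rw [this, map_smul, (hB y hy).2.euler, smul_eq_mul]; ring⟩) hz1 (by rw [hsm]; exact hz2)
  rw [hsm, e1] at e2
  have hexp3 : Real.exp (-3 * Real.log (k z)) = (k z ^ 3)⁻¹ := by
    rw [neg_mul, Real.exp_neg, mul_comm, Real.exp_mul, hexp]
    norm_cast
  rw [hexp3] at e2
  set w := k z • z.2 with hw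
  -- The two parameters of the translations bring the first two values to those of `z₀`; this needs
  -- `κ` to differ at the first two points.
  obtain ⟨c, hc, hc0, hc1⟩ : ∃ c ∈ Submodule.span ℝ {1, κ}, w 0 + c (s + nbr 0) = z₀.2 0 ∧
      w 1 + c (s + nbr 1) = z₀.2 1 := by
    set β := ((z₀.2 0 - w 0) - (z₀.2 1 - w 1)) / (κ (s + nbr 0) - κ (s + nbr 1)) with hβ
    have hβ' : β * (κ (s + nbr 0) - κ (s + nbr 1)) = (z₀.2 0 - w 0) - (z₀.2 1 - w 1) :=
      div_mul_cancel₀ _ hk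
    refine ⟨(z₀.2 0 - w 0 - β * κ (s + nbr 0)) • 1 + β • κ, Submodule.mem_span_pair.2 ⟨_, _, rfl⟩, ?_, ?_⟩
    · simp
    · simp only [Pi.add_apply, Pi.smul_apply, Pi.one_apply, smul_eq_mul]
      linear_combination -hβ'
  have hsl : slice2 κ s z₀.2 (xi2 κ s z.2) = w + fun i => c (s + nbr i) := by
    refine slice2_eq hκ hd hc0 hc1 fun i => ?_
    rw [det2_add hc, hw, det2_smul]
  have e3 := trans_invariant (fun y hy => ⟨hdiff y hy, (hB y hy).2.trans c hc⟩) hz2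
    (by rw [← hsl]; exact hz3)
  rw [← hsl, e2] at e3
  have hkne : k z ≠ 0 := hkpos.ne'
  have hz' : G (σ (xi2 κ s z.2)) = (k z ^ 3)⁻¹ * G z := e3
  rw [hz', hkdef]
  field_simp

theorem red_of_form2 {f : (Fin 4 → ℝ) → ℝ} (hG : DifferentiableAt ℝ G z₀)
    (h : ∀ᶠ z in 𝓝 z₀, G z = (det2 κ s z.2 2 ^ 3)⁻¹ * f (xi2 κ s z.2)) :
    Red ⊥ (Submodule.span ℝ {1, κ}) s G z₀ := by
  have hline : ∀ v : ℝ × (Fin 7 → ℝ), ∀ᶠ ρ in 𝓝 (0:ℝ), G (z₀ + ρ • v) =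
      (det2 κ s (z₀ + ρ • v).2 2 ^ 3)⁻¹ * f (xi2 κ s (z₀ + ρ • v).2) := fun v => by
    have : ContinuousAt (fun ρ : ℝ => z₀ + ρ • v) 0 := by fun_prop
    rw [ContinuousAt, zero_smul, add_zero] at this
    exact this.eventually h
  refine ⟨?_, ?_, ?_, ?_⟩
  · refine line_derivative hG ?_
    filter_upwards [hline (1, 0)] with ρ hρ
    rw [hρ, h.self_of_nhds]
    simp
  · have := scale_derivative (c := fun _ => 1) (κ := -3) hG ?_
    · simpa using this
    have hc : ContinuousAt (fun ρ : ℝ => (z₀.1, fun i => z₀.2 i * Real.exp (ρ * 1))) 0 := by fun_prop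
    rw [ContinuousAt] at hc
    simp only [Real.exp_zero, mul_one, Prod.mk.eta] at hc
    filter_upwards [hc.eventually h] with ρ hρ
    simp only [mul_one]
    have hsm : (fun i => z₀.2 i * Real.exp ρ) = Real.exp ρ • z₀.2 := by
      funext i; rw [Pi.smul_apply, smul_eq_mul, mul_comm]
    have he : Real.exp ρ ≠ 0 := (Real.exp_pos ρ).ne'
    have hx : xi2 κ s (Real.exp ρ • z₀.2) = xi2 κ s z₀.2 := by
      funext i
      rw [xi2, xi2, det2_smul, det2_smul, mul_div_mul_left _ _ he]
    have h3 : Real.exp (ρ * -3) = (Real.exp ρ ^ 3)⁻¹ := by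
      rw [mul_neg, Real.exp_neg, Real.exp_mul]; norm_cast
    rw [hρ, h.self_of_nhds, hsm, hx, h3, det2_smul, mul_pow, mul_inv]
    ring
  · intro a ha
    rw [Submodule.mem_bot] at ha
    simp only [ha, Pi.zero_apply, zero_mul]
    have : ((0, fun _ => 0) : ℝ × (Fin 7 → ℝ)) = 0 := rfl
    rw [this, map_zero]
  · intro c hc
    refine line_derivative hG ?_
    filter_upwards [hline (0, fun i => c (s + nbr i))] with ρ hρ
    rw [hρ, h.self_of_nhds]
    have hadd : ∀ i, det2 κ s (z₀ + ρ • ((0, fun i => c (s + nbr i)) : ℝ × (Fin 7 → ℝ))).2 i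
        = det2 κ s z₀.2 i := by
      intro i
      exact det2_add (c := ρ • c) (Submodule.smul_mem _ ρ hc) z₀.2 i
    have hx : xi2 κ s (z₀ + ρ • ((0, fun i => c (s + nbr i)) : ℝ × (Fin 7 → ℝ))).2 = xi2 κ s z₀.2 := by
      funext i; rw [xi2, xi2, hadd, hadd]
    rw [hx, hadd]

end

/-! ### The first class: invariants -/

section
variable {a : Fin 4 → Site → ℝ} {s : Site} {G : ℝ × (Fin 7 → ℝ) → ℝ} {z₀ : ℝ × (Fin 7 → ℝ)}

/-- The exponents of a scaling with coefficients `r` along `a⁽¹⁾, …, a⁽⁴⁾, 1`. -/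
def expo (a : Fin 4 → Site → ℝ) (r : Fin 5 → ℝ) (x : Site) : ℝ := ∑ k, r k * withOne a k x

theorem withOne_castSucc (a : Fin 4 → Site → ℝ) (k : Fin 4) : withOne a k.castSucc = a k :=
  Fin.snoc_castSucc (α := fun _ => Site → ℝ) _ _ k

theorem withOne_last (a : Fin 4 → Site → ℝ) : withOne a (Fin.last 4) = fun _ => 1 :=
  Fin.snoc_last (α := fun _ => Site → ℝ) _ _

theorem expo_eq (a : Fin 4 → Site → ℝ) (r : Fin 5 → ℝ) (x : Site) :
    expo a r x = (∑ k : Fin 4, r k.castSucc * a k x) + r (Fin.last 4) := by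
  rw [expo, Fin.sum_univ_castSucc]
  simp only [withOne_castSucc, withOne_last, mul_one]

/-- Expansion of a determinant with a repeated row. -/
theorem sum_latDet_eq_zero {N : ℕ} (f : Fin N → Site → ℝ) (p : Fin (N + 1) → Site) (k : Fin N) :
    ∑ j : Fin (N + 1), (-1) ^ (j : ℕ) * f k (p j) * latDet f (fun i => p (j.succAbove i)) = 0 := by
  have h := Matrix.det_succ_row_zero
    (Matrix.of (Fin.cons (fun j => f k (p j)) fun i j => f i (p j)) : Matrix (Fin (N + 1)) (Fin (N + 1)) ℝ)
  rw [Matrix.det_zero_of_row_eq (i := 0) (j := k.succ) (Fin.succ_ne_zero k).symm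
    (by funext j; simp)] at h
  rw [h]
  refine Finset.sum_congr rfl fun j _ => ?_
  simp only [Matrix.of_apply, Fin.cons_zero, latDet]
  congr 2

/-- Expansion along the row of ones. -/
theorem mainDet_expand (a : Fin 4 → Site → ℝ) (s : Site) : mainDet a s =
    ∑ j : Fin 5, (-1) ^ (j : ℕ) * latDet a (fun k => s + nbr (five (j.succAbove k))) := by
  rw [mainDet, latDet, Matrix.det_succ_row _ (Fin.last 4)]
  refine Finset.sum_congr rfl fun j _ => ?_
  simp only [Matrix.of_apply, withOne_last, mul_one, latDet, Fin.val_last]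
  have h1 : ((-1:ℝ)) ^ (4 + (j : ℕ)) = (-1) ^ (j : ℕ) := by rw [pow_add]; norm_num
  rw [h1]
  congr 2
  ext i k
  show withOne a ((Fin.last 4).succAbove i) _ = _
  rw [Fin.succAbove_last, withOne_castSucc]
  rfl

/-- The logarithm of an invariant is a determinant with first row `log |u|` above `a⁽¹⁾, …, a⁽⁴⁾,
1`. A scaling adds to the first row a combination of the others. -/
theorem sum_exponents_xi (r : Fin 5 → ℝ) (i : Fin 2) :
    ∑ j : Fin 6, expo a r (s + nbr (six i j)) * ((-1) ^ (j : ℕ) *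
      latDet (withOne a) (fun k => s + nbr (six i (j.succAbove k)))) = 0 := by
  have : ∀ k, ∑ j : Fin 6, (-1) ^ (j : ℕ) * withOne a k (s + nbr (six i j)) *
      latDet (withOne a) (fun k => s + nbr (six i (j.succAbove k))) = 0 := fun k =>
    sum_latDet_eq_zero (withOne a) (fun j => s + nbr (six i j)) k
  simp only [expo, Finset.sum_mul]
  rw [Finset.sum_comm]
  refine Finset.sum_eq_zero fun k _ => ?_
  rw [← mul_zero (r k), ← this k, Finset.mul_sum]
  exact Finset.sum_congr rfl fun j _ => by ring

/-- The contribution of each `a⁽ᵏ⁾` is a determinant with a repeated row. The constant function is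
not among the rows, and its contribution is the expansion of `Δ` along the row of ones. -/
theorem sum_exponents_factor (r : Fin 5 → ℝ) :
    ∑ j : Fin 5, expo a r (s + nbr (five j)) * ((-1) ^ ((j : ℕ) + 1) *
      latDet a (fun k => s + nbr (five (j.succAbove k)))) = -r (Fin.last 4) * mainDet a s := by
  have : ∀ k, ∑ j : Fin 5, (-1) ^ (j : ℕ) * a k (s + nbr (five j)) *
      latDet a (fun k => s + nbr (five (j.succAbove k))) = 0 := fun k =>
    sum_latDet_eq_zero a (fun j => s + nbr (five j)) k
  simp only [expo_eq, add_mul, Finset.sum_add_distrib, Finset.sum_mul]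
  rw [Finset.sum_comm, Finset.sum_eq_zero, zero_add, mainDet_expand, Finset.mul_sum]
  · exact Finset.sum_congr rfl fun j _ => by rw [pow_succ]; ring
  · intro k _
    rw [← mul_zero (-r k.castSucc), ← this k, Finset.mul_sum]
    exact Finset.sum_congr rfl fun j _ => by rw [pow_succ]; ring

theorem prod_scale {ι : Type*} (S : Finset ι) (v e p : ι → ℝ) :
    ∏ j ∈ S, |v j * Real.exp (e j)| ^ p j = Real.exp (∑ j ∈ S, e j * p j) * ∏ j ∈ S, |v j| ^ p j := by
  rw [Real.exp_sum, ← Finset.prod_mul_distrib]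
  refine Finset.prod_congr rfl fun j _ => ?_
  rw [abs_mul, Real.abs_exp, Real.mul_rpow (abs_nonneg _) (Real.exp_pos _).le, ← Real.exp_mul]
  ring

theorem xi1_scale (r : Fin 5 → ℝ) (v : Fin 7 → ℝ) :
    xi1 a s (fun i => v i * Real.exp (expo a r (s + nbr i))) = xi1 a s v := by
  funext i
  rw [xi1, xi1, prod_scale Finset.univ (fun j : Fin 6 => v (six i j)), sum_exponents_xi,
    Real.exp_zero, one_mul]

/-- The value at the centre contributes the exponent at `s`, and the bracket raised to `4 / Δ`
contributes `-4 r`, where `r` belongs to the uniform scaling. For a pure uniform scaling this is `r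
- 4 r = -3 r`, the required weight. -/
theorem factor1_scale (hΔ : mainDet a s ≠ 0) (r : Fin 5 → ℝ) (v : Fin 7 → ℝ) :
    factor1 a s (fun i => v i * Real.exp (expo a r (s + nbr i))) =
      Real.exp (expo a r s - 4 * r (Fin.last 4)) * factor1 a s v := by
  have h0 : s + nbr 0 = s := by simp [nbr_zero]
  rw [factor1, factor1, prod_scale Finset.univ (fun j : Fin 5 => v (five j)), sum_exponents_factor,
    Real.mul_rpow (Real.exp_pos _).le (Finset.prod_nonneg fun j _ => Real.rpow_nonneg (abs_nonneg _) _),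
    ← Real.exp_mul, h0, sub_eq_add_neg, Real.exp_add]
  have : -r (Fin.last 4) * mainDet a s * (4 / mainDet a s) = -(4 * r (Fin.last 4)) := by
    field_simp
  rw [this]
  ring

theorem factor1_congr {v w : Fin 7 → ℝ} (h : ∀ j : Fin 5, v (five j) = w (five j)) :
    factor1 a s v = factor1 a s w := by
  have h0 : v 0 = w 0 := h 0
  rw [factor1, factor1, h0]
  simp only [h]

theorem factor1_ne_zero {v : Fin 7 → ℝ} (h : ∀ i, v i ≠ 0) : factor1 a s v ≠ 0 := by
  refine mul_ne_zero (h 0) (Real.rpow_pos_of_pos ?_ _).ne'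
  exact Finset.prod_pos fun j _ => Real.rpow_pos_of_pos (abs_pos.2 (h _)) _

theorem xi1_pos {v : Fin 7 → ℝ} (h : ∀ i, v i ≠ 0) (i : Fin 2) : 0 < xi1 a s v i :=
  Finset.prod_pos fun _ _ => Real.rpow_pos_of_pos (abs_pos.2 (h _)) _

theorem six_castSucc (i : Fin 2) (j : Fin 5) : six i j.castSucc = five j :=
  Fin.snoc_castSucc (α := fun _ => Fin 7) _ _ j

theorem six_last (i : Fin 2) : six i (Fin.last 5) = Fin.natAdd 5 i :=
  Fin.snoc_last (α := fun _ => Fin 7) _ _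

theorem xi1_eq (v : Fin 7 → ℝ) (i : Fin 2) : xi1 a s v i =
    (∏ j : Fin 5, |v (five j)| ^ ((-1) ^ (j : ℕ) *
      latDet (withOne a) (fun k => s + nbr (six i (j.castSucc.succAbove k)))))
      * |v (Fin.natAdd 5 i)| ^ (-mainDet a s) := by
  rw [xi1, Fin.prod_univ_castSucc]
  simp only [six_castSucc, six_last, Fin.val_castSucc, Fin.val_last, Fin.succAbove_last]
  congr 2
  rw [mainDet]
  ring

/-- The derivative along a scaling. -/
theorem Red.expo {A C : Submodule ℝ (Site → ℝ)} (hA : ∀ k, a k ∈ A) {z : ℝ × (Fin 7 → ℝ)}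
    (h : Red A C s G z) (r : Fin 5 → ℝ) :
    fderiv ℝ G z (0, fun i => expo a r (s + nbr i) * z.2 i) =
      (expo a r s - 4 * r (Fin.last 4)) * G z := by
  have hv : ((0, fun i => TriLattice.expo a r (s + nbr i) * z.2 i) : ℝ × (Fin 7 → ℝ)) =
      (∑ k : Fin 4, r k.castSucc • ((0, fun i => a k (s + nbr i) * z.2 i) : ℝ × (Fin 7 → ℝ)))
        + r (Fin.last 4) • (0, z.2) := by
    refine Prod.ext ?_ (funext fun i => ?_)
    · simp [Prod.fst_sum]
    · simp [Prod.snd_sum, expo_eq, add_mul, Finset.sum_mul, Finset.sum_apply, mul_assoc]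
  rw [hv, map_add, map_sum, map_smul, h.euler, expo_eq]
  simp only [map_smul, h.scal _ (hA _), smul_eq_mul]
  rw [add_sub_assoc, add_mul, Finset.sum_mul]
  congr 1
  · exact Finset.sum_congr rfl fun k _ => by ring
  · ring

/-- The point on the slice through `v₀` with given invariants. -/
noncomputable def slice1 (a : Fin 4 → Site → ℝ) (s : Site) (v₀ : Fin 7 → ℝ) (ξ : Fin 2 → ℝ) :
    Fin 7 → ℝ :=
  Fin.append (m := 5) (n := 2) (fun j => v₀ (five j))
    (fun i => v₀ (Fin.natAdd 5 i) * (ξ i / xi1 a s v₀ i) ^ (-(mainDet a s)⁻¹))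

/-- With the first five values fixed, each invariant depends on one further value, through the power
`-Δ` of its modulus. Inverting this power recovers the value because its sign is known. -/
theorem slice1_eq (hΔ : mainDet a s ≠ 0) {v₀ w : Fin 7 → ℝ} (hv₀ : ∀ i, v₀ i ≠ 0)
    (h5 : ∀ j : Fin 5, w (five j) = v₀ (five j)) (hpos : ∀ i, 0 < w i / v₀ i) :
    slice1 a s v₀ (xi1 a s w) = w := by
  funext i
  refine Fin.addCases (m := 5) (n := 2) (fun j => ?_) (fun j => ?_) i
  · rw [slice1, Fin.append_left]; exact (h5 j).symm
  · rw [slice1, Fin.append_right]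
    have hr := hpos (Fin.natAdd 5 j)
    have hv := hv₀ (Fin.natAdd 5 j)
    have hξ : xi1 a s w j / xi1 a s v₀ j = (w (Fin.natAdd 5 j) / v₀ (Fin.natAdd 5 j)) ^ (-mainDet a s) := by
      rw [← abs_of_pos hr, abs_div, Real.div_rpow (abs_nonneg _) (abs_nonneg _), xi1_eq, xi1_eq]
      simp only [h5]
      rw [mul_div_mul_left]
      exact (Finset.prod_pos fun j _ => Real.rpow_pos_of_pos (abs_pos.2 (hv₀ _)) _).ne'
    rw [hξ, ← Real.rpow_mul hr.le]
    have : -mainDet a s * -(mainDet a s)⁻¹ = 1 := by field_simp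
    rw [this, Real.rpow_one]
    field_simp

/-- Since `Δ ≠ 0`, the scalings by `a⁽¹⁾, …, a⁽⁴⁾, 1` have arbitrary exponents at the first five
points. -/
theorem exists_expo (hΔ : mainDet a s ≠ 0) (b : Fin 5 → ℝ) :
    ∀ j, expo a (Matrix.vecMul b (Matrix.of fun k j => withOne a k (s + nbr (five j)))⁻¹)
      (s + nbr (five j)) = b j := by
  intro j
  set M : Matrix (Fin 5) (Fin 5) ℝ := Matrix.of fun k j => withOne a k (s + nbr (five j)) with hM
  have hu : IsUnit M.det := isUnit_iff_ne_zero.2 hΔ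
  have : Matrix.vecMul (Matrix.vecMul b M⁻¹) M = b := by
    rw [Matrix.vecMul_vecMul, Matrix.nonsing_inv_mul _ hu, Matrix.vecMul_one]
  exact congrFun this j

/-- The local form of the interaction in the first class. -/
theorem local_form1 (hΔ : mainDet a s ≠ 0) {A C : Submodule ℝ (Site → ℝ)} (hA : ∀ k, a k ∈ A)
    (hG : ∀ᶠ z in 𝓝 z₀, ContDiffAt ℝ ∞ G z ∧ Red A C s G z) (hz₀ : ∀ i, z₀.2 i ≠ 0) :
    ∃ (f : (Fin 2 → ℝ) → ℝ) (O : Set (Fin 2 → ℝ)), IsOpen O ∧ xi1 a s z₀.2 ∈ O ∧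
      ContDiffOn ℝ ∞ f O ∧
      ∀ᶠ z in 𝓝 z₀, G z = factor1 a s z.2 * f (xi1 a s z.2) := by
  obtain ⟨ε, hε, hB⟩ := exists_ball hG
  have hdiff : ∀ z ∈ Metric.ball z₀ ε, DifferentiableAt ℝ G z := fun z hz =>
    (hB z hz).1.differentiableAt (by simp)
  set σ : (Fin 2 → ℝ) → ℝ × (Fin 7 → ℝ) := fun ξ => (z₀.1, slice1 a s z₀.2 ξ) with hσ
  set O₀ : Set (Fin 2 → ℝ) := {ξ | ∀ i, 0 < ξ i} with hO₀
  have hO₀o : IsOpen O₀ := by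
    simp only [hO₀, Set.ofPred_forall]
    exact isOpen_iInter_of_finite fun i => isOpen_lt continuous_const (continuous_apply i)
  have hσc : ContDiffOn ℝ ∞ σ O₀ := by
    refine contDiffOn_const.prodMk (contDiffOn_pi.2 fun i => ?_)
    refine Fin.addCases (m := 5) (n := 2) (fun j => ?_) (fun j => ?_) i
    · simp only [slice1, Fin.append_left]; exact contDiffOn_const
    · simp only [slice1, Fin.append_right]
      refine contDiffOn_const.mul (ContDiffOn.rpow_const_of_ne (ContDiffOn.div_const (by fun_prop) _)
        fun ξ hξ => ?_)
      exact (div_pos (hξ j) (xi1_pos hz₀ j)).ne'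
  have hσ0 : σ (xi1 a s z₀.2) = z₀ := Prod.ext rfl (slice1_eq hΔ hz₀ (fun _ => rfl) fun i => by
    rw [div_self (hz₀ i)]; exact one_pos)
  -- The factor depends on the first five values only and is therefore constant on the slice.
  refine ⟨fun ξ => G (σ ξ) / factor1 a s z₀.2, O₀ ∩ σ ⁻¹' Metric.ball z₀ ε,
    hσc.continuousOn.isOpen_inter_preimage hO₀o Metric.isOpen_ball, ⟨fun i => xi1_pos hz₀ i, ?_⟩, ?_, ?_⟩
  · rw [mem_preimage, hσ0]; exact Metric.mem_ball_self hε
  · intro ξ hξ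
    exact (((hB _ hξ.2).1.comp ξ (hσc.contDiffAt (hO₀o.mem_nhds hξ.1))).div_const _).contDiffWithinAt
  -- The parameters of the scaling that carries the first five values of `w` to those of `z₀`; the
  -- logarithms make sense because the signs agree near `z₀`.
  set r : (Fin 7 → ℝ) → Fin 5 → ℝ := fun w => Matrix.vecMul (fun j => Real.log (z₀.2 (five j) / w (five j)))
    (Matrix.of fun k j => withOne a k (s + nbr (five j)))⁻¹ with hr
  set w' : (Fin 7 → ℝ) → Fin 7 → ℝ := fun w i => w i * Real.exp (expo a (r w) (s + nbr i)) with hw'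
  have hr0 : r z₀.2 = 0 := by
    have : (fun j => Real.log (z₀.2 (five j) / z₀.2 (five j))) = (0 : Fin 5 → ℝ) := by
      funext j; rw [div_self (hz₀ _), Real.log_one]; rfl
    rw [hr]
    simp only [this, Matrix.zero_vecMul]
  have hw0 : w' z₀.2 = z₀.2 := by
    funext i; simp [hw', hr0, expo]
  have hrc : ∀ k, ContinuousAt (fun z : ℝ × (Fin 7 → ℝ) => r z.2 k) z₀ := by
    intro k
    simp only [hr, Matrix.vecMul, dotProduct]
    refine tendsto_finsetSum _ fun j _ => Tendsto.mul ?_ tendsto_const_nhds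
    refine ContinuousAt.log (continuousAt_const.div (by fun_prop) (hz₀ _)) ?_
    rw [div_self (hz₀ _)]; exact one_ne_zero
  have hwc : ContinuousAt (fun z : ℝ × (Fin 7 → ℝ) => w' z.2) z₀ := by
    refine continuousAt_pi.2 fun i => ContinuousAt.mul (by fun_prop) (Real.continuous_exp.continuousAt.comp ?_)
    simp only [expo]
    exact tendsto_finsetSum _ fun k _ => Tendsto.mul (hrc k) tendsto_const_nhds
  have hwc' : ContinuousAt (fun z : ℝ × (Fin 7 → ℝ) => (z₀.1, w' z.2)) z₀ := continuousAt_const.prodMk hwc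
  have hsgn : ∀ i, ∀ᶠ z : ℝ × (Fin 7 → ℝ) in 𝓝 z₀, 0 < z.2 i / z₀.2 i := fun i => by
    have hc : ContinuousAt (fun z : ℝ × (Fin 7 → ℝ) => z.2 i / z₀.2 i) z₀ := by fun_prop
    refine hc.eventually (lt_mem_nhds ?_)
    show 0 < z₀.2 i / z₀.2 i
    rw [div_self (hz₀ i)]; exact one_pos
  have hs2 : ∀ᶠ z : ℝ × (Fin 7 → ℝ) in 𝓝 z₀, (z₀.1, w' z.2) ∈ Metric.ball z₀ ε :=
    hwc' (by simp only [hw0]; exact Metric.ball_mem_nhds _ hε)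
  filter_upwards [Metric.ball_mem_nhds z₀ hε, eventually_ball_fst hε, eventually_all.2 hsgn, hs2]
    with z hz hz1 hpos hz2
  have e1 : G (z₀.1, z.2) = G z := time_invariant (fun y hy => ⟨hdiff y hy, (hB y hy).2.time⟩) hz hz1
  have e2 := scale_equivariant hε (fun y hy => ⟨hdiff y hy, (hB y hy).2.expo hA (r z.2)⟩) hz1 hz2
  have h5 : ∀ j : Fin 5, w' z.2 (five j) = z₀.2 (five j) := by
    intro j
    have hp := hpos (five j)
    have hp' : 0 < z₀.2 (five j) / z.2 (five j) := by
      rw [← inv_div]; exact inv_pos.2 hp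
    have hzj : z.2 (five j) ≠ 0 := fun h0 => by rw [h0, zero_div] at hp; exact lt_irrefl _ hp
    simp only [hw', hr]
    rw [exists_expo hΔ, Real.exp_log hp']
    field_simp
  have hxi : xi1 a s (w' z.2) = xi1 a s z.2 := xi1_scale _ _
  have hfac := factor1_scale hΔ (r z.2) z.2
  have hsl : slice1 a s z₀.2 (xi1 a s z.2) = w' z.2 := by
    rw [← hxi]
    refine slice1_eq hΔ hz₀ h5 fun i => ?_
    rw [hw', mul_div_right_comm]
    exact mul_pos (hpos i) (Real.exp_pos _)
  have hfz : factor1 a s z₀.2 = Real.exp (expo a (r z.2) s - 4 * r z.2 (Fin.last 4)) * factor1 a s z.2 := by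
    rw [← hfac]
    exact factor1_congr fun j => (h5 j).symm
  have hσz : G (σ (xi1 a s z.2)) = Real.exp (expo a (r z.2) s - 4 * r z.2 (Fin.last 4)) * G z := by
    rw [← e1, ← e2, hσ]
    simp only [hsl]; rfl
  have hne := factor1_ne_zero (a := a) (s := s) hz₀
  have he := (Real.exp_pos (expo a (r z.2) s - 4 * r z.2 (Fin.last 4))).ne'
  rw [hσz, hfz]
  have hfz' : factor1 a s z.2 ≠ 0 := fun h0 => hne (by rw [hfz, h0, mul_zero])
  field_simp

theorem red_of_form1 (hΔ : mainDet a s ≠ 0) {f : (Fin 2 → ℝ) → ℝ} (hG : DifferentiableAt ℝ G z₀)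
    (h : ∀ᶠ z in 𝓝 z₀, G z = factor1 a s z.2 * f (xi1 a s z.2)) :
    Red (Submodule.span ℝ (range a)) ⊥ s G z₀ := by
  have key : ∀ r : Fin 5 → ℝ, fderiv ℝ G z₀ (0, fun i => expo a r (s + nbr i) * z₀.2 i) =
      (expo a r s - 4 * r (Fin.last 4)) * G z₀ := by
    intro r
    refine scale_derivative hG ?_
    have hc : ContinuousAt (fun ρ : ℝ => (z₀.1, fun i => z₀.2 i * Real.exp (ρ * expo a r (s + nbr i)))) 0 := by
      fun_prop
    rw [ContinuousAt] at hc
    simp only [zero_mul, Real.exp_zero, mul_one, Prod.mk.eta] at hc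
    filter_upwards [hc.eventually h] with ρ hρ
    have hexpo : ∀ x, ρ * expo a r x = expo a (ρ • r) x := fun x => by
      simp [expo, Finset.mul_sum, mul_assoc]
    simp only [hexpo] at hρ ⊢
    rw [hρ, h.self_of_nhds, xi1_scale, factor1_scale hΔ, mul_sub, hexpo, Pi.smul_apply, smul_eq_mul]
    ring_nf
  refine ⟨?_, ?_, ?_, ?_⟩
  · refine line_derivative hG ?_
    have : ContinuousAt (fun ρ : ℝ => z₀ + ρ • ((1, 0) : ℝ × (Fin 7 → ℝ))) 0 := by fun_prop
    rw [ContinuousAt, zero_smul, add_zero] at this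
    filter_upwards [this.eventually h] with ρ hρ
    rw [hρ, h.self_of_nhds]
    simp
  · have := key (Pi.single (Fin.last 4) 1)
    simp only [expo_eq, Pi.single_eq_same, Pi.single_eq_of_ne (Fin.castSucc_lt_last _).ne] at this
    norm_num at this
    simpa using this
  · intro c hc
    obtain ⟨r, rfl⟩ := (Submodule.mem_span_range_iff_exists_fun ℝ).1 hc
    have := key (Fin.snoc (α := fun _ => ℝ) r 0)
    simp only [expo_eq, Fin.snoc_castSucc, Fin.snoc_last, add_zero, mul_zero, sub_zero] at this
    simpa [Finset.sum_apply] using this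
  · intro c hc
    rw [Submodule.mem_bot] at hc
    simp only [hc, Pi.zero_apply]
    have : ((0, fun _ => 0) : ℝ × (Fin 7 → ℝ)) = 0 := rfl
    rw [this, map_zero]

end

/-! ### Members of the two classes have the stated algebras -/

section
variable {G : ℝ × (Fin 7 → ℝ) → ℝ} {z₀ : ℝ × (Fin 7 → ℝ)} {s : Site} {A C : Submodule ℝ (Site → ℝ)}

theorem eq_of_frequently {X Y : Type*} [TopologicalSpace X] [TopologicalSpace Y] [T2Space Y]
    {f g : X → Y} {x : X} (hf : ContinuousAt f x) (hg : ContinuousAt g x)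
    (h : ∃ᶠ y in 𝓝 x, f y = g y) : f x = g x := by
  by_contra hne
  exact h ((hf.prodMk hg).eventually ((isClosed_diagonal.isOpen_compl.mem_nhds hne)))

theorem red_of_frequently (hG : ContDiffAt ℝ ∞ G z₀) (h : ∃ᶠ z in 𝓝 z₀, Red A C s G z) :
    Red A C s G z₀ := by
  have hd : ContinuousAt (fderiv ℝ G) z₀ := (hG.fderiv_right (m := ∞) (by simp)).continuousAt
  have hc := hG.continuousAt
  refine ⟨eq_of_frequently (hd.clm_apply continuousAt_const) continuousAt_const (h.mono fun z hz => hz.time),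
    eq_of_frequently (g := fun z => -3 * G z) (hd.clm_apply (by fun_prop)) (continuousAt_const.mul hc)
      (h.mono fun z hz => hz.euler),
    fun a ha => eq_of_frequently (g := fun z => a s * G z)
      (f := fun z => fderiv ℝ G z (0, fun i => a (s + nbr i) * z.2 i)) (hd.clm_apply (by fun_prop))
      (continuousAt_const.mul hc) (h.mono fun z hz => hz.scal a ha),
    fun c hc => eq_of_frequently (hd.clm_apply continuousAt_const) continuousAt_const
      (h.mono fun z hz => hz.trans c hc)⟩

theorem frequently_of_line {p : ℝ × (Fin 7 → ℝ) → Prop} (v : ℝ × (Fin 7 → ℝ))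
    (h : ∀ᶠ ρ in 𝓝[≠] (0:ℝ), p (z₀ + ρ • v)) : ∃ᶠ z in 𝓝 z₀, p z := by
  have hc : Tendsto (fun ρ : ℝ => z₀ + ρ • v) (𝓝[≠] 0) (𝓝 z₀) := by
    have : ContinuousAt (fun ρ : ℝ => z₀ + ρ • v) 0 := by fun_prop
    rw [ContinuousAt, zero_smul, add_zero] at this
    exact this.mono_left nhdsWithin_le_nhds
  exact hc.frequently h.frequently

theorem eventually_add_mul_ne {x y : ℝ} (hy : y ≠ 0) : ∀ᶠ ρ in 𝓝[≠] (0:ℝ), x + ρ * y ≠ 0 := by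
  by_cases hx : x = 0
  · filter_upwards [self_mem_nhdsWithin] with ρ hρ
    rw [hx, zero_add]
    exact mul_ne_zero hρ hy
  · have : ContinuousAt (fun ρ : ℝ => x + ρ * y) 0 := by fun_prop
    exact (this.eventually_ne (by simpa using hx)).filter_mono nhdsWithin_le_nhds

end

/-! ### Algebra and radical of each class; the classes are disjoint -/

section
variable {D : LatticeDomain} {F : Site → ℝ × (Fin 7 → ℝ) → ℝ} {L : Submodule ℝ LatticeField}
  {Φ : AllowedMap} {a : Fin 4 → Site → ℝ} {κ : Site → ℝ} {A C : Submodule ℝ (Site → ℝ)}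

/-- The normal form is only assumed at good points. The equations of the reduced system equate
continuous functions, so they hold wherever good points accumulate. -/
theorem red_of_frequently_good (hD : D.Regular) (h : Φ.Admissible D.I)
    (hF : ∀ s, ContDiffOn ℝ ∞ (F s) (D.Ω s)) {s : Site} {good : (Fin 7 → ℝ) → Prop}
    (H : ∀ x ∈ D.Ω s, good (Φ.newV s x) → Red A C s (mixF Φ F s) (newZ Φ s x))
    {x : ℝ × (Fin 7 → ℝ)} (hx : x ∈ D.Ω s) (hf : ∃ᶠ z in 𝓝 (newZ Φ s x), good z.2) :
    Red A C s (mixF Φ F s) (newZ Φ s x) := by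
  have hx' : oldV Φ s (newZ Φ s x) ∈ D.Ω s := by rwa [oldV_newZ h (hD.Ω_subset s x hx).1]
  refine red_of_frequently (contDiffAt_mixF hD h (hF s) hx') ?_
  refine (hf.and_eventually (eventually_oldV_mem hD h hx)).mono fun z hz => ?_
  have hzz : newZ Φ s (oldV Φ s z) = z := newZ_oldV h (hD.Ω_subset s _ hz.2).1
  have := H _ hz.2 (by
    show good (newZ Φ s (oldV Φ s z)).2
    rw [hzz]
    exact hz.1)
  rwa [hzz] at this

theorem ClassOne.red (hc : ClassOne D F L Φ a) (hD : D.Regular)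
    (hF : ∀ s, ContDiffOn ℝ ∞ (F s) (D.Ω s)) (s : Site) (x) (hx : x ∈ D.Ω s) :
    Red (Submodule.span ℝ (range a)) ⊥ s (mixF Φ F s) (newZ Φ s x) := by
  have h := hc.admissible
  -- Along the direction `(0, 1)` all seven values move at once, and none is zero for small nonzero
  -- parameters.
  refine red_of_frequently_good hD h hF (good := fun v => ∀ i, v i ≠ 0) (fun y hy hg => ?_) hx
    (frequently_of_line (p := fun z => ∀ i, z.2 i ≠ 0) (0, 1) ?_)
  · obtain ⟨f, O, -, -, -, hf⟩ := hc.form s y hy hg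
    have hy' : oldV Φ s (newZ Φ s y) ∈ D.Ω s := by rwa [oldV_newZ h (hD.Ω_subset s y hy).1]
    exact red_of_form1 (hc.det_ne s) ((contDiffAt_mixF hD h (hF s) hy').differentiableAt (by simp))
      (eventually_mixF (g := fun v => factor1 a s v * f (xi1 a s v)) hD h hy hf)
  · refine eventually_all.2 fun i => ?_
    simpa using eventually_add_mul_ne (x := (newZ Φ s x).2 i) one_ne_zero

theorem ClassTwo.red (hc : ClassTwo D F L Φ κ) (hD : D.Regular)
    (hF : ∀ s, ContDiffOn ℝ ∞ (F s) (D.Ω s)) (s : Site) (x) (hx : x ∈ D.Ω s) :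
    Red ⊥ (Submodule.span ℝ {1, κ}) s (mixF Φ F s) (newZ Φ s x) := by
  have h := hc.admissible
  refine red_of_frequently_good hD h hF (good := fun v => det2 κ s v 2 ≠ 0) (fun y hy hg => ?_) hx
    (frequently_of_line (p := fun z => det2 κ s z.2 2 ≠ 0) (0, Pi.single 2 1) ?_)
  · obtain ⟨f, O, -, -, -, hf⟩ := hc.form s y hy hg
    have hy' : oldV Φ s (newZ Φ s y) ∈ D.Ω s := by rwa [oldV_newZ h (hD.Ω_subset s y hy).1]
    exact red_of_form2 ((contDiffAt_mixF hD h (hF s) hy').differentiableAt (by simp))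
      (eventually_mixF (g := fun v => (det2 κ s v 2 ^ 3)⁻¹ * f (xi2 κ s v)) hD h hy hf)
  · have hk : κ (s + nbr 0) - κ (s + nbr 1) ≠ 0 := by
      rw [nbr_zero, add_zero]
      exact sub_ne_zero.2 (hc.ne_n s)
    filter_upwards [eventually_add_mul_ne (x := det2 κ s (newZ Φ s x).2 2) hk] with ρ hρ
    convert hρ using 1
    simp only [det2_eq, Prod.snd_add, Prod.smul_snd, Pi.add_apply, Pi.smul_apply, smul_eq_mul,
      Pi.single_eq_same, Pi.single_eq_of_ne (show (0 : Fin 7) ≠ 2 by decide),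
      Pi.single_eq_of_ne (show (1 : Fin 7) ≠ 2 by decide)]
    ring

theorem isNonsolvableSeven_of_red (hD : D.Regular) (h : Φ.Admissible D.I)
    (hF : ∀ s, ContDiffOn ℝ ∞ (F s) (D.Ω s))
    (hred : ∀ s, ∀ x ∈ D.Ω s, Red A C s (mixF Φ F s) (newZ Φ s x))
    (hAC : ∀ a ∈ A, ∀ c ∈ C, a * c ∈ C) [FiniteDimensional ℝ A] [FiniteDimensional ℝ C]
    (hdim : Module.finrank ℝ A + 2 * Module.finrank ℝ C = 4)
    (h1 : NonvanishingDet (A ⊔ Submodule.span ℝ {1}))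
    (h2 : NonvanishingDet (C.map (LinearMap.mulLeft ℝ Φ.P)))
    (h3 : ∀ s, ∀ f ∈ C.map (LinearMap.mulLeft ℝ Φ.P), f s = 0 → f (s + (0, 1)) = 0 → f = 0) :
    IsNonsolvableSeven D F ((ParSub A C).map (pbF D Φ)) := by
  refine ⟨⟨(isSymmetry_iff_red hD h hF).2 hred, ?_, ?_⟩, ?_, ?_, ⟨?_, ?_, ?_⟩⟩
  · rintro _ ⟨m, hm, rfl⟩ _ ⟨m', hm', rfl⟩
    rw [bracket_pbF hD h]
    have := parBr_mem hAC hm hm'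
    rw [mem_ParSub] at this
    refine Submodule.mem_map_of_mem (mem_ParSub.2 ⟨?_, this.2⟩)
    rw [(Submodule.mem_bot ℝ).1 this.1]
    exact A.zero_mem
  · rintro _ ⟨m, -, rfl⟩ b c hbc hI hz
    rw [par_eq_zero hD h hbc hI hz, map_zero]
  · rw [finrank_map_pbF hD h, finrank_ParSub, hdim]
  · exact not_isSolvableSpace hD h (slPart_map_ParSub A C)
  · rwa [scalingSpace_eq hD h]
  · intro t ht
    rwa [translationSpace_eq hD h A C ht]
  · intro t ht _
    rwa [translationSpace_eq hD h A C ht]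

theorem expo_eq_zero {s : Site} (hΔ : mainDet a s ≠ 0) {r : Fin 5 → ℝ}
    (h : ∀ j, expo a r (s + nbr (five j)) = 0) : r = 0 := by
  set M : Matrix (Fin 5) (Fin 5) ℝ := Matrix.of fun k j => withOne a k (s + nbr (five j)) with hM
  have hu : IsUnit M.det := isUnit_iff_ne_zero.2 hΔ
  have h0 : Matrix.vecMul r M = 0 := funext h
  have : Matrix.vecMul (Matrix.vecMul r M) M⁻¹ = r := by
    rw [Matrix.vecMul_vecMul, Matrix.mul_nonsing_inv _ hu, Matrix.vecMul_one]
  rw [← this, h0, Matrix.zero_vecMul]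

theorem linearIndependent_withOne {s : Site} (hΔ : mainDet a s ≠ 0) :
    LinearIndependent ℝ (withOne a) := by
  rw [Fintype.linearIndependent_iff]
  intro r hr
  refine congrFun (expo_eq_zero hΔ (r := r) fun j => ?_)
  have := congrFun hr (s + nbr (five j))
  simpa [expo, Finset.sum_apply] using this

theorem range_withOne (a : Fin 4 → Site → ℝ) :
    Submodule.span ℝ (range (withOne a)) = Submodule.span ℝ (range a) ⊔ Submodule.span ℝ {1} := by
  rw [← Submodule.span_union]
  congr 1
  ext f
  constructor
  · rintro ⟨k, rfl⟩
    refine Fin.lastCases ?_ (fun k => ?_) k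
    · rw [withOne_last]; exact Or.inr rfl
    · rw [withOne_castSucc]; exact Or.inl ⟨k, rfl⟩
  · rintro (⟨k, rfl⟩ | rfl)
    · exact ⟨k.castSucc, withOne_castSucc a k⟩
    · exact ⟨Fin.last 4, withOne_last a⟩

theorem finrank_span_range_four {s : Site} (hΔ : mainDet a s ≠ 0) :
    Module.finrank ℝ (Submodule.span ℝ (range a)) = 4 := by
  have h4 : LinearIndependent ℝ a := by
    have := (linearIndependent_withOne hΔ).comp Fin.castSucc (Fin.castSucc_injective 4)
    have e : withOne a ∘ Fin.castSucc = a := funext fun k => withOne_castSucc a k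
    rwa [e] at this
  rw [finrank_span_eq_card h4, Fintype.card_fin]

theorem nonvanishingDet_withOne (hΔ : ∀ s, mainDet a s ≠ 0) :
    NonvanishingDet (Submodule.span ℝ (range a) ⊔ Submodule.span ℝ {1}) := by
  rw [← range_withOne]
  intro s f hf h0
  rw [finrank_span_eq_card (linearIndependent_withOne (hΔ s)), Fintype.card_fin] at h0
  obtain ⟨r, rfl⟩ := (Submodule.mem_span_range_iff_exists_fun ℝ).1 hf
  have : r = 0 := expo_eq_zero (hΔ s) fun j => by
    have := h0 (five j) j.2
    simpa [expo, Finset.sum_apply] using this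
  simp [this]

theorem ClassOne.eq_map (hc : ClassOne D F L Φ a) (hD : D.Regular) :
    L = (ParSub (Submodule.span ℝ (range a)) ⊥).map (pbF D Φ) := by
  have := hc.algebra
  rwa [stdSpan1_eq, corresponds_iff hD hc.admissible] at this

theorem ClassTwo.eq_map (hc : ClassTwo D F L Φ κ) (hD : D.Regular) :
    L = (ParSub ⊥ (Submodule.span ℝ {1, κ})).map (pbF D Φ) := by
  have := hc.algebra
  rwa [stdSpan2_eq, corresponds_iff hD hc.admissible] at this

theorem ClassOne.conclusion (hD : D.Regular) (hF : ∀ s, ContDiffOn ℝ ∞ (F s) (D.Ω s))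
    (hc : ClassOne D F L Φ a) :
    IsNonsolvableSeven D F L ∧ ∃ R, IsRadicalOf R L ∧ Corresponds D Φ R (radical1 a) := by
  have h := hc.admissible
  have hAC : ∀ f ∈ Submodule.span ℝ (range a), ∀ c ∈ (⊥ : Submodule ℝ (Site → ℝ)),
      f * c ∈ (⊥ : Submodule ℝ (Site → ℝ)) := by
    intro f _ c hc
    rw [(Submodule.mem_bot ℝ).1 hc, mul_zero]
    exact Submodule.zero_mem _
  have : FiniteDimensional ℝ (Submodule.span ℝ (range a)) := FiniteDimensional.span_of_finite ℝ (finite_range a)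
  rw [hc.eq_map hD]
  refine ⟨isNonsolvableSeven_of_red hD h hF (hc.red hD hF) hAC ?_ (nonvanishingDet_withOne hc.det_ne)
    ?_ ?_, (RadSub _ ⊥).map (pbF D Φ), isRadicalOf hD h hAC, ?_⟩
  · rw [finrank_span_range_four (hc.det_ne 0), finrank_bot]
  · intro s f hf _
    rwa [Submodule.map_bot, Submodule.mem_bot] at hf
  · intro s f hf _ _
    rwa [Submodule.map_bot, Submodule.mem_bot] at hf
  · rw [radical1_eq, corresponds_iff hD h]

theorem linearIndependent_one_pair {s t : Site} (h : κ s ≠ κ t) : LinearIndependent ℝ ![1, κ] := by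
  rw [LinearIndependent.pair_iff]
  intro α β hαβ
  have h1 := congrFun hαβ s
  have h2 := congrFun hαβ t
  simp only [Pi.add_apply, Pi.smul_apply, Pi.one_apply, smul_eq_mul, mul_one, Pi.zero_apply] at h1 h2
  have hβ : β = 0 := by
    have : β * (κ s - κ t) = 0 := by linarith
    exact (mul_eq_zero.1 this).resolve_right (sub_ne_zero.2 h)
  rw [hβ, zero_mul, add_zero] at h1
  exact ⟨h1, hβ⟩

theorem finrank_span_one_pair {s t : Site} (h : κ s ≠ κ t) :
    Module.finrank ℝ (Submodule.span ℝ {1, κ}) = 2 := by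
  have := finrank_span_eq_card (linearIndependent_one_pair h)
  rwa [Matrix.range_cons_cons_empty, Fintype.card_fin] at this

theorem mulLeft_injective {P : Site → ℝ} (hP : ∀ s, P s ≠ 0) :
    Function.Injective (LinearMap.mulLeft ℝ P) := fun _ _ hfg =>
  funext fun s => mul_left_cancel₀ (hP s) (congrFun hfg s)

theorem eq_zero_of_mem_map_span_pair {P f : Site → ℝ} (hP : ∀ s, P s ≠ 0) {s t : Site} (h : κ s ≠ κ t)
    (hf : f ∈ (Submodule.span ℝ {1, κ}).map (LinearMap.mulLeft ℝ P)) (hs : f s = 0) (ht : f t = 0) :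
    f = 0 := by
  obtain ⟨c, hc, rfl⟩ := hf
  obtain ⟨α, β, rfl⟩ := Submodule.mem_span_pair.1 hc
  have h1 := (mul_eq_zero.1 hs).resolve_left (hP s)
  have h2 := (mul_eq_zero.1 ht).resolve_left (hP t)
  simp only [Pi.add_apply, Pi.smul_apply, Pi.one_apply, smul_eq_mul, mul_one] at h1 h2
  have hβ : β = 0 := by
    have : β * (κ s - κ t) = 0 := by linarith
    exact (mul_eq_zero.1 this).resolve_right (sub_ne_zero.2 h)
  rw [hβ, zero_mul, add_zero] at h1
  rw [h1, hβ, zero_smul, zero_smul, add_zero, map_zero]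

theorem nonvanishingDet_span_one :
    NonvanishingDet ((⊥ : Submodule ℝ (Site → ℝ)) ⊔ Submodule.span ℝ {1}) := by
  intro s f hf h0
  rw [bot_sup_eq] at hf h0
  rw [finrank_span_singleton one_ne_zero] at h0
  obtain ⟨c, rfl⟩ := Submodule.mem_span_singleton.1 hf
  have := h0 0 (by norm_num)
  simp only [Pi.smul_apply, Pi.one_apply, smul_eq_mul, mul_one] at this
  rw [this, zero_smul]

theorem ClassTwo.conclusion (hD : D.Regular) (hF : ∀ s, ContDiffOn ℝ ∞ (F s) (D.Ω s))
    (hc : ClassTwo D F L Φ κ) :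
    IsNonsolvableSeven D F L ∧ ∃ R, IsRadicalOf R L ∧ Corresponds D Φ R (radical2 κ) := by
  have h := hc.admissible
  have hP := h.2.2.1
  have hAC : ∀ f ∈ (⊥ : Submodule ℝ (Site → ℝ)), ∀ c ∈ Submodule.span ℝ {1, κ},
      f * c ∈ Submodule.span ℝ {1, κ} := by
    intro f hf c _
    rw [(Submodule.mem_bot ℝ).1 hf, zero_mul]
    exact Submodule.zero_mem _
  have h2 := finrank_span_one_pair (hc.ne_n 0)
  have : FiniteDimensional ℝ (Submodule.span ℝ {1, κ}) :=
    FiniteDimensional.span_of_finite ℝ (by simp)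
  rw [hc.eq_map hD]
  refine ⟨isNonsolvableSeven_of_red hD h hF (hc.red hD hF) hAC ?_ nonvanishingDet_span_one
    ?_ fun s f hf hs ht => eq_zero_of_mem_map_span_pair hP (hc.ne_m s) hf hs ht,
    (RadSub ⊥ _).map (pbF D Φ), isRadicalOf hD h hAC, ?_⟩
  · rw [h2, finrank_bot]
  · intro s f hf h0
    rw [← (Submodule.equivMapOfInjective _ (mulLeft_injective hP) _).finrank_eq, h2] at h0
    have e0 := h0 0 (by norm_num)
    rw [nbr_zero, add_zero] at e0
    exact eq_zero_of_mem_map_span_pair hP (hc.ne_n s) hf e0 (h0 1 (by norm_num))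
  · rw [radical2_eq, corresponds_iff hD h]

/-- At any time the translation space is zero in the first class, while in the second it contains
the nowhere vanishing function `P`. -/
theorem ClassOne.not_classTwo {Φ' : AllowedMap} (hD : D.Regular) (h₁ : ClassOne D F L Φ a) :
    ¬ ClassTwo D F L Φ' κ := by
  intro h₂
  obtain ⟨t, ht⟩ := hD.nonempty_I
  have e₁ := translationSpace_eq hD h₁.admissible (Submodule.span ℝ (range a)) ⊥ ht
  have e₂ := translationSpace_eq hD h₂.admissible ⊥ (Submodule.span ℝ {1, κ}) ht
  rw [← h₁.eq_map hD, Submodule.map_bot] at e₁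
  rw [← h₂.eq_map hD, e₁] at e₂
  have : (LinearMap.mulLeft ℝ Φ'.P) 1 ∈ (⊥ : Submodule ℝ (Site → ℝ)) := by
    rw [e₂]
    exact Submodule.mem_map_of_mem (Submodule.subset_span (by simp))
  have h0 := congrFun ((Submodule.mem_bot ℝ).1 this) 0
  exact h₂.admissible.2.2.1 0 (by simpa using h0)

end

/-! ### Finite-dimensional Lie algebras of vector fields on the line -/

/-- The bracket `f g' - g f'` on `I`, extended by zero. -/
noncomputable def wr (I : Set ℝ) (f g : ℝ → ℝ) : ℝ → ℝ :=
  I.indicator fun t => f t * deriv g t - g t * deriv f t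

/-- `W` is a Lie algebra of vector fields on `I`, none of which vanishes on a whole interval. -/
structure LineAlgebra (I : Set ℝ) (W : Submodule ℝ (ℝ → ℝ)) : Prop where
  isOpen : IsOpen I
  smooth : ∀ f ∈ W, ContDiffOn ℝ ∞ f I
  zero_out : ∀ f ∈ W, ∀ t ∉ I, f t = 0
  closed : ∀ f ∈ W, ∀ g ∈ W, wr I f g ∈ W
  unique : ∀ f ∈ W, ∀ b c, b < c → Ioo b c ⊆ I → (∀ t ∈ Ioo b c, f t = 0) → f = 0

section
variable {I : Set ℝ} {W : Submodule ℝ (ℝ → ℝ)} {f g e : ℝ → ℝ} {t t₀ : ℝ} {m n k : ℕ}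

theorem wr_of_mem (ht : t ∈ I) : wr I f g t = f t * deriv g t - g t * deriv f t :=
  indicator_of_mem ht _

/-- `f` vanishes at `t₀` to the order `k`. -/
def VanishesTo (t₀ : ℝ) (k : ℕ) (f : ℝ → ℝ) : Prop := ∀ j < k, iteratedDeriv j f t₀ = 0

theorem VanishesTo.congr (h : VanishesTo t₀ k f) (hfg : f =ᶠ[𝓝 t₀] g) : VanishesTo t₀ k g :=
  fun j hj => by rw [← hfg.iteratedDeriv_eq, h j hj]

theorem VanishesTo.mono (h : VanishesTo t₀ k f) (hn : n ≤ k) : VanishesTo t₀ n f :=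
  fun j hj => h j (hj.trans_le hn)

theorem VanishesTo.add (hf : ContDiffAt ℝ ∞ f t₀) (hg : ContDiffAt ℝ ∞ g t₀)
    (h₁ : VanishesTo t₀ k f) (h₂ : VanishesTo t₀ k g) : VanishesTo t₀ k (f + g) := fun j hj => by
  rw [iteratedDeriv_add (hf.of_le (by exact_mod_cast le_top)) (hg.of_le (by exact_mod_cast le_top)),
    h₁ j hj, h₂ j hj, add_zero]

theorem VanishesTo.smul (c : ℝ) (h : VanishesTo t₀ k f) : VanishesTo t₀ k (c • f) := fun j hj => by
  rw [iteratedDeriv_const_smul_field, h j hj, smul_zero]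

theorem VanishesTo.mul (hf : ContDiffAt ℝ ∞ f t₀) (hg : ContDiffAt ℝ ∞ g t₀)
    (h₁ : VanishesTo t₀ m f) (h₂ : VanishesTo t₀ n g) : VanishesTo t₀ (m + n) (f * g) := fun j hj => by
  rw [iteratedDeriv_mul (hf.of_le (by exact_mod_cast le_top)) (hg.of_le (by exact_mod_cast le_top))]
  refine Finset.sum_eq_zero fun i hi => ?_
  rw [Finset.mem_range] at hi
  by_cases him : i < m
  · rw [h₁ i him, mul_zero, zero_mul]
  · rw [h₂ (j - i) (by omega), mul_zero]

theorem VanishesTo.deriv (h : VanishesTo t₀ (k + 1) f) : VanishesTo t₀ k (deriv f) := fun j hj => by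
  rw [← iteratedDeriv_succ']
  exact h _ (by omega)

theorem VanishesTo.of_deriv (h0 : f t₀ = 0) (h : VanishesTo t₀ k (_root_.deriv f)) :
    VanishesTo t₀ (k + 1) f := by
  intro j hj
  cases j with
  | zero => rwa [iteratedDeriv_zero]
  | succ j => rw [iteratedDeriv_succ']; exact h j (by omega)

theorem VanishesTo.zero (t₀ : ℝ) (f : ℝ → ℝ) : VanishesTo t₀ 0 f := fun j hj => absurd hj (Nat.not_lt_zero j)

/-! ### Orders of vanishing and their behaviour under brackets -/

namespace LineAlgebra

theorem contDiffAt (hW : LineAlgebra I W) (hf : f ∈ W) (ht : t ∈ I) : ContDiffAt ℝ ∞ f t :=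
  (hW.smooth f hf).contDiffAt (hW.isOpen.mem_nhds ht)

theorem contDiffAt_deriv (hW : LineAlgebra I W) (hf : f ∈ W) (ht : t ∈ I) :
    ContDiffAt ℝ ∞ (deriv f) t :=
  (smooth_deriv hW.isOpen (hW.smooth f hf)).contDiffAt (hW.isOpen.mem_nhds ht)

theorem hasDerivAt (hW : LineAlgebra I W) (hf : f ∈ W) (ht : t ∈ I) : HasDerivAt f (deriv f t) t :=
  smooth_hasDerivAt hW.isOpen (hW.smooth f hf) ht

theorem hasDerivAt_deriv (hW : LineAlgebra I W) (hf : f ∈ W) (ht : t ∈ I) :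
    HasDerivAt (deriv f) (deriv (deriv f) t) t :=
  smooth_hasDerivAt hW.isOpen (smooth_deriv hW.isOpen (hW.smooth f hf)) ht

theorem wr_eventuallyEq (hW : LineAlgebra I W) (ht : t₀ ∈ I) (f g : ℝ → ℝ) :
    wr I f g =ᶠ[𝓝 t₀] f * deriv g + (-1 : ℝ) • (g * deriv f) := by
  filter_upwards [hW.isOpen.mem_nhds ht] with t ht'
  rw [wr_of_mem ht']
  simp [sub_eq_add_neg]

theorem hasDerivAt_wr (hW : LineAlgebra I W) (hf : f ∈ W) (hg : g ∈ W) (ht : t ∈ I) :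
    HasDerivAt (wr I f g) (f t * deriv (deriv g) t - g t * deriv (deriv f) t) t := by
  have h := ((hW.hasDerivAt hf ht).mul (hW.hasDerivAt_deriv hg ht)).sub
    ((hW.hasDerivAt hg ht).mul (hW.hasDerivAt_deriv hf ht))
  refine (h.congr_of_eventuallyEq ?_).congr_deriv (by ring)
  filter_upwards [hW.isOpen.mem_nhds ht] with t ht'
  rw [wr_of_mem ht']
  rfl

theorem eq_zero_of_eqOn (hW : LineAlgebra I W) (hf : f ∈ W) (h : ∀ t ∈ I, f t = 0) : f = 0 :=
  funext fun t => by
    by_cases ht : t ∈ I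
    · exact h t ht
    · exact hW.zero_out f hf t ht

theorem eq_of_eqOn (hW : LineAlgebra I W) (hf : f ∈ W) (hg : g ∈ W) (h : ∀ t ∈ I, f t = g t) :
    f = g :=
  sub_eq_zero.1 (hW.eq_zero_of_eqOn (W.sub_mem hf hg) fun t ht => sub_eq_zero.2 (h t ht))

theorem eq_zero_of_eventually (hW : LineAlgebra I W) (hf : f ∈ W) (ht : t₀ ∈ I)
    (h : ∀ᶠ t in 𝓝 t₀, f t = 0) : f = 0 := by
  obtain ⟨ε, hε, hB⟩ := Metric.eventually_nhds_iff_ball.1 (h.and (hW.isOpen.mem_nhds ht))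
  rw [Real.ball_eq_Ioo] at hB
  exact hW.unique f hf _ _ (by linarith) (fun t ht => (hB t ht).2) fun t ht => (hB t ht).1

/-- The elements that vanish at `t₀` to the order `k`. -/
def vanishing (hW : LineAlgebra I W) (ht : t₀ ∈ I) (k : ℕ) : Submodule ℝ (ℝ → ℝ) where
  carrier := {f | f ∈ W ∧ VanishesTo t₀ k f}
  add_mem' hf hg := ⟨W.add_mem hf.1 hg.1,
    .add (hW.contDiffAt hf.1 ht) (hW.contDiffAt hg.1 ht) hf.2 hg.2⟩
  zero_mem' := ⟨W.zero_mem, fun j _ => by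
    rw [show (0 : ℝ → ℝ) = fun _ => 0 from rfl, iteratedDeriv_const]; simp⟩
  smul_mem' c _ hf := ⟨W.smul_mem c hf.1, hf.2.smul c⟩

/-- Orders add in products, and the derivative costs one. -/
theorem wr_vanishes (hW : LineAlgebra I W) (ht : t₀ ∈ I) (hf : f ∈ W) (hg : g ∈ W)
    (hm : VanishesTo t₀ (m + 1) f) (hn : VanishesTo t₀ (n + 1) g) :
    VanishesTo t₀ (m + n + 1) (wr I f g) := by
  have h₁ := hm.mul (hW.contDiffAt hf ht) (hW.contDiffAt_deriv hg ht) hn.deriv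
  have h₂ := hn.mul (hW.contDiffAt hg ht) (hW.contDiffAt_deriv hf ht) hm.deriv
  refine VanishesTo.congr (VanishesTo.add ?_ ?_ (h₁.mono (by omega)) ((h₂.mono (by omega)).smul (-1)))
    (hW.wr_eventuallyEq ht f g).symm
  · exact (hW.contDiffAt hf ht).mul (hW.contDiffAt_deriv hg ht)
  · exact contDiffAt_const.smul ((hW.contDiffAt hg ht).mul (hW.contDiffAt_deriv hf ht))

theorem wr_vanishes_pred (hW : LineAlgebra I W) (ht : t₀ ∈ I) (he : e ∈ W) (hf : f ∈ W)
    (hn : VanishesTo t₀ (n + 1) f) : VanishesTo t₀ n (wr I e f) := by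
  have h₁ := (VanishesTo.zero t₀ e).mul (hW.contDiffAt he ht) (hW.contDiffAt_deriv hf ht) hn.deriv
  have h₂ := hn.mul (hW.contDiffAt hf ht) (hW.contDiffAt_deriv he ht) (VanishesTo.zero t₀ _)
  refine VanishesTo.congr (VanishesTo.add ?_ ?_ (h₁.mono (by omega)) ((h₂.mono (by omega)).smul (-1)))
    (hW.wr_eventuallyEq ht e f).symm
  · exact (hW.contDiffAt he ht).mul (hW.contDiffAt_deriv hf ht)
  · exact contDiffAt_const.smul ((hW.contDiffAt hf ht).mul (hW.contDiffAt_deriv he ht))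

/-- Bracketing with `e`, where `e t₀ ≠ 0`, lowers the order of vanishing. -/
theorem vanishes_of_wr (hW : LineAlgebra I W) (ht : t₀ ∈ I) (he : e ∈ W) (he0 : e t₀ ≠ 0)
    (hf : f ∈ W) (hn : VanishesTo t₀ (n + 1) f) (hwr : VanishesTo t₀ (n + 1) (wr I e f)) :
    VanishesTo t₀ (n + 2) f := by
  refine VanishesTo.of_deriv (by simpa using hn 0 (by omega)) ?_
  have hfs := hW.contDiffAt hf ht
  have hes := hW.contDiffAt he ht
  have hds := hW.contDiffAt_deriv he ht
  -- Near `t₀` one has `f' = (wr e f + f e') / e`, and both summands vanish to the order `n + 1`.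
  have h₁ := hn.mul hfs hds (VanishesTo.zero t₀ _)
  have h₂ := VanishesTo.add (hW.contDiffAt (hW.closed e he f hf) ht) (hfs.mul hds) hwr h₁
  have h₃ := (VanishesTo.zero t₀ e⁻¹).mul (hes.inv he0)
    ((hW.contDiffAt (hW.closed e he f hf) ht).add (hfs.mul hds)) h₂
  rw [zero_add] at h₃
  refine h₃.congr ?_
  filter_upwards [hW.isOpen.mem_nhds ht, hes.continuousAt.eventually_ne he0] with t ht' h0
  simp only [Pi.mul_apply, Pi.inv_apply, wr_of_mem ht']
  field_simp
  ring

/-- A subspace invariant under `e` whose elements vanish at `t₀` is zero: the elements of a basis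
satisfy a linear system of differential equations. -/
theorem eq_bot_of_invariant (hW : LineAlgebra I W) [FiniteDimensional ℝ W] (ht : t₀ ∈ I)
    (he : e ∈ W) (he0 : e t₀ ≠ 0) {U : Submodule ℝ (ℝ → ℝ)} (hU : U ≤ W)
    (hinv : ∀ f ∈ U, wr I e f ∈ U) (hz : ∀ f ∈ U, f t₀ = 0) : U = ⊥ := by
  have : FiniteDimensional ℝ U := Submodule.finiteDimensional_of_le hU
  set b := Module.finBasis ℝ U
  set c : Matrix (Fin (Module.finrank ℝ U)) (Fin (Module.finrank ℝ U)) ℝ :=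
    Matrix.of fun i j => b.repr ⟨wr I e (b i), hinv _ (b i).2⟩ j with hc
  set φ : ℝ → Fin (Module.finrank ℝ U) → ℝ := fun t i => (b i : ℝ → ℝ) t with hφ
  set T : (Fin (Module.finrank ℝ U) → ℝ) →L[ℝ] (Fin (Module.finrank ℝ U) → ℝ) :=
    (Matrix.toLin' c).toContinuousLinearMap with hT
  -- The expression `wr e b_i = e b_i' - b_i e'`, solved for `b_i'`, where `wr e b_i` is again a
  -- combination of the basis. Dividing by `e` is possible near `t₀`.
  set A : ℝ → (Fin (Module.finrank ℝ U) → ℝ) →L[ℝ] (Fin (Module.finrank ℝ U) → ℝ) := fun t =>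
    (e t)⁻¹ • (T + deriv e t • ContinuousLinearMap.id ℝ _) with hA
  have hTφ : ∀ t i, T (φ t) i = wr I e (b i) t := by
    intro t i
    have h1 := congrArg (fun x : U => (x : ℝ → ℝ) t) (b.sum_repr ⟨wr I e (b i), hinv _ (b i).2⟩)
    simp only [Submodule.coe_sum, Submodule.coe_smul, Finset.sum_apply, Pi.smul_apply, smul_eq_mul] at h1
    rw [← h1]
    rfl
  have hAc : ContinuousAt A t₀ := by
    have h1 := (hW.contDiffAt he ht).continuousAt
    have h2 := (hW.contDiffAt_deriv he ht).continuousAt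
    exact (h1.inv₀ he0).smul (continuousAt_const.add (h2.smul continuousAt_const))
  have hode : φ =ᶠ[𝓝 t₀] fun _ => 0 := by
    refine ODE_solution_unique_of_eventually (v := fun t y => A t y) (K := ‖A t₀‖₊ + 1)
      (s := fun _ => univ) ?_ ?_ ?_ ?_
    · filter_upwards [hAc.nnnorm.eventually (gt_mem_nhds (lt_add_one ‖A t₀‖₊))] with t h
      exact ((A t).lipschitz.weaken h.le).lipschitzOnWith
    · filter_upwards [hW.isOpen.mem_nhds ht,
        (hW.contDiffAt he ht).continuousAt.eventually_ne he0] with t ht' h0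
      refine ⟨hasDerivAt_pi.2 fun i => ?_, mem_univ _⟩
      refine (hW.hasDerivAt (hU (b i).2) ht').congr_deriv ?_
      show _ = (e t)⁻¹ * (T (φ t) i + deriv e t * φ t i)
      rw [hTφ, wr_of_mem ht']
      field_simp
      ring
    · refine Eventually.of_forall fun t => ⟨?_, mem_univ _⟩
      rw [map_zero]
      exact hasDerivAt_const _ _
    · exact funext fun i => hz _ (b i).2
  rw [eq_bot_iff]
  intro f hf
  rw [Submodule.mem_bot]
  refine hW.eq_zero_of_eventually (hU hf) ht ?_
  filter_upwards [hode] with t h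
  have h1 := congrArg (fun x : U => (x : ℝ → ℝ) t) (b.sum_repr ⟨f, hf⟩)
  simp only [Submodule.coe_sum, Submodule.coe_smul, Finset.sum_apply, Pi.smul_apply, smul_eq_mul] at h1
  rw [← h1]
  refine Finset.sum_eq_zero fun i _ => ?_
  rw [show (b i : ℝ → ℝ) t = 0 from congrFun h i, mul_zero]

/-- A bracket with `e` costs at most one order, so the elements that vanish to all orders form an
invariant subspace, which is zero by uniqueness for the differential equation. A decreasing chain in
finite dimension reaches its intersection. -/
theorem exists_vanishing_eq_bot (hW : LineAlgebra I W) [FiniteDimensional ℝ W] (ht : t₀ ∈ I)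
    (he : e ∈ W) (he0 : e t₀ ≠ 0) : ∃ k, hW.vanishing ht k = ⊥ := by
  have hfd : ∀ k, FiniteDimensional ℝ (hW.vanishing ht k) := fun k =>
    Submodule.finiteDimensional_of_le (S₂ := W) fun f hf => hf.1
  have hinf : (⨅ k, hW.vanishing ht k) = ⊥ := by
    refine hW.eq_bot_of_invariant ht he he0 ?_ ?_ ?_
    · exact fun f hf => ((Submodule.mem_iInf _).1 hf 0).1
    · intro f hf
      rw [Submodule.mem_iInf] at hf ⊢
      exact fun k => ⟨hW.closed e he f (hf 0).1, hW.wr_vanishes_pred ht he (hf 0).1 (hf (k + 1)).2⟩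
    · intro f hf
      simpa using ((Submodule.mem_iInf _).1 hf 1).2 0 zero_lt_one
  obtain ⟨k, hk⟩ : ∃ k, ∀ j, Module.finrank ℝ (hW.vanishing ht k) ≤ Module.finrank ℝ (hW.vanishing ht j) := by
    obtain ⟨k, -, hk⟩ := WellFounded.has_min (measure fun k => Module.finrank ℝ (hW.vanishing ht k)).wf
      univ ⟨0, mem_univ _⟩
    exact ⟨k, fun j => not_lt.1 (hk j (mem_univ _))⟩
  refine ⟨k, ?_⟩
  rw [eq_bot_iff, ← hinf]
  refine le_iInf fun j => ?_
  have hle : hW.vanishing ht (max j k) ≤ hW.vanishing ht k := fun f hf =>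
    ⟨hf.1, hf.2.mono (le_max_right _ _)⟩
  rw [← Submodule.eq_of_le_of_finrank_le hle (hk _)]
  exact fun f hf => ⟨hf.1, hf.2.mono (le_max_left _ _)⟩

end LineAlgebra

end

/-! ### The bound on the order and the classification -/

namespace LineAlgebra
variable {I : Set ℝ} {W : Submodule ℝ (ℝ → ℝ)} {f g e h : ℝ → ℝ} {t t₀ : ℝ}

theorem deriv_comb (hW : LineAlgebra I W) (hf : f ∈ W) (hg : g ∈ W) (ht : t ∈ I) (α β : ℝ) :
    deriv (α • f + β • g) t = α * deriv f t + β * deriv g t :=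
  (((hW.hasDerivAt hf ht).const_mul α).add ((hW.hasDerivAt hg ht).const_mul β)).deriv

theorem wr_comb_right (hW : LineAlgebra I W) (he : e ∈ W) (hf : f ∈ W) (hg : g ∈ W) (α β : ℝ) :
    wr I e (α • f + β • g) = α • wr I e f + β • wr I e g := by
  have hfg := W.add_mem (W.smul_mem α hf) (W.smul_mem β hg)
  refine hW.eq_of_eqOn (hW.closed e he _ hfg) (W.add_mem (W.smul_mem α (hW.closed e he f hf))
    (W.smul_mem β (hW.closed e he g hg))) fun t ht => ?_
  rw [wr_of_mem ht, hW.deriv_comb hf hg ht]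
  simp only [Pi.add_apply, Pi.smul_apply, smul_eq_mul, wr_of_mem ht]
  ring

theorem wr_swap (I : Set ℝ) (f g : ℝ → ℝ) : wr I f g = (-1 : ℝ) • wr I g f := by
  funext t
  by_cases ht : t ∈ I
  · rw [Pi.smul_apply, wr_of_mem ht, wr_of_mem ht, smul_eq_mul]; ring
  · simp [wr, indicator_of_notMem ht]

theorem wr_self (I : Set ℝ) (f : ℝ → ℝ) : wr I f f = 0 := by
  funext t
  by_cases ht : t ∈ I
  · rw [wr_of_mem ht, sub_self]; rfl
  · simp [wr, indicator_of_notMem ht]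

theorem wr_comb_left (hW : LineAlgebra I W) (he : e ∈ W) (hf : f ∈ W) (hg : g ∈ W) (α β : ℝ) :
    wr I (α • f + β • g) e = α • wr I f e + β • wr I g e := by
  rw [wr_swap, hW.wr_comb_right he hf hg, smul_add, smul_comm, ← wr_swap, smul_comm, ← wr_swap]

theorem deriv_wr (hW : LineAlgebra I W) (hf : f ∈ W) (hg : g ∈ W) (ht : t ∈ I) :
    deriv (wr I f g) t = f t * deriv (deriv g) t - g t * deriv (deriv f) t :=
  (hW.hasDerivAt_wr hf hg ht).deriv

theorem deriv2_wr (hW : LineAlgebra I W) (hf : f ∈ W) (hg : g ∈ W) (ht : t ∈ I) :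
    deriv (deriv (wr I f g)) t = deriv f t * deriv (deriv g) t - deriv g t * deriv (deriv f) t
      + (f t * deriv (deriv (deriv g)) t - g t * deriv (deriv (deriv f)) t) := by
  have h3 : ∀ f ∈ W, HasDerivAt (deriv (deriv f)) (deriv (deriv (deriv f)) t) t := fun f hf =>
    smooth_hasDerivAt hW.isOpen (smooth_deriv hW.isOpen (smooth_deriv hW.isOpen (hW.smooth f hf))) ht
  have := ((hW.hasDerivAt hf ht).mul (h3 g hg)).sub ((hW.hasDerivAt hg ht).mul (h3 f hf))
  rw [deriv_congr_on hW.isOpen (fun t ht => hW.deriv_wr hf hg ht) ht]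
  exact this.deriv.trans (by ring)

theorem wr_jacobi (hW : LineAlgebra I W) (he : e ∈ W) (hf : f ∈ W) (hg : g ∈ W) :
    wr I e (wr I f g) = wr I (wr I e f) g + wr I f (wr I e g) := by
  have h1 := hW.closed f hf g hg
  have h2 := hW.closed e he f hf
  have h3 := hW.closed e he g hg
  refine hW.eq_of_eqOn (hW.closed _ he _ h1) (W.add_mem (hW.closed _ h2 _ hg) (hW.closed _ hf _ h3))
    fun t ht => ?_
  simp only [Pi.add_apply, wr_of_mem ht, hW.deriv_wr hf hg ht, hW.deriv_wr he hf ht,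
    hW.deriv_wr he hg ht]
  ring

theorem jet_three (f : ℝ → ℝ) (t₀ : ℝ) : VanishesTo t₀ 3 f ↔
    f t₀ = 0 ∧ deriv f t₀ = 0 ∧ deriv (deriv f) t₀ = 0 := by
  have h2 : iteratedDeriv 2 f t₀ = deriv (deriv f) t₀ := by
    rw [iteratedDeriv_succ, iteratedDeriv_one]
  constructor
  · intro h
    exact ⟨by simpa using h 0 (by norm_num), by simpa using h 1 (by norm_num),
      h2 ▸ h 2 (by norm_num)⟩
  · rintro ⟨h0, h1, h3⟩ j hj
    interval_cases j
    · simpa using h0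
    · simpa using h1
    · rw [h2, h3]

theorem jet_two (f : ℝ → ℝ) (t₀ : ℝ) : VanishesTo t₀ 2 f ↔ f t₀ = 0 ∧ deriv f t₀ = 0 := by
  constructor
  · intro h
    exact ⟨by simpa using h 0 (by norm_num), by simpa using h 1 (by norm_num)⟩
  · rintro ⟨h0, h1⟩ j hj
    interval_cases j
    · simpa using h0
    · simpa using h1

theorem jet_one (f : ℝ → ℝ) (t₀ : ℝ) : VanishesTo t₀ 1 f ↔ f t₀ = 0 := by
  constructor
  · intro h
    simpa using h 0 (by norm_num)
  · intro h0 j hj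
    interval_cases j
    simpa using h0

/-- The degenerate case: the algebra is at most two-dimensional. -/
theorem exists_derived_of_two (hW : LineAlgebra I W) (ht : t₀ ∈ I) (he : e ∈ W) (he0 : e t₀ ≠ 0)
    (h2 : hW.vanishing ht 2 = ⊥) : ∃ z ∈ W, ∀ f ∈ W, ∀ g ∈ W, ∃ c : ℝ, wr I f g = c • z := by
  -- An element is determined by its value and its first derivative at `t₀`. So `e` spans the
  -- algebra together with one element `f₀` that vanishes at `t₀`, possibly `0`.
  obtain ⟨f₀, hf₀, hspan⟩ : ∃ f₀ ∈ W, ∀ f ∈ W, ∃ α β : ℝ, f = α • e + β • f₀ := by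
    by_cases h1 : hW.vanishing ht 1 = ⊥
    · refine ⟨0, W.zero_mem, fun f hf => ⟨f t₀ / e t₀, 0, ?_⟩⟩
      have : f - (f t₀ / e t₀) • e ∈ hW.vanishing ht 1 := by
        refine ⟨W.sub_mem hf (W.smul_mem _ he), (jet_one _ _).2 ?_⟩
        simp only [Pi.sub_apply, Pi.smul_apply, smul_eq_mul]
        field_simp
        ring
      rw [h1, Submodule.mem_bot] at this
      rw [smul_zero, add_zero]
      exact sub_eq_zero.1 this
    · obtain ⟨f₀, ⟨hf₀, hv⟩, hne⟩ := Submodule.exists_mem_ne_zero_of_ne_bot h1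
      have hf00 := (jet_one _ _).1 hv
      have hd : deriv f₀ t₀ ≠ 0 := fun h0 => hne <| by
        have : f₀ ∈ hW.vanishing ht 2 := ⟨hf₀, (jet_two _ _).2 ⟨hf00, h0⟩⟩
        rwa [h2, Submodule.mem_bot] at this
      refine ⟨f₀, hf₀, fun f hf => ⟨f t₀ / e t₀,
        (deriv f t₀ - f t₀ / e t₀ * deriv e t₀) / deriv f₀ t₀, ?_⟩⟩
      set α := f t₀ / e t₀ with hα
      set β := (deriv f t₀ - α * deriv e t₀) / deriv f₀ t₀ with hβ
      have hmem := W.add_mem (W.smul_mem α he) (W.smul_mem β hf₀)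
      have : (1:ℝ) • f + (-1:ℝ) • (α • e + β • f₀) ∈ hW.vanishing ht 2 := by
        refine ⟨W.add_mem (W.smul_mem _ hf) (W.smul_mem _ hmem), (jet_two _ _).2 ⟨?_, ?_⟩⟩
        · simp only [Pi.add_apply, Pi.smul_apply, smul_eq_mul, hf00, hα]
          field_simp
          ring
        · rw [hW.deriv_comb hf hmem ht, hW.deriv_comb he hf₀ ht, hβ]
          field_simp
          ring
      rw [h2, Submodule.mem_bot, one_smul, neg_one_smul, ← sub_eq_add_neg] at this
      exact sub_eq_zero.1 this
  refine ⟨wr I e f₀, hW.closed e he f₀ hf₀, fun f hf g hg => ?_⟩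
  obtain ⟨α, β, rfl⟩ := hspan f hf
  obtain ⟨α', β', rfl⟩ := hspan g hg
  refine ⟨α * β' - β * α', ?_⟩
  rw [hW.wr_comb_right hf he hf₀, hW.wr_comb_left he he hf₀, hW.wr_comb_left hf₀ he hf₀, wr_self,
    wr_self, wr_swap I f₀ e]
  module

/-- The order of vanishing is at most two. -/
theorem order_le_two (hW : LineAlgebra I W) (ht : t₀ ∈ I) (he : e ∈ W) (he0 : e t₀ ≠ 0) {M : ℕ}
    (hM : hW.vanishing ht (M + 1) = ⊥) (hM' : hW.vanishing ht M ≠ ⊥) : M ≤ 2 := by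
  by_contra! hlt
  obtain ⟨n, rfl⟩ : ∃ n, M = n + 3 := ⟨M - 3, by omega⟩
  obtain ⟨f, ⟨hf, hv⟩, hne⟩ := Submodule.exists_mem_ne_zero_of_ne_bot hM'
  -- For `f` of the maximal order `n + 3`, the bracket `f₁` has the order `n + 2` exactly. The
  -- bracket of `f₁` and `f` vanishes to the order `2 n + 4 ≥ n + 4` and is therefore zero. This
  -- inequality would fail for maximal order two.
  set f₁ := wr I e f with hf₁
  have hf₁W : f₁ ∈ W := hW.closed e he f hf
  have hv₁ : VanishesTo t₀ (n + 2) f₁ := hW.wr_vanishes_pred ht he hf hv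
  have hv₁' : ¬ VanishesTo t₀ (n + 3) f₁ := fun hv' => hne <| by
    have : f ∈ hW.vanishing ht (n + 3 + 1) := ⟨hf, hW.vanishes_of_wr ht he he0 hf hv hv'⟩
    rwa [hM, Submodule.mem_bot] at this
  have h0 : wr I f₁ f = 0 := by
    have : wr I f₁ f ∈ hW.vanishing ht (n + 3 + 1) :=
      ⟨hW.closed _ hf₁W _ hf, (hW.wr_vanishes ht hf₁W hf hv₁ hv).mono (by omega)⟩
    rwa [hM, Submodule.mem_bot] at this
  obtain ⟨t₁, ht₁⟩ : ∃ t, f t ≠ 0 := by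
    by_contra! h; exact hne (funext h)
  have ht₁I : t₁ ∈ I := by
    by_contra h; exact ht₁ (hW.zero_out f hf t₁ h)
  obtain ⟨ε, hε, hB⟩ := Metric.eventually_nhds_iff_ball.1
    ((hW.isOpen.eventually_mem ht₁I).and
      ((hW.contDiffAt hf ht₁I).continuousAt.eventually_ne ht₁))
  -- Commuting fields on the line are proportional where `f ≠ 0`. Then `f₁` is a multiple of `f`,
  -- against their different orders at `t₀`.
  have hconst : ∀ t ∈ Metric.ball t₁ ε, f₁ t / f t = f₁ t₁ / f t₁ := by
    intro t ht'
    refine const_of_hasDerivAt_zero (f := fun t => f₁ t / f t) Metric.isOpen_ball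
      (by rw [Real.ball_eq_Ioo]; exact ordConnected_Ioo) (fun x hx => ?_) ht' (Metric.mem_ball_self hε)
    have hxI := (hB x hx).1
    refine ((hW.hasDerivAt hf₁W hxI).div (hW.hasDerivAt hf hxI) (hB x hx).2).congr_deriv ?_
    have := congrFun h0 x
    rw [wr_of_mem hxI, Pi.zero_apply] at this
    rw [show deriv f₁ x * f x - f₁ x * deriv f x = 0 by linarith, zero_div]
  have heq : f₁ - (f₁ t₁ / f t₁) • f = 0 := by
    refine hW.eq_zero_of_eventually (W.sub_mem hf₁W (W.smul_mem _ hf)) ht₁I ?_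
    filter_upwards [Metric.ball_mem_nhds t₁ hε] with t ht'
    have h1 := hconst t ht'
    rw [div_eq_iff (hB t ht').2] at h1
    simp only [Pi.sub_apply, Pi.smul_apply, smul_eq_mul, h1, sub_self]
  rw [sub_eq_zero] at heq
  exact hv₁' (heq ▸ hv.smul _)

/-- The nondegenerate case: a copy of `sl(2,ℝ)`. -/
theorem exists_sl_two (hW : LineAlgebra I W) (ht : t₀ ∈ I) (he : e ∈ W) (he0 : 0 < e t₀)
    (h3 : hW.vanishing ht 3 = ⊥) (h2 : hW.vanishing ht 2 ≠ ⊥) :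
    ∃ e ∈ W, ∃ h ∈ W, ∃ f ∈ W, 0 < e t₀ ∧ wr I e h = e ∧ wr I h f = f ∧ wr I e f = (2:ℝ) • h ∧
      ∀ w ∈ W, ∃ q₀ q₁ q₂ : ℝ, w = q₀ • e + q₁ • h + q₂ • f := by
  have hjet : ∀ w ∈ W, w t₀ = 0 → deriv w t₀ = 0 → deriv (deriv w) t₀ = 0 → w = 0 :=
    fun w hw a b c => by
      have : w ∈ hW.vanishing ht 3 := ⟨hw, (jet_three _ _).2 ⟨a, b, c⟩⟩
      rwa [h3, Submodule.mem_bot] at this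
  have d1 : ∀ {f g : ℝ → ℝ}, f ∈ W → g ∈ W → ∀ α β : ℝ,
      deriv (α • f + β • g) t₀ = α * deriv f t₀ + β * deriv g t₀ :=
    fun hf hg α β => hW.deriv_comb hf hg ht α β
  have d2 : ∀ {f g : ℝ → ℝ}, f ∈ W → g ∈ W → ∀ α β : ℝ,
      deriv (deriv (α • f + β • g)) t₀ = α * deriv (deriv f) t₀ + β * deriv (deriv g) t₀ := by
    intro f g hf hg α β
    rw [deriv_congr_on hW.isOpen (fun t ht => hW.deriv_comb hf hg ht α β) ht]
    exact (((hW.hasDerivAt_deriv hf ht).const_mul α).add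
      ((hW.hasDerivAt_deriv hg ht).const_mul β)).deriv
  obtain ⟨f₀, ⟨hf₀, hv⟩, hne⟩ := Submodule.exists_mem_ne_zero_of_ne_bot h2
  obtain ⟨hf00, hf01⟩ := (jet_two _ _).1 hv
  have hf02 : deriv (deriv f₀) t₀ ≠ 0 := fun h0 => hne (hjet f₀ hf₀ hf00 hf01 h0)
  -- normalise `f`
  set r := 2 / (e t₀ * deriv (deriv f₀) t₀) with hr
  -- With this `r` one has `f''(t₀) = 2 / e(t₀)`, and the bracket of `e` and `f` has derivative `2`
  -- at `t₀`. The summand with coefficient `0` only gives the two-term shape that the derivative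
  -- rules `d1`, `d2` expect.
  set f := r • f₀ + (0:ℝ) • f₀ with hfdef
  have hf : f ∈ W := W.add_mem (W.smul_mem _ hf₀) (W.smul_mem _ hf₀)
  have f0 : f t₀ = 0 := by simp [hfdef, hf00]
  have f1 : deriv f t₀ = 0 := by rw [hfdef, d1 hf₀ hf₀, hf01]; ring
  have f2 : deriv (deriv f) t₀ = 2 / e t₀ := by
    rw [hfdef, d2 hf₀ hf₀, hr]; field_simp; ring
  set h := (1 / 2 : ℝ) • wr I e f + (0:ℝ) • f with hhdef
  have hef := hW.closed e he f hf
  have hh : h ∈ W := W.add_mem (W.smul_mem _ hef) (W.smul_mem _ hf)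
  have ef2 : wr I e f = (2:ℝ) • h := by rw [hhdef]; module
  have h0 : h t₀ = 0 := by simp [hhdef, wr_of_mem ht, f0, f1]
  have h1 : deriv h t₀ = 1 := by
    rw [hhdef, d1 hef hf, hW.deriv_wr he hf ht, f0, f1, f2]; field_simp; ring
  have hhf := hW.closed h hh f hf
  -- Elements are determined by their 2-jets at `t₀`, so it suffices to compare these.
  have hf_eq : wr I h f = f := by
    rw [← sub_eq_zero]
    have e1 : wr I h f - f = (1:ℝ) • wr I h f + (-1:ℝ) • f := by module
    have hm := W.add_mem (W.smul_mem 1 hhf) (W.smul_mem (-1) hf)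
    rw [e1]
    refine hjet _ hm ?_ ?_ ?_
    · simp [wr_of_mem ht, h0, f0]
    · rw [d1 hhf hf, hW.deriv_wr hh hf ht, h0, f0, f1]; ring
    · rw [d2 hhf hf, hW.deriv2_wr hh hf ht, h0, h1, f0, f1]; ring
  have hspan : ∀ w ∈ W, ∃ q₀ q₁ q₂ : ℝ, w = q₀ • e + q₁ • h + q₂ • f := by
    intro w hw
    set q₀ := w t₀ / e t₀ with hq₀
    set w₁ := (1:ℝ) • w + (-q₀) • e with hw₁
    have hw₁W : w₁ ∈ W := W.add_mem (W.smul_mem _ hw) (W.smul_mem _ he)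
    set q₁ := deriv w₁ t₀ with hq₁
    set w₂ := (1:ℝ) • w₁ + (-q₁) • h with hw₂
    have hw₂W : w₂ ∈ W := W.add_mem (W.smul_mem _ hw₁W) (W.smul_mem _ hh)
    set q₂ := deriv (deriv w₂) t₀ / (2 / e t₀) with hq₂
    have hw₃W : (1:ℝ) • w₂ + (-q₂) • f ∈ W := W.add_mem (W.smul_mem _ hw₂W) (W.smul_mem _ hf)
    have w10 : w₁ t₀ = 0 := by
      simp only [hw₁, Pi.add_apply, Pi.smul_apply, smul_eq_mul, hq₀]; field_simp; ring
    have w20 : w₂ t₀ = 0 := by simp [hw₂, w10, h0]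
    have w21 : deriv w₂ t₀ = 0 := by rw [hw₂, d1 hw₁W hh, h1]; ring
    have key : (1:ℝ) • w₂ + (-q₂) • f = 0 := by
      refine hjet _ hw₃W ?_ ?_ ?_
      · simp [w20, f0]
      · rw [d1 hw₂W hf, w21, f1]; ring
      · rw [d2 hw₂W hf, f2, hq₂]; field_simp; ring
    refine ⟨q₀, q₁, q₂, ?_⟩
    have e2 : w = q₀ • e + q₁ • h + q₂ • f + ((1:ℝ) • w₂ + (-q₂) • f) := by
      rw [hw₂, hw₁]; module
    rwa [key, add_zero] at e2
  -- the bracket of `h` and `e`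
  obtain ⟨q₀, α, β, hhe⟩ := hspan _ (hW.closed h hh e he)
  have hq₀ : q₀ = -1 := by
    have := congrFun hhe t₀
    simp only [wr_of_mem ht, Pi.add_apply, Pi.smul_apply, smul_eq_mul, h0, h1, f0] at this
    have h' : (q₀ + 1) * e t₀ = 0 := by linarith
    linarith [(mul_eq_zero.1 h').resolve_right he0.ne']
  have hfne : f ≠ 0 := fun hz => by
    have : deriv (deriv f) t₀ = 0 := by rw [hz]; simp
    rw [f2] at this
    exact (div_pos two_pos he0).ne' this
  -- The Jacobi identity for `h, e, f`: the bracket of `h` with `2 h` vanishes, and what is left on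
  -- the other side is `α f`.
  have hα : α = 0 := by
    have hJ := hW.wr_jacobi hh he hf
    have hcomb : wr I h e = (1:ℝ) • (q₀ • e + α • h) + β • f := by rw [hhe, one_smul]
    have hm := W.add_mem (W.smul_mem q₀ he) (W.smul_mem α hh)
    have hz : wr I h ((2:ℝ) • h) = 0 := by
      have : (2:ℝ) • h = (2:ℝ) • h + (0:ℝ) • h := by module
      rw [this, hW.wr_comb_right hh hh hh, wr_self]
      simp
    rw [ef2, hz, hf_eq, ef2, hcomb, hW.wr_comb_left hf hm hf, hW.wr_comb_left hf he hh, wr_self,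
      hf_eq, ef2, hq₀] at hJ
    have : α • f = 0 := by rw [hJ]; module
    exact (smul_eq_zero.1 this).resolve_right hfne
  -- Now `[h, e] = -e + β f` and `[h, f] = f`, so subtracting `(β / 2) f` from `e` removes the last
  -- unwanted term.
  set e' := (1:ℝ) • e + (-(β / 2)) • f with he'
  have he'W : e' ∈ W := W.add_mem (W.smul_mem _ he) (W.smul_mem _ hf)
  refine ⟨e', he'W, h, hh, f, hf, ?_, ?_, hf_eq, ?_, ?_⟩
  · simpa [he', f0] using he0
  · rw [wr_swap, he', hW.wr_comb_right hh he hf, hhe, hf_eq, hq₀, hα]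
    module
  · rw [he', hW.wr_comb_left hf he hf, wr_self, ef2]
    module
  · intro w hw
    obtain ⟨p₀, p₁, p₂, hp⟩ := hspan w hw
    refine ⟨p₀, p₁, p₂ + p₀ * (β / 2), ?_⟩
    rw [hp, he']
    module

/-- A finite-dimensional Lie algebra of vector fields on the line is at most two-dimensional
modulo its centre, in the weak sense stated, or it is a copy of `sl(2,ℝ)`. -/
theorem classification (hW : LineAlgebra I W) [FiniteDimensional ℝ W] :
    (∃ z ∈ W, ∀ f ∈ W, ∀ g ∈ W, ∃ c : ℝ, wr I f g = c • z) ∨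
    ∃ t₀ ∈ I, ∃ e ∈ W, ∃ h ∈ W, ∃ f ∈ W, 0 < e t₀ ∧ wr I e h = e ∧ wr I h f = f ∧
      wr I e f = (2:ℝ) • h ∧ ∀ w ∈ W, ∃ q₀ q₁ q₂ : ℝ, w = q₀ • e + q₁ • h + q₂ • f := by
  by_cases hW0 : W = ⊥
  · refine Or.inl ⟨0, W.zero_mem, fun f hf g hg => ⟨0, ?_⟩⟩
    have := hW.closed f hf g hg
    rw [smul_zero]
    rwa [hW0, Submodule.mem_bot] at this
  obtain ⟨e₀, he₀, hne⟩ := Submodule.exists_mem_ne_zero_of_ne_bot hW0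
  obtain ⟨t₀, ht₀⟩ : ∃ t, e₀ t ≠ 0 := by
    by_contra! h; exact hne (funext h)
  have ht : t₀ ∈ I := by
    by_contra h; exact ht₀ (hW.zero_out e₀ he₀ t₀ h)
  obtain ⟨e, he, hepos⟩ : ∃ e ∈ W, 0 < e t₀ := by
    rcases lt_or_gt_of_ne ht₀ with hlt | hlt
    · exact ⟨-e₀, W.neg_mem he₀, by simpa using hlt⟩
    · exact ⟨e₀, he₀, hlt⟩
  classical
  have hex := hW.exists_vanishing_eq_bot ht he hepos.ne'
  obtain ⟨M, hM⟩ : ∃ M, Nat.find hex = M + 1 := by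
    refine Nat.exists_eq_succ_of_ne_zero fun h0 => ?_
    have h1 := Nat.find_spec hex
    rw [h0] at h1
    refine hne ?_
    have : e₀ ∈ hW.vanishing ht 0 := ⟨he₀, VanishesTo.zero _ _⟩
    rwa [h1, Submodule.mem_bot] at this
  have hM1 : hW.vanishing ht (M + 1) = ⊥ := hM ▸ Nat.find_spec hex
  have hM2 : hW.vanishing ht M ≠ ⊥ := Nat.find_min hex (by omega)
  have hle := hW.order_le_two ht he hepos.ne' hM1 hM2
  have hmono : ∀ {j k}, j ≤ k → hW.vanishing ht k ≤ hW.vanishing ht j := fun hjk f hf =>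
    ⟨hf.1, hf.2.mono hjk⟩
  by_cases hM3 : M = 2
  · subst hM3
    exact Or.inr ⟨t₀, ht, hW.exists_sl_two ht he hepos hM1 hM2⟩
  · refine Or.inl (hW.exists_derived_of_two ht he hepos.ne' ?_)
    rw [eq_bot_iff, ← hM1]
    exact hmono (by omega)

end LineAlgebra

/-! ### Subalgebras of the standard algebra that contain `sl(2,ℝ)` -/

/-- The bracket with `h = t ∂_t + …` has eigenvalue `-1/2` on the part `c` and `1/2` on the part
`d`, so the two parts of an element can be separated inside `M`. The third generator has eigenvalue
`1`, different from both, hence its translation part can be removed. Bracketing with the first and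
the third generator exchanges `c` and `d` up to sign, so both range over the same space. Products `a
* c` are brackets of scalings and translations. -/
theorem eq_ParSub {M : Submodule ℝ Par} (hbr : ∀ m ∈ M, ∀ m' ∈ M, parBr m m' ∈ M)
    (he : (![1, 0, 0], 0, 0, 0) ∈ M) (hh : (![0, 1, 0], 0, 0, 0) ∈ M) {c d : Site → ℝ}
    (hf : (![0, 0, 1], 0, c, d) ∈ M) :
    ∃ A C, M = ParSub A C ∧ ∀ a ∈ A, ∀ c ∈ C, a * c ∈ C := by
  have ext4 : ∀ {m m' : Par}, (∀ i, m.1 i = m'.1 i) → (∀ s, m.2.1 s = m'.2.1 s) →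
      (∀ s, m.2.2.1 s = m'.2.2.1 s) → (∀ s, m.2.2.2 s = m'.2.2.2 s) → m = m' :=
    fun a b c d => Prod.ext (funext a) (Prod.ext (funext b) (Prod.ext (funext c) (funext d)))
  have i : ∀ {d}, ((0, 0, 0, d) : Par) ∈ M → ((0, 0, d, 0) : Par) ∈ M := fun {d} hd => by
    convert hbr _ he _ hd using 1
    refine ext4 (fun i => ?_) ?_ ?_ ?_
    · fin_cases i <;> simp [parBr]
    all_goals intro s; simp [parBr]
  have ii : ∀ {c d}, ((0, 0, c, d) : Par) ∈ M →
      ((0, 0, c, 0) : Par) ∈ M ∧ ((0, 0, 0, d) : Par) ∈ M := fun {c d} hm => by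
    have h1 := hbr _ hh _ hm
    constructor
    · convert M.sub_mem (M.smul_mem (1 / 2 : ℝ) hm) h1 using 1
      refine ext4 (fun i => ?_) ?_ ?_ ?_
      · fin_cases i <;> simp [parBr]
      all_goals intro s; simp [parBr] <;> ring
    · convert M.add_mem (M.smul_mem (1 / 2 : ℝ) hm) h1 using 1
      refine ext4 (fun i => ?_) ?_ ?_ ?_
      · fin_cases i <;> simp [parBr]
      all_goals intro s; simp [parBr] <;> ring
  have hf' : ((![0, 0, 1], 0, 0, 0) : Par) ∈ M := by
    have h1 : ((0, 0, (-(3 / 2 : ℝ)) • c, (-(1 / 2) : ℝ) • d) : Par) ∈ M := by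
      convert M.sub_mem (hbr _ hh _ hf) hf using 1
      refine ext4 (fun i => ?_) ?_ ?_ ?_
      · fin_cases i <;> simp [parBr]
      all_goals intro s; simp [parBr] <;> ring
    obtain ⟨h2, h3⟩ := ii h1
    convert M.add_mem hf (M.add_mem (M.smul_mem (2 / 3 : ℝ) h2) (M.smul_mem (2 : ℝ) h3)) using 1
    refine ext4 (fun i => ?_) ?_ ?_ ?_
    · fin_cases i <;> simp
    all_goals intro s; simp <;> ring
  have iv : ∀ {c}, ((0, 0, c, 0) : Par) ∈ M → ((0, 0, 0, c) : Par) ∈ M := fun {c} hc => by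
    convert M.neg_mem (hbr _ hf' _ hc) using 1
    refine ext4 (fun i => ?_) ?_ ?_ ?_
    · fin_cases i <;> simp [parBr]
    all_goals intro s; simp [parBr]
  have hq : ∀ m ∈ M, ((0, m.2.1, m.2.2.1, m.2.2.2) : Par) ∈ M := fun m hm => by
    convert M.sub_mem hm (M.add_mem (M.smul_mem (m.1 0) he) (M.add_mem (M.smul_mem (m.1 1) hh)
      (M.smul_mem (m.1 2) hf'))) using 1
    refine ext4 (fun i => ?_) ?_ ?_ ?_
    · fin_cases i <;> simp
    all_goals intro s; simp
  have hcd : ∀ m ∈ M, ((0, 0, m.2.2.1, 0) : Par) ∈ M ∧ ((0, 0, 0, m.2.2.2) : Par) ∈ M := fun m hm => by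
    have h1 : ((0, 0, (-(1 / 2) : ℝ) • m.2.2.1, (1 / 2 : ℝ) • m.2.2.2) : Par) ∈ M := by
      convert hbr _ hh _ (hq m hm) using 1
      refine ext4 (fun i => ?_) ?_ ?_ ?_
      · fin_cases i <;> simp [parBr]
      all_goals intro s; simp [parBr] <;> ring
    obtain ⟨h2, h3⟩ := ii h1
    constructor
    · convert M.smul_mem (-2 : ℝ) h2 using 1
      refine ext4 ?_ ?_ ?_ ?_ <;> intro s <;> simp
    · convert M.smul_mem (2 : ℝ) h3 using 1
      refine ext4 ?_ ?_ ?_ ?_ <;> intro s <;> simp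
  refine ⟨M.comap parA, M.comap parC, ?_, ?_⟩
  · ext m
    rw [mem_ParSub, Submodule.mem_comap, Submodule.mem_comap, Submodule.mem_comap]
    constructor
    · intro hm
      refine ⟨?_, (hcd m hm).1, i (hcd m hm).2⟩
      convert M.sub_mem (hq m hm) (M.add_mem (hcd m hm).1 (hcd m hm).2) using 1
      refine ext4 ?_ ?_ ?_ ?_ <;> intro s <;> simp [parA]
    · rintro ⟨h1, h2, h3⟩
      have h4 := iv h3
      convert M.add_mem (M.add_mem (M.smul_mem (m.1 0) he) (M.add_mem (M.smul_mem (m.1 1) hh)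
        (M.smul_mem (m.1 2) hf'))) (M.add_mem h1 (M.add_mem h2 h4)) using 1
      refine ext4 (fun i => ?_) ?_ ?_ ?_
      · fin_cases i <;> simp [parA, parC]
      all_goals intro s; simp [parA, parC]
  · intro a ha c hc
    rw [Submodule.mem_comap] at ha hc ⊢
    convert M.neg_mem (hbr _ ha _ hc) using 1
    refine ext4 (fun i => ?_) ?_ ?_ ?_
    · fin_cases i <;> simp [parBr, parA, parC]
    all_goals intro s; simp [parBr, parA, parC] <;> ring

/-- In a representation of `sl(2,ℝ)` in which `E x = 0` implies `H x = -x/2`, the square of `E`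
vanishes. -/
theorem sq_eq_zero_of_sl_two {V : Type*} [AddCommGroup V] [Module ℝ V] [FiniteDimensional ℝ V]
    {E H F : Module.End ℝ V} (h1 : H * E - E * H = -E) (h2 : E * F - F * E = (2:ℝ) • H)
    (h3 : ∀ x, E x = 0 → H x = -(1 / 2 : ℝ) • x) : ∀ x, E (E x) = 0 := by
  have hHE : H * E = E * H - E := by rw [eq_sub_iff_add_eq, ← sub_eq_zero, ← sub_eq_zero.2 h1]; abel
  have hpow : ∀ k : ℕ, H * E ^ k = E ^ k * H - (k : ℝ) • E ^ k := by
    intro k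
    induction k with
    | zero => simp
    | succ k ih =>
      rw [pow_succ, ← mul_assoc, ih, sub_mul, mul_assoc, hHE, smul_mul_assoc, mul_sub, mul_assoc]
      push_cast
      module
  -- `E` is nilpotent
  have hnil : ∃ k : ℕ, E ^ k = 0 := by
    by_contra! hne
    -- Otherwise the powers of `E` would be eigenvectors of the commutator with `H` to infinitely
    -- many eigenvalues `-k`.
    set T : Module.End ℝ (Module.End ℝ V) := LinearMap.mulLeft ℝ H - LinearMap.mulRight ℝ H with hT
    have hev : ∀ k : ℕ, T.HasEigenvalue (-(k : ℝ)) := fun k =>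
      Module.End.hasEigenvalue_of_hasEigenvector (x := E ^ k)
        ⟨Module.End.mem_eigenspace_iff.2 (by
          rw [hT, LinearMap.sub_apply, LinearMap.mulLeft_apply, LinearMap.mulRight_apply, hpow]
          module), hne k⟩
    have hfin := T.finite_hasEigenvalue
    refine (Set.infinite_range_of_injective (f := fun k : ℕ => -(k : ℝ)) ?_) (hfin.subset ?_)
    · intro a b hab; simpa using hab
    · rintro _ ⟨k, rfl⟩; exact hev k
  have hcomm : ∀ k : ℕ, E ^ (k + 1) * F = F * E ^ (k + 1)
      + ((2 * (k + 1) : ℝ) • (E ^ k * H) - ((k : ℝ) * (k + 1)) • E ^ k) := by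
    intro k
    have hEF : E * F = F * E + (2:ℝ) • H := by rw [← h2]; abel
    induction k with
    | zero => simp [hEF]
    | succ k ih =>
      rw [pow_succ' E (k + 1), mul_assoc, ih, mul_add, ← mul_assoc, hEF, add_mul, mul_assoc,
        smul_mul_assoc, hpow (k + 1), mul_sub, mul_smul_comm, mul_smul_comm,
        show E * (E ^ k * H) = E ^ (k + 1) * H by rw [← mul_assoc, ← pow_succ'], ← pow_succ' E k,
        ← pow_succ' E (k + 1)]
      push_cast
      module
  classical
  intro x
  rcases Nat.eq_zero_or_pos (Nat.find hnil) with h0 | hpos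
  · have h := Nat.find_spec hnil
    rw [h0, pow_zero] at h
    have : E (E x) = (1 : Module.End ℝ V) (E (E x)) := rfl
    rw [this, h]; rfl
  · obtain ⟨k, hk⟩ : ∃ k, Nat.find hnil = k + 1 := ⟨Nat.find hnil - 1, by omega⟩
    have hk1 : E ^ (k + 1) = 0 := hk ▸ Nat.find_spec hnil
    have hk0 : E ^ k ≠ 0 := Nat.find_min hnil (by omega)
    have e1 := hcomm k
    rw [hk1, zero_mul, mul_zero, zero_add] at e1
    obtain ⟨v, hv⟩ : ∃ v, (E ^ k) v ≠ 0 := by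
      by_contra! h; exact hk0 (LinearMap.ext h)
    have hEv : E ((E ^ k) v) = 0 := by
      have : (E ^ (k + 1)) v = 0 := by rw [hk1]; rfl
      rwa [pow_succ'] at this
    have hHv := h3 _ hEv
    have e2 := congrArg (fun A : Module.End ℝ V => A v) (hpow k)
    have e3 := congrArg (fun A : Module.End ℝ V => A v) e1
    simp only [Module.End.mul_apply, LinearMap.sub_apply, LinearMap.smul_apply, LinearMap.zero_apply] at e2 e3
    rw [hHv] at e2
    have e4 : (E ^ k) (H v) = ((k : ℝ) - 1 / 2) • (E ^ k) v := by
      rw [eq_add_of_sub_eq e2.symm]; module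
    rw [e4] at e3
    -- On the highest nonzero power, the commutator with `F` gives `2 (k + 1) E^k H v = k (k + 1)
    -- E^k v`, while the weight `-1/2` gives `E^k H v = (k - 1/2) E^k v`. The difference of the two
    -- factors is `(k + 1) (k - 1)`.
    have e5 : (((k : ℝ) + 1) * (k - 1)) • (E ^ k) v = 0 := by rw [e3]; module
    have hk' : (k : ℝ) - 1 = 0 := by
      rcases smul_eq_zero.1 e5 with h | h
      · exact (mul_eq_zero.1 h).resolve_left (by positivity)
      · exact absurd h hv
    have : k = 1 := by exact_mod_cast sub_eq_zero.1 hk'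
    rw [this] at hk1
    have h := congrArg (fun A : Module.End ℝ V => A x) hk1
    simpa [pow_two] using h


/-! ### Arithmetic of affine fields -/

section
variable {D : LatticeDomain} {X Y : LatticeField} {τ τ₁ τ₂ : ℝ → ℝ} {a a₁ a₂ : Site → ℝ}
  {l l₁ l₂ : Site → ℝ → ℝ}

theorem IsAff.congr (h : IsAff D X τ a l) (hI : IsOpen D.I) (hτ : EqOn τ τ₁ D.I)
    (hl : ∀ s, EqOn (l s) (l₁ s) D.I) : IsAff D X τ₁ a l₁ where
  zero_out := h.zero_out
  eq s t u hp := by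
    rw [h.eq s t u hp, hτ hp.1, hl s hp.1, deriv_congr_on hI hτ hp.1]
  smooth_tau := h.smooth_tau.congr hτ.symm
  smooth_l s := (h.smooth_l s).congr (hl s).symm

theorem IsAff.add (h₁ : IsAff D X τ₁ a₁ l₁) (h₂ : IsAff D Y τ₂ a₂ l₂) (hI : IsOpen D.I) :
    IsAff D (X + Y) (τ₁ + τ₂) (a₁ + a₂) (l₁ + l₂) where
  zero_out s p hp := by
    rw [Pi.add_apply, Pi.add_apply, h₁.zero_out s p hp, h₂.zero_out s p hp, add_zero]
  eq s t u hp := by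
    rw [Pi.add_apply, Pi.add_apply, h₁.eq s t u hp, h₂.eq s t u hp,
      ((smooth_hasDerivAt hI h₁.smooth_tau hp.1).add (smooth_hasDerivAt hI h₂.smooth_tau hp.1)).deriv]
    refine Prod.ext rfl ?_
    simp only [Prod.mk_add_mk, Pi.add_apply]
    ring
  smooth_tau := h₁.smooth_tau.add h₂.smooth_tau
  smooth_l s := (h₁.smooth_l s).add (h₂.smooth_l s)

theorem IsAff.smul (h : IsAff D X τ a l) (hI : IsOpen D.I) (c : ℝ) :
    IsAff D (c • X) (c • τ) (c • a) (c • l) where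
  zero_out s p hp := by rw [Pi.smul_apply, Pi.smul_apply, h.zero_out s p hp, smul_zero]
  eq s t u hp := by
    rw [Pi.smul_apply, Pi.smul_apply, h.eq s t u hp,
      ((smooth_hasDerivAt hI h.smooth_tau hp.1).const_smul c).deriv]
    refine Prod.ext rfl ?_
    simp only [Prod.smul_mk, Pi.smul_apply, smul_eq_mul]
    ring
  smooth_tau := h.smooth_tau.const_smul c
  smooth_l s := (h.smooth_l s).const_smul c

theorem isAff_zero (D : LatticeDomain) : IsAff D 0 0 0 0 where
  zero_out _ _ _ := rfl
  eq s t u _ := by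
    refine Prod.ext rfl ?_
    show (0:ℝ) = (deriv (fun _ => (0:ℝ)) t / 2 + 0) * u + 0
    rw [deriv_const]
    ring
  smooth_tau := contDiffOn_const
  smooth_l _ := contDiffOn_const

theorem IsAff.ext (h₁ : IsAff D X τ a l) (h₂ : IsAff D Y τ a l) : X = Y := by
  funext s p
  by_cases hp : p ∈ D.plane s
  · rw [h₁.eq s p.1 p.2 hp, h₂.eq s p.1 p.2 hp]
  · rw [h₁.zero_out s p hp, h₂.zero_out s p hp]

theorem IsAff.isSmoothField (h : IsAff D X τ a l) (hD : D.Regular) : IsSmoothField D X :=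
  ⟨h.zero_out, h.smooth hD⟩

/-- The data of an affine field are determined by it. -/
theorem IsAff.unique (h₁ : IsAff D X τ₁ a₁ l₁) (h₂ : IsAff D X τ₂ a₂ l₂) (hD : D.Regular) :
    EqOn τ₁ τ₂ D.I ∧ a₁ = a₂ ∧ ∀ s, EqOn (l₁ s) (l₂ s) D.I := by
  have hτ : EqOn τ₁ τ₂ D.I := fun t ht => by
    obtain ⟨u, hu⟩ := hD.nonempty_J 0
    have h := (h₁.eq 0 t u ⟨ht, hu⟩).symm.trans (h₂.eq 0 t u ⟨ht, hu⟩)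
    exact congrArg Prod.fst h
  have key : ∀ s, ∀ t ∈ D.I, a₁ s = a₂ s ∧ l₁ s t = l₂ s t := by
    intro s t ht
    obtain ⟨u, hu, v, hv, huv⟩ := exists_ne_of_isOpen (hD.isOpen_J s) (hD.nonempty_J s)
    have e₁ := congrArg Prod.snd ((h₁.eq s t u ⟨ht, hu⟩).symm.trans (h₂.eq s t u ⟨ht, hu⟩))
    have e₂ := congrArg Prod.snd ((h₁.eq s t v ⟨ht, hv⟩).symm.trans (h₂.eq s t v ⟨ht, hv⟩))
    simp only [deriv_congr_on hD.isOpen_I hτ ht] at e₁ e₂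
    have ha : (a₁ s - a₂ s) * (u - v) = 0 := by linear_combination e₁ - e₂
    have ha' := sub_eq_zero.1 ((mul_eq_zero.1 ha).resolve_right (sub_ne_zero.2 huv))
    exact ⟨ha', by rw [ha'] at e₁; linarith⟩
  obtain ⟨t, ht⟩ := hD.nonempty_I
  exact ⟨hτ, funext fun s => (key s t ht).1, fun s t ht => (key s t ht).2⟩

/-- The bracket with a field that does not move the time. -/
theorem isAff_bracket_vertical (hD : D.Regular) (h₁ : IsAff D X τ 0 l₁) (h₂ : IsAff D Y 0 a l) :
    IsAff D (bracket X Y) 0 0 (fun s t => τ t * deriv (l s) t - l s t * deriv τ t / 2 + l₁ s t * a s) := by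
  have h0 : deriv (0 : ℝ → ℝ) = 0 := by
    show deriv (fun _ => (0:ℝ)) = 0
    rw [deriv_const']; rfl
  refine (IsAff.bracket hD h₁ h₂).congr hD.isOpen_I (fun t _ => ?_) (fun s t _ => ?_)
  · simp [h0]
  · simp only [h0, Pi.zero_apply]
    ring

/-- The fields of the form `λ_s(t) ∂_u` in `L`. -/
def verticals (D : LatticeDomain) (hI : IsOpen D.I) (L : Submodule ℝ LatticeField) :
    Submodule ℝ LatticeField where
  carrier := {X | X ∈ L ∧ ∃ l, IsAff D X 0 0 l}
  add_mem' := fun ⟨hX, l, h⟩ ⟨hY, l', h'⟩ => ⟨L.add_mem hX hY, l + l', by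
    simpa using h.add h' hI⟩
  zero_mem' := ⟨L.zero_mem, 0, isAff_zero D⟩
  smul_mem' := fun c _ ⟨hX, l, h⟩ => ⟨L.smul_mem c hX, c • l, by simpa using h.smul hI c⟩

end

/-! ### The action on translations -/

section
variable {I : Set ℝ} {e h θ l l' : ℝ → ℝ} {t : ℝ}

/-- The action of a field with time component `e` on the coefficients of translations. -/
noncomputable def eop (e l : ℝ → ℝ) (t : ℝ) : ℝ := e t * deriv l t - l t * deriv e t / 2

theorem smooth_eop (hI : IsOpen I) (he : ContDiffOn ℝ ∞ e I) (hl : ContDiffOn ℝ ∞ l I) :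
    ContDiffOn ℝ ∞ (eop e l) I :=
  (he.mul (smooth_deriv hI hl)).sub ((hl.mul (smooth_deriv hI he)).div_const 2)

theorem eop_congr (hI : IsOpen I) (hl : EqOn l l' I) : EqOn (eop e l) (eop e l') I := fun t ht => by
  rw [eop, eop, hl ht, deriv_congr_on hI hl ht]

theorem eop_comb (hI : IsOpen I) (hl : ContDiffOn ℝ ∞ l I) (hl' : ContDiffOn ℝ ∞ l' I) (ht : t ∈ I)
    (α β : ℝ) : eop e (fun t => α * l t + β * l' t) t = α * eop e l t + β * eop e l' t := by
  rw [eop, (((smooth_hasDerivAt hI hl ht).const_mul α).fun_add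
    ((smooth_hasDerivAt hI hl' ht).const_mul β)).deriv, eop, eop]
  ring

theorem eop_theta (hI : IsOpen I) (hl : ContDiffOn ℝ ∞ l I) (hθ : HasDerivAt θ (1 / e t) t)
    (he : e t ≠ 0) (ht : t ∈ I) : eop e (fun t => θ t * l t) t = l t + θ t * eop e l t := by
  rw [eop, (hθ.fun_mul (smooth_hasDerivAt hI hl ht)).deriv, eop]
  field_simp
  ring

theorem eop_sqrt (hI : IsOpen I) (he : ContDiffOn ℝ ∞ e I) (hpos : ∀ t ∈ I, 0 < e t) (ht : t ∈ I) :
    eop e (fun t => √(e t)) t = 0 := by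
  rw [eop, ((smooth_hasDerivAt hI he ht).sqrt (hpos t ht).ne').deriv]
  have h1 := Real.sqrt_pos.2 (hpos t ht)
  have h2 := Real.sq_sqrt (hpos t ht).le
  field_simp
  rw [h2]
  ring

theorem smooth_sqrt_of_pos (he : ContDiffOn ℝ ∞ e I) (hpos : ∀ t ∈ I, 0 < e t) :
    ContDiffOn ℝ ∞ (fun t => √(e t)) I := he.sqrt fun t ht => (hpos t ht).ne'

/-- The derivative of `l / √e` is `eop e l / (e √e)`. -/
theorem eq_const_mul_sqrt (hI : IsOpen I) (hc : I.OrdConnected) (hn : I.Nonempty)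
    (he : ContDiffOn ℝ ∞ e I) (hpos : ∀ t ∈ I, 0 < e t) (hl : ContDiffOn ℝ ∞ l I)
    (hz : ∀ t ∈ I, eop e l t = 0) : ∃ c : ℝ, ∀ t ∈ I, l t = c * √(e t) := by
  obtain ⟨t₀, ht₀⟩ := hn
  refine ⟨l t₀ / √(e t₀), fun t ht => ?_⟩
  have hs : ∀ t ∈ I, 0 < √(e t) := fun t ht => Real.sqrt_pos.2 (hpos t ht)
  have := const_of_hasDerivAt_zero (f := fun t => l t / √(e t)) hI hc (fun x hx => ?_) ht ht₀
  · exact (div_eq_iff (hs t ht).ne').1 this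
  · refine ((smooth_hasDerivAt hI hl hx).div ((smooth_hasDerivAt hI he hx).sqrt (hpos x hx).ne')
      (hs x hx).ne').congr_deriv ?_
    have h0 := hz x hx
    rw [eop] at h0
    have h1 := hs x hx
    have h2 := Real.sq_sqrt (hpos x hx).le
    rw [div_eq_zero_iff]
    left
    field_simp
    rw [h2]
    linarith

theorem eop_affine (hI : IsOpen I) (he : ContDiffOn ℝ ∞ e I) (hpos : ∀ t ∈ I, 0 < e t)
    (hθ : ∀ t ∈ I, HasDerivAt θ (1 / e t) t) (hθs : ContDiffOn ℝ ∞ θ I) (c d : ℝ) (ht : t ∈ I) :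
    eop e (fun t => (c + d * θ t) * √(e t)) t = d * √(e t) := by
  have hs := smooth_sqrt_of_pos he hpos
  have h1 : (fun t => (c + d * θ t) * √(e t)) = fun t => c * √(e t) + d * (θ t * √(e t)) := by
    funext t; ring
  rw [h1, eop_comb hI hs (hθs.mul hs) ht, eop_theta hI hs (hθ t ht) (hpos t ht).ne' ht,
    eop_sqrt hI he hpos ht]
  ring

/-- If the second power of the operator kills `l`, then `l` is `(c + d θ) √e`. -/
theorem eq_affine_mul_sqrt (hI : IsOpen I) (hc : I.OrdConnected) (hn : I.Nonempty)
    (he : ContDiffOn ℝ ∞ e I) (hpos : ∀ t ∈ I, 0 < e t) (hθ : ∀ t ∈ I, HasDerivAt θ (1 / e t) t)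
    (hθs : ContDiffOn ℝ ∞ θ I) (hl : ContDiffOn ℝ ∞ l I) (hz : ∀ t ∈ I, eop e (eop e l) t = 0) :
    ∃ c d : ℝ, ∀ t ∈ I, l t = (c + d * θ t) * √(e t) := by
  obtain ⟨d, hd⟩ := eq_const_mul_sqrt hI hc hn he hpos (smooth_eop hI he hl) hz
  have hs := smooth_sqrt_of_pos he hpos
  obtain ⟨c, hc⟩ := eq_const_mul_sqrt (l := fun t => 1 * l t + (-d) * (θ t * √(e t))) hI hc hn he hpos
    ((contDiffOn_const.mul hl).add (contDiffOn_const.mul (hθs.mul hs))) fun t ht => by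
      rw [eop_comb hI hl (hθs.mul hs) ht, hd t ht, eop_theta hI hs (hθ t ht) (hpos t ht).ne' ht,
        eop_sqrt hI he hpos ht]
      ring
  exact ⟨c, d, fun t ht => by linear_combination hc t ht⟩

/-- A function whose images under the operators are `(c + d θ) √e` is of this form as well. -/
theorem eq_affine_of_images (hI : IsOpen I) (hn : I.Nonempty)
    (he : ContDiffOn ℝ ∞ e I) (hpos : ∀ t ∈ I, 0 < e t) (hθ : ∀ t ∈ I, HasDerivAt θ (1 / e t) t)
    (hθs : ContDiffOn ℝ ∞ θ I) {k c₂ d₂ c₃ d₃ : ℝ} (hk : k ≠ 0) (hk2 : k ≠ 2)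
    (h₂ : ∀ t ∈ I, eop e l t = (c₂ + d₂ * θ t) * √(e t))
    (h₃ : ∀ t ∈ I, θ t * eop e l t - k * l t = (c₃ + d₃ * θ t) * √(e t)) :
    ∃ c d : ℝ, ∀ t ∈ I, l t = (c + d * θ t) * √(e t) := by
  have hs := smooth_sqrt_of_pos he hpos
  have hsp : ∀ t ∈ I, √(e t) ≠ 0 := fun t ht => (Real.sqrt_pos.2 (hpos t ht)).ne'
  have hl : EqOn l (fun t => (1 / k) * (θ t * ((c₂ + d₂ * θ t) * √(e t)))
      + (-(1 / k)) * ((c₃ + d₃ * θ t) * √(e t))) I := fun t ht => by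
    have := h₃ t ht
    rw [h₂ t ht] at this
    have e1 : l t * k = θ t * ((c₂ + d₂ * θ t) * √(e t)) - (c₃ + d₃ * θ t) * √(e t) := by linarith
    rw [← eq_div_iff hk] at e1
    rw [e1]; ring
  have haff : ∀ c d : ℝ, ContDiffOn ℝ ∞ (fun t => (c + d * θ t) * √(e t)) I := fun c d =>
    (contDiffOn_const.add (contDiffOn_const.mul hθs)).mul hs
  -- The second relation makes `l` a quadratic in `θ` times `√e`, and the first then becomes this
  -- identity. Since `θ` is not constant and `k ≠ 2`, the quadratic coefficient vanishes.
  have key : ∀ t ∈ I, c₂ * (k - 1) + d₃ = d₂ * (2 - k) * θ t := fun t ht => by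
    have e1 := (eop_congr (e := e) hI hl ht).symm.trans (h₂ t ht)
    rw [eop_comb hI (hθs.mul (haff _ _)) (haff _ _) ht, eop_theta hI (haff _ _) (hθ t ht)
      (hpos t ht).ne' ht, eop_affine hI he hpos hθ hθs _ _ ht, eop_affine hI he hpos hθ hθs _ _ ht] at e1
    have e2 : ((c₂ * (k - 1) + d₃) - d₂ * (2 - k) * θ t) * √(e t) = 0 := by
      field_simp at e1
      linear_combination (-1 : ℝ) * e1
    exact sub_eq_zero.1 ((mul_eq_zero.1 e2).resolve_right (hsp t ht))
  have hd₂ : d₂ = 0 := by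
    obtain ⟨t, ht⟩ := hn
    have h1 : HasDerivAt (fun t => d₂ * (2 - k) * θ t) (d₂ * (2 - k) * (1 / e t)) t :=
      (hθ t ht).const_mul _
    have h2 : HasDerivAt (fun t => d₂ * (2 - k) * θ t) 0 t :=
      (hasDerivAt_const t (c₂ * (k - 1) + d₃)).congr_of_eventuallyEq (by
        filter_upwards [hI.mem_nhds ht] with x hx
        exact (key x hx).symm)
    have h3 := h1.unique h2
    have hep := (hpos t ht).ne'
    rcases mul_eq_zero.1 h3 with h | h
    · exact (mul_eq_zero.1 h).resolve_right (sub_ne_zero.2 hk2.symm)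
    · exact absurd h (one_div_ne_zero hep)
  refine ⟨-(1 / k) * c₃, (1 / k) * c₂ - (1 / k) * d₃, fun t ht => ?_⟩
  rw [hl ht, hd₂]
  ring

end

/-! ### Normal form of an algebra with a copy of `sl(2,ℝ)` -/

/-- The algebra `L` contains fields with time components `e`, `h`, `f` that span a copy of
`sl(2,ℝ)` modulo the fields without time component. -/
structure SlData (D : LatticeDomain) (L : Submodule ℝ LatticeField) (Xe Xh Xf : LatticeField)
    (e h f : ℝ → ℝ) (le lh lf : Site → ℝ → ℝ) : Prop where
  closed : ∀ X ∈ L, ∀ Y ∈ L, bracket X Y ∈ L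
  mem_e : Xe ∈ L
  mem_h : Xh ∈ L
  mem_f : Xf ∈ L
  aff_e : IsAff D Xe e 0 le
  aff_h : IsAff D Xh h 0 lh
  aff_f : IsAff D Xf f 0 lf
  pos : ∀ t ∈ D.I, 0 < e t
  rel_eh : ∀ t ∈ D.I, e t * deriv h t - h t * deriv e t = e t
  rel_hf : ∀ t ∈ D.I, h t * deriv f t - f t * deriv h t = f t
  rel_ef : ∀ t ∈ D.I, e t * deriv f t - f t * deriv e t = 2 * h t
  span : ∀ X ∈ L, ∃ q₀ q₁ q₂ : ℝ, ∃ k ∈ L, X = q₀ • Xe + q₁ • Xh + q₂ • Xf + k ∧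
    ∃ a l, IsAff D k 0 a l

section
variable {D : LatticeDomain} {L : Submodule ℝ LatticeField} {X Y Z : LatticeField}
  {τ : ℝ → ℝ} {a : Site → ℝ} {l l' l'' : Site → ℝ → ℝ}

/-- The action of an element of `L` on the vertical fields in `L`. -/
noncomputable def adMap (hD : D.Regular) (hcl : ∀ X ∈ L, ∀ Y ∈ L, bracket X Y ∈ L) (hX : X ∈ L)
    (h : IsAff D X τ 0 l) : Module.End ℝ (verticals D hD.isOpen_I L) where
  toFun Y := ⟨bracket X Y, hcl X hX Y Y.2.1, by
    obtain ⟨l', h'⟩ := Y.2.2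
    exact ⟨_, isAff_bracket_vertical hD h h'⟩⟩
  map_add' Y Z := Subtype.ext <| by
    obtain ⟨l', h'⟩ := Y.2.2
    obtain ⟨l'', h''⟩ := Z.2.2
    exact bracket_add_right hD (h.isSmoothField hD) (h'.isSmoothField hD) (h''.isSmoothField hD)
  map_smul' c Y := Subtype.ext <| by
    obtain ⟨l', h'⟩ := Y.2.2
    exact bracket_smul_right hD (h.isSmoothField hD) (h'.isSmoothField hD) c

theorem IsAff.sub_eq_smul (hI : IsOpen D.I) (h : IsAff D X 0 0 l) (h' : IsAff D Y 0 0 l')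
    (h'' : IsAff D Z 0 0 l'') {r : ℝ} (hr : ∀ s, ∀ t ∈ D.I, l s t - l' s t = r * l'' s t) :
    X - Y = r • Z := by
  have e₁ := (h.add (h'.smul hI (-1)) hI).congr (τ₁ := 0) (l₁ := r • l'') hI (fun t _ => by simp)
    fun s t ht => by
      have := hr s t ht
      simp only [Pi.add_apply, Pi.smul_apply, smul_eq_mul]
      linarith
  have e₂ := h''.smul hI r
  simp only [smul_zero, add_zero] at e₁ e₂
  rw [sub_eq_add_neg, ← neg_one_smul ℝ Y]
  exact e₁.ext e₂

end

/-! ### The new time, the adjoint action, and the form of the translations -/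

namespace SlData
variable {D : LatticeDomain} {L : Submodule ℝ LatticeField} {Xe Xh Xf Y : LatticeField}
  {e h f : ℝ → ℝ} {le lh lf l : Site → ℝ → ℝ} {a : Site → ℝ} {t : ℝ}

/-- The new time. -/
noncomputable def theta (_ : SlData D L Xe Xh Xf e h f le lh lf) (t : ℝ) : ℝ := h t / e t

variable (S : SlData D L Xe Xh Xf e h f le lh lf)
include S

theorem h_eq (ht : t ∈ D.I) : h t = e t * S.theta t := by
  rw [theta, mul_div_cancel₀ _ (S.pos t ht).ne']

theorem smooth_theta : ContDiffOn ℝ ∞ S.theta D.I :=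
  S.aff_h.smooth_tau.div S.aff_e.smooth_tau fun t ht => (S.pos t ht).ne'

theorem hasDerivAt_theta (hD : D.Regular) (ht : t ∈ D.I) : HasDerivAt S.theta (1 / e t) t := by
  have hp := (S.pos t ht).ne'
  refine ((smooth_hasDerivAt hD.isOpen_I S.aff_h.smooth_tau ht).div
    (smooth_hasDerivAt hD.isOpen_I S.aff_e.smooth_tau ht) hp).congr_deriv ?_
  have := S.rel_eh t ht
  rw [show deriv h t * e t - h t * deriv e t = e t by linarith]
  field_simp

theorem deriv_h (ht : t ∈ D.I) : deriv h t = 1 + S.theta t * deriv e t := by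
  have hp := (S.pos t ht).ne'
  have := S.rel_eh t ht
  rw [theta]
  field_simp
  linarith

/-- The three relations together give `e f = h²`. So in the time `θ` the three components are those
of `∂, θ ∂, θ² ∂`. -/
theorem f_eq (ht : t ∈ D.I) : f t = e t * S.theta t ^ 2 := by
  have hp := (S.pos t ht).ne'
  have h1 := S.rel_eh t ht
  have h2 := S.rel_hf t ht
  have h3 := S.rel_ef t ht
  have h4 : e t * f t = h t ^ 2 := by
    have : (h t * deriv f t - f t * deriv h t) * e t = f t * e t := by rw [h2]
    have e1 : h t * (e t * deriv f t) - f t * (e t * deriv h t) = f t * e t := by linarith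
    rw [show e t * deriv f t = 2 * h t + f t * deriv e t by linarith,
      show e t * deriv h t = e t + h t * deriv e t by linarith] at e1
    nlinarith
  rw [theta]
  field_simp
  linarith

theorem deriv_f (ht : t ∈ D.I) : deriv f t = 2 * S.theta t + S.theta t ^ 2 * deriv e t := by
  have hp := (S.pos t ht).ne'
  have h3 := S.rel_ef t ht
  rw [S.f_eq ht, S.h_eq ht] at h3
  have : e t * (deriv f t - (2 * S.theta t + S.theta t ^ 2 * deriv e t)) = 0 := by linarith
  exact sub_eq_zero.1 ((mul_eq_zero.1 this).resolve_left hp)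

theorem ad_e (hD : D.Regular) (hY : IsAff D Y 0 a l) :
    IsAff D (bracket Xe Y) 0 0 (fun s t => eop e (l s) t + le s t * a s) :=
  isAff_bracket_vertical hD S.aff_e hY

theorem ad_h (hD : D.Regular) (hY : IsAff D Y 0 a l) :
    IsAff D (bracket Xh Y) 0 0 (fun s t => S.theta t * eop e (l s) t - l s t / 2 + lh s t * a s) :=
  (isAff_bracket_vertical hD S.aff_h hY).congr hD.isOpen_I (fun _ _ => rfl) fun s t ht => by
    simp only [eop]
    rw [S.h_eq ht, S.deriv_h ht]
    ring

theorem ad_f (hD : D.Regular) (hY : IsAff D Y 0 a l) :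
    IsAff D (bracket Xf Y) 0 0
      (fun s t => S.theta t ^ 2 * eop e (l s) t - S.theta t * l s t + lf s t * a s) :=
  (isAff_bracket_vertical hD S.aff_f hY).congr hD.isOpen_I (fun _ _ => rfl) fun s t ht => by
    simp only [eop]
    rw [S.f_eq ht, S.deriv_f ht]
    ring

theorem eop_theta' (hD : D.Regular) {m : ℝ → ℝ} (hm : ContDiffOn ℝ ∞ m D.I) (ht : t ∈ D.I) :
    eop e (fun t => S.theta t * m t) t = m t + S.theta t * eop e m t :=
  eop_theta hD.isOpen_I hm (S.hasDerivAt_theta hD ht) (S.pos t ht).ne' ht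

theorem smooth_eop' (hD : D.Regular) {m : ℝ → ℝ} (hm : ContDiffOn ℝ ∞ m D.I) :
    ContDiffOn ℝ ∞ (eop e m) D.I := smooth_eop hD.isOpen_I S.aff_e.smooth_tau hm

/-- The action of `h` on coefficients, followed by that of `e`. -/
theorem eop_hop (hD : D.Regular) {m : ℝ → ℝ} (hm : ContDiffOn ℝ ∞ m D.I) (ht : t ∈ D.I) :
    eop e (fun t => S.theta t * eop e m t - m t / 2) t =
      eop e m t / 2 + S.theta t * eop e (eop e m) t := by
  have h1 : (fun t => S.theta t * eop e m t - m t / 2) =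
      fun t => 1 * (S.theta t * eop e m t) + (-(1 / 2)) * m t := by funext t; ring
  have hs := S.smooth_eop' hD hm
  rw [h1, eop_comb hD.isOpen_I (S.smooth_theta.mul hs) hm ht, S.eop_theta' hD hs ht]
  ring

theorem eop_fop (hD : D.Regular) {m : ℝ → ℝ} (hm : ContDiffOn ℝ ∞ m D.I) (ht : t ∈ D.I) :
    eop e (fun t => S.theta t ^ 2 * eop e m t - S.theta t * m t) t =
      S.theta t * eop e m t - m t + S.theta t ^ 2 * eop e (eop e m) t := by
  have hs := S.smooth_eop' hD hm
  have h1 : (fun t => S.theta t ^ 2 * eop e m t - S.theta t * m t) =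
      fun t => 1 * (S.theta t * (S.theta t * eop e m t)) + (-1) * (S.theta t * m t) := by
    funext t; ring
  rw [h1, eop_comb hD.isOpen_I (S.smooth_theta.mul (S.smooth_theta.mul hs)) (S.smooth_theta.mul hm) ht,
    S.eop_theta' hD (S.smooth_theta.mul hs) ht, S.eop_theta' hD hs ht, S.eop_theta' hD hm ht]
  ring

/-- The coefficients of the translations in `L`. -/
theorem vertical_form (hD : D.Regular) [FiniteDimensional ℝ L] (hY : Y ∈ L) (hl : IsAff D Y 0 0 l) :
    ∃ c d : Site → ℝ, ∀ s, ∀ t ∈ D.I, l s t = (c s + d s * S.theta t) * √(e t) := by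
  have hI := hD.isOpen_I
  set T := verticals D hI L
  have : FiniteDimensional ℝ T := Submodule.finiteDimensional_of_le (S₂ := L) fun _ h => h.1
  set E := adMap hD S.closed S.mem_e S.aff_e
  set H := adMap hD S.closed S.mem_h S.aff_h
  set F := adMap hD S.closed S.mem_f S.aff_f
  have ade : ∀ {Y l}, IsAff D Y 0 0 l → IsAff D (bracket Xe Y) 0 0 (fun s => eop e (l s)) :=
    fun h => by simpa using S.ad_e hD h
  have adh : ∀ {Y l}, IsAff D Y 0 0 l →
      IsAff D (bracket Xh Y) 0 0 (fun s t => S.theta t * eop e (l s) t - l s t / 2) :=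
    fun h => by simpa using S.ad_h hD h
  have adf : ∀ {Y l}, IsAff D Y 0 0 l →
      IsAff D (bracket Xf Y) 0 0 (fun s t => S.theta t ^ 2 * eop e (l s) t - S.theta t * l s t) :=
    fun h => by simpa using S.ad_f hD h
  have h1 : H * E - E * H = -E := by
    refine LinearMap.ext fun Z => Subtype.ext ?_
    obtain ⟨l, hl⟩ := Z.2.2
    have := (adh (ade hl)).sub_eq_smul hI (ade (adh hl)) (ade hl) (r := -1) fun s t ht => by
      simp only [S.eop_hop hD (hl.smooth_l s) ht]
      ring
    rw [neg_one_smul] at this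
    exact this
  have h2 : E * F - F * E = (2:ℝ) • H := by
    refine LinearMap.ext fun Z => Subtype.ext ?_
    obtain ⟨l, hl⟩ := Z.2.2
    exact (ade (adf hl)).sub_eq_smul hI (adf (ade hl)) (adh hl) (r := 2) fun s t ht => by
      simp only [S.eop_fop hD (hl.smooth_l s) ht]
      ring
  -- On coefficients, the action of `h` is `θ` times that of `e`, minus `1/2`.
  have h3 : ∀ x, E x = 0 → H x = -(1 / 2 : ℝ) • x := by
    intro x hx
    obtain ⟨l, hl⟩ := x.2.2
    have h0 : bracket Xe x = 0 := congrArg Subtype.val hx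
    have hz := ((h0 ▸ ade hl).unique (isAff_zero D) hD).2.2
    refine Subtype.ext ?_
    have := (adh hl).sub_eq_smul hI (isAff_zero D) hl (r := -(1 / 2)) fun s t ht => by
      rw [hz s ht]
      simp only [Pi.zero_apply]
      ring
    rw [sub_zero] at this
    exact this
  have hE := sq_eq_zero_of_sl_two h1 h2 h3 ⟨Y, hY, l, hl⟩
  have h0 : bracket Xe (bracket Xe Y) = 0 := congrArg Subtype.val hE
  have hz := ((h0 ▸ ade (ade hl)).unique (isAff_zero D) hD).2.2
  have key : ∀ s, ∃ c d : ℝ, ∀ t ∈ D.I, l s t = (c + d * S.theta t) * √(e t) := fun s =>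
    eq_affine_mul_sqrt hI hD.ordConnected_I hD.nonempty_I S.aff_e.smooth_tau S.pos
      (fun t ht => S.hasDerivAt_theta hD ht) S.smooth_theta (hl.smooth_l s) fun t ht => hz s ht
  choose c d hcd using key
  exact ⟨c, d, hcd⟩

theorem eop_affine' (hD : D.Regular) (c d : ℝ) (ht : t ∈ D.I) :
    eop e (fun t => (c + d * S.theta t) * √(e t)) t = d * √(e t) :=
  eop_affine hD.isOpen_I S.aff_e.smooth_tau S.pos (fun _ ht => S.hasDerivAt_theta hD ht)
    S.smooth_theta c d ht

/-- Correcting `Xe` by a translation, the bracket of `Xe` and `Xh` becomes `Xe`. -/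
theorem exists_corrected (hD : D.Regular) [FiniteDimensional ℝ L] :
    ∃ Xe' le', SlData D L Xe' Xh Xf e h f le' lh lf ∧
      ∀ s, ∀ t ∈ D.I, eop e (lh s) t = h t / e t * eop e (le' s) t + le' s t / 2 := by
  have hI := hD.isOpen_I
  have hb := (IsAff.bracket hD S.aff_e S.aff_h).add (S.aff_e.smul hI (-1)) hI
  have hv : IsAff D (bracket Xe Xh + (-1 : ℝ) • Xe) 0 0 (fun s t => eop e (lh s) t -
      (S.theta t * eop e (le s) t - le s t / 2) - le s t) := by
    have := hb.congr (τ₁ := 0) (l₁ := fun s t => eop e (lh s) t -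
      (S.theta t * eop e (le s) t - le s t / 2) - le s t) hI (fun t ht => ?_) fun s t ht => ?_
    · simpa using this
    · have := S.rel_eh t ht
      simp only [Pi.add_apply, Pi.smul_apply, smul_eq_mul, Pi.zero_apply]
      linarith
    · simp only [Pi.add_apply, Pi.smul_apply, smul_eq_mul, Pi.zero_apply, eop]
      rw [S.h_eq ht, S.deriv_h ht]
      ring
  set t₁ := bracket Xe Xh + (-1 : ℝ) • Xe with ht₁
  have ht₁L : t₁ ∈ L := L.add_mem (S.closed _ S.mem_e _ S.mem_h) (L.smul_mem _ S.mem_e)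
  obtain ⟨c, d, hcd⟩ := S.vertical_form hD ht₁L hv
  have hv' : IsAff D t₁ 0 0 (fun s t => (c s + d s * S.theta t) * √(e t)) :=
    hv.congr hI (fun _ _ => rfl) fun s t ht => hcd s t ht
  have hbh := S.ad_h hD hv'
  -- The correction has to satisfy `[Xh, x] + x = t₁`. The action of `Xh` is `-1/2` on `c √e` and
  -- `1/2` on `d θ √e`, so `x` must have the coefficients `2 c` and `(2/3) d`. This combination has
  -- them and visibly lies in `L`.
  set x := (-(4 / 3) : ℝ) • (bracket Xh t₁ + (-1 : ℝ) • t₁) with hx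
  have hxL : x ∈ L := L.smul_mem _ (L.add_mem (S.closed _ S.mem_h _ ht₁L) (L.smul_mem _ ht₁L))
  have hxa : IsAff D x 0 0 (fun s t => (2 * c s + 2 / 3 * d s * S.theta t) * √(e t)) := by
    have := ((hbh.add (hv'.smul hI (-1)) hI).smul hI (-(4 / 3))).congr (τ₁ := 0)
      (l₁ := fun s t => (2 * c s + 2 / 3 * d s * S.theta t) * √(e t)) hI (fun t _ => by simp)
      fun s t ht => ?_
    · simp only [smul_zero, add_zero] at this
      exact this
    · simp only [Pi.add_apply, Pi.smul_apply, smul_eq_mul, Pi.zero_apply]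
      rw [S.eop_affine' hD _ _ ht]
      ring
  set lx : Site → ℝ → ℝ := fun s t => (2 * c s + 2 / 3 * d s * S.theta t) * √(e t) with hlx
  refine ⟨Xe + x, le + lx, { S with
    mem_e := L.add_mem S.mem_e hxL
    aff_e := by simpa using S.aff_e.add hxa hI
    span := ?_ }, ?_⟩
  · intro X hX
    obtain ⟨q₀, q₁, q₂, k, hk, hXk, a, l, ha⟩ := S.span X hX
    refine ⟨q₀, q₁, q₂, k + (-q₀) • x, L.add_mem hk (L.smul_mem _ hxL), ?_, a, l + (-q₀) • lx, ?_⟩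
    · rw [hXk]; module
    · simpa using ha.add (hxa.smul hI (-q₀)) hI
  · intro s t ht
    have e1 := hcd s t ht
    have e2 : eop e ((le + lx) s) t = eop e (le s) t + 2 / 3 * d s * √(e t) := by
      have h1 : (le + lx) s = fun t => 1 * le s t + 1 * ((2 * c s + 2 / 3 * d s * S.theta t) * √(e t)) := by
        funext t; simp [hlx]
      rw [h1, eop_comb hI (S.aff_e.smooth_l s) (hxa.smooth_l s) ht, S.eop_affine' hD _ _ ht]
      ring
    have e3 : h t / e t = S.theta t := rfl
    rw [e2, e3]
    simp only [Pi.add_apply, hlx]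
    linear_combination e1

end SlData

/-! ### The normalising transformation -/

namespace SlData
variable {D : LatticeDomain} {L : Submodule ℝ LatticeField} {Xe Xh Xf Y : LatticeField}
  {e h f : ℝ → ℝ} {le lh lf l : Site → ℝ → ℝ} {a : Site → ℝ} {t : ℝ}

/-- The transformation that brings the algebra to its normal form. -/
noncomputable def normalMap (S : SlData D L Xe Xh Xf e h f le lh lf) : AllowedMap where
  θ := S.theta
  P := fun _ => 1
  Q := fun s t => 2 * (S.theta t * le s t) + (-2) * lh s t

variable (S : SlData D L Xe Xh Xf e h f le lh lf)
include S

theorem normalMap_admissible (hD : D.Regular) : S.normalMap.Admissible D.I := by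
  refine ⟨S.smooth_theta, fun t ht => ?_, fun _ => one_ne_zero, fun s => ?_⟩
  · show 0 < deriv S.theta t
    rw [(S.hasDerivAt_theta hD ht).deriv]
    exact one_div_pos.2 (S.pos t ht)
  · exact (contDiffOn_const.mul (S.smooth_theta.mul (S.aff_e.smooth_l s))).add
      (contDiffOn_const.mul (S.aff_h.smooth_l s))

theorem eq_pbF (hD : D.Regular) {X : LatticeField} {τ : ℝ → ℝ} (q : Fin 3 → ℝ) (c d : Site → ℝ)
    (hX : IsAff D X τ a l) (hτ : ∀ t ∈ D.I, τ t = e t * quad q (S.theta t))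
    (hl : ∀ s, ∀ t ∈ D.I, l s t = τ t * deriv (S.normalMap.Q s) t
      - (deriv τ t / 2 + a s) * S.normalMap.Q s t + (c s + d s * S.theta t) * √(e t)) :
    X = pbF D S.normalMap (q, a, c, d) := by
  have hI := hD.isOpen_I
  have h1 : EqOn τ (pbTau S.normalMap (q, a, c, d)) D.I := fun t ht => by
    rw [hτ t ht, pbTau]
    show _ = quad q (S.theta t) / deriv S.theta t
    rw [(S.hasDerivAt_theta hD ht).deriv, div_div_eq_mul_div, div_one, mul_comm]
  refine (hX.congr hI h1 fun s t ht => ?_).ext (pbF_isAff hD (S.normalMap_admissible hD) (q, a, c, d))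
  rw [hl s t ht, pbL, ← h1 ht, ← deriv_congr_on hI h1 ht]
  show _ = _ + 1 * (c s + d s * S.theta t) / √(deriv S.theta t)
  rw [(S.hasDerivAt_theta hD ht).deriv, one_div, Real.sqrt_inv, div_inv_eq_mul, one_mul]

theorem affine_of_images (hD : D.Regular) {k : ℝ} (hk : k ≠ 0) (hk2 : k ≠ 2) {c₂ d₂ c₃ d₃ : Site → ℝ}
    (h₂ : ∀ s, ∀ t ∈ D.I, eop e (l s) t = (c₂ s + d₂ s * S.theta t) * √(e t))
    (h₃ : ∀ s, ∀ t ∈ D.I, S.theta t * eop e (l s) t - k * l s t = (c₃ s + d₃ s * S.theta t) * √(e t)) :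
    ∃ c d : Site → ℝ, ∀ s, ∀ t ∈ D.I, l s t = (c s + d s * S.theta t) * √(e t) := by
  have key := fun s => eq_affine_of_images hD.isOpen_I hD.nonempty_I S.aff_e.smooth_tau S.pos
    (fun t ht => S.hasDerivAt_theta hD ht) S.smooth_theta hk hk2 (h₂ s) (h₃ s)
  choose c d hcd using key
  exact ⟨c, d, hcd⟩

theorem smooth_Q (hD : D.Regular) (s : Site) : ContDiffOn ℝ ∞ (S.normalMap.Q s) D.I :=
  (S.normalMap_admissible hD).2.2.2 s

/-- In the new variables `Xh` has no inhomogeneous part when `θ le - Q / 2 = lh` holds for a `Q`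
with `eop e Q = le`, which is the same requirement for `Xe`. The first equation is the definition of
`Q`; the relation `hco`, obtained by correcting `Xe`, makes this `Q` satisfy the second. -/
theorem eop_Q (hD : D.Regular)
    (hco : ∀ s, ∀ t ∈ D.I, eop e (lh s) t = S.theta t * eop e (le s) t + le s t / 2) (s : Site)
    (ht : t ∈ D.I) : eop e (S.normalMap.Q s) t = le s t := by
  show eop e (fun t => 2 * (S.theta t * le s t) + (-2) * lh s t) t = _
  rw [eop_comb hD.isOpen_I (S.smooth_theta.mul (S.aff_e.smooth_l s)) (S.aff_h.smooth_l s) ht,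
    S.eop_theta' hD (S.aff_e.smooth_l s) ht, hco s t ht]
  ring

theorem e_eq_pbF (hD : D.Regular)
    (hco : ∀ s, ∀ t ∈ D.I, eop e (lh s) t = S.theta t * eop e (le s) t + le s t / 2) :
    Xe = pbF D S.normalMap (![1, 0, 0], 0, 0, 0) := by
  refine S.eq_pbF hD _ _ _ S.aff_e (fun t _ => by simp [quad]) fun s t ht => ?_
  rw [← S.eop_Q hD hco s ht, eop]
  simp only [Pi.zero_apply]
  ring

theorem h_eq_pbF (hD : D.Regular)
    (hco : ∀ s, ∀ t ∈ D.I, eop e (lh s) t = S.theta t * eop e (le s) t + le s t / 2) :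
    Xh = pbF D S.normalMap (![0, 1, 0], 0, 0, 0) := by
  refine S.eq_pbF hD _ _ _ S.aff_h (fun t ht => by simp [quad, S.h_eq ht]) fun s t ht => ?_
  have h1 := S.eop_Q hD hco s ht
  have h2 : S.normalMap.Q s t = 2 * (S.theta t * le s t) + (-2) * lh s t := rfl
  rw [← h1, eop] at h2
  rw [S.h_eq ht, S.deriv_h ht]
  simp only [Pi.zero_apply]
  linear_combination (1 / 2 : ℝ) * h2

/-- The fields `[Xe, Xf] - 2 Xh` and `[Xh, Xf] - Xf` are translations in `L`, hence of known form.
They are the two images that determine the deviation of `Xf` from its standard form; the constant is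
`k = 1/2 + 1`. -/
theorem f_eq_pbF (hD : D.Regular) [FiniteDimensional ℝ L]
    (hco : ∀ s, ∀ t ∈ D.I, eop e (lh s) t = S.theta t * eop e (le s) t + le s t / 2) :
    ∃ c d, Xf = pbF D S.normalMap (![0, 0, 1], 0, c, d) := by
  have hI := hD.isOpen_I
  have v₂ : IsAff D (bracket Xe Xf + (-2 : ℝ) • Xh) 0 0 (fun s t => eop e (lf s) t
      - (S.theta t ^ 2 * eop e (le s) t - S.theta t * le s t) - 2 * lh s t) := by
    have := ((IsAff.bracket hD S.aff_e S.aff_f).add (S.aff_h.smul hI (-2)) hI).congr (τ₁ := 0)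
      (l₁ := fun s t => eop e (lf s) t
        - (S.theta t ^ 2 * eop e (le s) t - S.theta t * le s t) - 2 * lh s t) hI
      (fun t ht => ?_) fun s t ht => ?_
    · simpa using this
    · have := S.rel_ef t ht
      simp only [Pi.add_apply, Pi.smul_apply, smul_eq_mul, Pi.zero_apply]
      linarith
    · simp only [Pi.add_apply, Pi.smul_apply, smul_eq_mul, Pi.zero_apply, eop]
      rw [S.f_eq ht, S.deriv_f ht]
      ring
  have v₃ : IsAff D (bracket Xh Xf + (-1 : ℝ) • Xf) 0 0 (fun s t => S.theta t * eop e (lf s) t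
      - lf s t / 2 - (S.theta t ^ 2 * eop e (lh s) t - S.theta t * lh s t) - lf s t) := by
    have := ((IsAff.bracket hD S.aff_h S.aff_f).add (S.aff_f.smul hI (-1)) hI).congr (τ₁ := 0)
      (l₁ := fun s t => S.theta t * eop e (lf s) t
      - lf s t / 2 - (S.theta t ^ 2 * eop e (lh s) t - S.theta t * lh s t) - lf s t) hI
      (fun t ht => ?_) fun s t ht => ?_
    · simpa using this
    · have := S.rel_hf t ht
      simp only [Pi.add_apply, Pi.smul_apply, smul_eq_mul, Pi.zero_apply]
      linarith
    · simp only [Pi.add_apply, Pi.smul_apply, smul_eq_mul, Pi.zero_apply, eop]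
      rw [S.f_eq ht, S.deriv_f ht, S.h_eq ht, S.deriv_h ht]
      ring
  obtain ⟨c₂, d₂, h₂⟩ := S.vertical_form hD
    (L.add_mem (S.closed _ S.mem_e _ S.mem_f) (L.smul_mem _ S.mem_h)) v₂
  obtain ⟨c₃, d₃, h₃⟩ := S.vertical_form hD
    (L.add_mem (S.closed _ S.mem_h _ S.mem_f) (L.smul_mem _ S.mem_f)) v₃
  have hΛ : ∀ s, ∀ t ∈ D.I, eop e (fun t => 1 * lf s t + (-1) *
      (S.theta t ^ 2 * eop e (S.normalMap.Q s) t - S.theta t * S.normalMap.Q s t)) t =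
      eop e (lf s) t - (S.theta t * le s t - S.normalMap.Q s t + S.theta t ^ 2 * eop e (le s) t) := by
    intro s t ht
    have hQ := S.smooth_Q hD s
    rw [eop_comb hI (S.aff_f.smooth_l s) (((S.smooth_theta.pow 2).mul (S.smooth_eop' hD hQ)).sub
      (S.smooth_theta.mul hQ)) ht, S.eop_fop hD hQ ht, S.eop_Q hD hco s ht,
      eop_congr hI (fun t ht => S.eop_Q hD hco s ht) ht]
    ring
  have hQt : ∀ s t, S.normalMap.Q s t = 2 * (S.theta t * le s t) + (-2) * lh s t := fun _ _ => rfl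
  obtain ⟨c, d, hcd⟩ := S.affine_of_images (l := fun s t => 1 * lf s t + (-1) *
      (S.theta t ^ 2 * eop e (S.normalMap.Q s) t - S.theta t * S.normalMap.Q s t)) (k := 3 / 2)
      (c₂ := c₂) (d₂ := d₂) (c₃ := c₃) (d₃ := d₃) hD (by norm_num) (by norm_num)
      (fun s t ht => by
        rw [hΛ s t ht, ← h₂ s t ht, hQt]
        ring)
      (fun s t ht => by
        rw [hΛ s t ht, ← h₃ s t ht, S.eop_Q hD hco s ht, hco s t ht, hQt]
        ring)
  refine ⟨c, d, S.eq_pbF hD _ _ _ S.aff_f (fun t ht => by simp [quad, S.f_eq ht]) fun s t ht => ?_⟩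
  have h1 := hcd s t ht
  rw [← h1, S.f_eq ht, S.deriv_f ht, eop]
  simp only [Pi.zero_apply]
  ring

/-- Here the translations of known form are `[Xe, Y]` and `[Xh, Y]`, and the constant is `k = 1/2`.
Adding `a_s Q_s` removes the contribution of the scaling. -/
theorem vertical_eq_pbF (hD : D.Regular) [FiniteDimensional ℝ L]
    (hco : ∀ s, ∀ t ∈ D.I, eop e (lh s) t = S.theta t * eop e (le s) t + le s t / 2)
    (hY : Y ∈ L) (hYa : IsAff D Y 0 a l) : ∃ c d, Y = pbF D S.normalMap (0, a, c, d) := by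
  have hI := hD.isOpen_I
  obtain ⟨c₂, d₂, h₂⟩ := S.vertical_form hD (S.closed _ S.mem_e _ hY) (S.ad_e hD hYa)
  obtain ⟨c₃, d₃, h₃⟩ := S.vertical_form hD (S.closed _ S.mem_h _ hY) (S.ad_h hD hYa)
  have hΛ : ∀ s, ∀ t ∈ D.I, eop e (fun t => 1 * l s t + a s * S.normalMap.Q s t) t =
      eop e (l s) t + a s * le s t := fun s t ht => by
    rw [eop_comb hI (hYa.smooth_l s) (S.smooth_Q hD s) ht, S.eop_Q hD hco s ht, one_mul]
  have hQt : ∀ s t, S.normalMap.Q s t = 2 * (S.theta t * le s t) + (-2) * lh s t := fun _ _ => rfl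
  obtain ⟨c, d, hcd⟩ := S.affine_of_images (l := fun s t => 1 * l s t + a s * S.normalMap.Q s t)
    (k := 1 / 2) (c₂ := c₂) (d₂ := d₂) (c₃ := c₃) (d₃ := d₃) hD (by norm_num) (by norm_num)
    (fun s t ht => by rw [hΛ s t ht, ← h₂ s t ht]; ring)
    (fun s t ht => by rw [hΛ s t ht, ← h₃ s t ht, hQt]; ring)
  refine ⟨c, d, S.eq_pbF hD _ _ _ hYa (fun t _ => by simp [quad]) fun s t ht => ?_⟩
  have h0 : deriv (0 : ℝ → ℝ) t = 0 := by
    show deriv (fun _ => (0:ℝ)) t = 0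
    rw [deriv_const]
  rw [← hcd s t ht, h0]
  simp only [Pi.zero_apply]
  ring

omit S in
-- After the correction two generators are exactly standard and everything else is standard up to
-- translations. The algebraic lemma `eq_ParSub` removes the remaining ambiguity.
theorem exists_standard (S : SlData D L Xe Xh Xf e h f le lh lf) (hD : D.Regular)
    [FiniteDimensional ℝ L] : ∃ Φ : AllowedMap, Φ.Admissible D.I ∧ (∀ s, Φ.P s = 1) ∧
      ∃ A C, L = (ParSub A C).map (pbF D Φ) ∧ ∀ a ∈ A, ∀ c ∈ C, a * c ∈ C := by
  obtain ⟨Xe', le', S', hco⟩ := S.exists_corrected hD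
  have h := S'.normalMap_admissible hD
  refine ⟨S'.normalMap, h, fun _ => rfl, ?_⟩
  set T := pbF D S'.normalMap with hT
  have he := S'.e_eq_pbF hD hco
  have hh := S'.h_eq_pbF hD hco
  obtain ⟨c, d, hf⟩ := S'.f_eq_pbF hD hco
  have hL : L = (L.comap T).map T := by
    rw [Submodule.map_comap_eq, right_eq_inf]
    intro X hX
    obtain ⟨q₀, q₁, q₂, k, hk, rfl, a, l, ha⟩ := S'.span X hX
    obtain ⟨c', d', hk'⟩ := S'.vertical_eq_pbF hD hco hk ha
    exact add_mem (add_mem (add_mem (Submodule.smul_mem _ _ ⟨_, he.symm⟩)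
      (Submodule.smul_mem _ _ ⟨_, hh.symm⟩)) (Submodule.smul_mem _ _ ⟨_, hf.symm⟩)) ⟨_, hk'.symm⟩
  obtain ⟨A, C, hAC, hC⟩ := eq_ParSub (M := L.comap T) (fun m hm m' hm' => by
    rw [Submodule.mem_comap, hT, ← bracket_pbF hD h]
    exact S'.closed _ hm _ hm') (by
      rw [Submodule.mem_comap, hT, ← he]; exact S'.mem_e) (by
      rw [Submodule.mem_comap, hT, ← hh]; exact S'.mem_h) (c := c) (d := d) (by
      rw [Submodule.mem_comap, hT, ← hf]; exact S'.mem_f)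
  exact ⟨A, C, hAC ▸ hL, hC⟩

end SlData

/-! ### Fields without time component, and restriction in time -/

section
variable {D : LatticeDomain} {L : Submodule ℝ LatticeField} {X Y : LatticeField} {τ : ℝ → ℝ}
  {a : Site → ℝ} {l : Site → ℝ → ℝ} {b c : ℝ} {I' : Set ℝ}

/-- A Lie algebra of affine fields, none of which vanishes during a whole interval of time. -/
structure IsAffAlgebra (D : LatticeDomain) (L : Submodule ℝ LatticeField) : Prop where
  aff : ∀ X ∈ L, ∃ τ a l, IsAff D X τ a l
  closed : ∀ X ∈ L, ∀ Y ∈ L, bracket X Y ∈ L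
  effective : ∀ X ∈ L, ∀ b c : ℝ, b < c → Ioo b c ⊆ D.I →
    (∀ s, ∀ p ∈ D.plane s, p.1 ∈ Ioo b c → X s p = 0) → X = 0

/-- The fields in `L` without time component at the times in `I'`. -/
def timeless (D : LatticeDomain) (L : Submodule ℝ LatticeField) (I' : Set ℝ) :
    Submodule ℝ LatticeField where
  carrier := {X | X ∈ L ∧ ∀ s, ∀ p ∈ D.plane s, p.1 ∈ I' → (X s p).1 = 0}
  add_mem' hX hY := ⟨L.add_mem hX.1 hY.1, fun s p hp h => by
    simp [hX.2 s p hp h, hY.2 s p hp h]⟩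
  zero_mem' := ⟨L.zero_mem, fun _ _ _ _ => rfl⟩
  smul_mem' r X hX := ⟨L.smul_mem r hX.1, fun s p hp h => by simp [hX.2 s p hp h]⟩

/-- The fields in `L` that, at the times in `I'`, have no time component and do not depend on `u`. -/
def translating (D : LatticeDomain) (L : Submodule ℝ LatticeField) (I' : Set ℝ) :
    Submodule ℝ LatticeField where
  carrier := {X | X ∈ timeless D L I' ∧ ∀ s, ∀ t ∈ D.I, t ∈ I' → ∀ u ∈ D.J s, ∀ u' ∈ D.J s,
    X s (t, u) = X s (t, u')}
  add_mem' hX hY := ⟨add_mem hX.1 hY.1, fun s t ht ht' u hu u' hu' => by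
    simp only [Pi.add_apply, hX.2 s t ht ht' u hu u' hu', hY.2 s t ht ht' u hu u' hu']⟩
  zero_mem' := ⟨zero_mem _, fun _ _ _ _ _ _ _ _ => rfl⟩
  smul_mem' r X hX := ⟨Submodule.smul_mem _ r hX.1, fun s t ht ht' u hu u' hu' => by
    simp only [Pi.smul_apply, hX.2 s t ht ht' u hu u' hu']⟩

theorem mem_timeless_iff (hD : D.Regular) (hX : X ∈ L) (h : IsAff D X τ a l) (hI' : I' ⊆ D.I) :
    X ∈ timeless D L I' ↔ ∀ t ∈ I', τ t = 0 := by
  constructor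
  · rintro ⟨-, h0⟩ t ht
    obtain ⟨u, hu⟩ := hD.nonempty_J 0
    have := h0 0 (t, u) ⟨hI' ht, hu⟩ ht
    rwa [h.eq 0 t u ⟨hI' ht, hu⟩] at this
  · refine fun h0 => ⟨hX, fun s p hp hp' => ?_⟩
    rw [h.eq s p.1 p.2 hp]
    exact h0 p.1 hp'

theorem deriv_zero_of_zero {τ : ℝ → ℝ} (hI' : IsOpen I') (h : ∀ t ∈ I', τ t = 0) {t : ℝ} (ht : t ∈ I') :
    deriv τ t = 0 := by
  have := deriv_congr_on (f := τ) (g := fun _ => 0) hI' h ht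
  rw [this, deriv_const]

theorem derivedSpan_mono {S T : Submodule ℝ LatticeField} (h : S ≤ T) : derivedSpan S ≤ derivedSpan T :=
  derivedSpan_le fun X hX Y hY => Submodule.subset_span ⟨X, h hX, Y, h hY, rfl⟩

/-- Brackets have no scaling constant, and over `I'` these have no time component either: pure
translations are left. -/
theorem derivedSpan_timeless_le (hD : D.Regular) (hL : IsAffAlgebra D L) (ho : IsOpen I') (hI' : I' ⊆ D.I) :
    derivedSpan (timeless D L I') ≤ translating D L I' := by
  refine derivedSpan_le fun X hX Y hY => ?_
  obtain ⟨τ₁, a₁, l₁, h₁⟩ := hL.aff X hX.1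
  obtain ⟨τ₂, a₂, l₂, h₂⟩ := hL.aff Y hY.1
  have z₁ := (mem_timeless_iff hD hX.1 h₁ hI').1 hX
  have z₂ := (mem_timeless_iff hD hY.1 h₂ hI').1 hY
  have hb := IsAff.bracket hD h₁ h₂
  have z : ∀ t ∈ I', τ₁ t * deriv τ₂ t - τ₂ t * deriv τ₁ t = 0 := fun t ht => by
    rw [z₁ t ht, z₂ t ht]; ring
  have hbL := hL.closed X hX.1 Y hY.1
  refine ⟨(mem_timeless_iff hD hbL hb hI').2 z, fun s t ht ht' u hu u' hu' => ?_⟩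
  rw [hb.eq s t u ⟨ht, hu⟩, hb.eq s t u' ⟨ht, hu'⟩, deriv_zero_of_zero ho z ht']
  simp

/-- Translations commute during the interval, and by effectivity a bracket that vanishes there
vanishes altogether. -/
theorem derivedSpan_translating (hD : D.Regular) (hL : IsAffAlgebra D L) (hbc : b < c)
    (hI' : Ioo b c ⊆ D.I) : derivedSpan (translating D L (Ioo b c)) = ⊥ := by
  rw [eq_bot_iff]
  refine derivedSpan_le fun X hX Y hY => ?_
  rw [Submodule.mem_bot]
  have key : ∀ X ∈ translating D L (Ioo b c), ∃ τ l, IsAff D X τ 0 l ∧ ∀ t ∈ Ioo b c, τ t = 0 := by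
    intro X hX
    obtain ⟨τ, a, l, h⟩ := hL.aff X hX.1.1
    have z := (mem_timeless_iff hD hX.1.1 h hI').1 hX.1
    have ha : a = 0 := funext fun s => by
      obtain ⟨t, ht⟩ := nonempty_Ioo.2 hbc
      obtain ⟨u, hu, v, hv, huv⟩ := exists_ne_of_isOpen (hD.isOpen_J s) (hD.nonempty_J s)
      have := congrArg Prod.snd (hX.2 s t (hI' ht) ht u hu v hv)
      rw [h.eq s t u ⟨hI' ht, hu⟩, h.eq s t v ⟨hI' ht, hv⟩, deriv_zero_of_zero isOpen_Ioo z ht] at this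
      have h0 : a s * (u - v) = 0 := by
        simp only [zero_div, zero_add] at this
        linarith
      exact (mul_eq_zero.1 h0).resolve_right (sub_ne_zero.2 huv)
    exact ⟨τ, l, ha ▸ h, z⟩
  obtain ⟨τ₁, l₁, h₁, z₁⟩ := key X hX
  obtain ⟨τ₂, l₂, h₂, z₂⟩ := key Y hY
  have hb := IsAff.bracket hD h₁ h₂
  refine hL.effective _ (hL.closed X hX.1.1 Y hY.1.1) b c hbc hI' fun s p hp hp' => ?_
  have z : ∀ t ∈ Ioo b c, τ₁ t * deriv τ₂ t - τ₂ t * deriv τ₁ t = 0 := fun t ht => by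
    rw [z₁ t ht, z₂ t ht]; ring
  have := hb.eq s p.1 p.2 hp
  rw [deriv_zero_of_zero isOpen_Ioo z hp', z _ hp', z₁ _ hp', z₂ _ hp',
    deriv_zero_of_zero isOpen_Ioo z₁ hp', deriv_zero_of_zero isOpen_Ioo z₂ hp'] at this
  rw [this]
  simp

theorem isSolvableSpace_timeless (hD : D.Regular) (hL : IsAffAlgebra D L) (hbc : b < c)
    (hI' : Ioo b c ⊆ D.I) : IsSolvableSpace (timeless D L (Ioo b c)) :=
  ⟨2, eq_bot_iff.2 ((derivedSpan_mono (derivedSpan_timeless_le hD hL isOpen_Ioo hI')).trans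
    (derivedSpan_translating hD hL hbc hI').le)⟩

theorem timeless_isIdealOf (hD : D.Regular) (hL : IsAffAlgebra D L) (ho : IsOpen I') (hI' : I' ⊆ D.I) :
    IsIdealOf (timeless D L I') L := by
  refine ⟨fun X hX => hX.1, fun X hX Y hY => ?_⟩
  obtain ⟨τ₁, a₁, l₁, h₁⟩ := hL.aff X hX
  obtain ⟨τ₂, a₂, l₂, h₂⟩ := hL.aff Y hY.1
  have z₂ := (mem_timeless_iff hD hY.1 h₂ hI').1 hY
  refine (mem_timeless_iff hD (hL.closed X hX Y hY.1) (IsAff.bracket hD h₁ h₂) hI').2 fun t ht => ?_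
  rw [z₂ t ht, deriv_zero_of_zero ho z₂ ht]
  ring

/-! ### Restriction in time -/

theorem cutoff_of_mem (X : LatticeField) (s : Site) {p : ℝ × ℝ} (hp : p.1 ∈ I') :
    cutoff I' X s p = X s p := indicator_of_mem (s := Prod.fst ⁻¹' I') hp _

theorem cutoff_of_notMem (X : LatticeField) (s : Site) {p : ℝ × ℝ} (hp : p.1 ∉ I') :
    cutoff I' X s p = 0 := indicator_of_notMem (s := Prod.fst ⁻¹' I') hp _

theorem cutoff_eventuallyEq (ho : IsOpen I') (X : LatticeField) (s : Site) {p : ℝ × ℝ} (hp : p.1 ∈ I') :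
    cutoff I' X s =ᶠ[𝓝 p] X s := by
  filter_upwards [(ho.preimage continuous_fst).mem_nhds hp] with q hq
  exact cutoff_of_mem X s hq

theorem bracket_cutoff (ho : IsOpen I') (X Y : LatticeField) :
    bracket (cutoff I' X) (cutoff I' Y) = cutoff I' (bracket X Y) := by
  funext s p
  by_cases hp : p.1 ∈ I'
  · rw [cutoff_of_mem _ _ hp, bracket_apply, bracket_apply, cutoff_of_mem _ _ hp, cutoff_of_mem _ _ hp,
      (cutoff_eventuallyEq ho X s hp).fderiv_eq, (cutoff_eventuallyEq ho Y s hp).fderiv_eq]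
  · rw [cutoff_of_notMem _ _ hp]
    exact bracket_zero_out (cutoff_of_notMem _ _ hp) (cutoff_of_notMem _ _ hp)

theorem IsAff.cutoff (h : IsAff D X τ a l) (hI' : I' ⊆ D.I) :
    IsAff (D.restrict I') (cutoff I' X) τ a l where
  zero_out s p hp := by
    by_cases hp' : p.1 ∈ I'
    · rw [cutoff_of_mem _ _ hp']
      exact h.zero_out s p fun hq => hp ⟨hp', hq.2⟩
    · exact cutoff_of_notMem _ _ hp'
  eq s t u hp := by
    rw [cutoff_of_mem X s (show (t, u).1 ∈ I' from hp.1)]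
    exact h.eq s t u ⟨hI' hp.1, hp.2⟩
  smooth_tau := h.smooth_tau.mono hI'
  smooth_l s := (h.smooth_l s).mono hI'

theorem cutoff_injOn (hL : IsAffAlgebra D L) (hbc : b < c) (hI' : Ioo b c ⊆ D.I) {X : LatticeField}
    (hX : X ∈ L) (h0 : TriLattice.cutoff (Ioo b c) X = 0) : X = 0 :=
  hL.effective X hX b c hbc hI' fun s p _ hp' => by
    rw [← cutoff_of_mem X s hp', h0]; rfl

theorem derivedSpan_map_cutoff_le (ho : IsOpen I') (S : Submodule ℝ LatticeField) :
    derivedSpan (S.map (TriLattice.cutoff I')) ≤ (derivedSpan S).map (TriLattice.cutoff I') := by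
  refine derivedSpan_le ?_
  rintro _ ⟨X, hX, rfl⟩ _ ⟨Y, hY, rfl⟩
  rw [bracket_cutoff ho]
  exact Submodule.mem_map_of_mem (Submodule.subset_span ⟨X, hX, Y, hY, rfl⟩)

theorem IsSolvableSpace.map_cutoff {S : Submodule ℝ LatticeField} (h : IsSolvableSpace S) (ho : IsOpen I') :
    IsSolvableSpace (S.map (TriLattice.cutoff I')) := by
  obtain ⟨k, hk⟩ := h
  have key : ∀ (k : ℕ) (S : Submodule ℝ LatticeField),
      derivedSpan^[k] (S.map (TriLattice.cutoff I')) ≤ (derivedSpan^[k] S).map (TriLattice.cutoff I') := by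
    intro k S
    induction k with
    | zero => exact le_rfl
    | succ k ih =>
      rw [Function.iterate_succ_apply', Function.iterate_succ_apply']
      exact (derivedSpan_mono ih).trans (derivedSpan_map_cutoff_le ho _)
  refine ⟨k, eq_bot_iff.2 ((key k S).trans ?_)⟩
  rw [hk, Submodule.map_bot]

theorem IsIdealOf.map_cutoff {S : Submodule ℝ LatticeField} (h : IsIdealOf S L) (ho : IsOpen I') :
    IsIdealOf (S.map (TriLattice.cutoff I')) (L.map (TriLattice.cutoff I')) := by
  refine ⟨Submodule.map_mono h.1, ?_⟩
  rintro _ ⟨X, hX, rfl⟩ _ ⟨Y, hY, rfl⟩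
  rw [bracket_cutoff ho]
  exact Submodule.mem_map_of_mem (h.2 X hX Y hY)

end

/-! ### The algebra of time components -/

section
variable {D : LatticeDomain} {L : Submodule ℝ LatticeField} {X Y : LatticeField} {τ : ℝ → ℝ}
  {a : Site → ℝ} {l : Site → ℝ → ℝ} {b c u₀ : ℝ} {I₁ : Set ℝ}

/-- The time component at the times in `I₁`. -/
noncomputable def timePart (u₀ : ℝ) (I₁ : Set ℝ) : LatticeField →ₗ[ℝ] (ℝ → ℝ) where
  toFun X := I₁.indicator fun t => (X 0 (t, u₀)).1
  map_add' X Y := indicator_add I₁ (fun t => (X 0 (t, u₀)).1) (fun t => (Y 0 (t, u₀)).1)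
  map_smul' r X := indicator_const_smul I₁ r (fun t => (X 0 (t, u₀)).1)

theorem timePart_eq (hu₀ : u₀ ∈ D.J 0) (h : IsAff D X τ a l) (hI₁ : I₁ ⊆ D.I) :
    EqOn (timePart u₀ I₁ X) τ I₁ := fun t ht => by
  show I₁.indicator (fun t => (X 0 (t, u₀)).1) t = τ t
  rw [indicator_of_mem ht, h.eq 0 t u₀ ⟨hI₁ ht, hu₀⟩]

theorem timePart_zero_out {t : ℝ} (ht : t ∉ I₁) : timePart u₀ I₁ X t = 0 :=
  indicator_of_notMem ht (fun t => (X 0 (t, u₀)).1)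

theorem timePart_bracket (hD : D.Regular) (hL : IsAffAlgebra D L) (hu₀ : u₀ ∈ D.J 0) (ho : IsOpen I₁)
    (hI₁ : I₁ ⊆ D.I) (hX : X ∈ L) (hY : Y ∈ L) :
    timePart u₀ I₁ (bracket X Y) = wr I₁ (timePart u₀ I₁ X) (timePart u₀ I₁ Y) := by
  obtain ⟨τ₁, a₁, l₁, h₁⟩ := hL.aff X hX
  obtain ⟨τ₂, a₂, l₂, h₂⟩ := hL.aff Y hY
  funext t
  by_cases ht : t ∈ I₁
  · have e₁ := timePart_eq hu₀ h₁ hI₁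
    have e₂ := timePart_eq hu₀ h₂ hI₁
    rw [timePart_eq hu₀ (IsAff.bracket hD h₁ h₂) hI₁ ht, wr_of_mem ht, e₁ ht, e₂ ht,
      deriv_congr_on ho e₁ ht, deriv_congr_on ho e₂ ht]
  · rw [timePart_zero_out ht, wr, indicator_of_notMem ht]

theorem timePart_eq_zero_iff (hD : D.Regular) (hL : IsAffAlgebra D L) (hu₀ : u₀ ∈ D.J 0)
    (hI₁ : I₁ ⊆ D.I) (hX : X ∈ L) : timePart u₀ I₁ X = 0 ↔ X ∈ timeless D L I₁ := by
  obtain ⟨τ, a, l, h⟩ := hL.aff X hX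
  rw [mem_timeless_iff hD hX h hI₁]
  have e := timePart_eq hu₀ h hI₁
  constructor
  · intro h0 t ht
    rw [← e ht, h0]; rfl
  · intro h0
    funext t
    by_cases ht : t ∈ I₁
    · rw [e ht, h0 t ht]; rfl
    · rw [timePart_zero_out ht]; rfl

theorem timeless_anti {I₁ I₂ : Set ℝ} (h : I₂ ⊆ I₁) : timeless D L I₁ ≤ timeless D L I₂ :=
  fun _ hX => ⟨hX.1, fun s p hp hp' => hX.2 s p hp (h hp')⟩

/-- There is an interval on which the algebra of time components cannot degenerate further. -/
theorem exists_stable_interval [FiniteDimensional ℝ L] (D : LatticeDomain) (hbc : b < c) :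
    ∃ b₁ c₁, b₁ < c₁ ∧ Ioo b₁ c₁ ⊆ Ioo b c ∧ ∀ b₂ c₂, b₂ < c₂ → Ioo b₂ c₂ ⊆ Ioo b₁ c₁ →
      timeless D L (Ioo b₂ c₂) = timeless D L (Ioo b₁ c₁) := by
  have hfd : ∀ I', FiniteDimensional ℝ (timeless D L I') := fun I' =>
    Submodule.finiteDimensional_of_le (S₂ := L) fun _ h => h.1
  have hle : ∀ I', Module.finrank ℝ (timeless D L I') ≤ Module.finrank ℝ L := fun I' =>
    Submodule.finrank_mono fun _ h => h.1
  -- The space `timeless` can only grow when the interval shrinks; an interval with the largest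
  -- dimension is taken.
  obtain ⟨⟨b₁, c₁⟩, ⟨h1, h2⟩, hmin⟩ := WellFounded.has_min
    (measure fun q : ℝ × ℝ => Module.finrank ℝ L - Module.finrank ℝ (timeless D L (Ioo q.1 q.2))).wf
    {q : ℝ × ℝ | q.1 < q.2 ∧ Ioo q.1 q.2 ⊆ Ioo b c} ⟨(b, c), hbc, subset_rfl⟩
  refine ⟨b₁, c₁, h1, h2, fun b₂ c₂ h3 h4 => ?_⟩
  have h5 : ¬ (Module.finrank ℝ L - Module.finrank ℝ (timeless D L (Ioo b₂ c₂)) <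
    Module.finrank ℝ L - Module.finrank ℝ (timeless D L (Ioo b₁ c₁))) :=
    hmin (b₂, c₂) ⟨h3, h4.trans h2⟩
  have h6 := hle (Ioo b₁ c₁)
  have h7 := hle (Ioo b₂ c₂)
  exact (Submodule.eq_of_le_of_finrank_le (timeless_anti h4) (by omega)).symm

/-- Stability of the interval is just what `unique` demands: a time component that vanishes on a
subinterval vanishes on the whole interval. -/
theorem lineAlgebra_map (hD : D.Regular) (hL : IsAffAlgebra D L) (hu₀ : u₀ ∈ D.J 0)
    (hI₁ : Ioo b c ⊆ D.I) (hst : ∀ b₂ c₂, b₂ < c₂ → Ioo b₂ c₂ ⊆ Ioo b c →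
      timeless D L (Ioo b₂ c₂) = timeless D L (Ioo b c)) :
    LineAlgebra (Ioo b c) (L.map (timePart u₀ (Ioo b c))) where
  isOpen := isOpen_Ioo
  smooth := by
    rintro _ ⟨X, hX, rfl⟩
    obtain ⟨τ, a, l, h⟩ := hL.aff X hX
    exact (h.smooth_tau.mono hI₁).congr (timePart_eq hu₀ h hI₁)
  zero_out := by
    rintro _ ⟨X, hX, rfl⟩ t ht
    exact timePart_zero_out ht
  closed := by
    rintro _ ⟨X, hX, rfl⟩ _ ⟨Y, hY, rfl⟩
    rw [← timePart_bracket hD hL hu₀ isOpen_Ioo hI₁ hX hY]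
    exact Submodule.mem_map_of_mem (hL.closed X hX Y hY)
  unique := by
    rintro _ ⟨X, hX, rfl⟩ b₂ c₂ hbc₂ hsub h0
    rw [timePart_eq_zero_iff hD hL hu₀ hI₁ hX, ← hst b₂ c₂ hbc₂ hsub]
    obtain ⟨τ, a, l, h⟩ := hL.aff X hX
    refine (mem_timeless_iff hD hX h (hsub.trans hI₁)).2 fun t ht => ?_
    rw [← timePart_eq hu₀ h hI₁ (hsub ht), h0 t ht]

/-- Along the derived series: time components that are multiples of `z`, no time components over the
interval, translations over the interval, zero. -/
theorem isSolvableSpace_of_derived (hD : D.Regular) (hL : IsAffAlgebra D L) (hu₀ : u₀ ∈ D.J 0)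
    (hbc : b < c) (hI₁ : Ioo b c ⊆ D.I) {z : ℝ → ℝ}
    (hz : ∀ X ∈ L, ∀ Y ∈ L, ∃ r : ℝ, timePart u₀ (Ioo b c) (bracket X Y) = r • z) :
    IsSolvableSpace L := by
  set T := timePart u₀ (Ioo b c)
  have h1 : derivedSpan L ≤ L ⊓ (Submodule.span ℝ {z}).comap T := derivedSpan_le fun X hX Y hY => by
    obtain ⟨r, hr⟩ := hz X hX Y hY
    exact ⟨hL.closed X hX Y hY, Submodule.mem_span_singleton.2 ⟨r, hr.symm⟩⟩
  have h2 : derivedSpan (L ⊓ (Submodule.span ℝ {z}).comap T) ≤ timeless D L (Ioo b c) :=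
    derivedSpan_le fun X hX Y hY => by
      obtain ⟨r, hr⟩ := Submodule.mem_span_singleton.1 hX.2
      obtain ⟨r', hr'⟩ := Submodule.mem_span_singleton.1 hY.2
      rw [← timePart_eq_zero_iff hD hL hu₀ hI₁ (hL.closed X hX.1 Y hY.1),
        timePart_bracket hD hL hu₀ isOpen_Ioo hI₁ hX.1 hY.1]
      funext t
      by_cases ht : t ∈ Ioo b c
      · rw [wr_of_mem ht]
        change _ = (0:ℝ)
        rw [← hr, ← hr']
        simp only [deriv_const_smul_field, Pi.smul_apply, smul_eq_mul]
        ring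
      · rw [wr, indicator_of_notMem ht]; rfl
  refine ⟨4, eq_bot_iff.2 ?_⟩
  show derivedSpan (derivedSpan (derivedSpan (derivedSpan L))) ≤ ⊥
  exact (derivedSpan_mono (derivedSpan_mono ((derivedSpan_mono h1).trans h2))).trans
    ((derivedSpan_mono (derivedSpan_timeless_le hD hL isOpen_Ioo hI₁)).trans
      (derivedSpan_translating hD hL hbc hI₁).le)

end

/-! ### The structure of the algebra over a small interval of times -/

section
variable {D : LatticeDomain} {L : Submodule ℝ LatticeField} {X : LatticeField} {τ : ℝ → ℝ}
  {a : Site → ℝ} {l : Site → ℝ → ℝ} {b c u₀ : ℝ} {I₁ I' : Set ℝ}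

theorem IsAff.cutoff_timePart (hu₀ : u₀ ∈ D.J 0) (h : IsAff D X τ a l)
    (hI₁ : I₁ ⊆ D.I) (hI' : I' ⊆ I₁) (ho : IsOpen I') :
    IsAff (D.restrict I') (TriLattice.cutoff I' X) (timePart u₀ I₁ X) a l :=
  (h.cutoff (hI'.trans hI₁)).congr ho (fun _ ht => (timePart_eq hu₀ h hI₁ (hI' ht)).symm)
    fun _ _ _ => rfl

/-- A nonsolvable algebra of affine fields is, over some interval of times in any given one,
in canonical form up to an allowed transformation. -/
theorem local_structure (hD : D.Regular) (hL : IsAffAlgebra D L) [FiniteDimensional ℝ L]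
    (hns : ¬ IsSolvableSpace L) (hbc : b < c) (hI : Ioo b c ⊆ D.I) :
    ∃ b' c', b' < c' ∧ Ioo b' c' ⊆ Ioo b c ∧ ∃ Φ : AllowedMap, Φ.Admissible (Ioo b' c') ∧
      (∀ s, Φ.P s = 1) ∧ ∃ A C, L.map (cutoff (Ioo b' c')) =
        (ParSub A C).map (pbF (D.restrict (Ioo b' c')) Φ) ∧ ∀ a ∈ A, ∀ c ∈ C, a * c ∈ C := by
  obtain ⟨u₀, hu₀⟩ := hD.nonempty_J 0
  obtain ⟨b₁, c₁, hbc₁, hsub₁, hst⟩ := exists_stable_interval (L := L) D hbc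
  have hI₁ := hsub₁.trans hI
  set T := timePart u₀ (Ioo b₁ c₁) with hT
  have hW := lineAlgebra_map hD hL hu₀ hI₁ hst
  have hTb : ∀ X ∈ L, ∀ Y ∈ L, T (bracket X Y) = wr (Ioo b₁ c₁) (T X) (T Y) := fun X hX Y hY =>
    timePart_bracket hD hL hu₀ isOpen_Ioo hI₁ hX hY
  rcases hW.classification with ⟨z, -, hz⟩ | ⟨t₀, ht₀, _, ⟨Xe, he, rfl⟩, _, ⟨Xh, hh, rfl⟩, _, ⟨Xf, hf, rfl⟩,
    hpos, reh, rhf, ref, hspan⟩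
  · refine absurd (isSolvableSpace_of_derived hD hL hu₀ hbc₁ hI₁ (z := z) fun X hX Y hY => ?_) hns
    rw [hTb X hX Y hY]
    exact hz _ (Submodule.mem_map_of_mem hX) _ (Submodule.mem_map_of_mem hY)
  have hsm : ContDiffOn ℝ ∞ (T Xe) (Ioo b₁ c₁) := hW.smooth _ (Submodule.mem_map_of_mem he)
  -- The new time requires `e > 0` on the whole interval.
  obtain ⟨b', c', hbc', -, hsub'⟩ := exists_Ioo_subset
    (hsm.continuousOn.isOpen_inter_preimage isOpen_Ioo isOpen_Ioi) (show t₀ ∈ _ ∩ T Xe ⁻¹' Ioi 0 from ⟨ht₀, hpos⟩)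
  have hs₁ : Ioo b' c' ⊆ Ioo b₁ c₁ := fun t ht => (hsub' ht).1
  have hI' := hs₁.trans hI₁
  have hD' := hD.restrict isOpen_Ioo ordConnected_Ioo (nonempty_Ioo.2 hbc') hI'
  have hbr : ∀ X ∈ L, ∀ Y ∈ L, ∃ l, IsAff (D.restrict (Ioo b' c')) (cutoff (Ioo b' c') (bracket X Y))
      (T (bracket X Y)) 0 l := fun X hX Y hY => by
    obtain ⟨τ₁, a₁, l₁, h₁⟩ := hL.aff X hX
    obtain ⟨τ₂, a₂, l₂, h₂⟩ := hL.aff Y hY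
    exact ⟨_, (IsAff.bracket hD h₁ h₂).cutoff_timePart hu₀ hI₁ hs₁ isOpen_Ioo⟩
  -- The brackets replace the fields themselves as generators: by the relations of `sl(2,ℝ)` they
  -- have the same time components up to the factor `2`, and they have no scaling constants.
  obtain ⟨le, hle⟩ := hbr Xe he Xh hh
  obtain ⟨lf, hlf⟩ := hbr Xh hh Xf hf
  obtain ⟨lh, hlh⟩ := hbr Xe he Xf hf
  have te : T (bracket Xe Xh) = T Xe := by rw [hTb _ he _ hh]; exact reh
  have tf : T (bracket Xh Xf) = T Xf := by rw [hTb _ hh _ hf]; exact rhf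
  have th : T (bracket Xe Xf) = (2:ℝ) • T Xh := by rw [hTb _ he _ hf]; exact ref
  rw [te] at hle
  rw [tf] at hlf
  have hlh' := hlh.smul isOpen_Ioo (1/2 : ℝ)
  rw [th, smul_smul, smul_zero, ← map_smul] at hlh'
  norm_num at hlh'
  have hrel : ∀ {f g k : ℝ → ℝ}, wr (Ioo b₁ c₁) f g = k → ∀ t ∈ Ioo b' c',
      f t * deriv g t - g t * deriv f t = k t := fun h t ht => by
    rw [← h, wr_of_mem (hs₁ ht)]
  have hbL := hL.closed
  have S : SlData (D.restrict (Ioo b' c')) (L.map (cutoff (Ioo b' c')))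
      (cutoff (Ioo b' c') (bracket Xe Xh)) (cutoff (Ioo b' c') ((1/2 : ℝ) • bracket Xe Xf))
      (cutoff (Ioo b' c') (bracket Xh Xf)) (T Xe) (T Xh) (T Xf) le ((1/2:ℝ) • lh) lf :=
    { closed := by
        rintro _ ⟨X, hX, rfl⟩ _ ⟨Y, hY, rfl⟩
        rw [bracket_cutoff isOpen_Ioo]
        exact Submodule.mem_map_of_mem (hbL X hX Y hY)
      mem_e := Submodule.mem_map_of_mem (hbL _ he _ hh)
      mem_h := Submodule.mem_map_of_mem (L.smul_mem _ (hbL _ he _ hf))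
      mem_f := Submodule.mem_map_of_mem (hbL _ hh _ hf)
      aff_e := hle
      aff_h := by simpa using hlh'
      aff_f := hlf
      pos := fun t ht => (hsub' ht).2
      rel_eh := hrel reh
      rel_hf := hrel rhf
      rel_ef := hrel ref
      span := by
        rintro _ ⟨X, hX, rfl⟩
        obtain ⟨q₀, q₁, q₂, hq⟩ := hspan _ (Submodule.mem_map_of_mem hX)
        set k := X - (q₀ • bracket Xe Xh + q₁ • (1/2:ℝ) • bracket Xe Xf + q₂ • bracket Xh Xf) with hk
        have hkL : k ∈ L := L.sub_mem hX (L.add_mem (L.add_mem (L.smul_mem _ (hbL _ he _ hh))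
          (L.smul_mem _ (L.smul_mem _ (hbL _ he _ hf)))) (L.smul_mem _ (hbL _ hh _ hf)))
        have hTk : T k = 0 := by
          rw [hk, map_sub, map_add, map_add, map_smul, map_smul, map_smul, map_smul, te, tf, th, hq,
            smul_smul (1/2:ℝ), one_div, inv_mul_cancel₀ two_ne_zero, one_smul]
          exact sub_self _
        obtain ⟨τ, a, l, h⟩ := hL.aff k hkL
        have h' := h.cutoff_timePart hu₀ hI₁ hs₁ isOpen_Ioo
        change IsAff _ _ (T k) _ _ at h'
        rw [hTk] at h'
        refine ⟨q₀, q₁, q₂, _, Submodule.mem_map_of_mem hkL, ?_, a, l, h'⟩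
        rw [← map_smul, ← map_smul, ← map_smul, ← map_add, ← map_add, ← map_add, hk, add_sub_cancel] }
  exact ⟨b', c', hbc', hs₁.trans hsub₁, S.exists_standard hD'⟩

/-- A field whose time component vanishes during some interval of times has none at all. -/
theorem timeless_vanish (hD : D.Regular) (hL : IsAffAlgebra D L) [FiniteDimensional ℝ L]
    (hns : ¬ IsSolvableSpace L) (hbc : b < c) (hI : Ioo b c ⊆ D.I) (hX : X ∈ timeless D L (Ioo b c))
    (h : IsAff D X τ a l) : ∀ t ∈ D.I, τ t = 0 := by
  by_contra! hne
  obtain ⟨t₁, ht₁, hne⟩ := hne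
  obtain ⟨b₁, c₁, hbc₁, -, hsub₁⟩ := exists_Ioo_subset
    (h.smooth_tau.continuousOn.isOpen_inter_preimage hD.isOpen_I isOpen_ne)
    (show t₁ ∈ D.I ∩ τ ⁻¹' {x | x ≠ 0} from ⟨ht₁, hne⟩)
  have hs₁ : Ioo b₁ c₁ ⊆ D.I := fun t ht => (hsub₁ ht).1
  obtain ⟨b', c', hbc', hs', Φ, hΦ, -, A, C, hmap, hAC⟩ := local_structure hD hL hns hbc₁ hs₁
  have hI' := hs'.trans hs₁
  have hD' := hD.restrict isOpen_Ioo ordConnected_Ioo (nonempty_Ioo.2 hbc') hI'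
  -- Over an interval on which `τ` has no zero, the restriction of this solvable ideal lies in the
  -- radical, whose elements have no time component.
  have hr := (isRadicalOf hD' hΦ hAC).2.2 ((timeless D L (Ioo b c)).map (cutoff (Ioo b' c')))
    (hmap ▸ (timeless_isIdealOf hD hL isOpen_Ioo hI).map_cutoff isOpen_Ioo)
    ((isSolvableSpace_timeless hD hL hbc hI).map_cutoff isOpen_Ioo)
  obtain ⟨m, hm, hmX⟩ := hr (Submodule.mem_map_of_mem hX)
  obtain ⟨t, ht⟩ := nonempty_Ioo.2 hbc'
  refine (hsub₁ (hs' ht)).2 ?_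
  have e₁ := h.cutoff hI'
  rw [← hmX] at e₁
  rw [← ((pbF_isAff hD' hΦ m).unique e₁ hD').1 ht]
  exact pbTau_of_zero (mem_RadSub.1 hm).1 t

end

/-! ### General position over a smaller interval of times -/

section
variable {D : LatticeDomain} {F : Site → ℝ × (Fin 7 → ℝ) → ℝ} {L : Submodule ℝ LatticeField}
  {X : LatticeField} {τ : ℝ → ℝ} {a : Site → ℝ} {l : Site → ℝ → ℝ} {b c : ℝ}

theorem IsAff.scaling_iff (h : IsAff D X τ a l) (hD : D.Regular) (f : Site → ℝ) :
    (∀ s, ∀ p ∈ D.plane s, (X s p).1 = 0 ∧ fderiv ℝ (X s) p (0, 1) = (0, f s)) ↔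
      (∀ t ∈ D.I, τ t = 0) ∧ a = f := by
  constructor
  · intro H
    have h0 : ∀ t ∈ D.I, τ t = 0 := fun t ht => by
      obtain ⟨u, hu⟩ := hD.nonempty_J 0
      have := (H 0 (t, u) ⟨ht, hu⟩).1
      rwa [h.eq 0 t u ⟨ht, hu⟩] at this
    refine ⟨h0, funext fun s => ?_⟩
    obtain ⟨⟨t, u⟩, hp⟩ := exists_mem_plane hD s
    have := (H s (t, u) hp).2
    rw [h.fderiv_apply hD hp, deriv_zero_of_zero hD.isOpen_I h0 hp.1] at this
    simpa using this
  · rintro ⟨h0, rfl⟩ s ⟨t, u⟩ hp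
    rw [h.fderiv_apply hD hp, deriv_zero_of_zero hD.isOpen_I h0 hp.1, h.eq s t u hp]
    simp [h0 t hp.1]

/-- A restriction in time might acquire new fields without time component. This is excluded by
`timeless_vanish`, so general position is inherited by smaller intervals. -/
theorem IsAff.scaling_cutoff_iff (hD : D.Regular) (hL : IsAffAlgebra D L) [FiniteDimensional ℝ L]
    (hns : ¬ IsSolvableSpace L) (hbc : b < c) (hI : Ioo b c ⊆ D.I) (hX : X ∈ L) (f : Site → ℝ) :
    (∀ s, ∀ p ∈ (D.restrict (Ioo b c)).plane s, (TriLattice.cutoff (Ioo b c) X s p).1 = 0 ∧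
      fderiv ℝ (TriLattice.cutoff (Ioo b c) X s) p (0, 1) = (0, f s)) ↔
    ∀ s, ∀ p ∈ D.plane s, (X s p).1 = 0 ∧ fderiv ℝ (X s) p (0, 1) = (0, f s) := by
  obtain ⟨τ, a, l, h⟩ := hL.aff X hX
  have hD' := hD.restrict isOpen_Ioo ordConnected_Ioo (nonempty_Ioo.2 hbc) hI
  rw [h.scaling_iff hD, (h.cutoff hI).scaling_iff hD']
  refine and_congr_left fun _ => ⟨fun h0 => ?_, fun h0 t ht => h0 t (hI ht)⟩
  exact timeless_vanish hD hL hns hbc hI ((mem_timeless_iff hD hX h hI).2 h0) h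

theorem scalingSpace_cutoff (hD : D.Regular) (hL : IsAffAlgebra D L) [FiniteDimensional ℝ L]
    (hns : ¬ IsSolvableSpace L) (hbc : b < c) (hI : Ioo b c ⊆ D.I) :
    scalingSpace (D.restrict (Ioo b c)) (L.map (cutoff (Ioo b c))) = scalingSpace D L := by
  rw [scalingSpace, scalingSpace]
  congr 2
  ext f
  constructor
  · rintro ⟨_, ⟨X, hX, rfl⟩, h⟩
    exact ⟨X, hX, (IsAff.scaling_cutoff_iff hD hL hns hbc hI hX f).1 h⟩
  · rintro ⟨X, hX, h⟩
    exact ⟨_, Submodule.mem_map_of_mem hX, (IsAff.scaling_cutoff_iff hD hL hns hbc hI hX f).2 h⟩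

theorem translationSpace_cutoff (hD : D.Regular) (hL : IsAffAlgebra D L) [FiniteDimensional ℝ L]
    (hns : ¬ IsSolvableSpace L) (hbc : b < c) (hI : Ioo b c ⊆ D.I) {t : ℝ} (ht : t ∈ Ioo b c) :
    translationSpace (D.restrict (Ioo b c)) (L.map (cutoff (Ioo b c))) t = translationSpace D L t := by
  rw [translationSpace, translationSpace]
  congr 1
  ext f
  constructor
  · rintro ⟨_, ⟨X, hX, rfl⟩, h, h'⟩
    refine ⟨X, hX, (IsAff.scaling_cutoff_iff hD hL hns hbc hI hX 0).1 h, fun s u hu => ?_⟩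
    rw [← h' s u hu, cutoff_of_mem X s (p := (t, u)) ht]
  · rintro ⟨X, hX, h, h'⟩
    refine ⟨_, Submodule.mem_map_of_mem hX, (IsAff.scaling_cutoff_iff hD hL hns hbc hI hX 0).2 h,
      fun s u hu => ?_⟩
    rw [← h' s u hu, cutoff_of_mem X s (p := (t, u)) ht]

theorem GeneralPosition.cutoff (hg : GeneralPosition D L) (hD : D.Regular) (hL : IsAffAlgebra D L)
    [FiniteDimensional ℝ L] (hns : ¬ IsSolvableSpace L) (hbc : b < c) (hI : Ioo b c ⊆ D.I) :
    GeneralPosition (D.restrict (Ioo b c)) (L.map (TriLattice.cutoff (Ioo b c))) where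
  scaling := by
    rw [scalingSpace_cutoff hD hL hns hbc hI]; exact hg.scaling
  translation t ht := by
    rw [translationSpace_cutoff hD hL hns hbc hI ht]; exact hg.translation t (hI ht)
  translation_two t ht := by
    rw [translationSpace_cutoff hD hL hns hbc hI ht]; exact hg.translation_two t (hI ht)

theorem IsAff.isSymmetry_cutoff (h : IsAff D X τ a l) (hD : D.Regular) (hX : IsSymmetry D F X)
    (hbc : b < c) (hI : Ioo b c ⊆ D.I) :
    IsSymmetry (D.restrict (Ioo b c)) F (TriLattice.cutoff (Ioo b c) X) := by
  rw [(h.cutoff hI).isSymmetry_iff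
    (hD.restrict isOpen_Ioo ordConnected_Ioo (nonempty_Ioo.2 hbc) hI)]
  exact fun s x hx => (h.isSymmetry_iff hD).1 hX s x hx.1

theorem finrank_map_cutoff (hL : IsAffAlgebra D L) (hbc : b < c) (hI : Ioo b c ⊆ D.I) :
    Module.finrank ℝ (L.map (cutoff (Ioo b c))) = Module.finrank ℝ L := by
  rw [← LinearMap.range_domRestrict]
  refine LinearMap.finrank_range_of_inj ?_
  rw [← LinearMap.ker_eq_bot, LinearMap.ker_eq_bot']
  exact fun X hX => Subtype.ext (cutoff_injOn hL hbc hI X.2 hX)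

theorem IsSymmetryAlgebra.isAffAlgebra (h : IsSymmetryAlgebra D F L) (hD : D.Regular)
    (hF : IsInteraction D F) : IsAffAlgebra D L :=
  ⟨fun X hX => (h.symm X hX).exists_isAff hD hF, h.closed, h.effective⟩

end

/-! ### Nondegenerate spaces of functions on the lattice -/

section
variable {A C V : Submodule ℝ (Site → ℝ)}

theorem NonvanishingDet.latDet_ne_zero {N : ℕ} (hN : N ≤ 7) {f : Fin N → Site → ℝ}
    (hf : LinearIndependent ℝ f) (h : NonvanishingDet (Submodule.span ℝ (range f))) (s : Site) :
    latDet f (fun k => s + nbr (Fin.castLE hN k)) ≠ 0 := by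
  intro h0
  obtain ⟨r, hr, hr0⟩ := Matrix.exists_vecMul_eq_zero_iff.2 h0
  refine hr (funext (Fintype.linearIndependent_iff.1 hf r (h s _ ?_ fun i hi => ?_)))
  · exact Submodule.sum_mem _ fun i _ => Submodule.smul_mem _ _ (Submodule.subset_span ⟨i, rfl⟩)
  · rw [finrank_span_eq_card hf, Fintype.card_fin] at hi
    have := congrFun hr0 ⟨i, hi⟩
    simpa [Matrix.vecMul, dotProduct, Finset.sum_apply] using this

theorem exists_basis_four [FiniteDimensional ℝ A] (hA : Module.finrank ℝ A = 4) (h1 : (1 : Site → ℝ) ∉ A)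
    (hd : NonvanishingDet (A ⊔ Submodule.span ℝ {1})) :
    ∃ a : Fin 4 → Site → ℝ, Submodule.span ℝ (range a) = A ∧ ∀ s, mainDet a s ≠ 0 := by
  let B := Module.finBasisOfFinrankEq ℝ A hA
  have hspan : Submodule.span ℝ (range fun i => (B i : Site → ℝ)) = A := by
    have := congrArg (Submodule.map A.subtype) B.span_eq
    rwa [Submodule.map_span, ← range_comp, Submodule.map_subtype_top] at this
  have hli : LinearIndependent ℝ fun i => (B i : Site → ℝ) :=
    B.linearIndependent.map' A.subtype A.ker_subtype
  refine ⟨fun i => B i, hspan, fun s => ?_⟩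
  have hli' : LinearIndependent ℝ (withOne fun i => (B i : Site → ℝ)) :=
    linearIndependent_finSnoc.2 ⟨hli, by rw [hspan]; exact h1⟩
  refine NonvanishingDet.latDet_ne_zero (by norm_num) hli' ?_ s
  rwa [range_withOne, hspan]

/-- Nondegeneracy says that the function `c` spanning `C` has no zeros; then `a * c ∈ C` forces `a`
to be constant. -/
theorem finrank_le_one_of_mul_mem [FiniteDimensional ℝ C] (hC : Module.finrank ℝ C = 1)
    (hd : NonvanishingDet C) (hAC : ∀ a ∈ A, ∀ c ∈ C, a * c ∈ C) : Module.finrank ℝ A ≤ 1 := by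
  obtain ⟨⟨c, hc⟩, hc0, hspan⟩ := finrank_eq_one_iff'.1 hC
  have hne : ∀ s, c s ≠ 0 := fun s h0 => hc0 <| Subtype.ext <| hd s c hc fun i hi => by
    rw [hC, Nat.lt_one_iff] at hi
    rw [show i = 0 from Fin.ext hi, nbr_zero, add_zero, h0]
  have hle : A ≤ Submodule.span ℝ {1} := fun a ha => by
    obtain ⟨r, hr⟩ := hspan ⟨a * c, hAC a ha c hc⟩
    refine Submodule.mem_span_singleton.2 ⟨r, funext fun s => ?_⟩
    have := congrFun (congrArg Subtype.val hr) s
    simp only [Submodule.coe_smul, Pi.smul_apply, Pi.mul_apply, smul_eq_mul] at this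
    simpa using mul_right_cancel₀ (hne s) this
  exact (Submodule.finrank_mono hle).trans (by
    simpa using finrank_span_le_card (R := ℝ) ({1} : Set (Site → ℝ)))

/-- A nondegenerate two-dimensional space of functions is `{c, c κ}` for a `c` without zeros. -/
theorem exists_pair [FiniteDimensional ℝ C] (hC : Module.finrank ℝ C = 2) (hd : NonvanishingDet C)
    (h2 : ∀ s, ∀ f ∈ C, f s = 0 → f (s + (0, 1)) = 0 → f = 0) :
    ∃ c κ : Site → ℝ, (∀ s, c s ≠ 0) ∧ C = (Submodule.span ℝ {1, κ}).map (LinearMap.mulLeft ℝ c) ∧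
      (∀ s, κ s ≠ κ (s + (1, 0))) ∧ ∀ s, κ s ≠ κ (s + (0, 1)) := by
  have hd' : ∀ s, ∀ f ∈ C, f s = 0 → f (s + (1, 0)) = 0 → f = 0 := fun s f hf e0 e1 =>
    hd s f hf fun i hi => by
      rw [hC] at hi
      have : i = 0 ∨ i = 1 := by
        rcases i with ⟨i, hi'⟩
        simp only at hi
        interval_cases i
        · exact Or.inl rfl
        · exact Or.inr rfl
      rcases this with rfl | rfl
      · rwa [nbr_zero, add_zero]
      · exact e1
  let B := Module.finBasisOfFinrankEq ℝ C hC
  set f := (B 0 : Site → ℝ) with hf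
  set g := (B 1 : Site → ℝ) with hg
  have hfC : f ∈ C := (B 0).2
  have hgC : g ∈ C := (B 1).2
  have hli : ∀ x y : ℝ, x • f + y • g = 0 → x = 0 ∧ y = 0 := by
    have := B.linearIndependent.map' C.subtype C.ker_subtype
    have h3 : (⇑C.subtype ∘ ⇑B) = ![f, g] := by
      funext i; fin_cases i <;> rfl
    rw [h3, LinearIndependent.pair_iff] at this
    exact this
  have hspan : ∀ h ∈ C, ∃ x y : ℝ, h = x • f + y • g := fun h hh => by
    have := congrArg Subtype.val (B.sum_repr ⟨h, hh⟩)
    rw [Fin.sum_univ_two] at this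
    exact ⟨_, _, this.symm⟩
  -- If both vanished at `s`, the combination that also vanishes at the next point would be zero. By
  -- independence `f` would then vanish at both points, hence identically.
  have hnz : ∀ s, f s ≠ 0 ∨ g s ≠ 0 := by
    intro s
    by_contra! h0
    have := hd' s (g (s + (1, 0)) • f + (-f (s + (1, 0))) • g)
      (add_mem (C.smul_mem _ hfC) (C.smul_mem _ hgC)) (by simp [h0.1, h0.2]) (by simp; ring)
    obtain ⟨e1, e2⟩ := hli _ _ this
    have hf0 := hd' s f hfC h0.1 (neg_eq_zero.1 e2)
    have := (hli 1 0 (by simp [hf0])).1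
    exact one_ne_zero this
  -- At each site at most one `x` is bad, and the lattice is countable.
  obtain ⟨x, hx⟩ : ∃ x : ℝ, ∀ s, f s + x * g s ≠ 0 := by
    have hcount : (⋃ s : Site, {x : ℝ | f s + x * g s = 0}).Countable := by
      refine countable_iUnion fun s => Set.Subsingleton.countable fun x hx y hy => ?_
      have hx' : f s + x * g s = 0 := hx
      have hy' : f s + y * g s = 0 := hy
      have hg0 : g s ≠ 0 := fun h0 => by
        rw [h0, mul_zero, add_zero] at hx'
        exact (hnz s).elim (absurd hx') (absurd h0)
      exact mul_right_cancel₀ hg0 (by linarith)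
    obtain ⟨x, hx⟩ := (Set.ne_univ_iff_exists_notMem _).1
      (fun h => not_countable_univ (α := ℝ) (h ▸ hcount))
    exact ⟨x, fun s hs => hx (mem_iUnion.2 ⟨s, hs⟩)⟩
  set k : Site → ℝ := f + x • g with hk
  have hk0 : ∀ s, k s ≠ 0 := hx
  have hkC : k ∈ C := add_mem hfC (C.smul_mem _ hgC)
  have hne : ∀ v : Site, (∀ s, ∀ f ∈ C, f s = 0 → f (s + v) = 0 → f = 0) →
      ∀ s, g s / k s ≠ g (s + v) / k (s + v) := by
    intro v hv s heq
    have := hv s (g + (-(g s / k s)) • k) (add_mem hgC (C.smul_mem _ hkC))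
      (by simp; field_simp [hk0 s]; ring) (by
        simp only [Pi.add_apply, Pi.smul_apply, smul_eq_mul]
        rw [heq]; field_simp [hk0 (s + v)]; ring)
    have e := hli (-(g s / k s)) (1 - g s / k s * x) (by
      rw [← this, hk]; funext r; simp; ring)
    have e1 := neg_eq_zero.1 e.1
    rw [e1] at e
    simp at e
  refine ⟨k, fun s => g s / k s, hk0, le_antisymm (fun h hh => ?_) ?_, hne _ hd', hne _ h2⟩
  · obtain ⟨y, z, rfl⟩ := hspan h hh
    refine ⟨y • 1 + (z - y * x) • fun s => g s / k s, add_mem (Submodule.smul_mem _ _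
      (Submodule.subset_span (by simp))) (Submodule.smul_mem _ _ (Submodule.subset_span (by simp))), ?_⟩
    funext s
    have := hk0 s
    have e : k s = f s + x * g s := rfl
    simp only [LinearMap.mulLeft_apply, Pi.mul_apply, Pi.add_apply, Pi.smul_apply, smul_eq_mul,
      Pi.one_apply]
    field_simp
    rw [e]; ring
  · rw [Submodule.map_span, Submodule.span_le]
    rintro _ ⟨w, (rfl | rfl), rfl⟩
    · simpa using hkC
    · have : LinearMap.mulLeft ℝ k (fun s => g s / k s) = g := funext fun s => by
        simp [mul_div_cancel₀ _ (hk0 s)]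
      rwa [SetLike.mem_coe, this]

end

/-! ### Completeness of the two classes -/

section
variable {D : LatticeDomain} {F : Site → ℝ × (Fin 7 → ℝ) → ℝ} {L : Submodule ℝ LatticeField}
  {Φ : AllowedMap} {A C : Submodule ℝ (Site → ℝ)} {b c : ℝ}

/-- For `a = 1` the scaling condition says that the interaction has degree `1`, against the degree
`-3` from `sl(2,ℝ)`. So the transformed interaction would vanish, and `F` would depend on `t` and
the central value only. -/
theorem one_notMem_of_coupled (hD : D.Regular) (h : Φ.Admissible D.I)
    (hF : ∀ s, ContDiffOn ℝ ∞ (F s) (D.Ω s))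
    (H : ∀ s, ∀ x ∈ D.Ω s, Red A C s (mixF Φ F s) (newZ Φ s x))
    (hc : ∀ i, ∀ O ⊆ D.Ω 0, IsOpen O → O.Nonempty → ∃ x ∈ O, partialU (F 0) i x ≠ 0) :
    (1 : Site → ℝ) ∉ A := by
  intro h1
  have hzero : ∀ x ∈ D.Ω 0, mixF Φ F 0 (newZ Φ 0 x) = 0 := fun x hx => by
    have e1 := (H 0 x hx).euler
    have e2 := (H 0 x hx).scal 1 h1
    simp only [Pi.one_apply, one_mul] at e2
    have e3 : fderiv ℝ (mixF Φ F 0) (newZ Φ 0 x) (0, fun i => (newZ Φ 0 x).2 i) =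
      fderiv ℝ (mixF Φ F 0) (newZ Φ 0 x) (0, (newZ Φ 0 x).2) := rfl
    rw [e3, e1] at e2
    linarith
  have hne : (D.Ω 0).Nonempty := by
    obtain ⟨t, ht⟩ := hD.nonempty_I
    obtain ⟨u, hu⟩ := hD.nonempty_J 0
    obtain ⟨v, hv, -⟩ := hD.Ω_onto 0 t ht u hu
    exact ⟨_, hv⟩
  obtain ⟨x, hx, hx0⟩ := hc 1 _ subset_rfl (hD.isOpen_Ω 0) hne
  refine hx0 (partialU_eq_zero_of_const (hD.isOpen_Ω 0) ((hF 0).differentiableOn (by simp))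
    (h := fun x => deriv (deriv (Φ.Q 0)) x.1 - coefS Φ x.1 * Φ.newU 0 (x.1, x.2 0) / coefA Φ 0 x.1)
    (fun y hy => ?_) (fun y r => ?_) hx)
  · have hyI := (hD.Ω_subset 0 y hy).1
    have e := hzero y hy
    rw [mixF_newZ h hyI, newF_eq] at e
    have hA : coefA Φ 0 y.1 ≠ 0 := by
      rw [coefA_eq h 0 hyI]
      exact mul_ne_zero (inv_ne_zero (pow_ne_zero 3 (h.sqrt_pos hyI).ne')) (inv_ne_zero (h.2.2.1 0))
    field_simp
    linear_combination e
  · simp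

theorem exists_classOne [FiniteDimensional ℝ A] (hD : D.Regular) (h : Φ.Admissible D.I)
    (hF : ∀ s, ContDiffOn ℝ ∞ (F s) (D.Ω s)) (hL : L = (ParSub A ⊥).map (pbF D Φ))
    (H : ∀ s, ∀ x ∈ D.Ω s, Red A ⊥ s (mixF Φ F s) (newZ Φ s x)) (hA : Module.finrank ℝ A = 4)
    (h1 : (1 : Site → ℝ) ∉ A) (hd : NonvanishingDet (A ⊔ Submodule.span ℝ {1})) :
    ∃ a, ClassOne D F L Φ a := by
  obtain ⟨a, hspan, hΔ⟩ := exists_basis_four hA h1 hd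
  refine ⟨a, h, hΔ, by rwa [stdSpan1_eq, corresponds_iff hD h, hspan], fun s x hx hx0 => ?_⟩
  obtain ⟨f, O, hO, hxO, hf, hev⟩ := local_form1 (hΔ s) (A := A)
    (fun k => hspan ▸ Submodule.subset_span ⟨k, rfl⟩) (eventually_red hD h hF H hx) hx0
  exact ⟨f, O, hO, hxO, hf,
    eventually_newF hD h hx (g := fun v => factor1 a s v * f (xi1 a s v)) hev⟩

/-- Absorbing the factor `c` of the translations into the transformation. -/
theorem map_pbF_mulLeft (hP : ∀ s, Φ.P s = 1) (k : Site → ℝ) :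
    (ParSub ⊥ (C.map (LinearMap.mulLeft ℝ k))).map (pbF D Φ) =
      (ParSub ⊥ C).map (pbF D ⟨Φ.θ, k, Φ.Q⟩) := by
  have key : ∀ q a c d, pbF D Φ (q, a, k * c, k * d) = pbF D ⟨Φ.θ, k, Φ.Q⟩ (q, a, c, d) := by
    intro q a c d
    funext s p
    by_cases hp : p ∈ D.plane s
    · rw [pbF_of_mem _ hp, pbF_of_mem _ hp]
      simp only [pbv, hP, Pi.mul_apply]
      congr 3
      ring
    · rw [pbF_of_notMem _ hp, pbF_of_notMem _ hp]
  ext X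
  constructor
  · rintro ⟨⟨q, a, _, _⟩, hm, rfl⟩
    obtain ⟨ha, ⟨c, hc, rfl⟩, ⟨d, hd, rfl⟩⟩ := mem_ParSub.1 hm
    exact ⟨(q, a, c, d), mem_ParSub.2 ⟨ha, hc, hd⟩, (key q a c d).symm⟩
  · rintro ⟨⟨q, a, c, d⟩, hm, rfl⟩
    obtain ⟨ha, hc, hd⟩ := mem_ParSub.1 hm
    exact ⟨(q, a, k * c, k * d), mem_ParSub.2 ⟨ha, ⟨c, hc, rfl⟩, ⟨d, hd, rfl⟩⟩, key q a c d⟩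

theorem exists_classTwo [FiniteDimensional ℝ C] (hD : D.Regular) (h : Φ.Admissible D.I)
    (hP : ∀ s, Φ.P s = 1) (hF : ∀ s, ContDiffOn ℝ ∞ (F s) (D.Ω s))
    (hL : L = (ParSub ⊥ C).map (pbF D Φ)) (hs : ∀ X ∈ L, IsSymmetry D F X)
    (hC : Module.finrank ℝ C = 2) (hd : NonvanishingDet C)
    (h2 : ∀ s, ∀ f ∈ C, f s = 0 → f (s + (0, 1)) = 0 → f = 0) : ∃ Φ κ, ClassTwo D F L Φ κ := by
  obtain ⟨k, κ, hk, rfl, hn, hm⟩ := exists_pair hC hd h2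
  rw [map_pbF_mulLeft hP] at hL
  have h' : (⟨Φ.θ, k, Φ.Q⟩ : AllowedMap).Admissible D.I := ⟨h.1, h.2.1, hk, h.2.2.2⟩
  have H := (isSymmetry_iff_red hD h' hF).1 (hL ▸ hs)
  refine ⟨_, κ, h', hn, hm, by rwa [stdSpan2_eq, corresponds_iff hD h'], fun s x hx hx0 => ?_⟩
  obtain ⟨f, O, hO, hxO, hf, hev⟩ := local_form2 (by rw [nbr_zero, add_zero]; exact hn s)
    (eventually_red hD h' hF H hx) hx0
  exact ⟨f, O, hO, hxO, hf,
    eventually_newF hD h' hx (g := fun v => (det2 κ s v 2 ^ 3)⁻¹ * f (xi2 κ s v)) hev⟩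

theorem finiteDimensional_of_ParSub [FiniteDimensional ℝ (ParSub A C)] :
    FiniteDimensional ℝ A ∧ FiniteDimensional ℝ C := by
  constructor
  · exact Submodule.finiteDimensional_of_le (S₂ := (ParSub A C).map
      (LinearMap.fst ℝ _ _ ∘ₗ LinearMap.snd ℝ _ _)) fun a ha =>
        ⟨(0, a, 0, 0), mem_ParSub.2 ⟨ha, C.zero_mem, C.zero_mem⟩, rfl⟩
  · exact Submodule.finiteDimensional_of_le (S₂ := (ParSub A C).map
      (LinearMap.fst ℝ _ _ ∘ₗ LinearMap.snd ℝ _ _ ∘ₗ LinearMap.snd ℝ _ _)) fun c hc =>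
        ⟨(0, 0, c, 0), mem_ParSub.2 ⟨A.zero_mem, hc, C.zero_mem⟩, rfl⟩

/-- Near a dense set of times, a nonsolvable seven-dimensional symmetry algebra in general position
belongs to one of the two classes. -/
theorem IsNonsolvableSeven.exists_class (h : IsNonsolvableSeven D F L) (hD : D.Regular)
    (hF : IsInteraction D F) (hbc : b < c) (hI : Ioo b c ⊆ D.I) :
    ∃ I' : Set ℝ, I' ⊆ Ioo b c ∧ IsOpen I' ∧ I'.OrdConnected ∧ I'.Nonempty ∧
      ((∃ Φ a, ClassOne (D.restrict I') F (L.map (cutoff I')) Φ a) ∨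
        (∃ Φ κ, ClassTwo (D.restrict I') F (L.map (cutoff I')) Φ κ)) := by
  have hL := h.algebra.isAffAlgebra hD hF
  have hfd : FiniteDimensional ℝ L := Module.finite_of_finrank_pos (by rw [h.dim]; norm_num)
  obtain ⟨b', c', hbc', hs', Φ, hΦ, hP, A, C, hmap, hAC⟩ := local_structure hD hL h.nonsolvable hbc hI
  refine ⟨Ioo b' c', hs', isOpen_Ioo, ordConnected_Ioo, nonempty_Ioo.2 hbc', ?_⟩
  have hI' := hs'.trans hI
  have hD' := hD.restrict isOpen_Ioo ordConnected_Ioo (nonempty_Ioo.2 hbc') hI'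
  have hF' : ∀ s, ContDiffOn ℝ ∞ (F s) ((D.restrict (Ioo b' c')).Ω s) := fun s =>
    (hF.smooth s).mono fun _ hx => hx.1
  have hg := h.position.cutoff hD hL h.nonsolvable hbc' hI'
  have hsym : ∀ X ∈ L.map (cutoff (Ioo b' c')), IsSymmetry (D.restrict (Ioo b' c')) F X := by
    rintro _ ⟨X, hX, rfl⟩
    obtain ⟨τ, a, l, hX'⟩ := hL.aff X hX
    exact hX'.isSymmetry_cutoff hD (h.algebra.symm X hX) hbc' hI'
  have hdim := (finrank_map_cutoff hL hbc' hI').trans h.dim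
  have hsc := hg.scaling
  have htr := hg.translation
  have htr2 := hg.translation_two
  rw [hmap, scalingSpace_eq hD' hΦ] at hsc
  rw [hmap, finrank_map_pbF hD' hΦ] at hdim
  have : FiniteDimensional ℝ (ParSub A C) := Module.finite_of_finrank_pos (by rw [hdim]; norm_num)
  obtain ⟨hfA, hfC⟩ := finiteDimensional_of_ParSub (A := A) (C := C)
  rw [finrank_ParSub] at hdim
  obtain ⟨t, ht⟩ := nonempty_Ioo.2 hbc'
  have hT : translationSpace (D.restrict (Ioo b' c')) (L.map (cutoff (Ioo b' c'))) t = C := by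
    rw [hmap, translationSpace_eq hD' hΦ A C ht, show Φ.P = 1 from funext hP]
    ext f; simp
  have hC := htr t ht
  have hC2 := htr2 t ht
  rw [hT] at hC hC2
  -- The dimension is `3 + dim A + 2 dim C = 7`.
  have cases : (Module.finrank ℝ A = 4 ∧ Module.finrank ℝ C = 0) ∨
      (Module.finrank ℝ A = 2 ∧ Module.finrank ℝ C = 1) ∨
      (Module.finrank ℝ A = 0 ∧ Module.finrank ℝ C = 2) := by omega
  rcases cases with ⟨dA, dC⟩ | ⟨dA, dC⟩ | ⟨dA, dC⟩
  · obtain rfl := Submodule.finrank_eq_zero.1 dC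
    have H := (isSymmetry_iff_red hD' hΦ hF').1 (hmap ▸ hsym)
    have h1 := one_notMem_of_coupled hD' hΦ hF' H fun i O hO =>
      hF.coupled 0 i O (hO.trans fun _ hx => hx.1)
    exact Or.inl ⟨Φ, exists_classOne hD' hΦ hF' hmap H dA h1 hsc⟩
  · have := finrank_le_one_of_mul_mem dC hC hAC
    omega
  · obtain rfl := Submodule.finrank_eq_zero.1 dA
    exact Or.inr (exists_classTwo hD' hΦ hP hF' hmap hsym dC hC (hC2 dC))

end

/-! ### Equations over the full domain, with the identical transformation -/

def AllowedMap.identity : AllowedMap := ⟨id, 1, 0⟩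

section
variable {Ω : Set (ℝ × (Fin 7 → ℝ))} {F : Site → ℝ × (Fin 7 → ℝ) → ℝ}

theorem AllowedMap.identity_admissible (I : Set ℝ) : AllowedMap.identity.Admissible I :=
  ⟨contDiffOn_id, fun t _ => by simp [AllowedMap.identity], fun s => by simp [AllowedMap.identity],
    fun _ => contDiffOn_const⟩

theorem newZ_identity (s : Site) (x : ℝ × (Fin 7 → ℝ)) : newZ .identity s x = x := by
  refine Prod.ext rfl (funext fun i => ?_)
  simp [newZ, AllowedMap.newV, AllowedMap.newU, AllowedMap.identity]

theorem mixF_identity (s : Site) : mixF .identity F s = F s := by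
  funext z
  rw [mixF_eq (D := fullDomain univ) (AllowedMap.identity_admissible _) (mem_univ _)]
  have : oldV .identity s z = z := by
    refine Prod.ext rfl (funext fun i => ?_)
    simp [oldV, AllowedMap.identity]
  rw [this]
  simp [coefA, coefS, AllowedMap.identity]

theorem pbF_identity (m : Par) : pbF (fullDomain Ω) .identity m = stdF m := by
  funext s p
  rw [pbF_of_mem m (mem_plane_fullDomain s p)]
  simp [pbv, stdF, AllowedMap.identity]

theorem eq_affine_of_deriv2 {f : ℝ → ℝ} (hf : ContDiff ℝ ∞ f) (h : ∀ t, deriv (deriv f) t = 0) :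
    ∀ t, f t = f 0 + deriv f 0 * t := by
  have h1 : ContDiff ℝ ∞ (deriv f) := (contDiff_infty_iff_deriv.1 hf).2
  have hd := is_const_of_deriv_eq_zero (h1.differentiable (by simp)) h
  have h2 : ∀ t, HasDerivAt (fun t => f t - deriv f 0 * t) 0 t := fun t => by
    have := ((hf.differentiable (by simp)) t).hasDerivAt.sub ((hasDerivAt_id t).const_mul (deriv f 0))
    exact this.congr_deriv (by rw [hd t 0]; ring)
  intro t
  have := is_const_of_deriv_eq_zero (fun t => (h2 t).differentiableAt) (fun t => (h2 t).deriv) t 0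
  simp only [mul_zero, sub_zero] at this
  linarith

theorem eq_quad_of_deriv3 {f : ℝ → ℝ} (hf : ContDiff ℝ ∞ f) (h : ∀ t, deriv (deriv (deriv f)) t = 0) :
    ∃ q, f = quad q := by
  have h1 : ContDiff ℝ ∞ (deriv f) := (contDiff_infty_iff_deriv.1 hf).2
  have hd := eq_affine_of_deriv2 h1 h
  set q : Fin 3 → ℝ := ![f 0, deriv f 0, deriv (deriv f) 0 / 2] with hq
  refine ⟨q, funext fun t => ?_⟩
  have h2 : ∀ t, HasDerivAt (fun t => f t - quad q t) 0 t := fun t => by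
    have := ((hf.differentiable (by simp)) t).hasDerivAt.sub (quad_hasDerivAt q t)
    refine this.congr_deriv ?_
    rw [hd t, quadD]
    simp [hq]; ring
  have := is_const_of_deriv_eq_zero (fun t => (h2 t).differentiableAt) (fun t => (h2 t).deriv) t 0
  have h0 : quad q 0 = f 0 := by simp [quad, hq]
  rw [h0, sub_self] at this
  linarith

theorem exists_shift {O : Set (ℝ × (Fin 7 → ℝ))} (hO : IsOpen O) {x : ℝ × (Fin 7 → ℝ)} (hx : x ∈ O)
    (i : Fin 7) {δ : ℝ} (hδ : 0 < δ) : ∃ ε, 0 < ε ∧ ε < δ ∧ (x.1, x.2 + ε • Pi.single i 1) ∈ O := by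
  have hc : Continuous fun ε : ℝ => (x.1, x.2 + ε • (Pi.single i 1 : Fin 7 → ℝ)) := by fun_prop
  have h0 : ∀ᶠ ε in 𝓝 (0:ℝ), (x.1, x.2 + ε • (Pi.single i 1 : Fin 7 → ℝ)) ∈ O :=
    hc.continuousAt (hO.mem_nhds (by simpa using hx))
  obtain ⟨r, hr, hb⟩ := Metric.eventually_nhds_iff.1 h0
  refine ⟨min r δ / 2, by positivity, ?_, hb ?_⟩
  · have := min_le_right r δ
    linarith [lt_min hr hδ]
  · have := min_le_left r δ
    have h3 := lt_min hr hδ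
    rw [Real.dist_eq, sub_zero, abs_of_pos (by linarith)]
    linarith

/-- The derivative of a function in a direction from its derivative along a line. -/
theorem fderiv_of_line {g : ℝ × (Fin 7 → ℝ) → ℝ} {x v : ℝ × (Fin 7 → ℝ)} {d : ℝ}
    (hg : DifferentiableAt ℝ g x) (h : HasDerivAt (fun ρ : ℝ => g (x + ρ • v)) d 0) :
    fderiv ℝ g x v = d := by
  rw [← hg.lineDeriv_eq_fderiv]
  exact h.deriv

end

/-! ### A member of the first class with full symmetry algebra -/

section

/-- The quotient of the interaction `exOne` by `v 0`. -/
noncomputable def exOneH (x : ℝ × (Fin 7 → ℝ)) : ℝ :=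
  ((x.2 1 * x.2 4) ^ 2)⁻¹ + ((x.2 2 * x.2 5) ^ 2)⁻¹ + x.2 6 * ((x.2 1 * x.2 4) ^ 2 * x.2 3)⁻¹

/-- For an antiperiodic `a` the exponents at the opposite neighbours `1, 4` and `2, 5` are opposite
and those at `3, 6` are equal. So `v 1 * v 4`, `v 2 * v 5` and `v 6 / v 3` are invariant. The terms
of degree `-4` times `v 0` have degree `-3`. -/
noncomputable def exOne (x : ℝ × (Fin 7 → ℝ)) : ℝ := x.2 0 * exOneH x

def exOneSet : Set (ℝ × (Fin 7 → ℝ)) := {x | ∀ i : Fin 6, x.2 i.succ ≠ 0}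

/-- The functions on the lattice that change sign under shifts by two. -/
def antiperiodic : Submodule ℝ (Site → ℝ) where
  carrier := {a | ∀ s, a (s + (2, 0)) = -a s ∧ a (s + (0, 2)) = -a s}
  add_mem' ha hb s := by
    simp only [Pi.add_apply, (ha s).1, (ha s).2, (hb s).1, (hb s).2]
    constructor <;> ring
  zero_mem' s := by simp
  smul_mem' r a ha s := by simp [(ha s).1, (ha s).2]

variable {x : ℝ × (Fin 7 → ℝ)} {a : Site → ℝ}

theorem isOpen_exOneSet : IsOpen exOneSet := by
  rw [exOneSet, Set.ofPred_forall]
  exact isOpen_iInter_of_finite fun i => isOpen_ne_fun (by fun_prop) continuous_const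

theorem ne_of_mem_exOneSet (hx : x ∈ exOneSet) :
    x.2 1 ≠ 0 ∧ x.2 2 ≠ 0 ∧ x.2 3 ≠ 0 ∧ x.2 4 ≠ 0 ∧ x.2 5 ≠ 0 ∧ x.2 6 ≠ 0 :=
  ⟨hx 0, hx 1, hx 2, hx 3, hx 4, hx 5⟩

theorem contDiffAt_exOneH (hx : x ∈ exOneSet) : ContDiffAt ℝ ∞ exOneH x := by
  obtain ⟨h1, h2, h3, h4, h5, h6⟩ := ne_of_mem_exOneSet hx
  unfold exOneH
  refine (ContDiffAt.add (ContDiffAt.inv (by fun_prop) ?_) (ContDiffAt.inv (by fun_prop) ?_)).add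
    (ContDiffAt.mul (by fun_prop) (ContDiffAt.inv (by fun_prop) ?_)) <;> positivity

theorem contDiffAt_exOne (hx : x ∈ exOneSet) : ContDiffAt ℝ ∞ exOne x := by
  unfold exOne
  exact ContDiffAt.mul (by fun_prop) (contDiffAt_exOneH hx)

theorem fderiv_exOneH (hx : x ∈ exOneSet) (t : ℝ) (w : Fin 7 → ℝ) :
    fderiv ℝ exOneH x (t, w) =
      -2 * (w 1 / x.2 1 + w 4 / x.2 4) * ((x.2 1 * x.2 4) ^ 2)⁻¹
      - 2 * (w 2 / x.2 2 + w 5 / x.2 5) * ((x.2 2 * x.2 5) ^ 2)⁻¹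
      + (w 6 / x.2 6 - w 3 / x.2 3 - 2 * (w 1 / x.2 1 + w 4 / x.2 4)) *
        (x.2 6 * ((x.2 1 * x.2 4) ^ 2 * x.2 3)⁻¹) := by
  obtain ⟨h1, h2, h3, h4, h5, h6⟩ := ne_of_mem_exOneSet hx
  refine fderiv_of_line ((contDiffAt_exOneH hx).differentiableAt (by simp)) ?_
  have hl : ∀ i, HasDerivAt (fun ρ : ℝ => (x + ρ • (t, w)).2 i) (w i) 0 := fun i => by
    simpa using ((hasDerivAt_id (0:ℝ)).mul_const (w i)).const_add (x.2 i)
  have e : ∀ i, (x + (0:ℝ) • (t, w)).2 i = x.2 i := fun i => by simp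
  have h14 := ((hl 1).mul (hl 4)).pow 2
  have h25 := ((hl 2).mul (hl 5)).pow 2
  have := ((h14.inv (by simp [h1, h4])).add (h25.inv (by simp [h2, h5]))).add
    ((hl 6).mul ((h14.mul (hl 3)).inv (by simp [h1, h4, h3])))
  refine this.congr_deriv ?_
  simp only [Pi.mul_apply, Pi.pow_apply, Pi.inv_apply, e]
  field_simp
  ring

theorem fderiv_exOne (hx : x ∈ exOneSet) (t : ℝ) (w : Fin 7 → ℝ) :
    fderiv ℝ exOne x (t, w) = w 0 * exOneH x + x.2 0 * fderiv ℝ exOneH x (t, w) := by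
  refine fderiv_of_line ((contDiffAt_exOne hx).differentiableAt (by simp)) ?_
  have h0 : HasDerivAt (fun ρ : ℝ => (x + ρ • (t, w)).2 0) (w 0) 0 := by
    simpa using ((hasDerivAt_id (0:ℝ)).mul_const (w 0)).const_add (x.2 0)
  have hl : HasDerivAt (fun ρ : ℝ => x + ρ • (t, w)) (t, w) 0 := by
    simpa using ((hasDerivAt_id (0:ℝ)).smul_const (t, w)).const_add x
  have e : x + (0:ℝ) • (t, w) = x := by simp
  have h1 := HasFDerivAt.comp_hasDerivAt (l := exOneH) (0:ℝ)
    (by rw [e]; exact ((contDiffAt_exOneH hx).differentiableAt (by simp)).hasFDerivAt) hl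
  refine (h0.mul h1).congr_deriv ?_
  simp [Function.comp]

theorem exOneDomain_regular : (fullDomain exOneSet).Regular :=
  fullDomain_regular isOpen_exOneSet fun _ u =>
    ⟨Fin.cons u fun _ => 1, fun i => by simp, rfl⟩

theorem antiperiodic_nbr (ha : a ∈ antiperiodic) (s : Site) :
    a (s + nbr 4) = -a (s + nbr 1) ∧ a (s + nbr 5) = -a (s + nbr 2) ∧
      a (s + nbr 6) = a (s + nbr 3) := by
  refine ⟨?_, ?_, ?_⟩
  · have := (ha (s + nbr 4)).1
    rw [add_assoc, show nbr 4 + (2, 0) = nbr 1 from rfl] at this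
    linarith
  · have := (ha (s + nbr 5)).2
    rw [add_assoc, show nbr 5 + (0, 2) = nbr 2 from rfl] at this
    linarith
  · have h1 := (ha (s + nbr 3)).1
    have h2 := (ha (s + nbr 6)).2
    rw [add_assoc, show nbr 6 + (0, 2) = nbr 3 + (2, 0) from rfl, ← add_assoc] at h2
    linarith

theorem red_exOne (s : Site) (hx : x ∈ exOneSet) : Red antiperiodic ⊥ s exOne x := by
  obtain ⟨h1, h2, h3, h4, h5, h6⟩ := ne_of_mem_exOneSet hx
  refine ⟨?_, ?_, fun a ha => ?_, fun c hc => ?_⟩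
  · rw [fderiv_exOne hx, fderiv_exOneH hx]
    simp
  · rw [fderiv_exOne hx, fderiv_exOneH hx, exOne, exOneH]
    field_simp
    ring
  · obtain ⟨e1, e2, e3⟩ := antiperiodic_nbr ha s
    rw [fderiv_exOne hx, fderiv_exOneH hx, exOne]
    simp only [mul_div_cancel_right₀ _ h1, mul_div_cancel_right₀ _ h2, mul_div_cancel_right₀ _ h3,
      mul_div_cancel_right₀ _ h4, mul_div_cancel_right₀ _ h5, mul_div_cancel_right₀ _ h6, e1, e2, e3,
      nbr_zero, add_zero]
    ring
  · rw [(Submodule.mem_bot ℝ).1 hc]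
    exact map_zero _

theorem isInteraction_exOne : IsInteraction (fullDomain exOneSet) fun _ => exOne := by
  have hp : ∀ x ∈ exOneSet, ∀ i, partialU exOne i x = (Pi.single i 1 : Fin 7 → ℝ) 0 * exOneH x +
      x.2 0 * fderiv ℝ exOneH x (0, Pi.single i 1) := fun x hx i => fderiv_exOne hx 0 _
  refine ⟨fun s x hx => (contDiffAt_exOne hx).contDiffWithinAt, fun s => ⟨0, 6, (0, 1), ?_, ?_⟩, ?_⟩
  · intro i; simp
  · have hx : ((0, 1) : ℝ × (Fin 7 → ℝ)) ∈ exOneSet := fun i => by simp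
    have : partialU exOne 0 =ᶠ[𝓝 (0, 1)] exOneH := by
      filter_upwards [isOpen_exOneSet.mem_nhds hx] with y hy
      rw [hp y hy, fderiv_exOneH hy]
      simp
    rw [partialU, this.fderiv_eq, fderiv_exOneH hx]
    simp
  · intro s i O hO ho ⟨y, hy⟩
    by_contra! H
    obtain ⟨x, hx, hx0⟩ : ∃ x ∈ O, x.2 0 ≠ 0 := by
      by_cases h0 : y.2 0 = 0
      · obtain ⟨ε, hε, -, hm⟩ := exists_shift ho hy 0 one_pos
        exact ⟨_, hm, by simp [h0, hε.ne']⟩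
      · exact ⟨y, hy, h0⟩
    -- For the indices `0`, `1` and `4` two terms could cancel at a point; comparing two values of
    -- `v 6` isolates the term that contains it.
    obtain ⟨ε, hε, -, hm⟩ := exists_shift ho hx 6 one_pos
    have e₁ := H _ hx
    have e₂ := H _ hm
    obtain ⟨h1, h2, h3, h4, h5, h6⟩ := ne_of_mem_exOneSet (hO hx)
    have h6' := (ne_of_mem_exOneSet (hO hm)).2.2.2.2.2
    rw [hp _ (hO hx), fderiv_exOneH (hO hx)] at e₁
    rw [hp _ (hO hm), fderiv_exOneH (hO hm)] at e₂
    simp only [Pi.add_apply, Pi.smul_apply, smul_eq_mul] at e₂ h6'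
    fin_cases i
    · simp [exOneH] at e₁ e₂
      have : ε * ((x.2 3)⁻¹ * ((x.2 1 * x.2 4) ^ 2)⁻¹) = 0 := by
        rw [mul_pow, mul_inv]
        linear_combination e₂ - e₁
      simp [hε.ne', h3, h1, h4] at this
    · simp at e₁ e₂
      have : ε * ((x.2 1)⁻¹ * ((x.2 3)⁻¹ * ((x.2 1 * x.2 4) ^ 2)⁻¹)) = 0 := by
        linear_combination (e₁.resolve_left hx0 - e₂.resolve_left hx0) / 2
      simp [hε.ne', h3, h1, h4] at this
    · simp [hx0, h2, h5] at e₁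
    · simp [hx0, h1, h3, h4, h6] at e₁
    · simp at e₁ e₂
      have : ε * ((x.2 4)⁻¹ * ((x.2 3)⁻¹ * ((x.2 1 * x.2 4) ^ 2)⁻¹)) = 0 := by
        linear_combination (e₁.resolve_left hx0 - e₂.resolve_left hx0) / 2
      simp [hε.ne', h3, h1, h4] at this
    · simp [hx0, h2, h5] at e₁
    · simp [hx0, h1, h3, h4, h6] at e₁

end

/-! ### All symmetries of the first example -/

section
variable {x : ℝ × (Fin 7 → ℝ)} {a : Site → ℝ} {X : LatticeField} {τ : ℝ → ℝ} {l : Site → ℝ → ℝ}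

theorem detEq_exOne (h : IsAff (fullDomain exOneSet) X τ a l)
    (hX : IsSymmetry (fullDomain exOneSet) (fun _ => exOne) X) :
    a ∈ antiperiodic ∧ l = 0 ∧ ∀ t, deriv (deriv (deriv τ)) t = 0 := by
  have hdet := (h.isSymmetry_iff exOneDomain_regular).1 hX
  have key : ∀ s t, ∀ v : Fin 7 → ℝ, (t, v) ∈ exOneSet →
      ((deriv τ t / 2 + a s) * v 0 + l s t) * exOneH (t, v) + v 0 * fderiv ℝ exOneH (t, v)
          (τ t, fun i => (deriv τ t / 2 + a (s + nbr i)) * v i + l (s + nbr i) t) =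
        deriv (deriv (deriv τ)) t / 2 * v 0 + deriv (deriv (l s)) t
          + (a s - 3 / 2 * deriv τ t) * (v 0 * exOneH (t, v)) := fun s t v hv => by
    have := hdet s (t, v) hv
    rwa [DetEq, fderiv_exOne hv, nbr_zero, add_zero] at this
  -- For `v 0 = 0` the equation reads `l * exOneH = l''`, and `exOneH` takes two different values at
  -- the chosen points.
  have hl : l = 0 := by
    funext s t
    have h1 : ((t, ![0, 1, 1, 1, 1, 1, 1]) : ℝ × (Fin 7 → ℝ)) ∈ exOneSet := fun i => by
      fin_cases i <;> simp
    have h2 : ((t, ![0, 1, 1, 1, 1, 1, 2]) : ℝ × (Fin 7 → ℝ)) ∈ exOneSet := fun i => by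
      fin_cases i <;> simp
    have e1 := key s t _ h1
    have e2 := key s t _ h2
    simp [exOneH] at e1 e2
    simp only [Pi.zero_apply]
    linarith
  subst hl
  -- By homogeneity `τ'` cancels. Four sample points give four independent equations for the sums of
  -- `a` over the pairs `1, 4` and `2, 5`, the difference of `a` over `3, 6`, and `τ'''`.
  have main : ∀ s t, a (s + nbr 1) + a (s + nbr 4) = 0 ∧ a (s + nbr 2) + a (s + nbr 5) = 0 ∧
      deriv (deriv (deriv τ)) t = 0 := by
    intro s t
    have h1 : ((t, ![1, 1, 1, 1, 1, 1, 1]) : ℝ × (Fin 7 → ℝ)) ∈ exOneSet := fun i => by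
      fin_cases i <;> simp
    have h2 : ((t, ![1, 1, 1, 1, 1, 1, 2]) : ℝ × (Fin 7 → ℝ)) ∈ exOneSet := fun i => by
      fin_cases i <;> simp
    have h3 : ((t, ![1, 1, 2, 1, 1, 1, 1]) : ℝ × (Fin 7 → ℝ)) ∈ exOneSet := fun i => by
      fin_cases i <;> simp
    have h4 : ((t, ![1, 2, 1, 1, 1, 1, 1]) : ℝ × (Fin 7 → ℝ)) ∈ exOneSet := fun i => by
      fin_cases i <;> simp
    have e1 := key s t _ h1
    have e2 := key s t _ h2
    have e3 := key s t _ h3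
    have e4 := key s t _ h4
    rw [fderiv_exOneH h1] at e1
    rw [fderiv_exOneH h2] at e2
    rw [fderiv_exOneH h3] at e3
    rw [fderiv_exOneH h4] at e4
    simp [exOneH] at e1 e2 e3 e4
    norm_num at e1 e2 e3 e4
    refine ⟨?_, ?_, ?_⟩ <;> linarith
  refine ⟨fun s => ⟨?_, ?_⟩, rfl, fun t => (main 0 t).2.2⟩
  · have := (main (s + (1, 0)) 0).1
    rw [add_assoc, add_assoc, show ((1, 0) : Site) + nbr 1 = (2, 0) from rfl,
      show ((1, 0) : Site) + nbr 4 = 0 from rfl, add_zero] at this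
    linarith
  · have := (main (s + (0, 1)) 0).2.1
    rw [add_assoc, add_assoc, show ((0, 1) : Site) + nbr 2 = (0, 2) from rfl,
      show ((0, 1) : Site) + nbr 5 = 0 from rfl, add_zero] at this
    linarith

theorem one_notMem_antiperiodic : (1 : Site → ℝ) ∉ antiperiodic := fun h => by
  have := (h 0).1
  simp only [Pi.one_apply] at this
  norm_num at this

theorem eq_zero_of_antiperiodic {f : ℤ → ℝ} (hf : ∀ n, f (n + 2) = -f n) {k : ℤ} (h0 : f k = 0)
    (h1 : f (k + 1) = 0) (n : ℤ) : f n = 0 := by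
  have key : ∀ n, f n = 0 ∧ f (n + 1) = 0 := by
    intro n
    induction n using Int.inductionOn' (b := k) with
    | zero => exact ⟨h0, h1⟩
    | succ j _ ih =>
      refine ⟨ih.2, ?_⟩
      rw [show j + 1 + 1 = j + 2 by ring, hf, ih.1, neg_zero]
    | pred j _ ih =>
      refine ⟨?_, by rw [sub_add_cancel]; exact ih.1⟩
      have := hf (j - 1)
      rw [show j - 1 + 2 = j + 1 by ring, ih.2] at this
      linarith
  exact (key n).1

theorem antiperiodic_eq_zero (ha : a ∈ antiperiodic) (s : Site) (h00 : a s = 0) (h10 : a (s + (1, 0)) = 0)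
    (h01 : a (s + (0, 1)) = 0) (h11 : a (s + (1, 1)) = 0) : a = 0 := by
  have hrow : ∀ m, a (s.1, m) = 0 → a (s.1 + 1, m) = 0 → ∀ n, a (n, m) = 0 := fun m e0 e1 n =>
    eq_zero_of_antiperiodic (f := fun n => a (n, m)) (fun n => by simpa using (ha (n, m)).1) e0 e1 n
  have h0 := hrow s.2 h00 (by simpa [Prod.add_def] using h10)
  have h1 := hrow (s.2 + 1) (by simpa [Prod.add_def] using h01) (by simpa [Prod.add_def] using h11)
  funext ⟨n, m⟩
  exact eq_zero_of_antiperiodic (f := fun m => a (n, m)) (fun m => by simpa using (ha (n, m)).2)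
    (h0 n) (h1 n) m

/-- The values at four points. -/
def antiperiodicEval : antiperiodic →ₗ[ℝ] (Fin 2 × Fin 2 → ℝ) where
  toFun a := fun i => a.1 ((i.1 : ℕ), (i.2 : ℕ))
  map_add' _ _ := rfl
  map_smul' _ _ := rfl

/-- A function on `ℤ` that changes sign under shifts by two, with given values at `0` and `1`. -/
noncomputable def antiperiodicWave (x : Fin 2 → ℝ) (n : ℤ) : ℝ :=
  x 0 * Real.cos (n * (Real.pi / 2)) + x 1 * Real.sin (n * (Real.pi / 2))

theorem antiperiodicWave_add_two (x : Fin 2 → ℝ) (n : ℤ) :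
    antiperiodicWave x (n + 2) = -antiperiodicWave x n := by
  have : ((n + 2 : ℤ) : ℝ) * (Real.pi / 2) = n * (Real.pi / 2) + Real.pi := by push_cast; ring
  rw [antiperiodicWave, antiperiodicWave, this, Real.cos_add_pi, Real.sin_add_pi]
  ring

theorem antiperiodicWave_coe (x : Fin 2 → ℝ) (i : Fin 2) : antiperiodicWave x (i : ℕ) = x i := by
  fin_cases i <;> simp [antiperiodicWave]

/-- An antiperiodic function is determined by its values on a two by two block, and these are
arbitrary: products of waves in `n` and `m` realise them. -/
theorem finrank_antiperiodic : Module.finrank ℝ antiperiodic = 4 := by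
  have hb : Function.Bijective antiperiodicEval := by
    constructor
    · rw [← LinearMap.ker_eq_bot, LinearMap.ker_eq_bot']
      intro a h
      refine Subtype.ext (antiperiodic_eq_zero a.2 0 ?_ ?_ ?_ ?_)
      · exact congrFun h (0, 0)
      · exact congrFun h (1, 0)
      · exact congrFun h (0, 1)
      · exact congrFun h (1, 1)
    · intro y
      refine ⟨⟨fun s => antiperiodicWave (fun i => antiperiodicWave (fun j => y (i, j)) s.2) s.1,
        fun s => ⟨?_, ?_⟩⟩, ?_⟩
      · simp [antiperiodicWave_add_two]
      · simp only [Prod.fst_add, Prod.snd_add, add_zero, antiperiodicWave_add_two]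
        simp only [antiperiodicWave]
        ring
      · funext i
        show antiperiodicWave (fun k => antiperiodicWave (fun j => y (k, j)) ((i.2 : ℕ) : ℤ))
          ((i.1 : ℕ) : ℤ) = y i
        rw [antiperiodicWave_coe, antiperiodicWave_coe]
  rw [(LinearEquiv.ofBijective _ hb).finrank_eq]
  simp

theorem nonvanishingDet_antiperiodic [FiniteDimensional ℝ antiperiodic] :
    NonvanishingDet (antiperiodic ⊔ Submodule.span ℝ {1}) := by
  have hdim : Module.finrank ℝ ↥(antiperiodic ⊔ Submodule.span ℝ {(1 : Site → ℝ)}) = 5 := by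
    have := Submodule.finrank_sup_add_finrank_inf_eq antiperiodic (Submodule.span ℝ {(1 : Site → ℝ)})
    have hinf : antiperiodic ⊓ Submodule.span ℝ {(1 : Site → ℝ)} = ⊥ := by
      rw [← disjoint_iff]
      exact Submodule.disjoint_span_singleton_of_notMem one_notMem_antiperiodic
    rw [hinf, finrank_bot, finrank_antiperiodic, finrank_span_singleton one_ne_zero] at this
    omega
  intro s f hf h0
  rw [hdim] at h0
  obtain ⟨a, ha, y, hy, rfl⟩ := Submodule.mem_sup.1 hf
  obtain ⟨r, rfl⟩ := Submodule.mem_span_singleton.1 hy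
  have e0 := h0 0 (by decide)
  have e1 := h0 1 (by decide)
  have e2 := h0 2 (by decide)
  have e3 := h0 3 (by decide)
  have e4 := h0 4 (by decide)
  simp only [Pi.add_apply, Pi.smul_apply, Pi.one_apply, smul_eq_mul, mul_one] at e0 e1 e2 e3 e4
  have h4 := (antiperiodic_nbr ha s).1
  -- The antiperiodic part cancels between the opposite neighbours `1` and `4`, leaving `2 r = 0`.
  have hr : r = 0 := by linarith
  subst hr
  -- The value at the offset `(-1, 1)` gives the one at `(1, 1)`, which completes a two by two
  -- block.
  have h3 := (ha (s + nbr 3)).1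
  rw [add_assoc, show nbr 3 + (2, 0) = (1, 1) from rfl] at h3
  rw [zero_smul, add_zero]
  refine antiperiodic_eq_zero ha s ?_ ?_ ?_ ?_
  · rw [nbr_zero, add_zero, add_zero] at e0; exact e0
  · change a (s + (1, 0)) + 0 = 0 at e1; linarith
  · change a (s + (0, 1)) + 0 = 0 at e2; linarith
  · linarith

theorem exists_classOne_full : ∃ (D : LatticeDomain) (F : Site → ℝ × (Fin 7 → ℝ) → ℝ)
    (L : Submodule ℝ LatticeField) (Φ : AllowedMap) (a : Fin 4 → Site → ℝ),
    D.Regular ∧ IsInteraction D F ∧ ClassOne D F L Φ a ∧ ∀ X, IsSymmetry D F X → X ∈ L := by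
  have hfd : FiniteDimensional ℝ antiperiodic :=
    Module.finite_of_finrank_pos (by rw [finrank_antiperiodic]; norm_num)
  have hD := exOneDomain_regular
  obtain ⟨a, ha⟩ := exists_classOne (F := fun _ => exOne) hD (AllowedMap.identity_admissible _)
    isInteraction_exOne.smooth rfl (fun s x hx => by
      rw [mixF_identity, newZ_identity]; exact red_exOne s hx) finrank_antiperiodic
    one_notMem_antiperiodic nonvanishingDet_antiperiodic
  refine ⟨_, _, _, _, a, hD, isInteraction_exOne, ha, fun X hX => ?_⟩
  obtain ⟨τ, b, l, h⟩ := hX.exists_isAff hD isInteraction_exOne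
  obtain ⟨hb, rfl, h3⟩ := detEq_exOne h hX
  obtain ⟨q, rfl⟩ := eq_quad_of_deriv3 (contDiffOn_univ.1 h.smooth_tau) h3
  refine ⟨(q, b, 0, 0), mem_ParSub.2 ⟨hb, Submodule.zero_mem _, Submodule.zero_mem _⟩, ?_⟩
  rw [pbF_identity]
  exact ((stdF_isAff exOneSet (q, b, 0, 0)).congr isOpen_univ (fun _ _ => rfl)
    fun s t _ => by simp).ext h

end

/-! ### A member of the second class with full symmetry algebra -/

section

/-- `κ` at the last five points of `Γ`, minus `κ` at the centre, for `κ = n + 2 m`. -/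
def slope : Fin 5 → ℝ := ![2, 1, -1, -2, -1]

/-- The deviation of `v` at the last five points of `Γ` from the function in the span of `1` and
`n + 2 m` with the values `v 0` and `v 1` at the first two points. -/
def dev (i : Fin 5) (v : Fin 7 → ℝ) : ℝ := v 0 * (1 - slope i) + v 1 * slope i - v (Fin.natAdd 2 i)

/-- The deviations are invariant under translations from the span of `1` and `n + 2 m`, and the
inverse cubes have degree `-3`. For given `v 0` and `v 1` they are free coordinates, so the sum
makes the determining equation separate. -/
noncomputable def exTwo (x : ℝ × (Fin 7 → ℝ)) : ℝ := ∑ i, ((dev i x.2) ^ 3)⁻¹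

def exTwoSet : Set (ℝ × (Fin 7 → ℝ)) := {x | ∀ i, dev i x.2 ≠ 0}

def height : Site → ℝ := fun s => s.1 + 2 * s.2

variable {x : ℝ × (Fin 7 → ℝ)} {a : Site → ℝ} {X : LatticeField} {τ : ℝ → ℝ} {l : Site → ℝ → ℝ}

theorem continuous_dev (i : Fin 5) : Continuous fun x : ℝ × (Fin 7 → ℝ) => dev i x.2 := by
  unfold dev; fun_prop

theorem contDiff_dev (i : Fin 5) : ContDiff ℝ ∞ fun x : ℝ × (Fin 7 → ℝ) => dev i x.2 := by
  unfold dev; fun_prop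

theorem isOpen_exTwoSet : IsOpen exTwoSet := by
  rw [exTwoSet, Set.ofPred_forall]
  exact isOpen_iInter_of_finite fun i => isOpen_ne_fun (continuous_dev i) continuous_const

theorem contDiffAt_exTwo (hx : x ∈ exTwoSet) : ContDiffAt ℝ ∞ exTwo x := by
  unfold exTwo
  exact ContDiffAt.sum fun i _ => ((contDiff_dev i).contDiffAt.pow 3).inv (pow_ne_zero 3 (hx i))

theorem hasDerivAt_dev (i : Fin 5) (x : ℝ × (Fin 7 → ℝ)) (t : ℝ) (w : Fin 7 → ℝ) :
    HasDerivAt (fun ρ : ℝ => dev i (x + ρ • (t, w)).2) (dev i w) 0 := by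
  have h : (fun ρ : ℝ => dev i (x + ρ • (t, w)).2) = fun ρ => dev i x.2 + ρ * dev i w := by
    funext ρ
    simp only [dev, Prod.snd_add, Prod.smul_snd, Pi.add_apply, Pi.smul_apply, smul_eq_mul]
    ring
  rw [h]
  simpa using ((hasDerivAt_id (0:ℝ)).mul_const (dev i w)).const_add (dev i x.2)

theorem fderiv_exTwo (hx : x ∈ exTwoSet) (t : ℝ) (w : Fin 7 → ℝ) :
    fderiv ℝ exTwo x (t, w) = ∑ i, -3 * dev i w / (dev i x.2) ^ 4 := by
  refine fderiv_of_line ((contDiffAt_exTwo hx).differentiableAt (by simp)) ?_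
  have e : ∀ i, dev i (x + (0:ℝ) • (t, w)).2 = dev i x.2 := fun i => by simp
  refine (HasDerivAt.fun_sum fun i _ => ((hasDerivAt_dev i x t w).pow 3).inv
    (by simpa using hx i)).congr_deriv (Finset.sum_congr rfl fun i _ => ?_)
  have := hx i
  simp only [Pi.pow_apply, e]
  field_simp
  norm_num
  ring

theorem exists_dev (v₀ v₁ : ℝ) (y : Fin 5 → ℝ) : ∃ v : Fin 7 → ℝ, v 0 = v₀ ∧ v 1 = v₁ ∧ ∀ i, dev i v = y i := by
  refine ⟨Fin.cons v₀ (Fin.cons v₁ fun i => v₀ * (1 - slope i) + v₁ * slope i - y i), rfl, rfl, fun i => ?_⟩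
  have : Fin.natAdd 2 i = i.succ.succ := Fin.ext (by simp; ring)
  show v₀ * _ + v₁ * _ - (Fin.cons v₀ (Fin.cons v₁ _) : Fin 7 → ℝ) (Fin.natAdd 2 i) = y i
  rw [this]
  simp

theorem exTwoDomain_regular : (fullDomain exTwoSet).Regular :=
  fullDomain_regular isOpen_exTwoSet fun t u => by
    obtain ⟨v, h0, -, h⟩ := exists_dev u 0 fun _ => 1
    exact ⟨v, fun i => by rw [h]; exact one_ne_zero, h0⟩

theorem dev_one (i : Fin 5) : dev i (fun _ => 1) = 0 := by simp [dev]

theorem dev_height (i : Fin 5) (s : Site) : dev i (fun j => height (s + nbr j)) = 0 := by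
  fin_cases i <;> simp [dev, slope, height, nbr, Fin.natAdd] <;> ring

theorem dev_comb (i : Fin 5) (x y : ℝ) (v w : Fin 7 → ℝ) :
    dev i (fun j => x * v j + y * w j) = x * dev i v + y * dev i w := by
  simp only [dev]; ring

theorem red_exTwo (s : Site) (hx : x ∈ exTwoSet) : Red ⊥ (Submodule.span ℝ {1, height}) s exTwo x := by
  refine ⟨?_, ?_, fun a ha => ?_, fun c hc => ?_⟩
  · rw [fderiv_exTwo hx]
    exact Finset.sum_eq_zero fun i _ => by simp [dev]
  · rw [fderiv_exTwo hx, exTwo, Finset.mul_sum]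
    refine Finset.sum_congr rfl fun i _ => ?_
    have := hx i
    field_simp
  · rw [(Submodule.mem_bot ℝ).1 ha]
    simp only [Pi.zero_apply, zero_mul]
    exact map_zero _
  · obtain ⟨y, z, rfl⟩ := Submodule.mem_span_pair.1 hc
    rw [fderiv_exTwo hx]
    refine Finset.sum_eq_zero fun i _ => ?_
    have := dev_comb i y z (fun _ => 1) fun j => height (s + nbr j)
    rw [dev_one, dev_height, mul_zero, mul_zero, add_zero] at this
    simp only [Pi.add_apply, Pi.smul_apply, Pi.one_apply, smul_eq_mul]
    rw [this]
    simp

theorem dev_single (i j : Fin 5) : dev i (Pi.single (Fin.natAdd 2 j) 1) = if i = j then -1 else 0 := by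
  have h0 : (0 : Fin 7) ≠ Fin.natAdd 2 j := fun h => by
    have : 0 = 2 + (j : ℕ) := congrArg Fin.val h
    omega
  have h1 : (1 : Fin 7) ≠ Fin.natAdd 2 j := fun h => by
    have : 1 = 2 + (j : ℕ) := congrArg Fin.val h
    omega
  rw [dev, Pi.single_eq_of_ne h0, Pi.single_eq_of_ne h1]
  split_ifs with h
  · subst h; rw [Pi.single_eq_same]; ring
  · rw [Pi.single_eq_of_ne fun e => h (Fin.natAdd_injective 5 2 e)]; ring

theorem partialU_exTwo_natAdd (hx : x ∈ exTwoSet) (j : Fin 5) :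
    partialU exTwo (Fin.natAdd 2 j) x = 3 * ((dev j x.2) ^ 4)⁻¹ := by
  rw [partialU, fderiv_exTwo hx, Finset.sum_eq_single j]
  · rw [dev_single, if_pos rfl]; ring
  · intro i _ h
    rw [dev_single, if_neg h]; simp
  · simp

theorem dev_shift (i : Fin 5) (v : Fin 7 → ℝ) (ε : ℝ) :
    dev i (v + ε • Pi.single (Fin.natAdd 2 (0 : Fin 5)) 1) = dev i v - if i = 0 then ε else 0 := by
  have := dev_comb i 1 ε v (Pi.single (Fin.natAdd 2 (0 : Fin 5)) 1)
  rw [dev_single] at this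
  have e : v + ε • Pi.single (Fin.natAdd 2 (0 : Fin 5)) 1 = fun j => 1 * v j + ε * (Pi.single (Fin.natAdd 2 (0 : Fin 5)) 1 : Fin 7 → ℝ) j := by
    funext j; simp
  rw [e, this]
  split_ifs <;> ring

theorem not_constant_partial {O : Set (ℝ × (Fin 7 → ℝ))} (hO : O ⊆ exTwoSet) (ho : IsOpen O) {x}
    (hx : x ∈ O) {w : Fin 7 → ℝ} (hw : dev 0 w ≠ 0) : ∃ y ∈ O, fderiv ℝ exTwo y (0, w) ≠ 0 := by
  by_contra! H
  have hd := hO hx 0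
  -- Only the first summand feels this shift. The fourth powers of `dev 0` and `dev 0 - ε` agree
  -- only for `ε = 0` or `ε = 2 dev 0`, which the bound on `ε` excludes.
  obtain ⟨ε, hε, hlt, hm⟩ := exists_shift ho hx (Fin.natAdd 2 (0 : Fin 5)) (abs_pos.2 hd)
  have e₁ := H _ hx
  have e₂ := H _ hm
  have hd' := hO hm 0
  rw [fderiv_exTwo (hO hx), Fin.sum_univ_succ] at e₁
  rw [fderiv_exTwo (hO hm), Fin.sum_univ_succ] at e₂
  simp only [dev_shift, Fin.succ_ne_zero, if_false, if_true, sub_zero] at e₂ hd'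
  have e : dev 0 x.2 ^ 4 = (dev 0 x.2 - ε) ^ 4 := by
    have h3 : -3 * dev 0 w / (dev 0 x.2) ^ 4 = -3 * dev 0 w / (dev 0 x.2 - ε) ^ 4 := by linarith
    have h4 : -3 * dev 0 w ≠ 0 := mul_ne_zero (by norm_num) hw
    rw [div_eq_mul_inv, div_eq_mul_inv] at h3
    exact inv_injective (mul_left_cancel₀ h4 h3)
  have e' : ε * (2 * dev 0 x.2 - ε) * (dev 0 x.2 ^ 2 + (dev 0 x.2 - ε) ^ 2) = 0 := by
    linear_combination e
  have hp : 0 < dev 0 x.2 ^ 2 + (dev 0 x.2 - ε) ^ 2 := by positivity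
  have h5 := (mul_eq_zero.1 ((mul_eq_zero.1 e').resolve_right hp.ne')).resolve_left hε.ne'
  rw [lt_abs] at hlt
  rcases hlt with h | h <;> linarith

theorem isInteraction_exTwo : IsInteraction (fullDomain exTwoSet) fun _ => exTwo := by
  refine ⟨fun s x hx => (contDiffAt_exTwo hx).contDiffWithinAt, fun s => ?_, ?_⟩
  · obtain ⟨v, -, -, hv⟩ := exists_dev 0 0 fun _ => 1
    have hx : ((0, v) : ℝ × (Fin 7 → ℝ)) ∈ exTwoSet := fun i => by rw [hv]; exact one_ne_zero
    refine ⟨Fin.natAdd 2 (0 : Fin 5), Fin.natAdd 2 (0 : Fin 5), (0, v), hx, ?_⟩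
    have : partialU exTwo (Fin.natAdd 2 (0 : Fin 5)) =ᶠ[𝓝 (0, v)] fun x => 3 * ((dev 0 x.2) ^ 4)⁻¹ := by
      filter_upwards [isOpen_exTwoSet.mem_nhds hx] with y hy using partialU_exTwo_natAdd hy 0
    rw [partialU, this.fderiv_eq]
    have hdiff : DifferentiableAt ℝ (fun x : ℝ × (Fin 7 → ℝ) => 3 * ((dev 0 x.2) ^ 4)⁻¹) (0, v) :=
      (((((contDiff_dev 0).contDiffAt.pow 4).inv (pow_ne_zero 4 (hx 0))).differentiableAt
        (by simp)).const_mul 3)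
    have hline := ((((hasDerivAt_dev 0 (0, v) 0 (Pi.single (Fin.natAdd 2 (0 : Fin 5)) 1)).pow 4).inv
      (by simp [hv])).const_mul 3)
    rw [fderiv_of_line hdiff hline, dev_single, if_pos rfl]
    simp [hv]
  · intro s i O hO ho ⟨x, hx⟩
    have htail : ∀ j : Fin 5, ∃ y ∈ O, partialU exTwo (Fin.natAdd 2 j) y ≠ 0 := fun j => by
      refine ⟨x, hx, ?_⟩
      rw [partialU_exTwo_natAdd (hO hx)]
      have := hO hx j
      positivity
    fin_cases i
    · exact not_constant_partial hO ho hx (by simp [dev, slope]; norm_num)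
    · exact not_constant_partial hO ho hx (by simp [dev, slope])
    · exact htail 0
    · exact htail 1
    · exact htail 2
    · exact htail 3
    · exact htail 4

end

/-! ### All symmetries of the second example -/

section
variable {a : Site → ℝ} {X : LatticeField} {τ : ℝ → ℝ} {l : Site → ℝ → ℝ}

/-- Vary one `y i` and keep the others equal to `1`: the functions `y⁻⁴, y⁻³, 1` are separated by
their values at `1, -1, 2`. -/
theorem inverse_powers_independent {p r : Fin 5 → ℝ} {c : ℝ} (h : ∀ y : Fin 5 → ℝ, (∀ i, y i ≠ 0) →
    ∑ i, (p i / y i ^ 4 + r i / y i ^ 3) + c = 0) : (∀ i, p i = 0) ∧ (∀ i, r i = 0) ∧ c = 0 := by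
  have key : ∀ i, p i = 0 ∧ r i = 0 := by
    intro i
    have hu : ∀ z : ℝ, z ≠ 0 → p i / z ^ 4 + r i / z ^ 3 +
        (∑ j ∈ Finset.univ.erase i, (p j + r j) + c) = 0 := by
      intro z hz
      have := h (Function.update 1 i z) fun j => by
        by_cases hj : j = i
        · subst hj; simpa using hz
        · simp [Function.update_of_ne hj]
      rw [← Finset.add_sum_erase _ _ (Finset.mem_univ i), Function.update_self, add_assoc] at this
      rw [← this]
      congr 2
      refine Finset.sum_congr rfl fun j hj => ?_
      rw [Function.update_of_ne (Finset.ne_of_mem_erase hj)]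
      simp
    have e1 := hu 1 one_ne_zero
    have e2 := hu (-1) (by norm_num)
    have e3 := hu 2 two_ne_zero
    norm_num at e1 e2 e3
    constructor <;> linarith
  refine ⟨fun i => (key i).1, fun i => (key i).2, ?_⟩
  have := h 1 fun i => one_ne_zero
  simpa [fun i => (key i).1, fun i => (key i).2] using this

/-- For fixed `v 0` and `v 1` the determining equation is a linear relation between inverse fourth
powers and cubes of the deviations and a constant, so all its coefficients vanish. -/
theorem detEq_exTwo (h : IsAff (fullDomain exTwoSet) X τ a l)
    (hX : IsSymmetry (fullDomain exTwoSet) (fun _ => exTwo) X) :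
    a = 0 ∧ (∀ s i t, dev i (fun j => l (s + nbr j) t) = 0) ∧ (∀ s t, deriv (deriv (l s)) t = 0) ∧
      ∀ t, deriv (deriv (deriv τ)) t = 0 := by
  have hdet := (h.isSymmetry_iff exTwoDomain_regular).1 hX
  have key : ∀ s t v₀ v₁,
      (∀ i : Fin 5, (a s - a (s + nbr (Fin.natAdd 2 i))) * (1 - slope i) * v₀
        + (a (s + nbr 1) - a (s + nbr (Fin.natAdd 2 i))) * slope i * v₁
        + dev i (fun j => l (s + nbr j) t) = 0) ∧
      (∀ i : Fin 5, 3 * a (s + nbr (Fin.natAdd 2 i)) + a s = 0) ∧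
      deriv (deriv (deriv τ)) t / 2 * v₀ + deriv (deriv (l s)) t = 0 := by
    intro s t v₀ v₁
    have := inverse_powers_independent
      (p := fun i : Fin 5 => 3 * ((a s - a (s + nbr (Fin.natAdd 2 i))) * (1 - slope i) * v₀
        + (a (s + nbr 1) - a (s + nbr (Fin.natAdd 2 i))) * slope i * v₁
        + dev i (fun j => l (s + nbr j) t)))
      (r := fun i : Fin 5 => 3 * a (s + nbr (Fin.natAdd 2 i)) + a s)
      (c := deriv (deriv (deriv τ)) t / 2 * v₀ + deriv (deriv (l s)) t) fun y hy => by
        obtain ⟨v, rfl, rfl, hv⟩ := exists_dev v₀ v₁ y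
        have hx : ((t, v) : ℝ × (Fin 7 → ℝ)) ∈ exTwoSet := fun i => by rw [hv]; exact hy i
        have hd := hdet s (t, v) hx
        rw [DetEq, fderiv_exTwo hx] at hd
        simp only [exTwo, hv] at hd
        have e : ∀ i : Fin 5, dev i (fun j => (deriv τ t / 2 + a (s + nbr j)) * v j + l (s + nbr j) t) =
            ((a s - a (s + nbr (Fin.natAdd 2 i))) * (1 - slope i) * v 0
            + (a (s + nbr 1) - a (s + nbr (Fin.natAdd 2 i))) * slope i * v 1
            + dev i (fun j => l (s + nbr j) t)) + (deriv τ t / 2 + a (s + nbr (Fin.natAdd 2 i))) * y i := by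
          intro i
          rw [← hv i]
          simp only [dev, nbr_zero, add_zero]
          ring
        simp only [e] at hd
        rw [← sub_eq_zero, Finset.mul_sum] at hd
        rw [← neg_eq_zero, ← hd, neg_add, ← Finset.sum_neg_distrib]
        rw [show ∀ A B C D : ℝ, A - (B + C + D) = (A - D) + -(B + C) from fun _ _ _ _ => by ring,
          ← Finset.sum_sub_distrib]
        congr 1
        refine Finset.sum_congr rfl fun i _ => ?_
        have := hy i
        field_simp
        ring
    exact ⟨fun i => (mul_eq_zero.1 (this.1 i)).resolve_left three_ne_zero, this.2⟩
  -- Changing `v 0` from `0` to `1` shows that `a` agrees at `(n, m)` and `(n, m+1)`; the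
  -- coefficient of the cube then says `4 a = 0`.
  have ha : a = 0 := by
    funext s
    obtain ⟨h1, h2, -⟩ := key s 0 1 0
    have e0 := (key s 0 0 0).1 0
    have e1 := h1 0
    have e2 := h2 0
    simp [slope] at e0 e1 e2
    simp only [Pi.zero_apply]
    linarith
  subst ha
  refine ⟨rfl, fun s i t => by simpa using (key s t 0 0).1 i, fun s t => by simpa using (key s t 0 0).2.2,
    fun t => ?_⟩
  have e0 := (key 0 t 0 0).2.2
  have e1 := (key 0 t 1 0).2.2
  linarith

theorem shift_invariant {f : Site → ℝ} (h1 : ∀ s, f (s + (1, 0)) = f s) (h2 : ∀ s, f (s + (0, 1)) = f s)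
    (s : Site) : f s = f 0 := by
  have hn : ∀ n m : ℤ, f (n, m) = f (0, m) := by
    intro n m
    induction n using Int.induction_on with
    | zero => rfl
    | succ j ih => rw [← ih, ← h1 (j, m)]; simp
    | pred j ih => rw [← ih, ← h1 (-j - 1, m)]; simp
  have hm : ∀ m : ℤ, f (0, m) = f (0, 0) := by
    intro m
    induction m using Int.induction_on with
    | zero => rfl
    | succ j ih => rw [← ih, ← h2 (0, j)]; simp
    | pred j ih => rw [← ih, ← h2 (0, -j - 1)]; simp
  exact (hn s.1 s.2).trans (hm s.2)

/-- The relations at the first three neighbours beyond `(n+1, m)` make the increment of `f` in `n`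
invariant under both shifts, hence constant, and make the increment in `m` twice as large. -/
theorem eq_of_dev_eq_zero {f : Site → ℝ} (h : ∀ s i, dev i (fun j => f (s + nbr j)) = 0) (s : Site) :
    f s = f 0 + (f (1, 0) - f 0) * height s := by
  have e2 : ∀ s, f (s + (0, 1)) = 2 * f (s + (1, 0)) - f s := fun s => by
    have := h s 0
    simp [dev, slope] at this
    change f (s + 0) * (1 - 2) + f (s + (1, 0)) * 2 - f (s + (0, 1)) = 0 at this
    rw [add_zero] at this
    linarith
  have e3 : ∀ s, f (s + (-1, 1)) = f (s + (1, 0)) := fun s => by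
    have := h s 1
    simp [dev, slope] at this
    change f (s + (1, 0)) - f (s + (-1, 1)) = 0 at this
    linarith
  have e4 : ∀ s, f (s + (-1, 0)) = 2 * f s - f (s + (1, 0)) := fun s => by
    have := h s 2
    simp [dev, slope] at this
    change f (s + 0) * (1 + 1) + -f (s + (1, 0)) - f (s + (-1, 0)) = 0 at this
    rw [add_zero] at this
    linarith
  have d1 : ∀ s, f (s + (1, 0) + (1, 0)) - f (s + (1, 0)) = f (s + (1, 0)) - f s := fun s => by
    have := e4 (s + (1, 0))
    rw [add_assoc s, show ((1, 0) : Site) + (-1, 0) = 0 from rfl, add_zero] at this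
    linarith
  have d2 : ∀ s, f (s + (0, 1) + (1, 0)) - f (s + (0, 1)) = f (s + (1, 0)) - f s := fun s => by
    have h3 := e3 (s + (1, 0))
    rw [add_assoc s, show ((1, 0) : Site) + (-1, 1) = (0, 1) from rfl] at h3
    have h2 := e2 (s + (1, 0))
    have h1 := d1 s
    rw [add_assoc s (1, 0) (0, 1), add_comm ((1, 0) : Site) (0, 1), ← add_assoc] at h2
    linarith
  have hd := shift_invariant (f := fun s => f (s + (1, 0)) - f s) d1 d2
  have hd' : ∀ s, f (s + (1, 0)) - f s = f (1, 0) - f 0 := fun s => by simpa using hd s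
  have := shift_invariant (f := fun s => f s - (f (1, 0) - f 0) * height s) (fun s => by
    have := hd' s
    simp [height]
    linarith) (fun s => by
    have h1 := hd' s
    have h2 := e2 s
    simp [height]
    linarith) s
  simp only [height] at this ⊢
  simp at this
  linarith

theorem exists_classTwo_full : ∃ (D : LatticeDomain) (F : Site → ℝ × (Fin 7 → ℝ) → ℝ)
    (L : Submodule ℝ LatticeField) (Φ : AllowedMap) (κ : Site → ℝ),
    D.Regular ∧ IsInteraction D F ∧ ClassTwo D F L Φ κ ∧ ∀ X, IsSymmetry D F X → X ∈ L := by
  have hD := exTwoDomain_regular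
  have hid := AllowedMap.identity_admissible (fullDomain exTwoSet).I
  have hF := isInteraction_exTwo
  have hn : ∀ s, height s ≠ height (s + (1, 0)) := fun s => by simp [height]
  have hm : ∀ s, height s ≠ height (s + (0, 1)) := fun s => by simp [height]
  have H : ∀ s, ∀ x ∈ exTwoSet, Red ⊥ (Submodule.span ℝ {1, height}) s
      (mixF .identity (fun _ => exTwo) s) (newZ .identity s x) := fun s x hx => by
    rw [mixF_identity, newZ_identity]; exact red_exTwo s hx
  refine ⟨_, _, (ParSub ⊥ (Submodule.span ℝ {1, height})).map (pbF _ .identity), .identity, height, hD, hF,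
    ⟨hid, hn, hm, by rw [stdSpan2_eq, corresponds_iff hD hid], fun s x hx hx0 => ?_⟩, fun X hX => ?_⟩
  · obtain ⟨f, O, hO, hxO, hf, hev⟩ := local_form2 (by rw [nbr_zero, add_zero]; exact hn s)
      (eventually_red hD hid hF.smooth H hx) hx0
    exact ⟨f, O, hO, hxO, hf, eventually_newF hD hid hx
      (g := fun v => (det2 height s v 2 ^ 3)⁻¹ * f (xi2 height s v)) hev⟩
  · obtain ⟨τ, b, l, h⟩ := hX.exists_isAff hD hF
    obtain ⟨rfl, hl, hl2, h3⟩ := detEq_exTwo h hX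
    obtain ⟨q, rfl⟩ := eq_quad_of_deriv3 (contDiffOn_univ.1 h.smooth_tau) h3
    have haff : ∀ s t, l s t = l s 0 + deriv (l s) 0 * t := fun s =>
      eq_affine_of_deriv2 (contDiffOn_univ.1 (h.smooth_l s)) (hl2 s)
    have hc : ∀ t s, l s t = l 0 t + (l (1, 0) t - l 0 t) * height s := fun t =>
      eq_of_dev_eq_zero (f := fun s => l s t) fun s i => hl s i t
    have hmem : ∀ y z : ℝ, (fun s => y + z * height s) ∈ Submodule.span ℝ {1, height} := fun y z =>
      Submodule.mem_span_pair.2 ⟨y, z, by funext s; simp⟩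
    refine ⟨(q, 0, fun s => l 0 0 + (l (1, 0) 0 - l 0 0) * height s, fun s => deriv (l 0) 0 +
      (deriv (l (1, 0)) 0 - deriv (l 0) 0) * height s), mem_ParSub.2 ⟨rfl, hmem _ _, hmem _ _⟩, ?_⟩
    rw [pbF_identity]
    refine ((stdF_isAff exTwoSet _).congr isOpen_univ (fun _ _ => rfl) fun s t _ => ?_).ext h
    rw [hc t s, haff 0 t, haff (1, 0) t]
    ring

end
end TriLattice

theorem mainTheorem11 :
    -- completeness: near a dense set of times, one of the two classes
    (∀ (D : LatticeDomain) (F : Site → ℝ × (Fin 7 → ℝ) → ℝ) (L : Submodule ℝ LatticeField),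
      D.Regular → IsInteraction D F → IsNonsolvableSeven D F L →
      ∀ b c : ℝ, b < c → Ioo b c ⊆ D.I →
        ∃ I' : Set ℝ, I' ⊆ Ioo b c ∧ IsOpen I' ∧ I'.OrdConnected ∧ I'.Nonempty ∧
          ((∃ Φ a, ClassOne (D.restrict I') F (L.map (cutoff I')) Φ a) ∨
            (∃ Φ κ, ClassTwo (D.restrict I') F (L.map (cutoff I')) Φ κ))) ∧
    -- every member of the first class has such an algebra, with the stated radical
    (∀ (D : LatticeDomain) (F : Site → ℝ × (Fin 7 → ℝ) → ℝ) (L : Submodule ℝ LatticeField)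
      (Φ : AllowedMap) (a : Fin 4 → Site → ℝ),
      D.Regular → (∀ s, ContDiffOn ℝ ∞ (F s) (D.Ω s)) → ClassOne D F L Φ a →
        IsNonsolvableSeven D F L ∧ ∃ R, IsRadicalOf R L ∧ Corresponds D Φ R (radical1 a)) ∧
    -- every member of the second class has such an algebra, with the stated radical
    (∀ (D : LatticeDomain) (F : Site → ℝ × (Fin 7 → ℝ) → ℝ) (L : Submodule ℝ LatticeField)
      (Φ : AllowedMap) (κ : Site → ℝ),
      D.Regular → (∀ s, ContDiffOn ℝ ∞ (F s) (D.Ω s)) → ClassTwo D F L Φ κ →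
        IsNonsolvableSeven D F L ∧ ∃ R, IsRadicalOf R L ∧ Corresponds D Φ R (radical2 κ)) ∧
    -- in both classes the algebra can be the full symmetry algebra
    (∃ (D : LatticeDomain) (F : Site → ℝ × (Fin 7 → ℝ) → ℝ) (L : Submodule ℝ LatticeField)
      (Φ : AllowedMap) (a : Fin 4 → Site → ℝ),
      D.Regular ∧ IsInteraction D F ∧ ClassOne D F L Φ a ∧ ∀ X, IsSymmetry D F X → X ∈ L) ∧
    (∃ (D : LatticeDomain) (F : Site → ℝ × (Fin 7 → ℝ) → ℝ) (L : Submodule ℝ LatticeField)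
      (Φ : AllowedMap) (κ : Site → ℝ),
      D.Regular ∧ IsInteraction D F ∧ ClassTwo D F L Φ κ ∧ ∀ X, IsSymmetry D F X → X ∈ L) ∧
    -- the two classes are different
    (∀ (D : LatticeDomain) (F : Site → ℝ × (Fin 7 → ℝ) → ℝ) (L : Submodule ℝ LatticeField)
      (Φ Φ' : AllowedMap) (a : Fin 4 → Site → ℝ) (κ : Site → ℝ),
      D.Regular → ClassOne D F L Φ a → ¬ ClassTwo D F L Φ' κ) := by
  refine ⟨?_, ?_, ?_, exists_classOne_full, exists_classTwo_full, ?_⟩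
  · exact fun D F L hD hF h b c hbc hI => h.exists_class hD hF hbc hI
  · exact fun D F L Φ a hD hF hc => hc.conclusion hD hF
  · exact fun D F L Φ κ hD hF hc => hc.conclusion hD hF
  · exact fun D F L Φ Φ' a κ hD h₁ => h₁.not_classTwo hD
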